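/- **Setting.** For $a\in\mathbb R$ let $L^2_a=\{f: e^{ax}f\in L^2(\mathbb R)\}$ with $\|f\|_a=\|e^{ax}f\|_{L^2}$, and let $H^m_a=\{f: e^{ax}f\in H^m(\mathbb R)\}$ with $\|f\|_{H^m_a}^2=\frac1{2\pi}\int(1+k^2)^m|\hat f(k+ia)|^2dk$. Write $D=-i\partial$; a Fourier multiplier $P(D)$ acts on $L^2_a$ by multiplying $\hat f(k+ia)$ by $P(k+ia)$, $k\in\mathbb R$. Fix $\alpha\in(0,\frac12]$, an integer $m\ge2$ and $\nu\in(0,1)$. For $\epsilon>0$ put $\gamma=1-\epsilon^2$, $a=\epsilon\alpha$, and let $\Theta(x)=\operatorname{sech}^2(\sqrt3x/2)$. *The solitary wave.* Let $\theta$ be an even real function with $\|\theta-\Theta\|_{H^m_\alpha}<\epsilon^\nu$ such that $\omega(x)=\epsilon^2\theta(\epsilon x)$ solves $$\omega=\Bigl(1-\gamma\tfrac{\tanh D}{D}\Bigr)^{-1}\frac{\frac32\omega^2+\omega^3-\frac12(i\tanh D\,\omega)^2(1-2\gamma\underline\eta)}{(1+\omega)^2},\qquad \underline\eta=\tfrac{\tanh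 D}{D}\omega .$$ *Coefficients.* With $\tau=i\tanh D\,\omega$ let $$u_1=\frac{\omega+\omega^2+\tau^2}{(1+\omega)^2+\tau^2},\quad v_1=\frac{1-u_1}{\gamma(1+\omega)}\,\partial\Bigl(\frac{-\tau}{(1+\omega)^2+\tau^2}\Bigr),\quad p=\frac{1-u_1}{1+\omega},\quad q=\sqrt{\frac{1-v_1}{1+\omega}},\quad \rho=\sqrt q .$$ *Operators on $L^2_a$.* Let $\mathcal S=\sqrt{-\gamma D\tanh D}$ (principal root), $\mathcal A_+=\partial+\mathcal S$, $\mathcal U=\partial(p-1)+\mathcal S(q-1)$, $R_1=q'pq^{-1}$, $R_2=p'+[p,\mathcal S]\mathcal S^{-1}\partial$, and $$J_{11}=-\tfrac12(R_2+R_1+[\mathcal S,q]),\quad J_{12}=-\tfrac12(R_1-R_2-[\mathcal S,q]),\quad J_{21}=-\tfrac12(R_1-R_2+[\mathcal S,q]),$$ $$J_{22}=-\tfrac12\bigl(R_1+[p,\mathcal S]\mathcal S^{-1}\partial+[[\mathcal S,\rho],\rho]\bigr),\qquad \mathcal A_{22}=\sqrt p\,\partial\sqrt p-\sqrt q\,\mathcal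 S\sqrt q+J_{22},$$ $$W(\lambda)=I-(\lambda-\mathcal A_+)^{-1}\mathcal U-(\lambda-\mathcal A_+)^{-1}\bigl(J_{11}+J_{12}(\lambda-\mathcal A_{22})^{-1}J_{21}\bigr).$$ On $L^2_\alpha$ let $W_0(\tilde\lambda)=I+(\tilde\lambda-\frac12\partial+\frac16\partial^3)^{-1}\partial(\frac32\Theta)$. All operators are taken on their natural domains. Let $(S_\epsilon f)(x)=f(x/\epsilon)/\sqrt\epsilon$, an isometry of $L^2_a$ onto $L^2_\alpha$, and $$\Omega_\epsilon=\{\tilde\lambda\in\mathbb C: |\epsilon^3\tilde\lambda|\le1,\ \operatorname{Re}\tilde\lambda\ge-\tfrac16\alpha\}.$$ **Proposition.** For all sufficiently small $\epsilon>0$, every such $\theta$ and every $\tilde\lambda\in\Omega_\epsilon$, the number $\epsilon^3\tilde\lambda$ is in the resolvent sets of $\mathcal A_+$ and $\mathcal A_{22}$ on $L^2_a$, $\tilde\lambda$ is in the resolvent set of $\frac12\partial-\frac16\partial^3$ on $L^2_\alpha$, and $W(\epsilon^3\tilde\lambda)$ and $W_0(\tilde\lambda)$ are densely defined and extend (uniquely)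 to bounded operators on $L^2_a$ and $L^2_\alpha$. With $\widetilde W(\tilde\lambda)=S_\epsilon W(\epsilon^3\tilde\lambda)S_\epsilon^{-1}$, in operator norm on $L^2_\alpha$, $$\sup_{\tilde\lambda\in\Omega_\epsilon}\|\widetilde W(\tilde\lambda)-W_0(\tilde\lambda)\|_\alpha\to0\quad\text{as }\epsilon\to0.$$ That is, for every $\delta>0$ there is $\epsilon_0>0$, depending only on $\alpha,m,\nu,\delta$, such that for $0<\epsilon<\epsilon_0$ the supremum is at most $\delta$ for every such $\theta$. -/

import Mathlib

open MeasureTheory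
open scoped ENNReal FourierTransform

noncomputable section

/-! ### The weighted spaces `L²_a` -/

/-- The measure `e^{2ax} dx` on the line. -/
def weightMeasure (a : ℝ) : Measure ℝ :=
  volume.withDensity fun x => ENNReal.ofReal (Real.exp (2 * a * x))

/-- `L²_a = {f : e^{ax} f ∈ L²(ℝ)}` with norm `‖f‖_a = ‖e^{ax} f‖_{L²}`. -/
abbrev L2w (a : ℝ) : Type := Lp ℂ 2 (weightMeasure a)

section WeightedComposition

variable {μ ν : Measure ℝ} {c : ℝ → ℂ} {e : ℝ ≃ᵐ ℝ}

theorem wcomp_ac (hc : Measurable c) (h0 : ∀ x, c x ≠ 0)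
    (h : μ = (ν.withDensity fun x => ‖c x‖ₑ ^ 2).map e) :
    ν ≪ μ.map e.symm := by
  subst h
  rw [e.map_symm_map]
  refine withDensity_absolutelyContinuous' (by fun_prop) (ae_of_all _ fun x => ?_)
  simp [h0 x]

theorem wcomp_ae (hc : Measurable c) (h0 : ∀ x, c x ≠ 0)
    (h : μ = (ν.withDensity fun x => ‖c x‖ₑ ^ 2).map e) {f g : ℝ → ℂ} (hfg : f =ᵐ[μ] g) :
    (fun x => c x * f (e x)) =ᵐ[ν] fun x => c x * g (e x) := by
  have h1 : ∀ᵐ x ∂(μ.map e.symm), f (e x) = g (e x) := by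
    rw [e.symm.measurableEmbedding.ae_map_iff]
    filter_upwards [hfg] with x hx
    simpa using hx
  filter_upwards [(wcomp_ac hc h0 h).ae_le h1] with x hx
  rw [hx]

theorem wcomp_eLpNorm (hc : Measurable c)
    (h : μ = (ν.withDensity fun x => ‖c x‖ₑ ^ 2).map e) {f : ℝ → ℂ} (hf : StronglyMeasurable f) :
    eLpNorm (fun x => c x * f (e x)) 2 ν = eLpNorm f 2 μ := by
  subst h
  rw [eLpNorm_eq_lintegral_rpow_enorm_toReal (by simp) (by simp),
    eLpNorm_eq_lintegral_rpow_enorm_toReal (by simp) (by simp), lintegral_map_equiv,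
    lintegral_withDensity_eq_lintegral_mul _ (by fun_prop)]
  · simp [enorm_mul, mul_pow]
  · have := hf.measurable
    have := e.measurable
    fun_prop

theorem wcomp_memLp (hc : Measurable c)
    (h : μ = (ν.withDensity fun x => ‖c x‖ₑ ^ 2).map e) (f : Lp ℂ 2 μ) :
    MemLp (fun x => c x * f (e x)) 2 ν := by
  refine ⟨?_, ?_⟩
  · have := (Lp.stronglyMeasurable f).measurable
    have := e.measurable
    exact (by fun_prop : Measurable fun x => c x * f (e x)).aestronglyMeasurable
  · rw [wcomp_eLpNorm hc h (Lp.stronglyMeasurable f)]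
    exact (Lp.memLp f).2

/-- The unitary map `f ↦ c · (f ∘ e)` from `L²(μ)` onto `L²(ν)`, when `∫ f dμ = ∫ (f ∘ e) |c|² dν`. -/
def wcompLI (hc : Measurable c) (h0 : ∀ x, c x ≠ 0)
    (h : μ = (ν.withDensity fun x => ‖c x‖ₑ ^ 2).map e) : Lp ℂ 2 μ →ₗᵢ[ℂ] Lp ℂ 2 ν where
  toFun f := (wcomp_memLp hc h f).toLp _
  map_add' f g := by
    rw [← MemLp.toLp_add, MemLp.toLp_eq_toLp_iff]
    filter_upwards [wcomp_ae hc h0 h (Lp.coeFn_add f g)] with x hx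
    simp only [hx, Pi.add_apply]
    ring
  map_smul' r f := by
    rw [RingHom.id_apply, ← MemLp.toLp_const_smul, MemLp.toLp_eq_toLp_iff]
    filter_upwards [wcomp_ae hc h0 h (Lp.coeFn_smul r f)] with x hx
    simp only [hx, Pi.smul_apply, smul_eq_mul]
    ring
  norm_map' f := by
    change ‖(wcomp_memLp hc h f).toLp _‖ = ‖f‖
    rw [Lp.norm_toLp, Lp.norm_def, wcomp_eLpNorm hc h (Lp.stronglyMeasurable f)]

theorem wcompLI_surjective (hc : Measurable c) (h0 : ∀ x, c x ≠ 0)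
    (h : μ = (ν.withDensity fun x => ‖c x‖ₑ ^ 2).map e) :
    Function.Surjective (wcompLI hc h0 h) := by
  intro g
  have hgm := (Lp.stronglyMeasurable g).measurable
  have hem := e.symm.measurable
  set f : ℝ → ℂ := fun y => (c (e.symm y))⁻¹ * g (e.symm y) with hf
  have hfm : Measurable f := by fun_prop
  have hcf : (fun x => c x * f (e x)) = g := by
    funext x
    simp [hf, h0 x]
  have hfL : MemLp f 2 μ := by
    refine ⟨hfm.aestronglyMeasurable, ?_⟩
    rw [← wcomp_eLpNorm hc h hfm.stronglyMeasurable, hcf]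
    exact (Lp.memLp g).2
  refine ⟨hfL.toLp f, ?_⟩
  apply Lp.ext
  refine (MemLp.coeFn_toLp (wcomp_memLp hc h (hfL.toLp f))).trans ?_
  refine (wcomp_ae hc h0 h hfL.coeFn_toLp).trans ?_
  rw [hcf]

/-- `wcompLI` as a unitary equivalence. -/
def wcompEquiv (hc : Measurable c) (h0 : ∀ x, c x ≠ 0)
    (h : μ = (ν.withDensity fun x => ‖c x‖ₑ ^ 2).map e) : Lp ℂ 2 μ ≃ₗᵢ[ℂ] Lp ℂ 2 ν :=
  LinearIsometryEquiv.ofSurjective (wcompLI hc h0 h) (wcompLI_surjective hc h0 h)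

end WeightedComposition

/-- The unitary map `f ↦ e^{ax} f` from `L²_a` onto `L²`. -/
def weightEquiv (a : ℝ) : L2w a ≃ₗᵢ[ℂ] Lp ℂ 2 (volume : Measure ℝ) :=
  wcompEquiv (c := fun x => ((Real.exp (a * x) : ℝ) : ℂ)) (e := MeasurableEquiv.refl ℝ)
    (by fun_prop) (fun x => by simp) (by
      change weightMeasure a = Measure.map id _
      rw [Measure.map_id, weightMeasure]
      congr 1
      funext x
      rw [← ofReal_norm, Complex.norm_real, Real.norm_of_nonneg (Real.exp_pos _).le,
        ← ENNReal.ofReal_pow (Real.exp_pos _).le, ← Real.exp_nat_mul]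
      congr 2
      push_cast
      ring)

/-- The dilation `(S_ε f)(x) = f(x/ε)/√ε`, a unitary map from `L²_{εα}` onto `L²_α`. -/
def dilation (α : ℝ) {ε : ℝ} (hε : 0 < ε) : L2w (ε * α) ≃ₗᵢ[ℂ] L2w α :=
  wcompEquiv (c := fun _ => (((Real.sqrt ε)⁻¹ : ℝ) : ℂ))
    (e := (Homeomorph.mulRight₀ ε⁻¹ (inv_ne_zero hε.ne')).toMeasurableEquiv)
    measurable_const (fun _ => by
      have := (Real.sqrt_pos.2 hε).ne'
      exact_mod_cast inv_ne_zero this) (by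
      refine Measure.ext_of_lintegral _ fun f hf => ?_
      have hw : ∀ b : ℝ, Measurable fun x : ℝ => ENNReal.ofReal (Real.exp (2 * b * x)) :=
        fun b => by fun_prop
      have hme : Measurable fun x : ℝ => x * ε⁻¹ := by fun_prop
      have hfe : Measurable fun x : ℝ => f (x * ε⁻¹) := hf.comp hme
      rw [lintegral_map_equiv]
      change _ = ∫⁻ x, f (x * ε⁻¹) ∂((weightMeasure α).withDensity _)
      rw [lintegral_withDensity_eq_lintegral_mul _ (by fun_prop) hfe,
        weightMeasure, weightMeasure, lintegral_withDensity_eq_lintegral_mul _ (hw _) hf,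
        lintegral_withDensity_eq_lintegral_mul _ (hw _) (by fun_prop)]
      simp only [Pi.mul_apply]
      have hvol : (volume : Measure ℝ)
          = ENNReal.ofReal ε⁻¹ • Measure.map (fun x : ℝ => x * ε⁻¹) volume := by
        rw [Real.map_volume_mul_right (inv_ne_zero hε.ne'), inv_inv, abs_of_pos hε, smul_smul,
          ← ENNReal.ofReal_mul (inv_pos.2 hε).le, inv_mul_cancel₀ hε.ne', ENNReal.ofReal_one,
          one_smul]
      conv_lhs => rw [hvol]
      have hG : Measurable fun x : ℝ => ENNReal.ofReal (Real.exp (2 * (ε * α) * x)) * f x :=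
        (hw _).mul hf
      rw [lintegral_smul_measure, lintegral_map hG hme, smul_eq_mul,
        ← lintegral_const_mul _ (by fun_prop)]
      refine lintegral_congr fun x => ?_
      have hc : ‖(((Real.sqrt ε)⁻¹ : ℝ) : ℂ)‖ₑ ^ 2 = ENNReal.ofReal ε⁻¹ := by
        have h1 : (0 : ℝ) ≤ (Real.sqrt ε)⁻¹ := by positivity
        rw [← ofReal_norm, Complex.norm_real, Real.norm_of_nonneg h1, ← ENNReal.ofReal_pow h1,
          inv_pow, Real.sq_sqrt hε.le]
      have hx : 2 * (ε * α) * (x * ε⁻¹) = 2 * α * x := by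
        field_simp
      rw [hc]
      simp only [hx]
      change _ = _ * (_ * f (x * ε⁻¹))
      ring)

/-- The map `f ↦ 𝓕(e^{ax} f)` from `L²_a` onto `L²`. In the normalization of the Fourier
transform used here (kernel `e^{-2πiξx}`), the wave number is `k = 2πξ`; thus the value at `ξ` is
`f̂(k + ia)` in the normalization with kernel `e^{-ikx}`. -/
def spectralEquiv (a : ℝ) : L2w a ≃ₗᵢ[ℂ] Lp ℂ 2 (volume : Measure ℝ) :=
  (weightEquiv a).trans (Lp.fourierTransformₗᵢ ℝ ℂ)

/-- The norm of `H^m_a`: `‖f‖² = (1/2π) ∫ (1 + k²)^m |f̂(k + ia)|² dk`, equal to `∞` when `f` is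
not in `H^m_a`. -/
def weightedSobolevNorm (m : ℕ) (a : ℝ) (f : ℝ → ℂ) : ℝ≥0∞ :=
  open Classical in
  if h : MemLp f 2 (weightMeasure a) then
    (∫⁻ ξ : ℝ, ENNReal.ofReal ((1 + (2 * Real.pi * ξ) ^ 2) ^ m)
      * ‖spectralEquiv a (h.toLp f) ξ‖ₑ ^ 2) ^ (1 / 2 : ℝ)
  else ⊤

/-! ### Unbounded operators, with their natural domains

Sums of partially defined operators (`LinearPMap`) live on the intersection of the domains. -/

section Operators

variable {E : Type*} [AddCommGroup E] [Module ℂ E]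

/-- The composition `A B`, with domain `{f ∈ dom B : B f ∈ dom A}`. -/
def opComp (A B : E →ₗ.[ℂ] E) : E →ₗ.[ℂ] E where
  domain := (A.domain.comap B.toFun).map B.domain.subtype
  toFun :=
    { toFun := fun f => A ⟨B ⟨f, by
          obtain ⟨g, -, hg⟩ := f.2
          exact hg ▸ g.2⟩, by
          obtain ⟨_, g, hg, rfl⟩ := f
          exact hg⟩
      map_add' := fun f g => by
        have hB : ∀ x : ((A.domain.comap B.toFun).map B.domain.subtype), (x : E) ∈ B.domain := by
          rintro ⟨_, y, -, rfl⟩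
          exact y.2
        rw [← LinearPMap.map_add]
        congr 1
        apply Subtype.ext
        exact LinearPMap.map_add B ⟨f, hB f⟩ ⟨g, hB g⟩
      map_smul' := fun c f => by
        have hB : ∀ x : ((A.domain.comap B.toFun).map B.domain.subtype), (x : E) ∈ B.domain := by
          rintro ⟨_, y, -, rfl⟩
          exact y.2
        rw [RingHom.id_apply, ← LinearPMap.map_smul]
        congr 1
        apply Subtype.ext
        exact LinearPMap.map_smul B c ⟨f, hB f⟩ }

instance opMul : Mul (E →ₗ.[ℂ] E) := ⟨opComp⟩

/-- The commutator `[A, B] = A B - B A`. -/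
def opComm (A B : E →ₗ.[ℂ] E) : E →ₗ.[ℂ] E := A * B - B * A

/-- The scalar operator `c I`. -/
def scalarOp (c : ℂ) : E →ₗ.[ℂ] E := (c • (LinearMap.id : E →ₗ[ℂ] E)).toPMap ⊤

/-- `(z - A)⁻¹`, with domain the range of `z - A`. -/
def resolventOp (A : E →ₗ.[ℂ] E) (z : ℂ) : E →ₗ.[ℂ] E := (scalarOp z - A).inverse

end Operators

section BoundedOperators

variable {E : Type*} [NormedAddCommGroup E] [NormedSpace ℂ E]

/-- `z` is in the resolvent set of `A`: `z - A` maps `dom A` bijectively onto the whole space, with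
bounded inverse. -/
def InResolventSet (A : E →ₗ.[ℂ] E) (z : ℂ) : Prop :=
  ∃ R : E →L[ℂ] E, (∀ f : E, ∃ h : R f ∈ A.domain, z • R f - A ⟨R f, h⟩ = f) ∧
    ∀ f : A.domain, R (z • (f : E) - A f) = f

/-- `T` is densely defined and `B` is its (necessarily unique) extension to a bounded operator on
the whole space. -/
def IsBoundedExtension (B : E →L[ℂ] E) (T : E →ₗ.[ℂ] E) : Prop :=
  Dense (T.domain : Set E) ∧ ∀ f : T.domain, B f = T f

end BoundedOperators

/-- Multiplication by the function `g` on `L²(μ)`, with domain `{f : g f ∈ L²(μ)}`. -/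
def mulOp (μ : Measure ℝ) (g : ℝ → ℂ) : Lp ℂ 2 μ →ₗ.[ℂ] Lp ℂ 2 μ where
  domain :=
    { carrier := {f | MemLp (fun x => g x * f x) 2 μ}
      zero_mem' := by
        refine (MemLp.zero (ε := ℂ)).ae_eq ?_
        filter_upwards [Lp.coeFn_zero ℂ 2 μ] with x hx
        rw [hx]
        simp
      add_mem' := fun {f h} hf hh => by
        refine (hf.add hh).ae_eq ?_
        filter_upwards [Lp.coeFn_add f h] with x hx
        rw [hx]
        simp [mul_add]
      smul_mem' := fun c f hf => by
        refine (hf.const_smul c).ae_eq ?_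
        filter_upwards [Lp.coeFn_smul c f] with x hx
        simp only [hx, Pi.smul_apply, smul_eq_mul]
        ring }
  toFun :=
    { toFun := fun f => MemLp.toLp (fun x => g x * (f : Lp ℂ 2 μ) x) f.2
      map_add' := fun f h => by
        rw [← MemLp.toLp_add, MemLp.toLp_eq_toLp_iff]
        filter_upwards [Lp.coeFn_add (f : Lp ℂ 2 μ) h] with x hx
        rw [Submodule.coe_add, hx]
        simp [mul_add]
      map_smul' := fun c f => by
        rw [RingHom.id_apply, ← MemLp.toLp_const_smul, MemLp.toLp_eq_toLp_iff]
        filter_upwards [Lp.coeFn_smul c (f : Lp ℂ 2 μ)] with x hx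
        simp only [Submodule.coe_smul, hx, Pi.smul_apply, smul_eq_mul]
        ring }

/-- Multiplication by a real function on `L²_a`. -/
def multOp (a : ℝ) (g : ℝ → ℝ) : L2w a →ₗ.[ℂ] L2w a := mulOp (weightMeasure a) fun x => (g x : ℂ)

/-- The Fourier multiplier `P(D)` on `L²_a`, where `D = -i∂`. Conjugated by `f ↦ e^{ax} f` it is the
Fourier multiplier `P(D + ia)` on `L²`, that is, `f̂(k + ia)` is multiplied by `P(k + ia)`, `k ∈ ℝ`.
The domain consists of all `f` for which the result is in `L²`. -/
def fourierMul (a : ℝ) (P : ℂ → ℂ) : L2w a →ₗ.[ℂ] L2w a :=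
  ((spectralEquiv a).symm.toLinearEquiv : Lp ℂ 2 (volume : Measure ℝ) →ₗ[ℂ] L2w a).compPMap
    { domain := (mulOp volume fun ξ : ℝ => P ((2 * Real.pi * ξ : ℝ) + a * Complex.I)).domain.comap
        ((spectralEquiv a).toLinearEquiv : L2w a →ₗ[ℂ] Lp ℂ 2 (volume : Measure ℝ))
      toFun := (mulOp volume fun ξ : ℝ => P ((2 * Real.pi * ξ : ℝ) + a * Complex.I)).toFun ∘ₗ
        ((spectralEquiv a).toLinearEquiv :
          L2w a →ₗ[ℂ] Lp ℂ 2 (volume : Measure ℝ)).submoduleComap _ }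

/-- The derivative `∂ = iD` on `L²_a`, with domain `H^1_a`. -/
def dOp (a : ℝ) : L2w a →ₗ.[ℂ] L2w a := fourierMul a fun ξ => Complex.I * ξ

/-! ### The solitary wave -/

/-- The KdV profile `Θ(x) = sech²(√3 x / 2)`. -/
def kdvProfile (x : ℝ) : ℝ := (1 / Real.cosh (Real.sqrt 3 * x / 2)) ^ 2

/-- `P(D) f` for a real integrable function `f`, given by Fourier inversion (the symbols used are
such that the result is real). -/
def realMul (P : ℝ → ℂ) (f : ℝ → ℝ) (x : ℝ) : ℝ :=
  (𝓕⁻ (fun ξ : ℝ => P (2 * Real.pi * ξ) * 𝓕 (fun y : ℝ => (f y : ℂ)) ξ) x).re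

/-- `i tanh D ω`. -/
def iTanhD (ω : ℝ → ℝ) : ℝ → ℝ := realMul (fun k => Complex.I * Real.tanh k) ω

/-- `(tanh D / D) ω`. -/
def tanhDOverD (ω : ℝ → ℝ) : ℝ → ℝ := realMul (fun k => ((Real.tanh k / k : ℝ) : ℂ)) ω

/-- The Riemann strain `ω(x) = ε² θ(εx)`. -/
def strain (ε : ℝ) (θ : ℝ → ℝ) (x : ℝ) : ℝ := ε ^ 2 * θ (ε * x)

/-- The inverse squared Froude number `γ = 1 - ε²`. -/
def gam (ε : ℝ) : ℝ := 1 - ε ^ 2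

/-- The steady water wave equation for the Riemann strain,
`ω = (1 - γ tanh D / D)⁻¹ ((3/2 ω² + ω³ - 1/2 (i tanh D ω)² (1 - 2 γ η)) / (1 + ω)²)`,
`η = (tanh D / D) ω`. -/
def IsSteady (γ : ℝ) (ω : ℝ → ℝ) : Prop :=
  ∀ x, ω x = realMul (fun k => ((1 - γ * (Real.tanh k / k) : ℝ) : ℂ)⁻¹)
    (fun y => (3 / 2 * ω y ^ 2 + ω y ^ 3
      - 1 / 2 * iTanhD ω y ^ 2 * (1 - 2 * γ * tanhDOverD ω y)) / (1 + ω y) ^ 2) x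

/-- `θ` is the scaled profile of the small solitary wave with parameter `ε`: it is even,
`‖θ - Θ‖ < ε^ν` in `H^m_α`, and `ω(x) = ε² θ(εx)` solves the steady wave equation. (For `m ≥ 1`
elements of `H^m_α` are continuous functions.) -/
structure IsSolitaryProfile (α : ℝ) (m : ℕ) (ν ε : ℝ) (θ : ℝ → ℝ) : Prop where
  continuous : Continuous θ
  even : ∀ x, θ (-x) = θ x
  close : weightedSobolevNorm m α (fun x => ((θ x - kdvProfile x : ℝ) : ℂ))
    < ENNReal.ofReal (ε ^ ν)
  steady : IsSteady (gam ε) (strain ε θ)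

/-! ### The coefficients, functions of `ε` and of the strain `ω` -/

/-- The horizontal surface velocity in flattened variables. -/
def uOne (ω : ℝ → ℝ) (x : ℝ) : ℝ :=
  (ω x + ω x ^ 2 + iTanhD ω x ^ 2) / ((1 + ω x) ^ 2 + iTanhD ω x ^ 2)

/-- The vertical surface velocity in flattened variables. -/
def vSurf (ω : ℝ → ℝ) (x : ℝ) : ℝ := -iTanhD ω x / ((1 + ω x) ^ 2 + iTanhD ω x ^ 2)

/-- `v₁ = (1 - u₁) ∂v / (γ (1 + ω))`. -/
def vOne (γ : ℝ) (ω : ℝ → ℝ) (x : ℝ) : ℝ :=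
  (1 - uOne ω x) * deriv (vSurf ω) x / (γ * (1 + ω x))

/-- `p = (1 - u₁) / ζ'`, where `ζ' = 1 + ω`. -/
def pCoef (ω : ℝ → ℝ) (x : ℝ) : ℝ := (1 - uOne ω x) / (1 + ω x)

/-- `q = √((1 - v₁) / ζ')`. -/
def qCoef (γ : ℝ) (ω : ℝ → ℝ) (x : ℝ) : ℝ := Real.sqrt ((1 - vOne γ ω x) / (1 + ω x))

/-- `ρ = √q`. -/
def rhoCoef (γ : ℝ) (ω : ℝ → ℝ) (x : ℝ) : ℝ := Real.sqrt (qCoef γ ω x)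

/-! ### The operators on `L²_a` -/

section Bundle

variable (a γ : ℝ) (ω : ℝ → ℝ)

/-- The symbol `√(-γ ξ tanh ξ)`, with the principal square root. -/
def scSymbol (ξ : ℂ) : ℂ := (-γ * ξ * Complex.tanh ξ) ^ (1 / 2 : ℂ)

/-- `𝒮 = √(-γ D tanh D)`. -/
def scOp : L2w a →ₗ.[ℂ] L2w a := fourierMul a (scSymbol γ)

/-- `𝒮⁻¹`. -/
def scInvOp : L2w a →ₗ.[ℂ] L2w a := fourierMul a fun ξ => (scSymbol γ ξ)⁻¹

/-- `𝒜₊ = ∂ + 𝒮`. -/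
def aPlus : L2w a →ₗ.[ℂ] L2w a := dOp a + scOp a γ

/-- `𝒰 = ∂ u_p + 𝒮 u_q`, where `u_p = p - 1`, `u_q = q - 1`. -/
def uuOp : L2w a →ₗ.[ℂ] L2w a :=
  dOp a * multOp a (fun x => pCoef ω x - 1) + scOp a γ * multOp a (fun x => qCoef γ ω x - 1)

/-- `R₁ = q' p q⁻¹`. -/
def rOne : L2w a →ₗ.[ℂ] L2w a :=
  multOp a fun x => deriv (qCoef γ ω) x * pCoef ω x * (qCoef γ ω x)⁻¹

/-- `[p, 𝒮] 𝒮⁻¹ ∂`. -/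
def pComm : L2w a →ₗ.[ℂ] L2w a :=
  opComm (multOp a (pCoef ω)) (scOp a γ) * (scInvOp a γ * dOp a)

/-- `R₂ = p' + [p, 𝒮] 𝒮⁻¹ ∂`. -/
def rTwo : L2w a →ₗ.[ℂ] L2w a := multOp a (deriv (pCoef ω)) + pComm a γ ω

/-- `[𝒮, q]`. -/
def qComm : L2w a →ₗ.[ℂ] L2w a := opComm (scOp a γ) (multOp a (qCoef γ ω))

/-- `[[𝒮, ρ], ρ]`. -/
def rhoComm : L2w a →ₗ.[ℂ] L2w a :=
  opComm (opComm (scOp a γ) (multOp a (rhoCoef γ ω))) (multOp a (rhoCoef γ ω))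

/-- `J₁₁`. -/
def jOneOne : L2w a →ₗ.[ℂ] L2w a := (-1 / 2 : ℂ) • (rTwo a γ ω + rOne a γ ω + qComm a γ ω)

/-- `J₁₂`. -/
def jOneTwo : L2w a →ₗ.[ℂ] L2w a := (-1 / 2 : ℂ) • (rOne a γ ω - rTwo a γ ω - qComm a γ ω)

/-- `J₂₁`. -/
def jTwoOne : L2w a →ₗ.[ℂ] L2w a := (-1 / 2 : ℂ) • (rOne a γ ω - rTwo a γ ω + qComm a γ ω)

/-- `J₂₂`. -/
def jTwoTwo : L2w a →ₗ.[ℂ] L2w a := (-1 / 2 : ℂ) • (rOne a γ ω + pComm a γ ω + rhoComm a γ ω)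

/-- `𝒜₂₂ = √p ∂ √p - √q 𝒮 √q + J₂₂`. -/
def aTwoTwo : L2w a →ₗ.[ℂ] L2w a :=
  multOp a (fun x => Real.sqrt (pCoef ω x)) * (dOp a * multOp a fun x => Real.sqrt (pCoef ω x))
    - multOp a (rhoCoef γ ω) * (scOp a γ * multOp a (rhoCoef γ ω)) + jTwoTwo a γ ω

/-- `W(z) = I - (z - 𝒜₊)⁻¹ 𝒰 - (z - 𝒜₊)⁻¹ (J₁₁ + J₁₂ (z - 𝒜₂₂)⁻¹ J₂₁)`, on its natural domain. -/
def wBundle (z : ℂ) : L2w a →ₗ.[ℂ] L2w a :=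
  scalarOp 1 - resolventOp (aPlus a γ) z * uuOp a γ ω
    - resolventOp (aPlus a γ) z *
      (jOneOne a γ ω + jOneTwo a γ ω * (resolventOp (aTwoTwo a γ ω) z * jTwoOne a γ ω))

end Bundle

/-- `½ ∂ - ⅙ ∂³` on `L²_α`. -/
def kdvOp (α : ℝ) : L2w α →ₗ.[ℂ] L2w α :=
  (1 / 2 : ℂ) • dOp α - (1 / 6 : ℂ) • (dOp α * (dOp α * dOp α))

/-- `W₀(z) = I + (z - ½ ∂ + ⅙ ∂³)⁻¹ ∂ (3/2 Θ)`, on its natural domain. -/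
def wZero (α : ℝ) (z : ℂ) : L2w α →ₗ.[ℂ] L2w α :=
  scalarOp 1 + resolventOp (kdvOp α) z * (dOp α * multOp α fun x => 3 / 2 * kdvProfile x)

/-- The similarity transform `S_ε B S_ε⁻¹`, a bounded operator on `L²_α`. -/
def dilConj (α : ℝ) {ε : ℝ} (hε : 0 < ε) (B : L2w (ε * α) →L[ℂ] L2w (ε * α)) :
    L2w α →L[ℂ] L2w α :=
  ((dilation α hε).toContinuousLinearEquiv : L2w (ε * α) →L[ℂ] L2w α) ∘L B ∘L
    ((dilation α hε).symm.toContinuousLinearEquiv : L2w α →L[ℂ] L2w (ε * α))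

end

/-! The unitary map `f ↦ 𝓕(e^{ax} f)` carries `L²_a` to `L²`. There a multiplier `P(D)` is
multiplication by `P` on the line `Im w = a`, and multiplication by `g = c + 𝓕⁻ φ` is `c` plus
convolution with `φ`. A commutator `[P(D), g]` therefore has the kernel `φ(η - ξ) (P(η) - P(ξ))`,
and Young's inequality bounds it by a moment of `φ`. The proof thus rests on two kinds of estimates:
for symbols on the line `Im w = εα`, and for moments of the transforms of the coefficients.

Symbols. Write `𝒮 = -∂ r` with `r² = γ tanh w / w` and `Re r > 0`, so that `𝒜₊ = ∂ (1 - r)`. With `k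
= Re w`, the bound `1 - |r| ≥ ε²/6 + (ε² + min(k², 1))/80` gives `Re (ε³ z - 𝒜₊) ≥ (α/80) ε (ε² +
min(k², 1))`; the term `ε²/6` pays for `Re z ≥ -α/6`. For fixed `α` it follows that `R = (ε³ z -
𝒜₊)⁻¹`, `∂ R` and `𝒜₊ R` are of size `ε⁻³`, `ε⁻²` and `ε⁻¹` (`SmallParam.aSym_bounds`). The
expansion `r ≈ 1 - ε²/2 - w²/6` identifies the KdV symbol as the limit, and
`SmallParam.norm_symbol_sub_le` shows that `ε² ∂ R` converges uniformly in `k` and `z`, at rate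
`√ε`. The operator `∂ - 𝒮` does not degenerate in this way: its resolvent is of size `ε⁻¹`, and so
is that of its perturbation `𝒜₂₂` (`exists_isResolvent_aTwoTwo`).

Coefficients. As `θ - Θ` is even, the weight `e^{αx}` controls `cosh(αx) (θ - Θ)`; this puts `θ` in
the Wiener algebra and gives `|θ - Θ| ≤ C ε^ν` (`exists_profile_bounds`). The steady equation then
yields regularity: its nonlinearity is quadratic and its inverse operator is smoothing at
frequencies above `ε`, so the third moment of the transform of `ω` in units of `ε` is `O(ε²)`
(`integral_cutWeight_le`). In `coefBounds` it follows that `p`, `q` and their roots are `1 + O(ε²)`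
in a Wiener algebra where a derivative gains `ε`, and that `(p - 1) - (q - 1) = -(3/2) ω + O(ε³)`.

Operators. The commutators, and with them all `J`, are `O(ε³)`. In the last term of `W` this gives
`ε⁻³ ε³ ε⁻¹ ε³ = ε²`. For `J₁₁` the product `ε⁻³ ε³` alone is not small, and structure is used: `R₂
= ∂ G` with `G = O(ε³)`, and `R₁ + [𝒮, q]` agrees with `[𝒜₊, q]` up to `O(ε⁵)`, a commutator on
which `R` acts well (`exists_maps_jOneOne`). Finally `𝒰 = ∂ ((p - 1) - (q - 1)) + 𝒜₊ (q - 1)`, where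
the second term contributes `O(ε)` after applying `R` and the first is `-ε² ∂ (3/2 θ(ε·))` up to a
small error (`exists_maps_uuOp`). Dilation turns the limit of this main term into the one in `W₀`.

Domains are handled by the relation `Maps T f g`. The domain of `W` lies in that of `∂`, and on the
latter everything is defined; as it is dense, the bounds there extend `W` to the whole space. -/

noncomputable section

/-! ### Partially defined operators as relations -/

section Relations

variable {E : Type*} [AddCommGroup E] [Module ℂ E]

/-- `f` is in the domain of `T` and `T f = g`. -/
def Maps (T : E →ₗ.[ℂ] E) (f g : E) : Prop := ∃ h : f ∈ T.domain, T ⟨f, h⟩ = g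

theorem Maps.mem {T : E →ₗ.[ℂ] E} {f g : E} (h : Maps T f g) : f ∈ T.domain := h.1

theorem Maps.unique {T : E →ₗ.[ℂ] E} {f g g' : E} (h : Maps T f g) (h' : Maps T f g') :
    g = g' := by
  obtain ⟨_, rfl⟩ := h
  obtain ⟨_, rfl⟩ := h'
  rfl

theorem maps_of_mem {T : E →ₗ.[ℂ] E} {f : E} (h : f ∈ T.domain) : Maps T f (T ⟨f, h⟩) := ⟨h, rfl⟩

theorem maps_add_iff {A B : E →ₗ.[ℂ] E} {f g : E} :
    Maps (A + B) f g ↔ ∃ g₁ g₂, Maps A f g₁ ∧ Maps B f g₂ ∧ g₁ + g₂ = g := by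
  constructor
  · rintro ⟨h, rfl⟩
    exact ⟨_, _, maps_of_mem h.1, maps_of_mem h.2, rfl⟩
  · rintro ⟨_, _, ⟨h₁, rfl⟩, ⟨h₂, rfl⟩, rfl⟩
    exact ⟨⟨h₁, h₂⟩, rfl⟩

theorem maps_sub_iff {A B : E →ₗ.[ℂ] E} {f g : E} :
    Maps (A - B) f g ↔ ∃ g₁ g₂, Maps A f g₁ ∧ Maps B f g₂ ∧ g₁ - g₂ = g := by
  constructor
  · rintro ⟨h, rfl⟩
    exact ⟨_, _, maps_of_mem h.1, maps_of_mem h.2, rfl⟩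
  · rintro ⟨_, _, ⟨h₁, rfl⟩, ⟨h₂, rfl⟩, rfl⟩
    exact ⟨⟨h₁, h₂⟩, rfl⟩

theorem maps_smul_iff {A : E →ₗ.[ℂ] E} {c : ℂ} {f g : E} :
    Maps (c • A) f g ↔ ∃ g₁, Maps A f g₁ ∧ c • g₁ = g := by
  constructor
  · rintro ⟨h, rfl⟩
    exact ⟨A ⟨f, h⟩, ⟨h, rfl⟩, rfl⟩
  · rintro ⟨_, ⟨h₁, rfl⟩, rfl⟩
    exact ⟨h₁, rfl⟩

theorem maps_mul_iff {A B : E →ₗ.[ℂ] E} {f g : E} :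
    Maps (A * B) f g ↔ ∃ g₁, Maps B f g₁ ∧ Maps A g₁ g := by
  constructor
  · rintro ⟨⟨f', h, rfl⟩, rfl⟩
    exact ⟨_, maps_of_mem f'.2, maps_of_mem h⟩
  · rintro ⟨_, ⟨h₁, rfl⟩, ⟨h₂, rfl⟩⟩
    exact ⟨⟨⟨f, h₁⟩, h₂, rfl⟩, rfl⟩

theorem maps_scalarOp_iff {c : ℂ} {f g : E} : Maps (scalarOp c) f g ↔ c • f = g := by
  constructor
  · rintro ⟨_, rfl⟩
    rfl
  · rintro rfl
    exact ⟨trivial, rfl⟩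

theorem maps_opComm_iff {A B : E →ₗ.[ℂ] E} {f g : E} :
    Maps (opComm A B) f g ↔ ∃ b ab a ba, Maps B f b ∧ Maps A b ab ∧ Maps A f a ∧ Maps B a ba ∧
      ab - ba = g := by
  simp only [opComm, maps_sub_iff, maps_mul_iff]
  constructor
  · rintro ⟨_, _, ⟨b, h1, h2⟩, ⟨a, h3, h4⟩, h5⟩
    exact ⟨b, _, a, _, h1, h2, h3, h4, h5⟩
  · rintro ⟨b, _, a, _, h1, h2, h3, h4, h5⟩
    exact ⟨_, _, ⟨b, h1, h2⟩, ⟨a, h3, h4⟩, h5⟩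

end Relations

/-! ### Bounded inverses and bounded extensions of partially defined operators. -/

section Resolvent

variable {E : Type*} [NormedAddCommGroup E] [NormedSpace ℂ E]

/-- `R` is the bounded inverse of `z - A`. -/
structure IsResolvent (A : E →ₗ.[ℂ] E) (z : ℂ) (R : E →L[ℂ] E) : Prop where
  right : ∀ f, Maps A (R f) (z • R f - f)
  left : ∀ f g, Maps A f g → R (z • f - g) = f

theorem IsResolvent.inResolventSet {A : E →ₗ.[ℂ] E} {z : ℂ} {R : E →L[ℂ] E}
    (h : IsResolvent A z R) : InResolventSet A z := by
  refine ⟨R, fun f => ?_, fun f => ?_⟩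
  · obtain ⟨h1, h2⟩ := h.right f
    exact ⟨h1, by rw [h2, sub_sub_cancel]⟩
  · exact h.left _ _ (maps_of_mem f.2)

theorem IsResolvent.maps_resolventOp {A : E →ₗ.[ℂ] E} {z : ℂ} {R : E →L[ℂ] E}
    (h : IsResolvent A z R) (f : E) : Maps (resolventOp A z) f (R f) := by
  -- `LinearPMap.inverse` is meaningful only for an injective operator; the left inverse property
  -- supplies injectivity.
  have hker : (scalarOp z - A).toFun.ker = ⊥ := by
    rw [LinearMap.ker_eq_bot']
    rintro ⟨x, hx⟩ h0
    have h1 : Maps (scalarOp z - A) x 0 := ⟨hx, h0⟩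
    obtain ⟨g₁, g₂, h2, h3, h4⟩ := maps_sub_iff.1 h1
    rw [maps_scalarOp_iff] at h2
    have := h.left x g₂ h3
    rw [h2, h4, map_zero] at this
    exact Subtype.ext this.symm
  have h1 : Maps (scalarOp z - A) (R f) f :=
    maps_sub_iff.2 ⟨_, _, maps_scalarOp_iff.2 rfl, h.right f, by simp⟩
  obtain ⟨hm, hf⟩ := h1
  have hd : f ∈ (resolventOp A z).domain := by
    rw [resolventOp, LinearPMap.inverse_domain]
    exact ⟨⟨R f, hm⟩, hf⟩
  exact ⟨hd, LinearPMap.inverse_apply_eq hker (y := ⟨f, hd⟩) (x := ⟨R f, hm⟩) hf⟩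

theorem IsResolvent.maps_resolventOp_iff {A : E →ₗ.[ℂ] E} {z : ℂ} {R : E →L[ℂ] E}
    (h : IsResolvent A z R) {f g : E} : Maps (resolventOp A z) f g ↔ g = R f :=
  ⟨fun h' => h'.unique (h.maps_resolventOp f), fun h' => h' ▸ h.maps_resolventOp f⟩

/-- A densely defined operator that is close to a bounded one on its domain has a bounded
extension. -/
theorem exists_isBoundedExtension [CompleteSpace E] {T : E →ₗ.[ℂ] E} (hd : Dense (T.domain : Set E))
    (B : E →L[ℂ] E) {C : ℝ} (hC : ∀ f g, Maps T f g → ‖g - B f‖ ≤ C * ‖f‖) (hC0 : 0 ≤ C) :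
    ∃ W : E →L[ℂ] E, IsBoundedExtension W T ∧ ‖W - B‖ ≤ C := by
  -- Only the difference `T - B` is extended by continuity. Adding `B` back gives the extension of
  -- `T` and the bound on `W - B` at once.
  let L : T.domain →ₗ[ℂ] E := T.toFun - (B : E →ₗ[ℂ] E) ∘ₗ T.domain.subtype
  have hL : ∀ f, ‖L f‖ ≤ C * ‖f‖ := fun f => hC f _ (maps_of_mem f.2)
  let Lc : T.domain →L[ℂ] E := L.mkContinuous C hL
  have hdr : DenseRange (T.domain.subtypeL) := by
    simpa [DenseRange] using hd
  have hui : IsUniformInducing (T.domain.subtypeL) := isUniformInducing_val _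
  let D : E →L[ℂ] E := Lc.extend T.domain.subtypeL
  have hD : ∀ f : T.domain, D f = L f := fun f => Lc.extend_eq hdr hui f
  refine ⟨D + B, ⟨hd, fun f => ?_⟩, ?_⟩
  · change D f + B f = T f
    rw [hD]
    simp [L]
  · rw [add_sub_cancel_right]
    refine ContinuousLinearMap.opNorm_le_bound _ hC0 fun f => ?_
    refine hdr.induction_on (p := fun f => ‖D f‖ ≤ C * ‖f‖) f ?_ ?_
    · exact isClosed_le (by fun_prop) (by fun_prop)
    · intro f
      have := hL f
      rw [← hD] at this
      exact this

end Resolvent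

/-! ### Multiplication operators and Fourier multipliers -/

theorem maps_mulOp_iff {μ : Measure ℝ} {g : ℝ → ℂ} {f h : Lp ℂ 2 μ} :
    Maps (mulOp μ g) f h ↔ h =ᵐ[μ] fun x => g x * f x := by
  constructor
  · rintro ⟨hf, rfl⟩
    exact MemLp.coeFn_toLp (p := 2) hf
  · intro hh
    have hf : f ∈ (mulOp μ g).domain := (Lp.memLp h).ae_eq hh
    refine ⟨hf, Lp.ext ?_⟩
    exact (MemLp.coeFn_toLp (p := 2) hf).trans hh.symm

theorem maps_multOp_iff {a : ℝ} {g : ℝ → ℝ} {f h : L2w a} :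
    Maps (multOp a g) f h ↔ h =ᵐ[weightMeasure a] fun x => (g x : ℂ) * f x := maps_mulOp_iff

/-- The point `k + ia`, `k = 2πξ`, at which symbols are evaluated. -/
def shiftedFreq (a ξ : ℝ) : ℂ := ((2 * Real.pi * ξ : ℝ) : ℂ) + a * Complex.I

/-- Together with `maps_multOp_iff` this reduces operator identities, domains included, to
identities of functions almost everywhere. -/
theorem maps_fourierMul_iff {a : ℝ} {P : ℂ → ℂ} {f g : L2w a} :
    Maps (fourierMul a P) f g ↔
      spectralEquiv a g =ᵐ[volume] fun ξ => P (shiftedFreq a ξ) * spectralEquiv a f ξ := by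
  have key : Maps (fourierMul a P) f g ↔
      Maps (mulOp volume fun ξ : ℝ => P (shiftedFreq a ξ)) (spectralEquiv a f)
        (spectralEquiv a g) := by
    constructor
    · rintro ⟨hf, rfl⟩
      refine ⟨hf, ?_⟩
      exact ((spectralEquiv a).apply_symm_apply _).symm
    · rintro ⟨hf, hg⟩
      refine ⟨hf, ?_⟩
      rw [← (spectralEquiv a).symm_apply_apply g, ← hg]
      rfl
  rw [key, maps_mulOp_iff]

theorem maps_dOp_iff {a : ℝ} {f g : L2w a} :
    Maps (dOp a) f g ↔
      spectralEquiv a g =ᵐ[volume] fun ξ => Complex.I * shiftedFreq a ξ * spectralEquiv a f ξ :=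
  maps_fourierMul_iff

/-- Bounded multiplication operators. -/
theorem exists_mulOp_clm {μ : Measure ℝ} {g : ℝ → ℂ} (hg : AEStronglyMeasurable g μ) {C : ℝ}
    (hC0 : 0 ≤ C) (hC : ∀ x, ‖g x‖ ≤ C) :
    ∃ B : Lp ℂ 2 μ →L[ℂ] Lp ℂ 2 μ, ‖B‖ ≤ C ∧ ∀ f, Maps (mulOp μ g) f (B f) := by
  have hb : ∀ f : Lp ℂ 2 μ, ∀ᵐ x ∂μ, ‖g x * f x‖ ≤ C * ‖f x‖ := fun f => by
    filter_upwards with x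
    rw [norm_mul]
    gcongr
    exact hC x
  have hd : ∀ f : Lp ℂ 2 μ, f ∈ (mulOp μ g).domain := fun f =>
    (Lp.memLp f).of_le_mul (hg.mul (Lp.aestronglyMeasurable f)) (hb f)
  let L : Lp ℂ 2 μ →ₗ[ℂ] Lp ℂ 2 μ :=
    (mulOp μ g).toFun ∘ₗ LinearMap.codRestrict _ LinearMap.id hd
  have hL : ∀ f, Maps (mulOp μ g) f (L f) := fun f => ⟨hd f, rfl⟩
  have hn : ∀ f, ‖L f‖ ≤ C * ‖f‖ := fun f => by
    refine Lp.norm_le_mul_norm_of_ae_le_mul ?_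
    filter_upwards [maps_mulOp_iff.1 (hL f), hb f] with x h1 h2
    rwa [h1]
  exact ⟨L.mkContinuous C hn, LinearMap.mkContinuous_norm_le _ hC0 _, hL⟩

theorem exists_multOp_clm (a : ℝ) {g : ℝ → ℝ} (hg : Measurable g) {C : ℝ}
    (hC0 : 0 ≤ C) (hC : ∀ x, |g x| ≤ C) :
    ∃ B : L2w a →L[ℂ] L2w a, ‖B‖ ≤ C ∧ ∀ f, Maps (multOp a g) f (B f) :=
  exists_mulOp_clm (by fun_prop) hC0 fun x => by simpa using hC x

theorem norm_le_of_maps_multOp {a : ℝ} {g : ℝ → ℝ} {C : ℝ} (hC : ∀ x, |g x| ≤ C) {f h : L2w a}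
    (hm : Maps (multOp a g) f h) : ‖h‖ ≤ C * ‖f‖ := by
  refine Lp.norm_le_mul_norm_of_ae_le_mul ?_
  filter_upwards [maps_multOp_iff.1 hm] with x h1
  rw [h1, norm_mul]
  gcongr
  simpa using hC x

@[fun_prop]
theorem measurable_shiftedFreq (a : ℝ) : Measurable (shiftedFreq a) := by
  unfold shiftedFreq
  fun_prop

theorem exists_fourierMul_clm (a : ℝ) {P : ℂ → ℂ} (hP : Measurable P) {C : ℝ}
    (hC0 : 0 ≤ C) (hC : ∀ ξ, ‖P (shiftedFreq a ξ)‖ ≤ C) :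
    ∃ B : L2w a →L[ℂ] L2w a, ‖B‖ ≤ C ∧ ∀ f, Maps (fourierMul a P) f (B f) := by
  obtain ⟨B, hB, hB'⟩ := exists_mulOp_clm (μ := volume) (g := fun ξ => P (shiftedFreq a ξ))
    (hP.comp (measurable_shiftedFreq a)).aestronglyMeasurable hC0 hC
  refine ⟨((spectralEquiv a).symm.toContinuousLinearEquiv : _ →L[ℂ] L2w a) ∘L B ∘L
    ((spectralEquiv a).toContinuousLinearEquiv : L2w a →L[ℂ] _), ?_, fun f => ?_⟩
  · refine ContinuousLinearMap.opNorm_le_bound _ hC0 fun f => ?_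
    change ‖(spectralEquiv a).symm (B (spectralEquiv a f))‖ ≤ _
    rw [LinearIsometryEquiv.norm_map]
    refine (B.le_of_opNorm_le hB _).trans ?_
    rw [LinearIsometryEquiv.norm_map]
  · rw [maps_fourierMul_iff]
    have := maps_mulOp_iff.1 (hB' (spectralEquiv a f))
    change (spectralEquiv a ((spectralEquiv a).symm (B (spectralEquiv a f)))) =ᵐ[volume] _
    rwa [LinearIsometryEquiv.apply_symm_apply]

theorem norm_eq_norm_spectralEquiv {a : ℝ} (f : L2w a) : ‖spectralEquiv a f‖ = ‖f‖ :=
  (spectralEquiv a).norm_map f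

theorem norm_le_of_maps_fourierMul {a : ℝ} {P : ℂ → ℂ} {C : ℝ}
    (hC : ∀ ξ, ‖P (shiftedFreq a ξ)‖ ≤ C) {f h : L2w a}
    (hm : Maps (fourierMul a P) f h) : ‖h‖ ≤ C * ‖f‖ := by
  rw [← norm_eq_norm_spectralEquiv h, ← norm_eq_norm_spectralEquiv f]
  refine Lp.norm_le_mul_norm_of_ae_le_mul ?_
  filter_upwards [maps_fourierMul_iff.1 hm] with x h1
  rw [h1, norm_mul]
  gcongr
  exact hC x

/-- Two elements of `L²_a` with a.e. equal transforms are equal. -/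
theorem eq_of_spectral_ae_eq {a : ℝ} {f g : L2w a}
    (h : spectralEquiv a f =ᵐ[volume] spectralEquiv a g) : f = g :=
  (spectralEquiv a).injective (Lp.ext h)

theorem spectral_add {a : ℝ} (f g : L2w a) :
    spectralEquiv a (f + g) =ᵐ[volume] fun ξ => spectralEquiv a f ξ + spectralEquiv a g ξ := by
  rw [map_add]
  exact Lp.coeFn_add _ _

theorem spectral_sub {a : ℝ} (f g : L2w a) :
    spectralEquiv a (f - g) =ᵐ[volume] fun ξ => spectralEquiv a f ξ - spectralEquiv a g ξ := by
  rw [map_sub]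
  exact Lp.coeFn_sub _ _

theorem spectral_smul {a : ℝ} (c : ℂ) (f : L2w a) :
    spectralEquiv a (c • f) =ᵐ[volume] fun ξ => c * spectralEquiv a f ξ := by
  rw [map_smul]
  exact Lp.coeFn_smul _ _

/-- The domain of a Fourier multiplier is dense. -/
theorem dense_fourierMul_domain (a : ℝ) {P : ℂ → ℂ} (hP : Measurable P) :
    Dense ((fourierMul a P).domain : Set (L2w a)) := by
  -- The multiplier `(1 + |P|)⁻¹` maps the whole space into the domain, so for `f` orthogonal to the
  -- domain, with transform `u`, the integral of `(1 + |P|)⁻¹ |u|²` vanishes.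
  have hQm : Measurable fun w => (((1 + ‖P w‖)⁻¹ : ℝ) : ℂ) := by fun_prop
  have hQ : ∀ w, ‖(((1 + ‖P w‖)⁻¹ : ℝ) : ℂ)‖ = (1 + ‖P w‖)⁻¹ := fun w => by
    rw [Complex.norm_real, Real.norm_of_nonneg (by positivity)]
  obtain ⟨B, -, hB⟩ := exists_fourierMul_clm a hQm zero_le_one fun ξ => by
    rw [hQ]
    exact inv_le_one_of_one_le₀ (by simp)
  have hPQm : Measurable fun w => P w * (((1 + ‖P w‖)⁻¹ : ℝ) : ℂ) := by fun_prop
  obtain ⟨B', -, hB'⟩ := exists_fourierMul_clm a hPQm zero_le_one fun ξ => by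
    rw [norm_mul, hQ, ← div_eq_mul_inv]
    exact div_le_one_of_le₀ (by simp) (by positivity)
  rw [Submodule.dense_iff_topologicalClosure_eq_top,
    Submodule.topologicalClosure_eq_top_iff, Submodule.eq_bot_iff]
  intro f hf
  have hmem : B f ∈ (fourierMul a P).domain := by
    refine Maps.mem (g := B' f) (maps_fourierMul_iff.2 ?_)
    filter_upwards [maps_fourierMul_iff.1 (hB f), maps_fourierMul_iff.1 (hB' f)] with ξ h1 h2
    rw [h1, h2, mul_assoc]
  have h0 := hf _ hmem
  rw [← (spectralEquiv a).inner_map_map, L2.inner_def] at h0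
  set u := spectralEquiv a f with hu
  have h1 : ∫ ξ, (1 + ‖P (shiftedFreq a ξ)‖)⁻¹ * ‖u ξ‖ ^ 2 = 0 := by
    have : ∫ ξ, (((1 + ‖P (shiftedFreq a ξ)‖)⁻¹ * ‖u ξ‖ ^ 2 : ℝ) : ℂ) = 0 := by
      rw [← h0]
      refine integral_congr_ae ?_
      filter_upwards [maps_fourierMul_iff.1 (hB f)] with ξ h1
      rw [h1, ← hu, RCLike.inner_apply, map_mul, Complex.conj_ofReal, mul_left_comm,
        Complex.mul_conj, Complex.normSq_eq_norm_sq]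
      push_cast
      ring
    rw [integral_complex_ofReal] at this
    exact_mod_cast this
  have h2 : (fun ξ => (1 + ‖P (shiftedFreq a ξ)‖)⁻¹ * ‖u ξ‖ ^ 2) =ᵐ[volume] 0 := by
    refine (integral_eq_zero_iff_of_nonneg (fun ξ => by positivity) ?_).1 h1
    have hu2 : Integrable (fun ξ => ‖u ξ‖ ^ 2) := (Lp.memLp u).integrable_norm_pow (by norm_num)
    refine hu2.mono' ?_ ?_
    · have := (Lp.stronglyMeasurable u).measurable
      exact Measurable.aestronglyMeasurable (by fun_prop)
    · filter_upwards with ξ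
      rw [Real.norm_of_nonneg (by positivity)]
      refine mul_le_of_le_one_left (by positivity) (inv_le_one_of_one_le₀ (by simp))
  have h3 : u = 0 := by
    refine Lp.ext ?_
    filter_upwards [h2, Lp.coeFn_zero ℂ 2 volume] with ξ h4 h5
    have : (1 + ‖P (shiftedFreq a ξ)‖)⁻¹ ≠ 0 := by positivity
    rw [h5]
    simpa [this] using h4
  exact (spectralEquiv a).map_eq_zero_iff.1 h3

/-! ### Young's inequality for `L¹ ⋆ L²` -/

/-- Cauchy–Schwarz for the splitting `K u = K^{1/2} · (K^{1/2} u)`. -/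
theorem sq_lintegral_mul_le {X : Type*} [MeasurableSpace X] {μ : Measure X} {K u : X → ℝ≥0∞}
    (hK : AEMeasurable K μ) (hu : AEMeasurable u μ) :
    (∫⁻ x, K x * u x ∂μ) ^ 2 ≤ (∫⁻ x, K x ∂μ) * ∫⁻ x, K x * u x ^ 2 ∂μ := by
  have h := ENNReal.lintegral_mul_le_Lp_mul_Lq μ (p := 2) (q := 2)
    (Real.holderConjugate_iff.2 ⟨by norm_num, by norm_num⟩)
    (f := fun x => K x ^ (1 / 2 : ℝ)) (g := fun x => K x ^ (1 / 2 : ℝ) * u x)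
    (hK.pow_const _) ((hK.pow_const _).mul hu)
  have hsq : ∀ y : ℝ≥0∞, (y ^ (1 / 2 : ℝ)) ^ (2 : ℝ) = y := fun y => by
    rw [← ENNReal.rpow_mul]
    norm_num
  have hsq' : ∀ y : ℝ≥0∞, y ^ (1 / 2 : ℝ) * y ^ (1 / 2 : ℝ) = y := fun y => by
    rw [← sq, ← ENNReal.rpow_ofNat, hsq]
  have e1 : (fun x => K x ^ (1 / 2 : ℝ)) * (fun x => K x ^ (1 / 2 : ℝ) * u x)
      = fun x => K x * u x := by
    funext x
    simp only [Pi.mul_apply]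
    rw [← mul_assoc, hsq']
  rw [e1] at h
  simp only [ENNReal.mul_rpow_of_nonneg _ _ (zero_le_two : (0 : ℝ) ≤ 2), hsq] at h
  calc _ ≤ _ := pow_le_pow_left' h 2
    _ = _ := by
      rw [mul_pow, ← ENNReal.rpow_ofNat, ← ENNReal.rpow_ofNat]
      simp only [hsq, ENNReal.rpow_ofNat]

/-- Cauchy–Schwarz with respect to the measure `K dκ` in the inner integral, then Tonelli and
translation invariance. -/
theorem lintegral_sq_lintegral_mul_sub_le {K u : ℝ → ℝ≥0∞} (hK : AEMeasurable K)
    (hu : Measurable u) :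
    ∫⁻ η, (∫⁻ κ, K κ * u (η - κ)) ^ 2 ≤ (∫⁻ κ, K κ) ^ 2 * ∫⁻ ξ, u ξ ^ 2 := by
  have hm : AEMeasurable (Function.uncurry fun η κ : ℝ => K κ * u (η - κ) ^ 2)
      (volume.prod volume) :=
    (hK.comp_snd).mul (by fun_prop : Measurable fun p : ℝ × ℝ => u (p.1 - p.2) ^ 2).aemeasurable
  calc ∫⁻ η, (∫⁻ κ, K κ * u (η - κ)) ^ 2
      ≤ ∫⁻ η, (∫⁻ κ, K κ) * ∫⁻ κ, K κ * u (η - κ) ^ 2 :=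
        lintegral_mono fun η => sq_lintegral_mul_le hK (by fun_prop)
    _ = (∫⁻ κ, K κ) * ∫⁻ η, ∫⁻ κ, K κ * u (η - κ) ^ 2 :=
        lintegral_const_mul'' _ hm.lintegral_prod_right'
    _ = (∫⁻ κ, K κ) * ∫⁻ κ, ∫⁻ η, K κ * u (η - κ) ^ 2 := by
        rw [lintegral_lintegral_swap hm]
    _ = _ := by
        have : ∀ κ, ∫⁻ η, K κ * u (η - κ) ^ 2 = K κ * ∫⁻ ξ, u ξ ^ 2 := fun κ => by
          rw [lintegral_const_mul _ (by fun_prop),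
            lintegral_sub_right_eq_self (fun ξ => u ξ ^ 2) κ]
        simp_rw [this]
        rw [lintegral_mul_const'' _ hK, sq, mul_assoc]

theorem eLpNorm_two_sq {X : Type*} [MeasurableSpace X] {μ : Measure X} {F : Type*}
    [NormedAddCommGroup F] (f : X → F) :
    eLpNorm f 2 μ ^ 2 = ∫⁻ x, ‖f x‖ₑ ^ 2 ∂μ := by
  rw [eLpNorm_eq_lintegral_rpow_enorm_toReal (by simp) (by simp)]
  simp only [ENNReal.toReal_ofNat, ENNReal.rpow_ofNat]
  rw [← ENNReal.rpow_ofNat, ← ENNReal.rpow_mul]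
  norm_num

/-- Young's inequality, with the a.e. convergence of the integrals. -/
theorem young_one_two {K : ℝ → ℝ} (hK : Integrable K) (hK0 : ∀ κ, 0 ≤ K κ) {u : ℝ → ℂ}
    (hum : Measurable u) (hu : MemLp u 2) :
    (∀ᵐ η, Integrable fun κ => K κ * ‖u (η - κ)‖) ∧
    MemLp (fun η => ∫ κ, K κ * ‖u (η - κ)‖) 2 ∧
    eLpNorm (fun η => ∫ κ, K κ * ‖u (η - κ)‖) 2 volume
      ≤ ENNReal.ofReal (∫ κ, K κ) * eLpNorm u 2 volume := by
  have hKm : AEMeasurable (fun κ => ENNReal.ofReal (K κ)) := hK.1.aemeasurable.ennreal_ofReal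
  have h1 := lintegral_sq_lintegral_mul_sub_le hKm (u := fun ξ => ‖u ξ‖ₑ) (by fun_prop)
  rw [← ofReal_integral_eq_lintegral_ofReal hK (ae_of_all _ hK0), ← eLpNorm_two_sq] at h1
  have hjm : AEStronglyMeasurable (fun p : ℝ × ℝ => K p.2 * ‖u (p.1 - p.2)‖)
      (volume.prod volume) :=
    hK.1.comp_snd.mul (by fun_prop : Measurable fun p : ℝ × ℝ => ‖u (p.1 - p.2)‖).aestronglyMeasurable
  have hlm : AEMeasurable (fun η => ∫⁻ κ, ENNReal.ofReal (K κ) * ‖u (η - κ)‖ₑ) :=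
    ((hKm.comp_snd).mul (by fun_prop :
      Measurable fun p : ℝ × ℝ => ‖u (p.1 - p.2)‖ₑ).aemeasurable).lintegral_prod_right'
  have hfin : ENNReal.ofReal (∫ κ, K κ) ^ 2 * eLpNorm u 2 volume ^ 2 < ⊤ :=
    ENNReal.mul_lt_top (ENNReal.pow_lt_top ENNReal.ofReal_lt_top) (ENNReal.pow_lt_top hu.2)
  have hae : ∀ᵐ η, Integrable fun κ => K κ * ‖u (η - κ)‖ := by
    have h2 := ae_lt_top' (hlm.pow_const 2) (h1.trans_lt hfin).ne
    filter_upwards [h2] with η h3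
    refine ⟨hK.1.mul (by fun_prop : Measurable fun κ => ‖u (η - κ)‖).aestronglyMeasurable, ?_⟩
    rw [hasFiniteIntegral_iff_enorm]
    have h4 : ∫⁻ κ, ENNReal.ofReal (K κ) * ‖u (η - κ)‖ₑ < ⊤ := by
      by_contra hc
      rw [not_lt, top_le_iff] at hc
      simp [hc] at h3
    refine lt_of_le_of_lt (lintegral_mono fun κ => ?_) h4
    rw [enorm_mul, enorm_norm, Real.enorm_of_nonneg (hK0 κ)]
  have hm : AEStronglyMeasurable (fun η => ∫ κ, K κ * ‖u (η - κ)‖) volume :=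
    hjm.integral_prod_right'
  have hle : eLpNorm (fun η => ∫ κ, K κ * ‖u (η - κ)‖) 2 volume
      ≤ ENNReal.ofReal (∫ κ, K κ) * eLpNorm u 2 volume := by
    rw [← ENNReal.pow_le_pow_left_iff (two_ne_zero), eLpNorm_two_sq, mul_pow]
    refine le_trans (lintegral_mono fun η => ?_) h1
    refine pow_le_pow_left' ((enorm_integral_le_lintegral_enorm _).trans
      (lintegral_mono fun κ => ?_)) 2
    rw [enorm_mul, enorm_norm, Real.enorm_of_nonneg (hK0 κ)]
  exact ⟨hae, ⟨hm, hle.trans_lt (ENNReal.mul_lt_top ENNReal.ofReal_lt_top hu.2)⟩, hle⟩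

theorem norm_le_of_ae_le_convolution {K : ℝ → ℝ} (hK : Integrable K) (hK0 : ∀ κ, 0 ≤ K κ)
    {u h : Lp ℂ 2 (volume : Measure ℝ)} (hh : ∀ᵐ η, ‖h η‖ ≤ ∫ κ, K κ * ‖u (η - κ)‖) :
    ‖h‖ ≤ (∫ κ, K κ) * ‖u‖ := by
  obtain ⟨-, h2, h3⟩ := young_one_two hK hK0 (Lp.stronglyMeasurable u).measurable (Lp.memLp u)
  rw [Lp.norm_def, Lp.norm_def]
  have h4 : eLpNorm h 2 volume ≤ eLpNorm (fun η => ∫ κ, K κ * ‖u (η - κ)‖) 2 volume :=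
    eLpNorm_mono_ae_real hh
  have h5 := h4.trans h3
  have h6 := ENNReal.toReal_mono
    (ENNReal.mul_lt_top ENNReal.ofReal_lt_top (Lp.memLp u).2).ne h5
  rwa [ENNReal.toReal_mul, ENNReal.toReal_ofReal (integral_nonneg hK0)] at h6

/-! ### The Fourier transform on `L²` -/

/-- The transform on `L²` is an abstract extension with no integral formula. Testing against
Schwartz functions moves it onto `ψ`, where the formula is available; the identities for the `L²`
transform below are proved in this way. -/
theorem integral_schwartz_mul_fourier (f : Lp ℂ 2 (volume : Measure ℝ)) (ψ : SchwartzMap ℝ ℂ) :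
    ∫ ξ, ψ ξ * Lp.fourierTransformₗᵢ ℝ ℂ f ξ = ∫ x, (𝓕 ψ) x * f x := by
  have h := DFunLike.congr_fun (Lp.fourier_toTemperedDistribution_eq f) ψ
  rw [TemperedDistribution.fourier_apply, Lp.toTemperedDistribution_apply,
    Lp.toTemperedDistribution_apply] at h
  exact h.symm

theorem ae_eq_of_integral_schwartz_mul {f g : ℝ → ℂ} (hf : LocallyIntegrable f)
    (hg : LocallyIntegrable g) (h : ∀ ψ : SchwartzMap ℝ ℂ, ∫ x, ψ x * f x = ∫ x, ψ x * g x) :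
    f =ᵐ[volume] g := by
  refine ae_eq_of_integral_contDiff_smul_eq hf hg fun ψ hψ hc => ?_
  have hψc : HasCompactSupport fun x => (ψ x : ℂ) := hc.comp_left (g := Complex.ofReal) rfl
  have hψs : ContDiff ℝ (⊤ : ℕ∞) fun x => (ψ x : ℂ) := Complex.ofRealCLM.contDiff.comp hψ
  have := h (hψc.toSchwartzMap hψs)
  simpa [Complex.real_smul] using this

theorem fourierInv_real_eq (φ : ℝ → ℂ) (x : ℝ) :
    𝓕⁻ φ x = ∫ κ, (Real.fourierChar (κ * x) : ℂ) * φ κ := by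
  rw [Real.fourierInv_eq]
  refine integral_congr_ae (ae_of_all _ fun κ => ?_)
  simp [Circle.smul_def, mul_comm]

/-- Absorbs the character that arises when `𝓕⁻ φ` is written as an integral; this is what turns a
product into a convolution. -/
theorem fourier_schwartz_translate (ψ : SchwartzMap ℝ ℂ) (κ x : ℝ) :
    (𝓕 (ψ.compSubConstCLM ℂ (-κ))) x = (Real.fourierChar (κ * x) : ℂ) * (𝓕 ψ) x := by
  rw [SchwartzMap.fourier_coe, SchwartzMap.fourier_coe, Real.fourier_real_eq, Real.fourier_real_eq]
  have h := integral_add_right_eq_self (μ := volume)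
    (fun v : ℝ => Real.fourierChar (-(v * x)) • ψ v) κ
  rw [← h, ← integral_const_mul]
  refine integral_congr_ae (ae_of_all _ fun v => ?_)
  simp only [SchwartzMap.compSubConstCLM_apply, sub_neg_eq_add, Circle.smul_def, smul_eq_mul]
  rw [← mul_assoc, ← Circle.coe_mul, ← AddChar.map_add_eq_mul]
  congr 3
  ring

/-- The convolution of an integrable and a square integrable function, tested against a Schwartz
function. -/
theorem integrable_schwartz_mul_convolution {φ : ℝ → ℂ} (hφ : Integrable φ)
    (u : Lp ℂ 2 (volume : Measure ℝ)) (ψ : SchwartzMap ℝ ℂ) :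
    Integrable (fun p : ℝ × ℝ => ψ p.1 * (φ p.2 * u (p.1 - p.2))) (volume.prod volume) := by
  have hum := (Lp.stronglyMeasurable u).measurable
  obtain ⟨h1, h2, -⟩ := young_one_two hφ.norm (fun κ => norm_nonneg _) hum (Lp.memLp u)
  rw [integrable_prod_iff]
  · constructor
    · filter_upwards [h1] with η hη
      refine (Integrable.mono hη (hφ.1.mul
        (by fun_prop : Measurable fun κ => u (η - κ)).aestronglyMeasurable)
        (ae_of_all _ fun κ => ?_)).const_mul _
      simp
    · have h3 : Integrable fun η => ‖ψ η‖ * ∫ κ, ‖φ κ‖ * ‖u (η - κ)‖ :=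
        (ψ.memLp 2).norm.integrable_mul h2
      refine h3.congr (ae_of_all _ fun η => ?_)
      simp only [norm_mul]
      rw [integral_const_mul]
  · refine ψ.continuous.aestronglyMeasurable.comp_fst.mul (hφ.1.comp_snd.mul ?_)
    exact (by fun_prop : Measurable fun p : ℝ × ℝ => u (p.1 - p.2)).aestronglyMeasurable

theorem ae_integrable_convolution {φ : ℝ → ℂ} (hφ : Integrable φ) {u : ℝ → ℂ} (hum : Measurable u)
    (hu : MemLp u 2) : ∀ᵐ η, Integrable fun κ => φ κ * u (η - κ) := by
  obtain ⟨h1, -, -⟩ := young_one_two hφ.norm (fun κ => norm_nonneg _) hum hu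
  filter_upwards [h1] with η hη
  refine Integrable.mono hη (hφ.1.mul
    (by fun_prop : Measurable fun κ => u (η - κ)).aestronglyMeasurable) (ae_of_all _ fun κ => ?_)
  simp

theorem memLp_convolution {φ : ℝ → ℂ} (hφ : Integrable φ) {u : ℝ → ℂ} (hum : Measurable u)
    (hu : MemLp u 2) : MemLp (fun η => ∫ κ, φ κ * u (η - κ)) 2 := by
  obtain ⟨-, h2, -⟩ := young_one_two hφ.norm (fun κ => norm_nonneg _) hum hu
  refine h2.of_le ?_ (ae_of_all _ fun η => ?_)
  · refine AEStronglyMeasurable.integral_prod_right' (f := fun p : ℝ × ℝ => φ p.2 * u (p.1 - p.2)) ?_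
    exact hφ.1.comp_snd.mul
      (by fun_prop : Measurable fun p : ℝ × ℝ => u (p.1 - p.2)).aestronglyMeasurable
  · refine (norm_integral_le_integral_norm _).trans (le_of_eq ?_)
    rw [Real.norm_of_nonneg (integral_nonneg fun κ => by positivity)]
    simp only [norm_mul]

/-- The transform of `g f`, `g = 𝓕⁻ φ`, is the convolution of `φ` with the transform of `f`. -/
theorem fourier_mul_ae_eq_convolution {φ : ℝ → ℂ} (hφ : Integrable φ)
    {f h : Lp ℂ 2 (volume : Measure ℝ)} (hh : h =ᵐ[volume] fun x => 𝓕⁻ φ x * f x) :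
    Lp.fourierTransformₗᵢ ℝ ℂ h =ᵐ[volume]
      fun η => ∫ κ, φ κ * Lp.fourierTransformₗᵢ ℝ ℂ f (η - κ) := by
  set u := Lp.fourierTransformₗᵢ ℝ ℂ f with hu
  have hum := (Lp.stronglyMeasurable u).measurable
  refine ae_eq_of_integral_schwartz_mul ((Lp.memLp _).locallyIntegrable (by norm_num))
    ((memLp_convolution hφ hum (Lp.memLp u)).locallyIntegrable (by norm_num)) fun ψ => ?_
  have hψf : Integrable fun x => (𝓕 ψ) x * f x := ((𝓕 ψ).memLp 2).integrable_mul (Lp.memLp f)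
  -- Write `𝓕⁻ φ` as an integral over `κ`, exchange the integrals, absorb each character into a
  -- translate of `ψ`, move the transform back to `f`, and exchange again.
  calc ∫ ξ, ψ ξ * Lp.fourierTransformₗᵢ ℝ ℂ h ξ = ∫ x, (𝓕 ψ) x * h x :=
        integral_schwartz_mul_fourier h ψ
    _ = ∫ x, ∫ κ, (Real.fourierChar (κ * x) : ℂ) * φ κ * ((𝓕 ψ) x * f x) := by
        refine integral_congr_ae ?_
        filter_upwards [hh] with x hx
        rw [hx, fourierInv_real_eq, integral_mul_const]
        ring
    _ = ∫ κ, ∫ x, (Real.fourierChar (κ * x) : ℂ) * φ κ * ((𝓕 ψ) x * f x) := by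
        refine integral_integral_swap ?_
        have hprod : Integrable (fun p : ℝ × ℝ => (𝓕 ψ) p.1 * f p.1 * φ p.2)
            (volume.prod volume) := hψf.mul_prod hφ
        refine (hprod.bdd_mul (c := 1)
          (f := fun p : ℝ × ℝ => (Real.fourierChar (p.2 * p.1) : ℂ)) ?_ ?_).congr ?_
        · exact Continuous.aestronglyMeasurable (by fun_prop)
        · exact ae_of_all _ fun p => (Circle.norm_coe _).le
        · refine ae_of_all _ fun p => ?_
          simp only [Function.uncurry]
          ring
    _ = ∫ κ, φ κ * ∫ ξ, ψ ξ * u (ξ - κ) := by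
        refine integral_congr_ae (ae_of_all _ fun κ => ?_)
        have h1 := integral_schwartz_mul_fourier f (ψ.compSubConstCLM ℂ (-κ))
        rw [← hu] at h1
        have h2 := integral_sub_right_eq_self (μ := volume)
          (fun ξ => (ψ.compSubConstCLM ℂ (-κ)) ξ * u ξ) κ
        have h3 : ∀ ξ, (ψ.compSubConstCLM ℂ (-κ)) (ξ - κ) = ψ ξ := fun ξ => by
          simp [SchwartzMap.compSubConstCLM_apply]
        simp only [h3] at h2
        change ∫ x, (Real.fourierChar (κ * x) : ℂ) * φ κ * ((𝓕 ψ) x * f x)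
          = φ κ * ∫ ξ, ψ ξ * u (ξ - κ)
        rw [h2, h1, ← integral_const_mul]
        refine integral_congr_ae (ae_of_all _ fun x => ?_)
        simp only [fourier_schwartz_translate]
        ring
    _ = ∫ κ, ∫ η, ψ η * (φ κ * u (η - κ)) := by
        refine integral_congr_ae (ae_of_all _ fun κ => ?_)
        simp only
        rw [← integral_const_mul]
        refine integral_congr_ae (ae_of_all _ fun x => ?_)
        simp only
        ring
    _ = ∫ η, ∫ κ, ψ η * (φ κ * u (η - κ)) :=
        (integral_integral_swap (f := fun η κ => ψ η * (φ κ * u (η - κ)))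
          (integrable_schwartz_mul_convolution hφ u ψ)).symm
    _ = _ := by simp only [integral_const_mul]

theorem integral_mul_fourierInv {f φ : ℝ → ℂ} (hf : Integrable f) (hφ : Integrable φ) :
    ∫ x, f x * 𝓕⁻ φ x = ∫ κ, 𝓕⁻ f κ * φ κ := by
  have hsw := integral_integral_swap (μ := volume) (ν := volume)
    (f := fun x κ : ℝ => (Real.fourierChar (κ * x) : ℂ) * (f x * φ κ)) (by
      refine (hf.mul_prod hφ).bdd_mul (c := 1)
        (f := fun p : ℝ × ℝ => (Real.fourierChar (p.2 * p.1) : ℂ)) ?_ ?_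
      · exact Continuous.aestronglyMeasurable (by fun_prop)
      · exact ae_of_all _ fun p => (Circle.norm_coe _).le)
  calc _ = ∫ x, ∫ κ, (Real.fourierChar (κ * x) : ℂ) * (f x * φ κ) := by
        refine integral_congr_ae (ae_of_all _ fun x => ?_)
        simp only
        rw [fourierInv_real_eq, ← integral_const_mul]
        refine integral_congr_ae (ae_of_all _ fun κ => ?_)
        simp only
        ring
    _ = _ := hsw
    _ = _ := by
        refine integral_congr_ae (ae_of_all _ fun κ => ?_)
        simp only
        rw [fourierInv_real_eq, ← integral_mul_const]
        refine integral_congr_ae (ae_of_all _ fun x => ?_)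
        simp only
        rw [mul_comm κ x]
        ring

theorem continuous_fourierInv_of_integrable {φ : ℝ → ℂ} (hφ : Integrable φ) :
    Continuous (𝓕⁻ φ) := by
  have h1 : Continuous (𝓕 φ) := by
    have := VectorFourier.fourierIntegral_continuous (V := ℝ) (W := ℝ) (μ := volume)
      Real.continuous_fourierChar (L := innerₗ ℝ) (by exact continuous_inner) hφ
    exact this
  have h2 : 𝓕⁻ φ = fun x => 𝓕 φ (-x) := by
    funext x
    exact Real.fourierInv_eq_fourier_neg φ x
  rw [h2]
  exact h1.comp continuous_neg

theorem continuous_fourier_of_integrable {φ : ℝ → ℂ} (hφ : Integrable φ) :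
    Continuous (𝓕 φ) := by
  have h2 : 𝓕 φ = fun x => 𝓕⁻ φ (-x) := by
    funext x
    rw [Real.fourierInv_eq_fourier_neg φ, neg_neg]
  rw [h2]
  exact (continuous_fourierInv_of_integrable hφ).comp continuous_neg

theorem norm_fourierInv_le {φ : ℝ → ℂ} (x : ℝ) : ‖𝓕⁻ φ x‖ ≤ ∫ κ, ‖φ κ‖ := by
  rw [fourierInv_real_eq]
  refine (norm_integral_le_integral_norm _).trans (le_of_eq ?_)
  simp [Circle.norm_coe]

theorem norm_fourier_le {φ : ℝ → ℂ} (x : ℝ) : ‖𝓕 φ x‖ ≤ ∫ κ, ‖φ κ‖ := by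
  have := norm_fourierInv_le (φ := φ) (-x)
  rwa [Real.fourierInv_eq_fourier_neg φ, neg_neg] at this

/-- An `L²` function with integrable transform is given by the inversion formula. -/
theorem fourierInv_ae_eq_of_integrable {f : Lp ℂ 2 (volume : Measure ℝ)}
    (hf : Integrable (Lp.fourierTransformₗᵢ ℝ ℂ f)) :
    f =ᵐ[volume] 𝓕⁻ (Lp.fourierTransformₗᵢ ℝ ℂ f : ℝ → ℂ) := by
  refine ae_eq_of_integral_schwartz_mul ((Lp.memLp _).locallyIntegrable (by norm_num))
    (continuous_fourierInv_of_integrable hf).locallyIntegrable fun ψ => ?_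
  rw [integral_mul_fourierInv ψ.integrable hf]
  have h := integral_schwartz_mul_fourier f (𝓕⁻ ψ)
  rw [FourierTransform.fourier_fourierInv_eq, SchwartzMap.fourierInv_coe] at h
  exact h.symm

/-- An integrable function `𝓕⁻ φ` has transform `φ`. -/
theorem fourier_ae_eq_of_eq_fourierInv {f φ : ℝ → ℂ} (hf : Integrable f) (hφ : Integrable φ)
    (h : ∀ x, f x = 𝓕⁻ φ x) : 𝓕 f =ᵐ[volume] φ := by
  refine ae_eq_of_integral_schwartz_mul (continuous_fourier_of_integrable hf).locallyIntegrable
    hφ.locallyIntegrable fun ψ => ?_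
  have h1 : 𝓕 f = fun x => 𝓕⁻ f (-x) := by
    funext x
    rw [Real.fourierInv_eq_fourier_neg f, neg_neg]
  have h2 : ∀ x, (𝓕⁻ fun y => ψ (-y)) x = (𝓕 ψ) x := fun x => by
    rw [SchwartzMap.fourier_coe]
    exact congrFun (Real.fourierInv_eq_fourier_comp_neg (fun y => ψ (-y)) |>.trans (by simp)) x
  -- Inversion is applied to the Schwartz function only: integrability of `𝓕 f` is a consequence of
  -- the claim, not known beforehand.
  calc ∫ x, ψ x * 𝓕 f x = ∫ x, ψ (-x) * 𝓕⁻ f x := by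
        rw [← integral_neg_eq_self (fun x => ψ x * 𝓕 f x)]
        simp [h1]
    _ = ∫ κ, (𝓕 ψ) κ * f κ := by
        rw [integral_mul_fourierInv ψ.integrable.comp_neg hf]
        simp only [h2]
    _ = ∫ κ, (𝓕 ψ) κ * 𝓕⁻ φ κ := by simp only [h]
    _ = ∫ κ, ψ κ * φ κ := by
        rw [integral_mul_fourierInv (𝓕 ψ).integrable hφ, ← SchwartzMap.fourierInv_coe,
          FourierTransform.fourierInv_fourier_eq]

/-- The transform of a dilation. -/
theorem fourier_dilation_ae_eq {ε : ℝ} (hε : 0 < ε) (c : ℂ) {f h : Lp ℂ 2 (volume : Measure ℝ)}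
    (hh : h =ᵐ[volume] fun x => c * f (x * ε⁻¹)) :
    Lp.fourierTransformₗᵢ ℝ ℂ h =ᵐ[volume]
      fun ξ => c * ε * Lp.fourierTransformₗᵢ ℝ ℂ f (ε * ξ) := by
  set u := Lp.fourierTransformₗᵢ ℝ ℂ f with hu
  have hum := (Lp.stronglyMeasurable u).measurable
  have hL : MemLp (fun ξ => c * ε * u (ε * ξ)) 2 := by
    refine MemLp.const_mul ?_ _
    refine ⟨(by fun_prop : Measurable fun ξ => u (ε * ξ)).aestronglyMeasurable, ?_⟩
    have h1 : eLpNorm (fun ξ => u (ε * ξ)) 2 volume ^ 2 < ⊤ := by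
      rw [eLpNorm_two_sq]
      have h2 : Measurable fun ξ => ‖u ξ‖ₑ ^ 2 := by fun_prop
      have h3 := lintegral_map h2 (measurable_const_mul ε) (μ := volume)
      rw [Real.map_volume_mul_left hε.ne', lintegral_smul_measure, ← eLpNorm_two_sq] at h3
      rw [← h3]
      exact ENNReal.mul_lt_top ENNReal.ofReal_lt_top (ENNReal.pow_lt_top (Lp.memLp u).2)
    by_contra hc
    rw [not_lt, top_le_iff] at hc
    simp [hc] at h1
  refine ae_eq_of_integral_schwartz_mul ((Lp.memLp _).locallyIntegrable (by norm_num))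
    (hL.locallyIntegrable (by norm_num)) fun ψ => ?_
  let e : ℝ ≃L[ℝ] ℝ := ContinuousLinearEquiv.smulLeft (Units.mk0 ε⁻¹ (inv_ne_zero hε.ne'))
  let χ : SchwartzMap ℝ ℂ := SchwartzMap.compCLMOfContinuousLinearEquiv ℂ e ψ
  have hχ : ∀ ξ, χ ξ = ψ (ε⁻¹ * ξ) := fun ξ => rfl
  have hFχ : ∀ x, (𝓕 χ) x = (ε : ℂ) * (𝓕 ψ) (ε * x) := fun x => by
    rw [SchwartzMap.fourier_coe, SchwartzMap.fourier_coe, Real.fourier_real_eq,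
      Real.fourier_real_eq]
    have h1 := Measure.integral_comp_mul_left
      (fun v : ℝ => Real.fourierChar (-(v * (ε * x))) • ψ v) ε⁻¹
    rw [inv_inv, abs_of_pos hε, Complex.real_smul] at h1
    rw [← h1]
    refine integral_congr_ae (ae_of_all _ fun v => ?_)
    simp only [hχ]
    congr 3
    field_simp
  calc ∫ ξ, ψ ξ * Lp.fourierTransformₗᵢ ℝ ℂ h ξ = ∫ x, (𝓕 ψ) x * h x :=
        integral_schwartz_mul_fourier h ψ
    _ = ∫ x, (𝓕 ψ) (ε * (x * ε⁻¹)) * (c * f (x * ε⁻¹)) := by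
        refine integral_congr_ae ?_
        filter_upwards [hh] with x hx
        rw [hx]
        congr 2
        field_simp
    _ = ε * ∫ y, (𝓕 ψ) (ε * y) * (c * f y) := by
        have h1 := Measure.integral_comp_mul_right
          (fun y : ℝ => (𝓕 ψ) (ε * y) * (c * f y)) ε⁻¹
        rw [inv_inv, abs_of_pos hε, Complex.real_smul] at h1
        exact h1
    _ = c * ∫ y, (𝓕 χ) y * f y := by
        rw [← integral_const_mul, ← integral_const_mul]
        refine integral_congr_ae (ae_of_all _ fun y => ?_)
        simp only [hFχ]
        ring
    _ = c * ∫ ξ, χ ξ * u ξ := by rw [← integral_schwartz_mul_fourier, hu]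
    _ = c * (ε * ∫ ξ, ψ ξ * u (ε * ξ)) := by
        have h1 := Measure.integral_comp_mul_left
          (fun v : ℝ => ψ v * u (ε * v)) ε⁻¹
        rw [inv_inv, abs_of_pos hε, Complex.real_smul] at h1
        rw [← h1]
        congr 1
        refine integral_congr_ae (ae_of_all _ fun v => ?_)
        simp only [hχ]
        rw [mul_inv_cancel_left₀ hε.ne']
    _ = _ := by
        rw [← integral_const_mul, ← integral_const_mul]
        refine integral_congr_ae (ae_of_all _ fun v => ?_)
        simp only
        ring

/-! ### Multiplication by functions with integrable transform, on `L²_a` -/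

/-- `g = c + 𝓕⁻ φ` with `φ` integrable. -/
structure HasSpectrum (g : ℝ → ℝ) (c : ℝ) (φ : ℝ → ℂ) : Prop where
  integrable : Integrable φ
  eq : ∀ x, (g x : ℂ) = c + 𝓕⁻ φ x

theorem volume_ac_weightMeasure (a : ℝ) : (volume : Measure ℝ) ≪ weightMeasure a :=
  withDensity_absolutelyContinuous' (by fun_prop) (ae_of_all _ fun x => by
    simp [Real.exp_pos])

theorem weightMeasure_ac_volume (a : ℝ) : weightMeasure a ≪ (volume : Measure ℝ) :=
  withDensity_absolutelyContinuous _ _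

theorem wcompEquiv_ae_eq {μ ν : Measure ℝ} {c : ℝ → ℂ} {e : ℝ ≃ᵐ ℝ} (hc : Measurable c)
    (h0 : ∀ x, c x ≠ 0) (h : μ = (ν.withDensity fun x => ‖c x‖ₑ ^ 2).map e) (f : Lp ℂ 2 μ) :
    wcompEquiv hc h0 h f =ᵐ[ν] fun x => c x * f (e x) :=
  MemLp.coeFn_toLp (wcomp_memLp hc h f)

theorem weightEquiv_ae_eq {a : ℝ} (f : L2w a) :
    weightEquiv a f =ᵐ[volume] fun x => ((Real.exp (a * x) : ℝ) : ℂ) * f x :=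
  wcompEquiv_ae_eq _ _ _ f

/-- The weight `e^{ax}` commutes with multiplication by `g`, so the same `φ` serves for every `a`.
-/
theorem HasSpectrum.spectral_ae_eq {g : ℝ → ℝ} {c : ℝ} {φ : ℝ → ℂ} (hg : HasSpectrum g c φ)
    {a : ℝ} {f h : L2w a} (hm : Maps (multOp a g) f h) :
    spectralEquiv a h =ᵐ[volume]
      fun η => c * spectralEquiv a f η + ∫ κ, φ κ * spectralEquiv a f (η - κ) := by
  have h1 := (volume_ac_weightMeasure a).ae_le (maps_multOp_iff.1 hm)
  have h2 : weightEquiv a (h - (c : ℂ) • f) =ᵐ[volume] fun x => 𝓕⁻ φ x * weightEquiv a f x := by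
    have h3 := (volume_ac_weightMeasure a).ae_le (Lp.coeFn_sub h ((c : ℂ) • f))
    have h4 := (volume_ac_weightMeasure a).ae_le (Lp.coeFn_smul (c : ℂ) f)
    filter_upwards [weightEquiv_ae_eq (h - (c : ℂ) • f), weightEquiv_ae_eq f, h1, h3, h4]
      with x e1 e2 e3 e4 e5
    rw [e1, e2, e4, Pi.sub_apply, e5, e3, hg.eq, Pi.smul_apply, smul_eq_mul]
    ring
  have h5 := fourier_mul_ae_eq_convolution hg.integrable h2
  filter_upwards [h5, spectral_sub h ((c : ℂ) • f), spectral_smul (c : ℂ) f] with η e1 e2 e3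
  change spectralEquiv a (h - (c : ℂ) • f) η = ∫ κ, φ κ * spectralEquiv a f (η - κ) at e1
  rw [← e1, e2, e3]
  ring

theorem measurable_spectral {a : ℝ} (f : L2w a) : Measurable (spectralEquiv a f) :=
  (Lp.stronglyMeasurable _).measurable

theorem memLp_spectral {a : ℝ} (f : L2w a) : MemLp (spectralEquiv a f) 2 volume := Lp.memLp _

/-- A bound for integral operators with kernel `φ(η - ξ) b(η, ξ)`. -/
theorem norm_le_of_kernel {a : ℝ} {φ : ℝ → ℂ} {k : ℝ → ℝ} (hk0 : ∀ κ, 0 ≤ k κ)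
    (hk : Integrable fun κ => k κ * ‖φ κ‖) {b : ℝ → ℝ → ℂ} (hb : ∀ η κ, ‖b η (η - κ)‖ ≤ k κ)
    {f h : L2w a} (hh : ∀ᵐ η, spectralEquiv a h η
      = ∫ κ, φ κ * (b η (η - κ) * spectralEquiv a f (η - κ))) :
    ‖h‖ ≤ (∫ κ, k κ * ‖φ κ‖) * ‖f‖ := by
  have hK0 : ∀ κ, 0 ≤ k κ * ‖φ κ‖ := fun κ => mul_nonneg (hk0 κ) (norm_nonneg _)
  obtain ⟨h1, -, -⟩ := young_one_two hk hK0 (measurable_spectral f) (memLp_spectral f)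
  rw [← norm_eq_norm_spectralEquiv h, ← norm_eq_norm_spectralEquiv f]
  refine norm_le_of_ae_le_convolution hk hK0 ?_
  filter_upwards [hh, h1] with η e1 e2
  rw [e1]
  refine norm_integral_le_of_norm_le e2 (ae_of_all _ fun κ => ?_)
  rw [norm_mul, norm_mul, mul_comm (k κ), mul_assoc]
  gcongr
  exact hb η κ

theorem ae_integrable_spectral {a : ℝ} {φ : ℝ → ℂ} (hφ : Integrable φ) (f : L2w a) :
    ∀ᵐ η, Integrable fun κ => φ κ * spectralEquiv a f (η - κ) :=
  ae_integrable_convolution hφ (measurable_spectral f) (memLp_spectral f)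

/-- Pull an a.e. statement back under `κ ↦ η - κ`. -/
theorem ae_ae_sub {p : ℝ → Prop} (h : ∀ᵐ ξ, p ξ) (η : ℝ) : ∀ᵐ κ, p (η - κ) :=
  (volume.measurePreserving_sub_left η).quasiMeasurePreserving.ae h

/-- The transform of a commutator of a multiplier and a multiplication, written with `P f = f'`,
`g f = h`, `P h = h'`, `g f' = h''`. -/
theorem HasSpectrum.spectral_commutator {g : ℝ → ℝ} {c : ℝ} {φ : ℝ → ℂ} (hg : HasSpectrum g c φ)
    {a : ℝ} {P : ℂ → ℂ} {f f' h h' h'' : L2w a} (h1 : Maps (fourierMul a P) f f')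
    (h2 : Maps (multOp a g) f h) (h3 : Maps (fourierMul a P) h h')
    (h4 : Maps (multOp a g) f' h'') :
    ∀ᵐ η, spectralEquiv a (h' - h'') η = ∫ κ, φ κ *
      ((P (shiftedFreq a η) - P (shiftedFreq a (η - κ))) * spectralEquiv a f (η - κ)) := by
  filter_upwards [spectral_sub h' h'', maps_fourierMul_iff.1 h1, hg.spectral_ae_eq h2,
    maps_fourierMul_iff.1 h3, hg.spectral_ae_eq h4, ae_integrable_spectral hg.integrable f,
    ae_integrable_spectral hg.integrable f'] with η e1 e2 e3 e4 e5 i1 i2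
  have e6 := ae_ae_sub (maps_fourierMul_iff.1 h1) η
  rw [e1, e4, e5, e3, e2]
  have e7 : ∫ κ, φ κ * ((P (shiftedFreq a η) - P (shiftedFreq a (η - κ)))
        * spectralEquiv a f (η - κ))
      = ∫ κ, (P (shiftedFreq a η) * (φ κ * spectralEquiv a f (η - κ))
        - φ κ * spectralEquiv a f' (η - κ)) := by
    refine integral_congr_ae ?_
    filter_upwards [e6] with κ e8
    rw [e8]
    ring
  rw [e7, integral_sub (i1.const_mul _) i2, integral_const_mul]
  ring

/-- Multiplication by a function with enough regularity preserves the domain of a multiplier. -/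
theorem HasSpectrum.exists_maps_fourierMul {g : ℝ → ℝ} {c : ℝ} {φ : ℝ → ℂ}
    (hg : HasSpectrum g c φ) (hφ : Integrable fun κ => |κ| * ‖φ κ‖) {a : ℝ} {P : ℂ → ℂ}
    (hP : Measurable P) {C : ℝ} (hC : 0 ≤ C)
    (hPC : ∀ η ξ, ‖P (shiftedFreq a η)‖ ≤ ‖P (shiftedFreq a ξ)‖ + C * |η - ξ|)
    {f f' h : L2w a} (h1 : Maps (fourierMul a P) f f') (h2 : Maps (multOp a g) f h) :
    ∃ h', Maps (fourierMul a P) h h' := by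
  set u := spectralEquiv a f with hu
  set u' := spectralEquiv a f' with hu'
  have hum := measurable_spectral f
  have hum' := measurable_spectral f'
  have hK : Integrable fun κ => (1 + C * |κ|) * ‖φ κ‖ :=
    (hg.integrable.norm.add (hφ.const_mul C)).congr (ae_of_all _ fun κ => by
      simp only [Pi.add_apply]
      ring)
  have hK0 : ∀ κ, 0 ≤ (1 + C * |κ|) * ‖φ κ‖ := fun κ => by positivity
  -- The hypothesis gives `|P(η)| ≤ (1 + C|κ|) (1 + |P(η - κ)|)`. So `P` times the convolution of
  -- `φ` and `u` is dominated by the convolution of `(1 + C|κ|) |φ|` with `|u| + |P u|`, to which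
  -- Young's inequality applies.
  have hUm : Measurable fun ξ => ((‖u ξ‖ + ‖u' ξ‖ : ℝ) : ℂ) := by fun_prop
  have hU : MemLp (fun ξ => ((‖u ξ‖ + ‖u' ξ‖ : ℝ) : ℂ)) 2 volume :=
    ((memLp_spectral f).norm.add (memLp_spectral f').norm).ofReal
  obtain ⟨y1, y2, -⟩ := young_one_two hK hK0 hUm hU
  have hmem : MemLp (fun η => P (shiftedFreq a η) * spectralEquiv a h η) 2 volume := by
    refine ((memLp_spectral f').norm.const_mul |c| |>.add y2).of_le ?_ ?_
    · exact ((hP.comp (measurable_shiftedFreq a)).mul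
        (measurable_spectral h)).aestronglyMeasurable
    · filter_upwards [maps_fourierMul_iff.1 h1, hg.spectral_ae_eq h2, y1,
        ae_integrable_spectral hg.integrable f] with η e1 e2 e3 e4
      have e5 := ae_ae_sub (maps_fourierMul_iff.1 h1) η
      have hnn : 0 ≤ ∫ κ, (1 + C * |κ|) * ‖φ κ‖ * ‖((‖u (η - κ)‖ + ‖u' (η - κ)‖ : ℝ) : ℂ)‖ :=
        integral_nonneg fun κ => by positivity
      rw [e2, mul_add, mul_left_comm, ← hu, ← e1, ← integral_const_mul, Pi.add_apply,
        Real.norm_of_nonneg (by positivity)]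
      refine (norm_add_le _ _).trans (add_le_add ?_ ?_)
      · simp
      · refine norm_integral_le_of_norm_le e3 ?_
        filter_upwards [e5] with κ e6
        rw [← hu, ← hu'] at e6
        have e7 := hPC η (η - κ)
        rw [sub_sub_cancel] at e7
        have e8 : ‖u' (η - κ)‖ = ‖P (shiftedFreq a (η - κ))‖ * ‖u (η - κ)‖ := by
          rw [e6, norm_mul]
        rw [norm_mul, norm_mul, Complex.norm_real, Real.norm_of_nonneg (by positivity), e8]
        have e9 : 0 ≤ C * |κ| := by positivity
        have e10 : ‖P (shiftedFreq a η)‖ ≤ (1 + C * |κ|) * (1 + ‖P (shiftedFreq a (η - κ))‖) := by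
          nlinarith [norm_nonneg (P (shiftedFreq a (η - κ)))]
        calc _ ≤ (1 + C * |κ|) * (1 + ‖P (shiftedFreq a (η - κ))‖) * (‖φ κ‖ * ‖u (η - κ)‖) := by
              gcongr
          _ = _ := by ring
  refine ⟨(spectralEquiv a).symm (hmem.toLp _), maps_fourierMul_iff.2 ?_⟩
  rw [LinearIsometryEquiv.apply_symm_apply]
  exact hmem.coeFn_toLp

/-! ### Dilations -/

theorem dilation_ae_eq (α : ℝ) {ε : ℝ} (hε : 0 < ε) (f : L2w (ε * α)) :
    dilation α hε f =ᵐ[weightMeasure α] fun x => (((Real.sqrt ε)⁻¹ : ℝ) : ℂ) * f (x * ε⁻¹) :=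
  wcompEquiv_ae_eq _ _ _ f

theorem ae_comp_mul_right {p : ℝ → Prop} (h : ∀ᵐ x, p x) {c : ℝ} (hc : c ≠ 0) :
    ∀ᵐ x, p (x * c) := by
  have : Measure.QuasiMeasurePreserving (fun x : ℝ => x * c) volume volume := by
    refine ⟨by fun_prop, ?_⟩
    rw [Real.map_volume_mul_right hc]
    exact Measure.smul_absolutelyContinuous
  exact this.ae h

theorem spectral_dilation (α : ℝ) {ε : ℝ} (hε : 0 < ε) (f : L2w (ε * α)) :
    spectralEquiv α (dilation α hε f) =ᵐ[volume]
      fun ξ => (((Real.sqrt ε)⁻¹ : ℝ) : ℂ) * ε * spectralEquiv (ε * α) f (ε * ξ) := by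
  refine fourier_dilation_ae_eq hε _ ?_
  filter_upwards [weightEquiv_ae_eq (dilation α hε f),
    (volume_ac_weightMeasure α).ae_le (dilation_ae_eq α hε f),
    ae_comp_mul_right (weightEquiv_ae_eq f) (inv_ne_zero hε.ne')] with x e1 e2 e3
  change weightEquiv α (dilation α hε f) x = _ * weightEquiv (ε * α) f (x * ε⁻¹)
  rw [e1, e2, e3]
  have : ε * α * (x * ε⁻¹) = α * x := by field_simp
  rw [this]
  ring

/-- The line `Im w = εα` is the dilate of `Im w = α`, which is why the weight is scaled with `ε`. -/
theorem shiftedFreq_dilation (α : ℝ) {ε : ℝ} (ξ : ℝ) :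
    shiftedFreq (ε * α) (ε * ξ) = ε * shiftedFreq α ξ := by
  simp only [shiftedFreq]
  push_cast
  ring

theorem maps_fourierMul_dilation {α : ℝ} {ε : ℝ} (hε : 0 < ε) {P Q : ℂ → ℂ}
    (hPQ : ∀ w, Q (ε * w) = P w) {f g : L2w (ε * α)} (h : Maps (fourierMul (ε * α) Q) f g) :
    Maps (fourierMul α P) (dilation α hε f) (dilation α hε g) := by
  rw [maps_fourierMul_iff] at h ⊢
  have h' := ae_comp_mul_right h hε.ne'
  filter_upwards [spectral_dilation α hε f, spectral_dilation α hε g, h'] with ξ e1 e2 e3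
  rw [e1, e2, mul_comm ε ξ, e3, mul_comm ξ ε, shiftedFreq_dilation, hPQ]
  ring

theorem maps_multOp_dilation {α : ℝ} {ε : ℝ} (hε : 0 < ε) {g : ℝ → ℝ}
    {f h : L2w (ε * α)} (hm : Maps (multOp (ε * α) fun x => g (ε * x)) f h) :
    Maps (multOp α g) (dilation α hε f) (dilation α hε h) := by
  rw [maps_multOp_iff] at hm ⊢
  have h1 := (volume_ac_weightMeasure (ε * α)).ae_le hm
  have h2 := (weightMeasure_ac_volume α).ae_le (ae_comp_mul_right h1 (inv_ne_zero hε.ne'))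
  filter_upwards [h2, dilation_ae_eq α hε f, dilation_ae_eq α hε h] with x e1 e2 e3
  rw [e2, e3, e1]
  have : ε * (x * ε⁻¹) = x := by field_simp
  rw [this]
  ring

/-! ### Hyperbolic functions on a strip -/

section Strip

/-- The derivative of the difference is `t sinh t - t²`, nonnegative since `sinh t ≥ t`. -/
theorem sinh_le_mul_cosh {k : ℝ} (hk : 0 ≤ k) :
    Real.sinh k ≤ k * Real.cosh k - k ^ 3 / 3 := by
  let F : ℝ → ℝ := fun t => t * Real.cosh t - t ^ 3 / 3 - Real.sinh t
  have hF : ∀ t, HasDerivAt F (t * Real.sinh t - t ^ 2) t := fun t => by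
    have h := (((hasDerivAt_id t).mul (Real.hasDerivAt_cosh t)).sub
      ((hasDerivAt_pow 3 t).div_const 3)).sub (Real.hasDerivAt_sinh t)
    refine HasDerivAt.congr_deriv (f := F) h ?_
    simp
    ring
  have hmono : MonotoneOn F (Set.Ici 0) := by
    refine monotoneOn_of_deriv_nonneg (convex_Ici 0) (fun t _ => (hF t).continuousAt.continuousWithinAt)
      (fun t _ => (hF t).differentiableAt.differentiableWithinAt) fun t ht => ?_
    rw [interior_Ici] at ht
    rw [(hF t).deriv]
    have : t ≤ Real.sinh t := Real.self_le_sinh_iff.2 (le_of_lt ht)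
    have h0 : 0 < t := ht
    nlinarith
  have h := hmono (Set.mem_Ici.2 le_rfl) (Set.mem_Ici.2 hk) hk
  simp only [F] at h
  simp at h
  linarith

theorem sinh_le_min_mul {k : ℝ} (hk : 0 ≤ k) :
    Real.sinh k ≤ (1 - min (k ^ 2) 1 / 9) * (k * Real.cosh k) := by
  have hc := Real.cosh_pos k
  -- At `k = 9/8` the factor `(1 - 1/9) k` reaches `1`, so beyond it `sinh ≤ cosh` suffices; below
  -- it `cosh k ≤ 3`, and the cubic gain `k³/3` is large enough.
  rcases le_total (9 / 8) k with h | h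
  · have h1 : min (k ^ 2) 1 = 1 := min_eq_right (by nlinarith)
    rw [h1]
    have := (Real.sinh_lt_cosh k).le
    nlinarith
  · have h1 := sinh_le_mul_cosh hk
    have h2 : Real.cosh k ≤ 3 := by
      refine (Real.cosh_le_exp_half_sq k).trans ?_
      have : Real.exp (k ^ 2 / 2) ≤ Real.exp 1 := Real.exp_le_exp.2 (by nlinarith)
      have := Real.exp_one_lt_d9
      linarith
    have h3 : min (k ^ 2) 1 ≤ k ^ 2 := min_le_left _ _
    have h4 : k * Real.cosh k * k ^ 2 ≤ 3 * k ^ 3 := by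
      have : 0 ≤ k ^ 3 := by positivity
      nlinarith
    have h5 : min (k ^ 2) 1 * (k * Real.cosh k) ≤ k ^ 2 * (k * Real.cosh k) := by gcongr
    nlinarith

theorem sinh_sq_le (k : ℝ) :
    Real.sinh k ^ 2 ≤ (1 - min (k ^ 2) 1 / 9) * (k ^ 2 * Real.cosh k ^ 2) := by
  have h := sinh_le_min_mul (abs_nonneg k)
  rw [sq_abs, Real.cosh_abs, ← Real.abs_sinh] at h
  have h0 : 0 ≤ min (k ^ 2) 1 := le_min (by positivity) zero_le_one
  have h1 : min (k ^ 2) 1 ≤ 1 := min_le_right _ _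
  have h2 : |Real.sinh k| ^ 2 ≤ ((1 - min (k ^ 2) 1 / 9) * (|k| * Real.cosh k)) ^ 2 :=
    pow_le_pow_left₀ (abs_nonneg _) h 2
  rw [sq_abs, mul_pow, mul_pow, sq_abs] at h2
  refine h2.trans ?_
  have : (1 - min (k ^ 2) 1 / 9) ^ 2 ≤ 1 - min (k ^ 2) 1 / 9 := by nlinarith
  gcongr

theorem tanh_div_le (k : ℝ) : Real.tanh k / k ≤ 1 - min (k ^ 2) 1 / 9 := by
  have key : ∀ t : ℝ, 0 < t → Real.tanh t / t ≤ 1 - min (t ^ 2) 1 / 9 := fun t ht => by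
    rw [div_le_iff₀ ht, Real.tanh_eq_sinh_div_cosh, div_le_iff₀ (Real.cosh_pos t), mul_assoc]
    exact sinh_le_min_mul ht.le
  have h1 : min (k ^ 2) 1 ≤ 1 := min_le_right _ _
  rcases lt_trichotomy k 0 with h | h | h
  · have := key (-k) (by linarith)
    rwa [Real.tanh_neg, neg_div_neg_eq, neg_sq] at this
  · subst h
    simp
  · exact key k h

theorem tanh_div_nonneg (k : ℝ) : 0 ≤ Real.tanh k / k := by
  rcases le_total 0 k with h | h
  · refine div_nonneg ?_ h
    rw [Real.tanh_eq_sinh_div_cosh]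
    exact div_nonneg (Real.sinh_nonneg_iff.2 h) (Real.cosh_pos k).le
  · refine div_nonneg_of_nonpos ?_ h
    rw [Real.tanh_eq_sinh_div_cosh]
    exact div_nonpos_of_nonpos_of_nonneg (Real.sinh_nonpos_iff.2 h) (Real.cosh_pos k).le

theorem sq_le_sinh_sq (k : ℝ) : k ^ 2 ≤ Real.sinh k ^ 2 := by
  rw [← sq_abs k, ← sq_abs (Real.sinh k), Real.abs_sinh]
  exact pow_le_pow_left₀ (abs_nonneg k) (Real.self_le_sinh_iff.2 (abs_nonneg k)) 2

theorem sq_le_mul_sinh_mul_cosh (k : ℝ) : k ^ 2 ≤ k * (Real.sinh k * Real.cosh k) := by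
  have key : ∀ t : ℝ, 0 ≤ t → t ^ 2 ≤ t * (Real.sinh t * Real.cosh t) := fun t ht => by
    have h1 := Real.self_le_sinh_iff.2 ht
    have h2 := Real.one_le_cosh t
    rw [sq]
    gcongr
    nlinarith
  rcases le_total 0 k with h | h
  · exact key k h
  · have := key (-k) (by linarith)
    rw [Real.sinh_neg, Real.cosh_neg] at this
    nlinarith

variable {k a : ℝ}

theorem sinh_strip (k a : ℝ) : Complex.sinh (k + a * Complex.I)
    = ((Real.sinh k * Real.cos a : ℝ) : ℂ) + ((Real.cosh k * Real.sin a : ℝ) : ℂ) * Complex.I := by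
  rw [Complex.sinh_add, Complex.sinh_mul_I, Complex.cosh_mul_I]
  push_cast
  ring

theorem cosh_strip (k a : ℝ) : Complex.cosh (k + a * Complex.I)
    = ((Real.cosh k * Real.cos a : ℝ) : ℂ) + ((Real.sinh k * Real.sin a : ℝ) : ℂ) * Complex.I := by
  rw [Complex.cosh_add, Complex.sinh_mul_I, Complex.cosh_mul_I]
  push_cast
  ring

theorem normSq_strip (x y : ℝ) : Complex.normSq (x + y * Complex.I) = x ^ 2 + y ^ 2 := by
  rw [Complex.normSq_add_mul_I]

theorem normSq_sinh_strip (k a : ℝ) : Complex.normSq (Complex.sinh (k + a * Complex.I))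
    = Real.sinh k ^ 2 + Real.sin a ^ 2 := by
  rw [sinh_strip, normSq_strip]
  have h1 := Real.cosh_sq k
  have h2 := Real.sin_sq_add_cos_sq a
  nlinarith

theorem normSq_cosh_strip (k a : ℝ) : Complex.normSq (Complex.cosh (k + a * Complex.I))
    = Real.sinh k ^ 2 + Real.cos a ^ 2 := by
  rw [cosh_strip, normSq_strip]
  have h1 := Real.cosh_sq k
  have h2 := Real.sin_sq_add_cos_sq a
  nlinarith

theorem cos_sq_strip (ha0 : 0 < a) (ha : a ≤ 1 / 2) :
    Real.sin a ^ 2 ≤ a ^ 2 ∧ a ^ 2 / 4 ≤ Real.sin a ^ 2 ∧ 1 - a ^ 2 ≤ Real.cos a ^ 2 ∧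
      0 < Real.sin a ∧ 0 < Real.cos a := by
  have h1 : Real.sin a ≤ a := Real.sin_le ha0.le
  have h2 : a / 2 ≤ Real.sin a := by
    have := Real.sin_gt_sub_cube ha0
    nlinarith [sq_nonneg a, mul_nonneg ha0.le (sq_nonneg a)]
  have h3 := Real.sin_sq_add_cos_sq a
  refine ⟨by nlinarith, by nlinarith, by nlinarith, by linarith, ?_⟩
  exact Real.cos_pos_of_mem_Ioo ⟨by linarith [Real.pi_gt_three], by linarith [Real.pi_gt_three]⟩

theorem cosh_strip_ne_zero (ha0 : 0 < a) (ha : a ≤ 1 / 2) :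
    Complex.cosh (k + a * Complex.I) ≠ 0 := by
  intro h
  have h1 := normSq_cosh_strip k a
  rw [h, map_zero] at h1
  obtain ⟨-, -, -, -, h2⟩ := cos_sq_strip ha0 ha
  nlinarith [sq_nonneg (Real.sinh k)]

theorem strip_ne_zero (ha0 : 0 < a) : (k + a * Complex.I : ℂ) ≠ 0 := by
  intro h
  have := congrArg Complex.im h
  simp at this
  exact ha0.ne' this

theorem norm_strip_sq (k a : ℝ) : ‖(k + a * Complex.I : ℂ)‖ ^ 2 = k ^ 2 + a ^ 2 := by
  rw [← Complex.normSq_eq_norm_sq, normSq_strip]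

theorem tanh_strip (ha0 : 0 < a) (ha : a ≤ 1 / 2) : Complex.tanh (k + a * Complex.I)
    = ((Real.sinh k * Real.cosh k / (Real.sinh k ^ 2 + Real.cos a ^ 2) : ℝ) : ℂ)
      + ((Real.sin a * Real.cos a / (Real.sinh k ^ 2 + Real.cos a ^ 2) : ℝ) : ℂ) * Complex.I := by
  obtain ⟨-, -, -, -, h2⟩ := cos_sq_strip ha0 ha
  have hD : (0 : ℝ) < Real.sinh k ^ 2 + Real.cos a ^ 2 := by positivity
  have hD' : ((Real.sinh k ^ 2 + Real.cos a ^ 2 : ℝ) : ℂ) ≠ 0 := by exact_mod_cast hD.ne'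
  rw [Complex.tanh_eq_sinh_div_cosh, div_eq_iff (cosh_strip_ne_zero ha0 ha), sinh_strip,
    cosh_strip]
  have h3 : (Real.cosh k : ℂ) ^ 2 = (Real.sinh k : ℂ) ^ 2 + 1 := by
    exact_mod_cast Real.cosh_sq k
  have h4 : (Real.sin a : ℂ) ^ 2 + (Real.cos a : ℂ) ^ 2 = 1 := by
    exact_mod_cast Real.sin_sq_add_cos_sq a
  push_cast at hD' ⊢
  set S : ℂ := Complex.sinh k
  set C : ℂ := Complex.cosh k
  set s : ℂ := Complex.sin a
  set c : ℂ := Complex.cos a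
  push_cast at h3 h4
  field_simp
  have hI := Complex.I_sq
  linear_combination (-S * s ^ 2 * c) * hI + (-S * c) * h3 + (S * c) * h4

/-- `T(w) = tanh w / w`. -/
def tanhQuot (w : ℂ) : ℂ := Complex.tanh w / w

theorem mul_tanhQuot {w : ℂ} (hw : w ≠ 0) : w * tanhQuot w = Complex.tanh w := by
  rw [tanhQuot, mul_div_cancel₀ _ hw]

theorem normSq_tanh_strip (k a : ℝ) : Complex.normSq (Complex.tanh (k + a * Complex.I))
    = (Real.sinh k ^ 2 + Real.sin a ^ 2) / (Real.sinh k ^ 2 + Real.cos a ^ 2) := by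
  rw [Complex.tanh_eq_sinh_div_cosh, map_div₀, normSq_sinh_strip, normSq_cosh_strip]

theorem norm_tanh_strip_le (ha0 : 0 < a) (ha : a ≤ 1 / 2) :
    ‖Complex.tanh (k + a * Complex.I)‖ ≤ 1 := by
  obtain ⟨h1, -, h2, -, h3⟩ := cos_sq_strip ha0 ha
  have hD : (0 : ℝ) < Real.sinh k ^ 2 + Real.cos a ^ 2 := by positivity
  rw [← sq_le_one_iff₀ (norm_nonneg _), ← Complex.normSq_eq_norm_sq, normSq_tanh_strip,
    div_le_one hD]
  nlinarith

theorem norm_tanhQuot_sq (k a : ℝ) : ‖tanhQuot (k + a * Complex.I)‖ ^ 2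
    = (Real.sinh k ^ 2 + Real.sin a ^ 2) / (Real.sinh k ^ 2 + Real.cos a ^ 2) / (k ^ 2 + a ^ 2) := by
  rw [tanhQuot, norm_div, div_pow, norm_strip_sq, ← Complex.normSq_eq_norm_sq, normSq_tanh_strip]

/-- Numerator and denominator are both compared with `cosh² k`. The bound `tanh k / k ≤ 1 - min(k²,
1)/9` of the real line thereby survives on the shifted line up to errors of order `a²`; for `a ≤
ε/2` these are absorbed by `γ = 1 - ε²`. -/
theorem norm_tanhQuot_sq_le (ha0 : 0 < a) (ha : a ≤ 1 / 2) :
    (1 - a ^ 2) * ‖tanhQuot (k + a * Complex.I)‖ ^ 2 ≤ 1 - min (k ^ 2) 1 / 9 + a ^ 2 / 9 := by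
  obtain ⟨h1, -, h2, -, h3⟩ := cos_sq_strip ha0 ha
  have hD : (0 : ℝ) < Real.sinh k ^ 2 + Real.cos a ^ 2 := by positivity
  have hka : 0 < k ^ 2 + a ^ 2 := by positivity
  set t := min (k ^ 2) 1 with ht
  have ht0 : 0 ≤ t := le_min (by positivity) zero_le_one
  have ht1 : t ≤ 1 := min_le_right _ _
  have htk : t ≤ k ^ 2 := min_le_left _ _
  have hS := sinh_sq_le k
  rw [← ht] at hS
  have hC := Real.cosh_sq k
  have hC1 : 1 ≤ Real.cosh k ^ 2 := by nlinarith [sq_nonneg (Real.sinh k)]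
  have e1 : Real.sinh k ^ 2 + Real.sin a ^ 2
      ≤ ((1 - t / 9) * k ^ 2 + a ^ 2) * Real.cosh k ^ 2 := by nlinarith [sq_nonneg a]
  have e2 : (1 - t / 9) * k ^ 2 + a ^ 2 ≤ (1 - t / 9 + a ^ 2 / 9) * (k ^ 2 + a ^ 2) := by
    nlinarith [mul_nonneg (sq_nonneg a) (sub_nonneg.2 htk), sq_nonneg (a ^ 2)]
  have e3 : (1 - a ^ 2) * Real.cosh k ^ 2 ≤ Real.sinh k ^ 2 + Real.cos a ^ 2 := by
    nlinarith [mul_nonneg (sq_nonneg a) (sq_nonneg (Real.sinh k))]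
  have ha2 : a ^ 2 ≤ 1 / 4 := by nlinarith
  rw [norm_tanhQuot_sq, div_div, ← mul_div_assoc, div_le_iff₀ (by positivity)]
  calc (1 - a ^ 2) * (Real.sinh k ^ 2 + Real.sin a ^ 2)
      ≤ (1 - a ^ 2) * (((1 - t / 9 + a ^ 2 / 9) * (k ^ 2 + a ^ 2)) * Real.cosh k ^ 2) := by
        refine mul_le_mul_of_nonneg_left (e1.trans ?_) (by linarith)
        gcongr
    _ = ((1 - t / 9 + a ^ 2 / 9) * (k ^ 2 + a ^ 2)) * ((1 - a ^ 2) * Real.cosh k ^ 2) := by ring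
    _ ≤ ((1 - t / 9 + a ^ 2 / 9) * (k ^ 2 + a ^ 2)) * (Real.sinh k ^ 2 + Real.cos a ^ 2) := by
        refine mul_le_mul_of_nonneg_left e3 (mul_nonneg ?_ hka.le)
        nlinarith [sq_nonneg a]
    _ = _ := by ring

theorem norm_tanhQuot_le (ha0 : 0 < a) (ha : a ≤ 1 / 2) :
    ‖tanhQuot (k + a * Complex.I)‖ ≤ 3 / 2 := by
  have h := norm_tanhQuot_sq_le (k := k) ha0 ha
  have ht0 : 0 ≤ min (k ^ 2) 1 := le_min (by positivity) zero_le_one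
  have ha2 : a ^ 2 ≤ 1 / 4 := by nlinarith
  refine abs_le_of_sq_le_sq' (b := 3 / 2) ?_ (by norm_num) |>.2
  nlinarith [sq_nonneg ‖tanhQuot (k + a * Complex.I)‖]

/-- Decay no faster than `1/|w|`; this makes bounds relative to `r` possible, which division by `r`
in `𝒮⁻¹ ∂` requires. -/
theorem le_norm_tanhQuot (ha0 : 0 < a) (ha : a ≤ 1 / 2) :
    1 ≤ 2 * (1 + ‖(k + a * Complex.I : ℂ)‖) * ‖tanhQuot (k + a * Complex.I)‖ := by
  obtain ⟨h1, h1', h2, -, h3⟩ := cos_sq_strip ha0 ha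
  have hD : (0 : ℝ) < Real.sinh k ^ 2 + Real.cos a ^ 2 := by positivity
  have hka : 0 < k ^ 2 + a ^ 2 := by positivity
  have hsq := norm_strip_sq k a
  have hn := norm_nonneg (k + a * Complex.I : ℂ)
  have e1 : 1 ≤ 4 * (1 + k ^ 2) * ‖tanhQuot (k + a * Complex.I)‖ ^ 2 := by
    rw [norm_tanhQuot_sq, div_div, ← mul_div_assoc, le_div_iff₀ (by positivity)]
    have := sq_le_sinh_sq k
    have h4 := Real.sin_sq_add_cos_sq a
    have e2 : (k ^ 2 + a ^ 2 / 4) * (Real.sinh k ^ 2 + Real.cos a ^ 2)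
        ≤ (1 + k ^ 2) * (Real.sinh k ^ 2 + Real.sin a ^ 2) := by
      have e3 : (k ^ 2 + Real.sin a ^ 2) * (Real.sinh k ^ 2 + 1)
          ≤ (1 + k ^ 2) * (Real.sinh k ^ 2 + Real.sin a ^ 2) := by
        nlinarith [mul_nonneg (sub_nonneg.2 this) (sq_nonneg (Real.cos a))]
      refine le_trans ?_ e3
      gcongr
      nlinarith [sq_nonneg (Real.sin a)]
    nlinarith [mul_nonneg (sq_nonneg a) hD.le, mul_nonneg (sq_nonneg k) hD.le]
  have e4 : 1 + k ^ 2 ≤ (1 + ‖(k + a * Complex.I : ℂ)‖) ^ 2 := by nlinarith [sq_nonneg a]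
  have e5 : 1 ^ 2 ≤ (2 * (1 + ‖(k + a * Complex.I : ℂ)‖) * ‖tanhQuot (k + a * Complex.I)‖) ^ 2 := by
    calc (1 : ℝ) ^ 2 ≤ 4 * (1 + k ^ 2) * ‖tanhQuot (k + a * Complex.I)‖ ^ 2 := by rwa [one_pow]
      _ ≤ 4 * (1 + ‖(k + a * Complex.I : ℂ)‖) ^ 2 * ‖tanhQuot (k + a * Complex.I)‖ ^ 2 := by gcongr
      _ = _ := by ring
  exact (pow_le_pow_iff_left₀ zero_le_one (by positivity) two_ne_zero).1 e5

/-- Real and imaginary parts of `T`, up to a positive factor. -/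
theorem tanhQuot_re_im (ha0 : 0 < a) (ha : a ≤ 1 / 2) :
    0 ≤ (tanhQuot (k + a * Complex.I)).re ∧ k * (tanhQuot (k + a * Complex.I)).im ≤ 0 ∧
    0 ≤ k * ((k + a * Complex.I) * Complex.tanh (k + a * Complex.I)).im ∧
    (((k + a * Complex.I) * Complex.tanh (k + a * Complex.I)).im = 0 → k = 0) := by
  obtain ⟨h1, h1', h2, hs, hc⟩ := cos_sq_strip ha0 ha
  have hD : (0 : ℝ) < Real.sinh k ^ 2 + Real.cos a ^ 2 := by positivity
  have hka : 0 < k ^ 2 + a ^ 2 := by positivity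
  have hkk := sq_le_mul_sinh_mul_cosh k
  have hsc : Real.sin a * Real.cos a ≤ a := by
    have := Real.sin_le ha0.le
    have := Real.cos_le_one a
    nlinarith
  set X := Real.sinh k * Real.cosh k with hX
  set Y := Real.sin a * Real.cos a with hY
  have hY0 : 0 < Y := by positivity
  set D := Real.sinh k ^ 2 + Real.cos a ^ 2 with hDdef
  have hT : tanhQuot (k + a * Complex.I) = (((k * X + a * Y) / D / (k ^ 2 + a ^ 2) : ℝ) : ℂ)
      + (((k * Y - a * X) / D / (k ^ 2 + a ^ 2) : ℝ) : ℂ) * Complex.I := by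
    rw [tanhQuot, tanh_strip ha0 ha, div_eq_iff (strip_ne_zero ha0)]
    have hD' : (D : ℂ) ≠ 0 := by exact_mod_cast hD.ne'
    have hka' : (k : ℂ) ^ 2 + (a : ℂ) ^ 2 ≠ 0 := by exact_mod_cast hka.ne'
    rw [← hX, ← hY, ← hDdef]
    push_cast
    field_simp
    linear_combination (-(k : ℂ) * a * Y + a ^ 2 * X) * Complex.I_sq
  have hP : (k + a * Complex.I) * Complex.tanh (k + a * Complex.I)
      = (((k * X - a * Y) / D : ℝ) : ℂ) + (((k * Y + a * X) / D : ℝ) : ℂ) * Complex.I := by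
    rw [tanh_strip ha0 ha, ← hX, ← hY, ← hDdef]
    have hD' : (D : ℂ) ≠ 0 := by exact_mod_cast hD.ne'
    push_cast
    field_simp
    linear_combination (a * Y : ℂ) * Complex.I_sq
  rw [hT, hP]
  simp only [Complex.add_re, Complex.ofReal_re, Complex.mul_re, Complex.I_re, Complex.ofReal_im,
    Complex.I_im, Complex.add_im, Complex.mul_im, mul_zero, mul_one, sub_zero, add_zero,
    zero_add]
  refine ⟨?_, ?_, ?_, ?_⟩
  · have : 0 ≤ k * X + a * Y := by nlinarith [sq_nonneg k]
    positivity
  · rw [div_div, ← mul_div_assoc]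
    refine div_nonpos_of_nonpos_of_nonneg ?_ (by positivity)
    nlinarith [mul_nonneg ha0.le (sub_nonneg.2 hkk), mul_nonneg (sq_nonneg k) (sub_nonneg.2 hsc)]
  · rw [← mul_div_assoc]
    refine div_nonneg ?_ hD.le
    nlinarith [mul_nonneg ha0.le (sub_nonneg.2 hkk), mul_nonneg (sq_nonneg k) hY0.le,
      mul_nonneg ha0.le (sq_nonneg k)]
  · intro h
    rw [div_eq_zero_iff, or_iff_left hD.ne'] at h
    have h5 : k * (k * Y + a * X) = 0 := by rw [h, mul_zero]
    have h6 : k ^ 2 * Y = 0 := by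
      nlinarith [mul_nonneg ha0.le (sub_nonneg.2 hkk), mul_nonneg (sq_nonneg k) hY0.le,
        mul_nonneg ha0.le (sq_nonneg k)]
    rcases mul_eq_zero.1 h6 with h7 | h7
    · exact pow_eq_zero_iff two_ne_zero |>.1 h7
    · exact absurd h7 hY0.ne'

end Strip

/-! ### Lipschitz bounds and Taylor expansion of `tanh w / w` on a horizontal line. -/

section StripLipschitz

variable {k l a : ℝ}

theorem hasDerivAt_strip (a t : ℝ) : HasDerivAt (fun t : ℝ => (t + a * Complex.I : ℂ)) 1 t :=
  Complex.ofRealCLM.hasDerivAt.add_const _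

theorem hasDerivAt_tanh {w : ℂ} (hw : Complex.cosh w ≠ 0) :
    HasDerivAt Complex.tanh (1 / Complex.cosh w ^ 2) w := by
  have h := (Complex.hasDerivAt_sinh w).div (Complex.hasDerivAt_cosh w) hw
  have h1 : (Complex.sinh / Complex.cosh) = Complex.tanh := by
    funext x
    rw [Pi.div_apply, Complex.tanh_eq_sinh_div_cosh]
  rw [h1] at h
  refine h.congr_deriv ?_
  rw [← Complex.cosh_sq_sub_sinh_sq w]
  ring

theorem norm_cosh_strip_sq (k a : ℝ) :
    ‖Complex.cosh (k + a * Complex.I)‖ ^ 2 = Real.sinh k ^ 2 + Real.cos a ^ 2 := by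
  rw [← Complex.normSq_eq_norm_sq, normSq_cosh_strip]

theorem le_norm_cosh_strip_sq (ha0 : 0 < a) (ha : a ≤ 1 / 2) :
    k ^ 2 + 3 / 4 ≤ ‖Complex.cosh (k + a * Complex.I)‖ ^ 2 := by
  obtain ⟨-, -, h2, -, -⟩ := cos_sq_strip ha0 ha
  rw [norm_cosh_strip_sq]
  nlinarith [sq_le_sinh_sq k]

theorem norm_strip_le (ha0 : 0 < a) : ‖(k + a * Complex.I : ℂ)‖ ≤ |k| + a := by
  refine (norm_add_le _ _).trans ?_
  simp [abs_of_pos ha0]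

theorem norm_tanh_sub_le (ha0 : 0 < a) (ha : a ≤ 1 / 2) :
    ‖Complex.tanh (k + a * Complex.I) - Complex.tanh (l + a * Complex.I)‖ ≤ 2 * |k - l| := by
  have h := Convex.norm_image_sub_le_of_norm_hasDerivWithin_le (s := Set.univ) (𝕜 := ℝ) (C := 2)
    (f := fun t : ℝ => Complex.tanh (t + a * Complex.I))
    (f' := fun t => 1 / Complex.cosh (t + a * Complex.I) ^ 2 * 1) (x := l) (y := k)
    (fun t _ => (HasDerivAt.comp t (hasDerivAt_tanh (cosh_strip_ne_zero ha0 ha))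
      (hasDerivAt_strip a t)).hasDerivWithinAt) (fun t _ => ?_) convex_univ trivial trivial
  · simpa using h
  · have h1 := le_norm_cosh_strip_sq (k := t) ha0 ha
    rw [mul_one, norm_div, norm_one, norm_pow, div_le_iff₀ (by nlinarith [sq_nonneg t])]
    nlinarith [sq_nonneg t]

theorem norm_mul_tanh_sub_le (ha0 : 0 < a) (ha : a ≤ 1 / 2) :
    ‖(k + a * Complex.I) * Complex.tanh (k + a * Complex.I)
      - (l + a * Complex.I) * Complex.tanh (l + a * Complex.I)‖ ≤ 3 * |k - l| := by
  have h := Convex.norm_image_sub_le_of_norm_hasDerivWithin_le (s := Set.univ) (𝕜 := ℝ) (C := 3)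
    (f := fun t : ℝ => (t + a * Complex.I) * Complex.tanh (t + a * Complex.I))
    (f' := fun t => 1 * Complex.tanh (t + a * Complex.I)
      + (t + a * Complex.I) * (1 / Complex.cosh (t + a * Complex.I) ^ 2 * 1)) (x := l) (y := k)
    (fun t _ => ((hasDerivAt_strip a t).mul
      (HasDerivAt.comp t (hasDerivAt_tanh (cosh_strip_ne_zero ha0 ha))
      (hasDerivAt_strip a t))).hasDerivWithinAt) (fun t _ => ?_) convex_univ trivial trivial
  · simpa using h
  · have h1 := le_norm_cosh_strip_sq (k := t) ha0 ha
    have h2 := norm_tanh_strip_le (k := t) ha0 ha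
    have h3 := norm_strip_le (k := t) ha0
    have h4 : ‖(t + a * Complex.I) * (1 / Complex.cosh (t + a * Complex.I) ^ 2 * 1)‖ ≤ 2 := by
      rw [mul_one, norm_mul, norm_div, norm_one, norm_pow, mul_one_div,
        div_le_iff₀ (by nlinarith [sq_nonneg t])]
      nlinarith [sq_abs t, sq_nonneg (|t| - 1 / 4), abs_nonneg t]
    refine (norm_add_le _ _).trans ?_
    rw [one_mul]
    linarith

theorem norm_sinh_sub_self_le {x : ℂ} (hx : ‖x‖ ≤ 1) : ‖Complex.sinh x - x‖ ≤ ‖x‖ ^ 2 := by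
  have h1 := Complex.norm_exp_sub_one_sub_id_le hx
  have h2 := Complex.norm_exp_sub_one_sub_id_le (x := -x) (by rwa [norm_neg])
  rw [norm_neg] at h2
  have h3 : Complex.sinh x - x
      = ((Complex.exp x - 1 - x) - (Complex.exp (-x) - 1 - -x)) / 2 := by
    rw [Complex.sinh]
    ring
  rw [h3, norm_div, Complex.norm_ofNat, div_le_iff₀ two_pos]
  refine (norm_sub_le _ _).trans ?_
  linarith

theorem norm_tanhQuot_sub_le_of_small (ha0 : 0 < a) (ha : a ≤ 1 / 2)
    (hk : ‖(k + a * Complex.I : ℂ)‖ ≤ 1 / 2) (hl : ‖(l + a * Complex.I : ℂ)‖ ≤ 1 / 2) :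
    ‖tanhQuot (k + a * Complex.I) - tanhQuot (l + a * Complex.I)‖ ≤ 3 * |k - l| := by
  have hder : ∀ t : ℝ, HasDerivAt (fun t : ℝ => tanhQuot (t + a * Complex.I))
      ((1 / Complex.cosh (t + a * Complex.I) ^ 2 * 1 * (t + a * Complex.I)
        - Complex.tanh (t + a * Complex.I) * 1) / (t + a * Complex.I) ^ 2) t := fun t =>
    (HasDerivAt.comp t (hasDerivAt_tanh (cosh_strip_ne_zero ha0 ha))
      (hasDerivAt_strip a t)).div (hasDerivAt_strip a t) (strip_ne_zero ha0)
  have hkm : |k| ≤ max |k| |l| := le_max_left _ _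
  have hlm : |l| ≤ max |k| |l| := le_max_right _ _
  have hm : max |k| |l| ^ 2 + a ^ 2 ≤ 1 / 4 := by
    have e1 := norm_strip_sq k a
    have e2 := norm_strip_sq l a
    rcases max_choice |k| |l| with h | h <;> rw [h, sq_abs] <;>
      nlinarith [norm_nonneg (k + a * Complex.I : ℂ), norm_nonneg (l + a * Complex.I : ℂ)]
  have h := Convex.norm_image_sub_le_of_norm_hasDerivWithin_le
    (s := Set.Icc (-max |k| |l|) (max |k| |l|)) (C := 3)
    (fun t _ => (hder t).hasDerivWithinAt) (fun t ht => ?_) (convex_Icc _ _)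
    (Set.mem_Icc.2 (abs_le.1 hlm)) (Set.mem_Icc.2 (abs_le.1 hkm))
  · simpa using h
  · have ht' : |t| ≤ max |k| |l| := abs_le.2 ht
    set w : ℂ := t + a * Complex.I with hw
    have hw2 : ‖w‖ ^ 2 ≤ 1 / 4 := by
      rw [hw, norm_strip_sq]
      nlinarith [sq_abs t, abs_nonneg t]
    have hw0 : w ≠ 0 := strip_ne_zero ha0
    have hwn : 0 < ‖w‖ := norm_pos_iff.2 hw0
    have hc0 : Complex.cosh w ≠ 0 := cosh_strip_ne_zero ha0 ha
    have hc : 3 / 4 ≤ ‖Complex.cosh w‖ ^ 2 :=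
      le_trans (by nlinarith [sq_nonneg t]) (le_norm_cosh_strip_sq (k := t) ha0 ha)
    have h1 := norm_sinh_sub_self_le (x := 2 * w) (by
      rw [norm_mul, Complex.norm_ofNat]
      nlinarith)
    -- In this form the numerator `sinh 2w - 2w` is bounded by `4 |w|²`, which cancels the factor
    -- `w²` of the denominator near the origin.
    have h2 : (1 / Complex.cosh w ^ 2 * 1 * w - Complex.tanh w * 1) / w ^ 2
        = -(Complex.sinh (2 * w) - 2 * w) / (2 * Complex.cosh w ^ 2 * w ^ 2) := by
      rw [Complex.sinh_two_mul, Complex.tanh_eq_sinh_div_cosh]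
      field_simp
      ring
    rw [h2, norm_div, norm_neg, norm_mul, norm_mul, norm_pow, norm_pow, Complex.norm_ofNat,
      div_le_iff₀ (by positivity)]
    refine h1.trans ?_
    rw [norm_mul, Complex.norm_ofNat, mul_pow]
    nlinarith [mul_le_mul_of_nonneg_right hc (sq_nonneg ‖w‖)]

/-- Lipschitz bound for `T`, with decay. -/
theorem norm_tanhQuot_sub_le (ha0 : 0 < a) (ha : a ≤ 1 / 2) :
    (1 + ‖(k + a * Complex.I : ℂ)‖) * (1 + ‖(l + a * Complex.I : ℂ)‖)
      * ‖tanhQuot (k + a * Complex.I) - tanhQuot (l + a * Complex.I)‖ ≤ 21 * |k - l| := by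
  have e0 := norm_tanhQuot_sub_le_of_small (k := k) (l := l) ha0 ha
  have e1 := norm_tanh_sub_le (k := k) (l := l) ha0 ha
  have e2 := norm_mul_tanh_sub_le (k := k) (l := l) ha0 ha
  have e3 := norm_tanhQuot_le (k := k) ha0 ha
  have e4 := norm_tanhQuot_le (k := l) ha0 ha
  have e5 := norm_tanh_strip_le (k := k) ha0 ha
  have e6 := norm_tanh_strip_le (k := l) ha0 ha
  have m1 := mul_tanhQuot (strip_ne_zero ha0 (k := k))
  have m2 := mul_tanhQuot (strip_ne_zero ha0 (k := l))
  have hd : ((k + a * Complex.I : ℂ) - (l + a * Complex.I)) = ((k - l : ℝ) : ℂ) := by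
    push_cast
    ring
  set w : ℂ := k + a * Complex.I
  set v : ℂ := l + a * Complex.I
  have hdn : ‖w - v‖ = |k - l| := by rw [hd, Complex.norm_real, Real.norm_eq_abs]
  -- Expanding `(1 + |w|) (1 + |v|)` gives four terms, with constants `8 + 4 + 4 + 5 = 21`. Factors
  -- `w` and `v` are absorbed through the Lipschitz bounds for `tanh w` and `w tanh w`; the term
  -- without factors follows from these unless both points are near the origin.
  have f1 : ‖w‖ * ‖tanhQuot w - tanhQuot v‖ ≤ 4 * |k - l| := by
    have : w * (tanhQuot w - tanhQuot v)
        = (Complex.tanh w - Complex.tanh v) - (w - v) * tanhQuot v := by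
      rw [← m1, ← m2]
      ring
    rw [← norm_mul, this]
    refine (norm_sub_le _ _).trans ?_
    rw [norm_mul, hdn]
    nlinarith [abs_nonneg (k - l)]
  have f2 : ‖v‖ * ‖tanhQuot w - tanhQuot v‖ ≤ 4 * |k - l| := by
    have : v * (tanhQuot w - tanhQuot v)
        = (Complex.tanh w - Complex.tanh v) - (w - v) * tanhQuot w := by
      rw [← m1, ← m2]
      ring
    rw [← norm_mul, this]
    refine (norm_sub_le _ _).trans ?_
    rw [norm_mul, hdn]
    nlinarith [abs_nonneg (k - l)]
  have f3 : ‖w‖ * ‖v‖ * ‖tanhQuot w - tanhQuot v‖ ≤ 5 * |k - l| := by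
    have : w * v * (tanhQuot w - tanhQuot v) = -(w - v) * Complex.tanh w
        + (w * Complex.tanh w - v * Complex.tanh v) - (w - v) * Complex.tanh v := by
      rw [← m1, ← m2]
      ring
    rw [← norm_mul, ← norm_mul, this]
    refine (norm_sub_le _ _).trans ?_
    refine (add_le_add_left (norm_add_le _ _) _).trans ?_
    rw [norm_mul, norm_mul, norm_neg, hdn]
    nlinarith [abs_nonneg (k - l)]
  have f0 : ‖tanhQuot w - tanhQuot v‖ ≤ 8 * |k - l| := by
    have hn := norm_nonneg (tanhQuot w - tanhQuot v)
    rcases le_total ‖w‖ (1 / 2) with h | h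
    · rcases le_total ‖v‖ (1 / 2) with h' | h'
      · have := e0 h h'
        linarith [abs_nonneg (k - l)]
      · nlinarith
    · nlinarith
  nlinarith

/-- The expansion of `T` at the origin. -/
theorem norm_tanhQuot_sub_taylor_le (ha0 : 0 < a) (ha : a ≤ 1 / 2)
    (hk : ‖(k + a * Complex.I : ℂ)‖ ≤ 1) :
    ‖tanhQuot (k + a * Complex.I) - (1 - (k + a * Complex.I) ^ 2 / 3)‖
      ≤ ‖(k + a * Complex.I : ℂ)‖ ^ 4 := by
  have hw0 := strip_ne_zero ha0 (k := k)
  have hc0 := cosh_strip_ne_zero ha0 ha (k := k)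
  have hc := le_norm_cosh_strip_sq (k := k) ha0 ha
  set w : ℂ := k + a * Complex.I
  have hn := norm_nonneg w
  have hcl : 3 / 4 ≤ ‖Complex.cosh w‖ := by
    by_contra hcon
    push Not at hcon
    nlinarith [norm_nonneg (Complex.cosh w), sq_nonneg k]
  have b5 : ∀ x : ℂ, ‖x‖ ≤ 1 → ‖Complex.exp x - (1 + x + x ^ 2 / 2 + x ^ 3 / 6 + x ^ 4 / 24)‖
      ≤ ‖x‖ ^ 5 * (1 / 100) := fun x hx => by
    have := Complex.exp_bound hx (n := 5) (by norm_num)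
    simp only [Finset.sum_range_succ, Finset.sum_range_zero, Nat.factorial] at this
    norm_num at this
    norm_num
    exact this
  have b4 : ∀ x : ℂ, ‖x‖ ≤ 1 → ‖Complex.exp x - (1 + x + x ^ 2 / 2 + x ^ 3 / 6)‖
      ≤ ‖x‖ ^ 4 * (5 / 96) := fun x hx => by
    have := Complex.exp_bound hx (n := 4) (by norm_num)
    simp only [Finset.sum_range_succ, Finset.sum_range_zero, Nat.factorial] at this
    norm_num at this
    norm_num
    exact this
  have hk' : ‖-w‖ ≤ 1 := by rwa [norm_neg]
  have s5 : ‖Complex.sinh w - (w + w ^ 3 / 6)‖ ≤ ‖w‖ ^ 5 * (1 / 100) := by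
    have h1 := b5 w hk
    have h2 := b5 (-w) hk'
    rw [norm_neg] at h2
    have h3 : Complex.sinh w - (w + w ^ 3 / 6)
        = ((Complex.exp w - (1 + w + w ^ 2 / 2 + w ^ 3 / 6 + w ^ 4 / 24))
          - (Complex.exp (-w) - (1 + -w + (-w) ^ 2 / 2 + (-w) ^ 3 / 6 + (-w) ^ 4 / 24))) / 2 := by
      rw [Complex.sinh]
      ring
    rw [h3, norm_div, Complex.norm_ofNat, div_le_iff₀ two_pos]
    refine (norm_sub_le _ _).trans ?_
    linarith
  have c4 : ‖Complex.cosh w - (1 + w ^ 2 / 2)‖ ≤ ‖w‖ ^ 4 * (5 / 96) := by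
    have h1 := b4 w hk
    have h2 := b4 (-w) hk'
    rw [norm_neg] at h2
    have h3 : Complex.cosh w - (1 + w ^ 2 / 2)
        = ((Complex.exp w - (1 + w + w ^ 2 / 2 + w ^ 3 / 6))
          + (Complex.exp (-w) - (1 + -w + (-w) ^ 2 / 2 + (-w) ^ 3 / 6))) / 2 := by
      rw [Complex.cosh]
      ring
    rw [h3, norm_div, Complex.norm_ofNat, div_le_iff₀ two_pos]
    refine (norm_add_le _ _).trans ?_
    linarith
  -- The product of `w - w³/3` and `1 + w²/2` is `w + w³/6 - w⁵/6`, so every term of the numerator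
  -- is of fifth order.
  have key : tanhQuot w - (1 - w ^ 2 / 3) = ((Complex.sinh w - (w + w ^ 3 / 6)) + w ^ 5 / 6
      - (Complex.cosh w - (1 + w ^ 2 / 2)) * (w * (1 - w ^ 2 / 3))) / (w * Complex.cosh w) := by
    rw [tanhQuot, Complex.tanh_eq_sinh_div_cosh]
    field_simp
    ring
  have hwp : 0 < ‖w‖ := norm_pos_iff.2 hw0
  rw [key, norm_div, norm_mul w, div_le_iff₀ (by positivity)]
  have h13 : ‖w * (1 - w ^ 2 / 3)‖ ≤ ‖w‖ * (4 / 3) := by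
    rw [norm_mul]
    gcongr
    refine (norm_sub_le _ _).trans ?_
    rw [norm_one, norm_div, norm_pow, Complex.norm_ofNat]
    nlinarith
  calc _ ≤ ‖w‖ ^ 5 * (1 / 100) + ‖w‖ ^ 5 / 6 + ‖w‖ ^ 4 * (5 / 96) * (‖w‖ * (4 / 3)) := by
        refine (norm_sub_le _ _).trans (add_le_add ((norm_add_le _ _).trans
          (add_le_add s5 (le_of_eq ?_))) ?_)
        · rw [norm_div, norm_pow, Complex.norm_ofNat]
        · rw [norm_mul]
          gcongr
    _ ≤ ‖w‖ ^ 5 * (3 / 4) := by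
        have : 0 ≤ ‖w‖ ^ 5 := by positivity
        nlinarith
    _ ≤ ‖w‖ ^ 5 * ‖Complex.cosh w‖ := by gcongr
    _ = _ := by ring

end StripLipschitz

/-! ### The symbols of `𝒮` and `𝒜₊` and the square root `r`. -/

section Symbols

variable {k l a γ : ℝ}

/-- The symbol `r` with `𝒮 = -∂ r`, a square root of `γ tanh w / w`. -/
def rSym (γ : ℝ) (w : ℂ) : ℂ := Complex.I * scSymbol γ w / w

/-- The symbol of `𝒜₊`. -/
def aSym (γ : ℝ) (w : ℂ) : ℂ := Complex.I * w + scSymbol γ w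

theorem scSymbol_eq {w : ℂ} (hw : w ≠ 0) : scSymbol γ w = -(Complex.I * w * rSym γ w) := by
  rw [rSym]
  field_simp
  linear_combination (scSymbol γ w) * Complex.I_sq

theorem aSym_eq {w : ℂ} (hw : w ≠ 0) : aSym γ w = Complex.I * w * (1 - rSym γ w) := by
  rw [aSym, scSymbol_eq hw]
  ring

theorem scSymbol_sq (w : ℂ) : scSymbol γ w ^ 2 = -γ * w * Complex.tanh w := by
  have h := Complex.cpow_ofNat_inv_pow (-γ * w * Complex.tanh w) 2
  rw [scSymbol, one_div]
  exact h

theorem rSym_sq {w : ℂ} (hw : w ≠ 0) : rSym γ w ^ 2 = γ * tanhQuot w := by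
  rw [rSym, div_pow, mul_pow, scSymbol_sq, Complex.I_sq, tanhQuot]
  field_simp

/-- The principal root halves the argument, which then lies in `[-π/2, π/2]`. -/
theorem re_scSymbol_nonneg (w : ℂ) : 0 ≤ (scSymbol γ w).re := by
  rw [scSymbol]
  set x : ℂ := -γ * w * Complex.tanh w
  rcases eq_or_ne x 0 with h | h
  · rw [h, Complex.zero_cpow (by norm_num)]
    simp
  · rw [Complex.cpow_def_of_ne_zero h, Complex.exp_re]
    refine mul_nonneg (Real.exp_pos _).le (Real.cos_nonneg_of_mem_Icc ?_)
    have h1 : (Complex.log x * (1 / 2)).im = x.arg / 2 := by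
      rw [Complex.mul_im, Complex.log_im]
      norm_num
      ring
    rw [h1]
    have h2 := Complex.neg_pi_lt_arg x
    have h3 := Complex.arg_le_pi x
    exact ⟨by linarith, by linarith⟩

theorem measurable_scSymbol : Measurable (scSymbol γ) := by
  have h : Measurable Complex.tanh := by
    have : Complex.tanh = fun w => Complex.sinh w / Complex.cosh w := by
      funext w
      exact Complex.tanh_eq_sinh_div_cosh w
    rw [this]
    fun_prop
  unfold scSymbol
  fun_prop

theorem measurable_rSym : Measurable (rSym γ) := by
  have := measurable_scSymbol (γ := γ)
  unfold rSym
  fun_prop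

theorem measurable_aSym : Measurable (aSym γ) := by
  have := measurable_scSymbol (γ := γ)
  unfold aSym
  fun_prop

theorem rSym_ne_zero (ha0 : 0 < a) (ha : a ≤ 1 / 2) (hγ : 0 < γ) :
    rSym γ (k + a * Complex.I) ≠ 0 := by
  intro h
  have h1 := rSym_sq (γ := γ) (strip_ne_zero ha0 (k := k))
  have h2 := le_norm_tanhQuot (k := k) ha0 ha
  have hγ' : (γ : ℂ) ≠ 0 := by exact_mod_cast hγ.ne'
  have h3 : tanhQuot (k + a * Complex.I) = 0 := by
    rw [h] at h1
    simpa [hγ'] using h1.symm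
  rw [h3, norm_zero, mul_zero] at h2
  linarith

/-- Identifies the branch of the root. The sign of `Im (w tanh w)` and `Re 𝒮 ≥ 0` give `k Im 𝒮 ≤ 0`,
and `|w|² Re r = a Re 𝒮 - k Im 𝒮` is then nonnegative. From `Re r² ≥ 0` follows `|Im r| ≤ Re r`, and
the sign of `Im r²` gives the last claim. -/
theorem rSym_re_im (ha0 : 0 < a) (ha : a ≤ 1 / 2) (hγ : 0 < γ) :
    0 < (rSym γ (k + a * Complex.I)).re ∧
    ‖rSym γ (k + a * Complex.I)‖ ≤ 2 * (rSym γ (k + a * Complex.I)).re ∧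
    k * (rSym γ (k + a * Complex.I)).im ≤ 0 := by
  obtain ⟨t1, t2, t3, t4⟩ := tanhQuot_re_im (k := k) ha0 ha
  have hr0 := rSym_ne_zero (k := k) ha0 ha hγ
  have hw := strip_ne_zero ha0 (k := k)
  have hsq := rSym_sq (γ := γ) hw
  have hS := re_scSymbol_nonneg (γ := γ) (k + a * Complex.I)
  have hS2 := scSymbol_sq (γ := γ) (k + a * Complex.I)
  have hnorm := norm_strip_sq k a
  have hSr := scSymbol_eq (γ := γ) hw
  set r := rSym γ (k + a * Complex.I) with hr
  set S := scSymbol γ (k + a * Complex.I) with hSdef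
  set T := tanhQuot (k + a * Complex.I)
  have s1 : r.re ^ 2 - r.im ^ 2 = γ * T.re := by
    have := congrArg Complex.re hsq
    rw [sq, Complex.mul_re, Complex.re_ofReal_mul] at this
    linarith
  have s2 : 2 * (r.re * r.im) = γ * T.im := by
    have := congrArg Complex.im hsq
    rw [sq, Complex.mul_im, Complex.im_ofReal_mul] at this
    linarith
  have s3 : 2 * (S.re * S.im) = -γ * ((k + a * Complex.I) * Complex.tanh (k + a * Complex.I)).im := by
    have := congrArg Complex.im hS2
    have h5 : -(γ : ℂ) * (k + a * Complex.I) * Complex.tanh (k + a * Complex.I)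
      = ((-γ : ℝ) : ℂ) * ((k + a * Complex.I) * Complex.tanh (k + a * Complex.I)) := by
        push_cast
        ring
    rw [sq, Complex.mul_im, h5, Complex.im_ofReal_mul] at this
    linarith
  have hkS : k * S.im ≤ 0 := by
    rcases hS.lt_or_eq with h | h
    · have : S.re * (k * S.im) ≤ 0 := by
        have e : 2 * (S.re * (k * S.im)) = -(γ * (k * ((k + a * Complex.I)
            * Complex.tanh (k + a * Complex.I)).im)) := by linear_combination k * s3
        linarith [mul_nonneg hγ.le t3]
      by_contra hc
      push Not at hc
      nlinarith [mul_pos h hc]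
    -- If `Re 𝒮 = 0`, the sign of `Im 𝒮` cannot be read off; but then `𝒮²` is real, which forces `k
    -- = 0`.
    · rw [← h] at s3
      have h5 : ((k + a * Complex.I) * Complex.tanh (k + a * Complex.I)).im = 0 := by
        have : γ * ((k + a * Complex.I) * Complex.tanh (k + a * Complex.I)).im = 0 := by linarith
        exact (mul_eq_zero.1 this).resolve_left hγ.ne'
      rw [t4 h5, zero_mul]
  have hre : (k ^ 2 + a ^ 2) * r.re = a * S.re - k * S.im := by
    have e1 := congrArg Complex.re hSr
    have e2 := congrArg Complex.im hSr
    simp [Complex.mul_re, Complex.mul_im] at e1 e2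
    rw [e1, e2]
    ring
  have hka : 0 < k ^ 2 + a ^ 2 := by positivity
  have hre0 : 0 ≤ r.re := by
    have : 0 ≤ (k ^ 2 + a ^ 2) * r.re := by
      rw [hre]
      nlinarith
    exact nonneg_of_mul_nonneg_right this hka
  have him : r.im ^ 2 ≤ r.re ^ 2 := by nlinarith
  have hpos : 0 < r.re := by
    refine hre0.lt_of_ne fun h => hr0 ?_
    rw [← h] at him
    refine Complex.ext h.symm ?_
    simp only [Complex.zero_im]
    nlinarith
  refine ⟨hpos, ?_, ?_⟩
  · refine abs_le_of_sq_le_sq' (b := 2 * r.re) ?_ (by linarith) |>.2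
    rw [← Complex.normSq_eq_norm_sq, Complex.normSq_apply]
    nlinarith
  · have : r.re * (k * r.im) ≤ 0 := by
      have e : 2 * (r.re * (k * r.im)) = γ * (k * T.im) := by linear_combination k * s2
      linarith [mul_nonneg hγ.le (neg_nonneg.2 t2)]
    by_contra hc
    push Not at hc
    nlinarith [mul_pos hpos hc]

/-- Lipschitz bounds for `r`. -/
theorem norm_rSym_sub_le (ha0 : 0 < a) (ha : a ≤ 1 / 2) (hγ : 1 / 2 ≤ γ) (hγ1 : γ ≤ 1) :
    (1 + ‖(k + a * Complex.I : ℂ)‖)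
      * ‖rSym γ (k + a * Complex.I) - rSym γ (l + a * Complex.I)‖
      ≤ 168 * |k - l| * ‖rSym γ (l + a * Complex.I)‖ := by
  obtain ⟨p1, p2, -⟩ := rSym_re_im (k := k) ha0 ha (by linarith : 0 < γ)
  obtain ⟨q1, q2, -⟩ := rSym_re_im (k := l) ha0 ha (by linarith : 0 < γ)
  have hT := norm_tanhQuot_sub_le (k := k) (l := l) ha0 ha
  have hr1 := rSym_sq (γ := γ) (strip_ne_zero ha0 (k := k))
  have hr2 := rSym_sq (γ := γ) (strip_ne_zero ha0 (k := l))
  have hlow := le_norm_tanhQuot (k := l) ha0 ha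
  set w : ℂ := k + a * Complex.I
  set v : ℂ := l + a * Complex.I
  set r := rSym γ w
  set s := rSym γ v
  have hs0 : 0 < ‖s‖ := by
    refine lt_of_lt_of_le q1 (Complex.re_le_norm s)
  -- Since both roots have positive real part, there is no cancellation in `r + s`, and `r - s` can
  -- be recovered from `r² - s²`. The lower bound for `|s|²` below then converts the estimate into
  -- one relative to `|s|`.
  have h1 : ‖s‖ ≤ 2 * ‖r + s‖ := by
    have := Complex.re_le_norm (r + s)
    rw [Complex.add_re] at this
    linarith
  have h2 : ‖r - s‖ * ‖r + s‖ ≤ ‖tanhQuot w - tanhQuot v‖ := by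
    rw [← norm_mul]
    have : (r - s) * (r + s) = γ * (tanhQuot w - tanhQuot v) := by
      rw [mul_sub, ← hr1, ← hr2]
      ring
    rw [this, norm_mul, Complex.norm_real, Real.norm_of_nonneg (by linarith)]
    exact mul_le_of_le_one_left (norm_nonneg _) hγ1
  have h3 : 1 ≤ 4 * (1 + ‖v‖) * ‖s‖ ^ 2 := by
    rw [← norm_pow, hr2, norm_mul, Complex.norm_real, Real.norm_of_nonneg (by linarith)]
    nlinarith [mul_nonneg (by positivity : 0 ≤ 2 * (1 + ‖v‖)) (norm_nonneg (tanhQuot v))]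
  have h4 : ‖r - s‖ * ‖s‖ ≤ 2 * ‖tanhQuot w - tanhQuot v‖ := by
    nlinarith [norm_nonneg (r - s)]
  have h5 : (1 + ‖w‖) * ‖r - s‖ * (‖s‖ * (1 + ‖v‖)) ≤ 42 * |k - l| := by
    calc _ = (1 + ‖w‖) * (1 + ‖v‖) * (‖r - s‖ * ‖s‖) := by ring
      _ ≤ (1 + ‖w‖) * (1 + ‖v‖) * (2 * ‖tanhQuot w - tanhQuot v‖) := by gcongr
      _ ≤ _ := by nlinarith
  have h6 : 0 ≤ (1 + ‖w‖) * ‖r - s‖ := by positivity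
  calc (1 + ‖w‖) * ‖r - s‖ ≤ (1 + ‖w‖) * ‖r - s‖ * (4 * (1 + ‖v‖) * ‖s‖ ^ 2) :=
        le_mul_of_one_le_right h6 h3
    _ = 4 * ((1 + ‖w‖) * ‖r - s‖ * (‖s‖ * (1 + ‖v‖))) * ‖s‖ := by ring
    _ ≤ 4 * (42 * |k - l|) * ‖s‖ := by gcongr
    _ = _ := by ring

end Symbols

/-! ### The spectral gap of `𝒜₊` on the line `Im w = εα`. -/

theorem gam_le_one (ε : ℝ) : gam ε ≤ 1 := by
  rw [gam]
  nlinarith [sq_nonneg ε]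

/-- The parameters: `0 < ε`, small. -/
structure SmallParam (α ε : ℝ) : Prop where
  α_pos : 0 < α
  α_le : α ≤ 1 / 2
  ε_pos : 0 < ε
  ε_le : ε ≤ 1 / 4

namespace SmallParam

variable {α ε : ℝ} {k l : ℝ}

theorem a_pos (h : SmallParam α ε) : 0 < ε * α := mul_pos h.ε_pos h.α_pos

theorem a_le_half_eps (h : SmallParam α ε) : ε * α ≤ ε / 2 := by
  have := h.α_le
  have := h.ε_pos
  nlinarith

theorem a_le (h : SmallParam α ε) : ε * α ≤ 1 / 2 := by
  have := h.a_le_half_eps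
  have := h.ε_le
  linarith

theorem half_le_gam (h : SmallParam α ε) : 1 / 2 ≤ gam ε := by
  have := h.ε_le
  have := h.ε_pos
  rw [gam]
  nlinarith

theorem gam_pos (h : SmallParam α ε) : 0 < gam ε := lt_of_lt_of_le (by norm_num) h.half_le_gam

/-- Here `|r|⁴ = γ² |tanh w / w|²`, and `1 - x⁴ ≤ 4 (1 - x)` for `0 ≤ x ≤ 1`. The term `ε²/6` is set
aside to compensate `Re z ≥ -α/6`; the rest is the gap that remains. -/
theorem one_sub_norm_rSym (h : SmallParam α ε) :
    ε ^ 2 / 6 + (ε ^ 2 + min (k ^ 2) 1) / 80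
      ≤ 1 - ‖rSym (gam ε) (k + (ε * α : ℝ) * Complex.I)‖ := by
  have hT := norm_tanhQuot_sq_le (k := k) h.a_pos h.a_le
  have hr := rSym_sq (γ := gam ε) (strip_ne_zero h.a_pos (k := k))
  have ha := h.a_le_half_eps
  have ha0 := h.a_pos
  have hε := h.ε_pos
  have hε1 := h.ε_le
  have ht0 : 0 ≤ min (k ^ 2) 1 := le_min (by positivity) zero_le_one
  have ht1 : min (k ^ 2) 1 ≤ 1 := min_le_right _ _
  have hN : ‖rSym (gam ε) (k + (ε * α : ℝ) * Complex.I)‖ ^ 4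
      = gam ε ^ 2 * ‖tanhQuot (k + (ε * α : ℝ) * Complex.I)‖ ^ 2 := by
    have : ‖rSym (gam ε) (k + (ε * α : ℝ) * Complex.I)‖ ^ 2
        = gam ε * ‖tanhQuot (k + (ε * α : ℝ) * Complex.I)‖ := by
      rw [← norm_pow, hr, norm_mul, Complex.norm_real, Real.norm_of_nonneg h.gam_pos.le]
    calc _ = (‖rSym (gam ε) (k + (ε * α : ℝ) * Complex.I)‖ ^ 2) ^ 2 := by ring
      _ = _ := by rw [this]; ring
  set x := ‖rSym (gam ε) (k + (ε * α : ℝ) * Complex.I)‖ with hx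
  set y := ‖tanhQuot (k + (ε * α : ℝ) * Complex.I)‖ ^ 2 with hy
  set t := min (k ^ 2) 1
  have hx0 : 0 ≤ x := norm_nonneg _
  have hy0 : 0 ≤ y := by positivity
  set b := (ε * α) ^ 2 with hb
  set e := ε ^ 2 with he
  have hbe : b ≤ e / 4 := by nlinarith
  have hb0 : 0 ≤ b := by positivity
  have he0 : 0 < e := by positivity
  have he1 : e ≤ 1 / 16 := by nlinarith
  rw [gam, ← he] at hN
  have hx4 : x ^ 4 ≤ 1 - 4 * (e / 6 + (e + t) / 80) := by
    have h1 : (1 - e) ^ 2 * ((1 - b) * y) ≤ (1 - e) ^ 2 * (1 - t / 9 + e / 36) := by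
      gcongr
      linarith
    have h2 : (1 - e / 4) * x ^ 4 ≤ (1 - e) ^ 2 * (1 - t / 9 + e / 36) := by
      rw [hN]
      refine le_trans ?_ h1
      have : 0 ≤ (1 - e) ^ 2 * y := by positivity
      nlinarith
    have h3 : (1 - e) ^ 2 * (1 - t / 9 + e / 36)
        ≤ (1 - e / 4) * (1 - 4 * (e / 6 + (e + t) / 80)) := by
      nlinarith [mul_nonneg he0.le ht0, mul_nonneg he0.le he0.le,
        mul_nonneg (mul_nonneg he0.le he0.le) ht0,
        mul_nonneg he0.le (sub_nonneg.2 he1), mul_nonneg ht0 (sub_nonneg.2 he1),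
        mul_nonneg (mul_nonneg he0.le he0.le) (sub_nonneg.2 he1)]
    by_contra hc
    push Not at hc
    have : 0 < 1 - e / 4 := by linarith
    nlinarith
  have hx1 : x ≤ 1 := by
    by_contra hc
    push Not at hc
    have : 1 < x ^ 4 := one_lt_pow₀ hc (by norm_num)
    linarith
  have h5 : 1 - x ^ 4 ≤ 4 * (1 - x) := by
    have : 1 - x ^ 4 = (1 - x) * (1 + x + x ^ 2 + x ^ 3) := by ring
    rw [this]
    have h6 : x ^ 2 ≤ 1 := by nlinarith
    have h7 : x ^ 3 ≤ 1 := pow_le_one₀ hx0 hx1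
    nlinarith
  linarith

theorem norm_rSym_le (h : SmallParam α ε) : ‖rSym (gam ε) (k + (ε * α : ℝ) * Complex.I)‖ ≤ 1 := by
  have h1 := h.one_sub_norm_rSym (k := k)
  have ht0 : 0 ≤ min (k ^ 2) 1 := le_min (by positivity) zero_le_one
  nlinarith [sq_nonneg ε]

/-- The real part of `λ - 𝒜₊`. -/
theorem re_sub_aSym (h : SmallParam α ε) {z : ℂ} (hz : -(1 / 6) * α ≤ z.re) :
    α / 80 * ε * (ε ^ 2 + min (k ^ 2) 1)
      ≤ ((ε : ℂ) ^ 3 * z - aSym (gam ε) (k + (ε * α : ℝ) * Complex.I)).re := by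
  have h1 := h.one_sub_norm_rSym (k := k)
  obtain ⟨-, -, h2⟩ := rSym_re_im (k := k) h.a_pos h.a_le h.gam_pos
  have h3 := Complex.re_le_norm (rSym (gam ε) (k + (ε * α : ℝ) * Complex.I))
  rw [aSym_eq (strip_ne_zero h.a_pos)]
  set r := rSym (gam ε) (k + (ε * α : ℝ) * Complex.I)
  have e1 : ((ε : ℂ) ^ 3 * z).re = ε ^ 3 * z.re := by
    have : (ε : ℂ) ^ 3 = ((ε ^ 3 : ℝ) : ℂ) := by push_cast; rfl
    rw [this, Complex.re_ofReal_mul]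
  -- Both terms are favourable: the first carries the gap, since `Re r ≤ |r|`, and `k Im r ≤ 0`.
  have e2 : (Complex.I * (k + (ε * α : ℝ) * Complex.I) * (1 - r)).re
      = -(ε * α) * (1 - r.re) + k * r.im := by
    simp [Complex.mul_re, Complex.mul_im]
  rw [Complex.sub_re, e1, e2]
  have hε := h.ε_pos
  have hα := h.α_pos
  have h4 : 0 < ε ^ 3 := by positivity
  have h5 : ε ^ 3 * (-(1 / 6) * α) ≤ ε ^ 3 * z.re := by gcongr
  have h6 : ε * α * (ε ^ 2 / 6 + (ε ^ 2 + min (k ^ 2) 1) / 80) ≤ ε * α * (1 - r.re) := by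
    have := h.a_pos
    gcongr
    linarith
  nlinarith

end SmallParam

/-! ### Resolvent symbols in the long-wave scaling and their KdV limit. -/

/-- The symbol of `ε³ (½ ∂ - ⅙ ∂³)`, `∂` replaced by `ε⁻¹ ∂`. -/
def kdvSym (ε : ℝ) (w : ℂ) : ℂ := Complex.I * w * (ε ^ 2 / 2 + w ^ 2 / 6)

namespace SmallParam

variable {α ε : ℝ} {k l : ℝ} {z : ℂ}

theorem norm_sq_le (h : SmallParam α ε) :
    ε ^ 2 + ‖(k + (ε * α : ℝ) * Complex.I : ℂ)‖ ^ 2 ≤ 5 / 4 * (ε ^ 2 + k ^ 2) := by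
  rw [norm_strip_sq]
  have := h.a_le_half_eps
  have := h.a_pos
  nlinarith [sq_nonneg k]

/-- Comparing squares avoids expanding a root: for the approximation `r₀`, the difference `r² - r₀²`
is of fourth order in `(ε, w)`, and `Re (r + r₀) ≥ 1/2`. -/
theorem norm_rSym_sub_taylor (h : SmallParam α ε) (hk : |k| ≤ 1 / 2) :
    ‖rSym (gam ε) (k + (ε * α : ℝ) * Complex.I)
      - (1 - ε ^ 2 / 2 - (k + (ε * α : ℝ) * Complex.I) ^ 2 / 6)‖
      ≤ 7 * (ε ^ 2 + k ^ 2) ^ 2 := by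
  obtain ⟨p1, -, -⟩ := rSym_re_im (k := k) h.a_pos h.a_le h.gam_pos
  have hr := rSym_sq (γ := gam ε) (strip_ne_zero h.a_pos (k := k))
  have hsq := norm_strip_sq k (ε * α)
  have hle := h.norm_sq_le (k := k)
  have hε := h.ε_pos
  have hε1 := h.ε_le
  have ha := h.a_le_half_eps
  have ha0 := h.a_pos
  have hk2 : k ^ 2 ≤ 1 / 4 := by nlinarith [sq_abs k, abs_nonneg k]
  have hT := norm_tanhQuot_sub_taylor_le (k := k) h.a_pos h.a_le (by
    refine abs_le_of_sq_le_sq' (b := 1) ?_ zero_le_one |>.2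
    nlinarith)
  set w : ℂ := k + (ε * α : ℝ) * Complex.I
  set r := rSym (gam ε) w
  set E := tanhQuot w - (1 - w ^ 2 / 3) with hE
  have hTE : tanhQuot w = 1 - w ^ 2 / 3 + E := by rw [hE]; ring
  set r₀ : ℂ := 1 - ε ^ 2 / 2 - w ^ 2 / 6 with hr₀
  have hw2 : ‖w ^ 2 / 6‖ ≤ 1 / 6 := by
    rw [norm_div, norm_pow, Complex.norm_ofNat]
    nlinarith
  have hre : 1 / 2 ≤ (r + r₀).re := by
    have e1 : (w ^ 2 / 6).re ≤ 1 / 6 := (Complex.re_le_norm _).trans hw2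
    have e2 : ((ε : ℂ) ^ 2 / 2).re = ε ^ 2 / 2 := by
      have : (ε : ℂ) ^ 2 / 2 = ((ε ^ 2 / 2 : ℝ) : ℂ) := by push_cast; rfl
      rw [this, Complex.ofReal_re]
    rw [Complex.add_re, hr₀, Complex.sub_re, Complex.sub_re, Complex.one_re, e2]
    nlinarith
  have hprod : (r - r₀) * (r + r₀) = (gam ε : ℂ) * E + ε ^ 2 * w ^ 2 / 6 - ε ^ 4 / 4 - w ^ 4 / 36 := by
    have : (r - r₀) * (r + r₀) = r ^ 2 - r₀ ^ 2 := by ring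
    rw [this, hr, hTE, hr₀, gam]
    push_cast
    ring
  have hn : ‖(r - r₀) * (r + r₀)‖ ≤ 2 * (ε ^ 2 + ‖w‖ ^ 2) ^ 2 := by
    rw [hprod]
    have n1 : ‖(gam ε : ℂ) * E‖ ≤ ‖w‖ ^ 4 := by
      rw [norm_mul, Complex.norm_real, Real.norm_of_nonneg h.gam_pos.le]
      refine le_trans (mul_le_of_le_one_left (norm_nonneg _) (gam_le_one ε)) hT
    have n2 : ‖(ε : ℂ) ^ 2 * w ^ 2 / 6‖ = ε ^ 2 * ‖w‖ ^ 2 / 6 := by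
      rw [norm_div, norm_mul, norm_pow, norm_pow, Complex.norm_ofNat, Complex.norm_real,
        Real.norm_of_nonneg hε.le]
    have n3 : ‖(ε : ℂ) ^ 4 / 4‖ = ε ^ 4 / 4 := by
      rw [norm_div, norm_pow, Complex.norm_ofNat, Complex.norm_real, Real.norm_of_nonneg hε.le]
    have n4 : ‖w ^ 4 / 36‖ = ‖w‖ ^ 4 / 36 := by
      rw [norm_div, norm_pow, Complex.norm_ofNat]
    refine (norm_sub_le _ _).trans ((add_le_add_left ((norm_sub_le _ _).trans
      (add_le_add_left (norm_add_le _ _) _)) _).trans ?_)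
    rw [n2, n3, n4]
    nlinarith [sq_nonneg (ε ^ 2), sq_nonneg (‖w‖ ^ 2), mul_nonneg (sq_nonneg ε) (sq_nonneg ‖w‖)]
  have hlow : 1 / 2 ≤ ‖r + r₀‖ := hre.trans (Complex.re_le_norm _)
  rw [norm_mul] at hn
  have hfin : ‖r - r₀‖ ≤ 4 * (ε ^ 2 + ‖w‖ ^ 2) ^ 2 := by nlinarith [norm_nonneg (r - r₀)]
  have h0 : 0 ≤ ε ^ 2 + ‖w‖ ^ 2 := by positivity
  have := pow_le_pow_left₀ h0 hle 2
  nlinarith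

theorem norm_one_sub_rSym_le (h : SmallParam α ε) (hk : |k| ≤ 1 / 2) :
    ‖1 - rSym (gam ε) (k + (ε * α : ℝ) * Complex.I)‖ ≤ 4 * (ε ^ 2 + k ^ 2) := by
  have h1 := h.norm_rSym_sub_taylor hk
  have hsq := h.norm_sq_le (k := k)
  have hε := h.ε_pos
  have hε1 := h.ε_le
  have hk2 : k ^ 2 ≤ 1 / 4 := by nlinarith [sq_abs k, abs_nonneg k]
  set w : ℂ := k + (ε * α : ℝ) * Complex.I
  set r := rSym (gam ε) w
  have e : 1 - r = ε ^ 2 / 2 + w ^ 2 / 6 - (r - (1 - ε ^ 2 / 2 - w ^ 2 / 6)) := by ring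
  have n2 : ‖(ε : ℂ) ^ 2 / 2‖ = ε ^ 2 / 2 := by
    rw [norm_div, norm_pow, Complex.norm_ofNat, Complex.norm_real, Real.norm_of_nonneg hε.le]
  have n4 : ‖w ^ 2 / 6‖ = ‖w‖ ^ 2 / 6 := by rw [norm_div, norm_pow, Complex.norm_ofNat]
  rw [e]
  refine (norm_sub_le _ _).trans ((add_le_add_left (norm_add_le _ _) _).trans ?_)
  rw [n2, n4]
  have h5 : ε ^ 2 + k ^ 2 ≤ 5 / 16 := by nlinarith
  have h6 : (ε ^ 2 + k ^ 2) ^ 2 ≤ 5 / 16 * (ε ^ 2 + k ^ 2) := by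
    nlinarith [sq_nonneg ε, sq_nonneg k]
  linarith [sq_nonneg ε, sq_nonneg k, sq_nonneg ‖w‖]

theorem eps_mul_norm_le (h : SmallParam α ε) :
    ε * ‖(k + (ε * α : ℝ) * Complex.I : ℂ)‖ ≤ ε ^ 2 + k ^ 2 := by
  have h1 := norm_strip_le (k := k) h.a_pos
  have := h.a_le_half_eps
  have hε := h.ε_pos
  nlinarith [sq_abs k, sq_nonneg (ε - |k|)]

theorem le_norm_sub_aSym (h : SmallParam α ε) (hz : -(1 / 6) * α ≤ z.re) :
    α * ε * (ε ^ 2 + min (k ^ 2) 1)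
      ≤ 80 * ‖(ε : ℂ) ^ 3 * z - aSym (gam ε) (k + (ε * α : ℝ) * Complex.I)‖ := by
  have := (h.re_sub_aSym (k := k) hz).trans (Complex.re_le_norm _)
  linarith

theorem pow_le_norm_sub_aSym (h : SmallParam α ε) (hz : -(1 / 6) * α ≤ z.re) :
    α * ε ^ 3 ≤ 80 * ‖(ε : ℂ) ^ 3 * z - aSym (gam ε) (k + (ε * α : ℝ) * Complex.I)‖ := by
  refine le_trans ?_ (h.le_norm_sub_aSym hz)
  have ht0 : 0 ≤ min (k ^ 2) 1 := le_min (by positivity) zero_le_one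
  nlinarith [mul_nonneg h.a_pos.le ht0]

/-- At high frequency `|ε³ z - 𝒜₊|` is bounded below by a multiple of `αε`, and `|ε³ z| ≤ 1` gives
`|𝒜₊| ≤ |ε³ z - 𝒜₊| + 1`. As `1 - r` stays away from zero, `𝒜₊` controls `w`. The bound for `w`
carries only one factor `ε`; the factor saved yields decay in the comparison with KdV. -/
theorem aSym_bounds_of_large (h : SmallParam α ε) (hz1 : ‖(ε : ℂ) ^ 3 * z‖ ≤ 1)
    (hz : -(1 / 6) * α ≤ z.re) (hk : 1 / 2 ≤ |k|) :
    α * (ε * ‖aSym (gam ε) (k + (ε * α : ℝ) * Complex.I)‖)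
      ≤ 400 * ‖(ε : ℂ) ^ 3 * z - aSym (gam ε) (k + (ε * α : ℝ) * Complex.I)‖ ∧
    α * (ε * ‖(k + (ε * α : ℝ) * Complex.I : ℂ)‖)
      ≤ 128000 * ‖(ε : ℂ) ^ 3 * z - aSym (gam ε) (k + (ε * α : ℝ) * Complex.I)‖ ∧
    α * (ε * ‖1 - rSym (gam ε) (k + (ε * α : ℝ) * Complex.I)‖)
      ≤ 640 * ‖(ε : ℂ) ^ 3 * z - aSym (gam ε) (k + (ε * α : ℝ) * Complex.I)‖ := by
  have h1 := h.le_norm_sub_aSym (k := k) hz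
  have h2 := h.one_sub_norm_rSym (k := k)
  have h3 := h.norm_rSym_le (k := k)
  have hε := h.ε_pos
  have hε1 := h.ε_le
  have hα := h.α_pos
  have hα1 := h.α_le
  have hm : 1 / 4 ≤ min (k ^ 2) 1 := le_min (by nlinarith [sq_abs k]) (by norm_num)
  have hA := aSym_eq (γ := gam ε) (strip_ne_zero h.a_pos (k := k))
  set w : ℂ := k + (ε * α : ℝ) * Complex.I
  set A := aSym (gam ε) w
  set r := rSym (gam ε) w
  set L := ‖(ε : ℂ) ^ 3 * z - A‖ with hL
  have hL0 : 0 ≤ L := norm_nonneg _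
  have hαε : 0 < α * ε := mul_pos hα hε
  have e1 : α * ε ≤ 320 * L := by nlinarith [mul_nonneg hαε.le (sq_nonneg ε)]
  have e2 : ‖A‖ ≤ L + 1 := by
    have : A = (ε : ℂ) ^ 3 * z - ((ε : ℂ) ^ 3 * z - A) := by ring
    calc ‖A‖ = ‖(ε : ℂ) ^ 3 * z - ((ε : ℂ) ^ 3 * z - A)‖ := by rw [← this]
      _ ≤ 1 + L := (norm_sub_le _ _).trans (by gcongr)
      _ = _ := by ring
  have e3 : α * (ε * ‖A‖) ≤ 400 * L := by
    have h8 : α * ε ≤ 1 / 8 := by nlinarith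
    have h9 := mul_le_mul_of_nonneg_left e2 hαε.le
    nlinarith
  have e4 : ‖w‖ ≤ 320 * ‖A‖ := by
    have : ‖A‖ = ‖w‖ * ‖1 - r‖ := by rw [hA, norm_mul, norm_mul, Complex.norm_I, one_mul]
    have e5 : 1 / 320 ≤ ‖1 - r‖ := by
      have := norm_sub_norm_le (1 : ℂ) r
      rw [norm_one] at this
      nlinarith [sq_nonneg ε]
    rw [this]
    nlinarith [norm_nonneg w]
  refine ⟨e3, ?_, ?_⟩
  · nlinarith
  · have : ‖1 - r‖ ≤ 2 := by
      refine (norm_sub_le _ _).trans ?_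
      rw [norm_one]
      linarith
    nlinarith

/-- Bounds for the symbols of `∂ (λ - 𝒜₊)⁻¹`, `𝒜₊ (λ - 𝒜₊)⁻¹` and `(1 - r) (λ - 𝒜₊)⁻¹`. -/
theorem aSym_bounds (h : SmallParam α ε) (hz1 : ‖(ε : ℂ) ^ 3 * z‖ ≤ 1)
    (hz : -(1 / 6) * α ≤ z.re) (k : ℝ) :
    α * (ε * ‖aSym (gam ε) (k + (ε * α : ℝ) * Complex.I)‖)
      ≤ 128000 * ‖(ε : ℂ) ^ 3 * z - aSym (gam ε) (k + (ε * α : ℝ) * Complex.I)‖ ∧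
    α * (ε ^ 2 * ‖(k + (ε * α : ℝ) * Complex.I : ℂ)‖)
      ≤ 128000 * ‖(ε : ℂ) ^ 3 * z - aSym (gam ε) (k + (ε * α : ℝ) * Complex.I)‖ ∧
    α * (ε * ‖1 - rSym (gam ε) (k + (ε * α : ℝ) * Complex.I)‖)
      ≤ 128000 * ‖(ε : ℂ) ^ 3 * z - aSym (gam ε) (k + (ε * α : ℝ) * Complex.I)‖ := by
  have hε := h.ε_pos
  have hε1 := h.ε_le
  have hα := h.α_pos
  have hL0 := norm_nonneg ((ε : ℂ) ^ 3 * z - aSym (gam ε) (k + (ε * α : ℝ) * Complex.I))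
  rcases le_total (1 / 2) |k| with hk | hk
  · obtain ⟨e1, e2, e3⟩ := h.aSym_bounds_of_large hz1 hz hk
    refine ⟨by linarith, le_trans ?_ e2, by linarith⟩
    have : 0 ≤ α * (ε * ‖(k + (ε * α : ℝ) * Complex.I : ℂ)‖) := by positivity
    nlinarith
  -- At low frequency all three left-hand sides are at most a multiple of `αε (ε² + k²)`, the lower
  -- bound available for the denominator.
  · have hk2 : k ^ 2 ≤ 1 / 4 := by nlinarith [sq_abs k, abs_nonneg k]
    have h1 := h.le_norm_sub_aSym (k := k) hz
    rw [min_eq_left (by linarith)] at h1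
    have h2 := h.norm_one_sub_rSym_le hk
    have h3 := h.eps_mul_norm_le (k := k)
    have h4 := norm_strip_le (k := k) h.a_pos
    have h5 := h.a_le
    have hA := aSym_eq (γ := gam ε) (strip_ne_zero h.a_pos (k := k))
    have hαε : 0 < α * ε := mul_pos hα hε
    refine ⟨?_, ?_, ?_⟩
    · rw [hA, norm_mul, norm_mul, Complex.norm_I, one_mul, ← hA]
      have : ‖(k + (ε * α : ℝ) * Complex.I : ℂ)‖
          * ‖1 - rSym (gam ε) (k + (ε * α : ℝ) * Complex.I)‖ ≤ 4 * (ε ^ 2 + k ^ 2) := by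
        refine le_trans (mul_le_of_le_one_left (norm_nonneg _) (by linarith)) h2
      nlinarith
    · nlinarith
    · nlinarith

/-- Taking real parts, the coefficient of `αε³` is at least `1/2 - 1/6 - 1/24`, where `1/6` comes
from `Re z` and `1/24` from `a³/6` with `α ≤ 1/2`; this exceeds `1/4`. -/
theorem le_norm_sub_kdvSym (h : SmallParam α ε) (hz : -(1 / 6) * α ≤ z.re) :
    α * ε * (ε ^ 2 + k ^ 2)
      ≤ 4 * ‖(ε : ℂ) ^ 3 * z - kdvSym ε (k + (ε * α : ℝ) * Complex.I)‖ := by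
  have hε := h.ε_pos
  have hα := h.α_pos
  have hα1 := h.α_le
  have e1 : ((ε : ℂ) ^ 3 * z).re = ε ^ 3 * z.re := by
    have : (ε : ℂ) ^ 3 = ((ε ^ 3 : ℝ) : ℂ) := by push_cast; rfl
    rw [this, Complex.re_ofReal_mul]
  have e2 : (kdvSym ε (k + (ε * α : ℝ) * Complex.I)).re
      = -(ε * α) * ε ^ 2 / 2 - k ^ 2 * (ε * α) / 2 + (ε * α) ^ 3 / 6 := by
    have : kdvSym ε (k + (ε * α : ℝ) * Complex.I)
        = ((-(ε * α) * ε ^ 2 / 2 - k ^ 2 * (ε * α) / 2 + (ε * α) ^ 3 / 6 : ℝ) : ℂ)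
          + ((k * ε ^ 2 / 2 + k ^ 3 / 6 - k * (ε * α) ^ 2 / 2 : ℝ) : ℂ) * Complex.I := by
      rw [kdvSym]
      push_cast
      have hI := Complex.I_sq
      have hI4 : Complex.I ^ 4 = 1 := Complex.I_pow_four
      have hI3 : Complex.I ^ 3 = -Complex.I := Complex.I_pow_three
      ring_nf
      rw [hI4, hI3, hI]
      ring
    rw [this, Complex.add_re, Complex.ofReal_re, Complex.re_ofReal_mul, Complex.I_re]
    ring
  have h1 : ε ^ 3 * (-(1 / 6) * α) ≤ ε ^ 3 * z.re := by gcongr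
  have h2 := Complex.re_le_norm ((ε : ℂ) ^ 3 * z - kdvSym ε (k + (ε * α : ℝ) * Complex.I))
  rw [Complex.sub_re, e1, e2] at h2
  have h3 : (ε * α) ^ 3 ≤ ε ^ 3 * α / 4 := by
    have : α ^ 3 ≤ α / 4 := by
      have : α ^ 2 ≤ 1 / 4 := by nlinarith
      nlinarith
    calc (ε * α) ^ 3 = ε ^ 3 * α ^ 3 := by ring
      _ ≤ ε ^ 3 * (α / 4) := by gcongr
      _ = _ := by ring
  have h4 : 0 ≤ ε * α * k ^ 2 := by positivity
  have h5 : 0 < ε ^ 3 * α := by positivity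
  nlinarith

theorem kdvSym_bound (h : SmallParam α ε) (hz : -(1 / 6) * α ≤ z.re) (k : ℝ) :
    α * (ε ^ 2 * ‖(k + (ε * α : ℝ) * Complex.I : ℂ)‖)
      ≤ 4 * ‖(ε : ℂ) ^ 3 * z - kdvSym ε (k + (ε * α : ℝ) * Complex.I)‖ := by
  refine le_trans ?_ (h.le_norm_sub_kdvSym hz)
  have := h.eps_mul_norm_le (k := k)
  have := mul_pos h.α_pos h.ε_pos
  nlinarith

set_option maxHeartbeats 1000000 in
/-- The symbol of `ε² ∂ (λ - 𝒜₊)⁻¹` converges to that of `∂ (λ - ½ ∂ + ⅙ ∂³)⁻¹`. -/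
theorem norm_symbol_sub_le (h : SmallParam α ε) (hz1 : ‖(ε : ℂ) ^ 3 * z‖ ≤ 1)
    (hz : -(1 / 6) * α ≤ z.re) (k : ℝ) :
    ‖(ε : ℂ) ^ 2 * (Complex.I * (k + (ε * α : ℝ) * Complex.I))
        / ((ε : ℂ) ^ 3 * z - aSym (gam ε) (k + (ε * α : ℝ) * Complex.I))
      - (ε : ℂ) ^ 2 * (Complex.I * (k + (ε * α : ℝ) * Complex.I))
        / ((ε : ℂ) ^ 3 * z - kdvSym ε (k + (ε * α : ℝ) * Complex.I))‖
      ≤ 200000 / α ^ 2 * Real.sqrt ε := by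
  have hε := h.ε_pos
  have hε1 := h.ε_le
  have hα := h.α_pos
  have hα1 := h.α_le
  have hs0 := Real.sqrt_pos.2 hε
  have hss := Real.sq_sqrt hε.le
  have hs1 : Real.sqrt ε ≤ 1 / 2 := by nlinarith
  have hL := h.le_norm_sub_aSym (k := k) hz
  have hM := h.le_norm_sub_kdvSym (k := k) hz
  have hlarge := h.aSym_bounds_of_large (k := k) hz1 hz
  have hw := norm_strip_le (k := k) h.a_pos
  have ha := h.a_le_half_eps
  have htay := h.norm_rSym_sub_taylor (k := k)
  have hA := aSym_eq (γ := gam ε) (strip_ne_zero h.a_pos (k := k))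
  have hwsq := h.norm_sq_le (k := k)
  set w : ℂ := k + (ε * α : ℝ) * Complex.I
  set A := aSym (gam ε) w
  set K := kdvSym ε w with hK
  set Λ := (ε : ℂ) ^ 3 * z
  set L := ‖Λ - A‖ with hLdef
  set M := ‖Λ - K‖ with hMdef
  have hαε : 0 < α * ε := mul_pos hα hε
  have hm0 : 0 ≤ min (k ^ 2) 1 := le_min (by positivity) zero_le_one
  have hLp : 0 < L := by nlinarith [mul_pos hαε (pow_pos hε 2), mul_nonneg hαε.le hm0]
  have hMp : 0 < M := by nlinarith [mul_pos hαε (pow_pos hε 2), mul_nonneg hαε.le (sq_nonneg k)]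
  have hnum : ‖(ε : ℂ) ^ 2 * (Complex.I * w)‖ = ε ^ 2 * ‖w‖ := by
    rw [norm_mul, norm_mul, norm_pow, Complex.norm_I, one_mul, Complex.norm_real,
      Real.norm_of_nonneg hε.le]
  have hes : ε ≤ Real.sqrt ε := by nlinarith
  -- For `|k| ≤ √ε` the fourth-order Taylor error is balanced by the product of the two quadratic
  -- lower bounds, and a factor `|w|² ≤ √ε` is left over. For `|k| ≥ √ε` each symbol is small by
  -- itself, since `ε |k| ≤ √ε k²`.
  rcases le_total |k| (Real.sqrt ε) with hk | hk
  · have hk12 : |k| ≤ 1 / 2 := hk.trans hs1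
    have hk2 : k ^ 2 ≤ ε := by
      rw [← sq_abs, ← hss]
      exact pow_le_pow_left₀ (abs_nonneg k) hk 2
    rw [min_eq_left (by linarith)] at hL
    have hAK : ‖A - K‖ ≤ ‖w‖ * (7 * (ε ^ 2 + k ^ 2) ^ 2) := by
      have : A - K = -(Complex.I * w * (rSym (gam ε) w - (1 - ε ^ 2 / 2 - w ^ 2 / 6))) := by
        rw [hA, hK, kdvSym]
        ring
      rw [this, norm_neg, norm_mul, norm_mul, Complex.norm_I, one_mul]
      gcongr
      exact htay hk12
    have hdiff : (ε : ℂ) ^ 2 * (Complex.I * w) / (Λ - A) - (ε : ℂ) ^ 2 * (Complex.I * w) / (Λ - K)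
        = (ε : ℂ) ^ 2 * (Complex.I * w) * (A - K) / ((Λ - A) * (Λ - K)) := by
      have h1 : Λ - A ≠ 0 := norm_pos_iff.1 hLp
      have h2 : Λ - K ≠ 0 := norm_pos_iff.1 hMp
      field_simp
      ring
    rw [hdiff, norm_div, norm_mul, norm_mul (Λ - A), hnum, ← hLdef, ← hMdef,
      div_le_iff₀ (by positivity)]
    have hLM : (α * ε * (ε ^ 2 + k ^ 2)) * (α * ε * (ε ^ 2 + k ^ 2)) ≤ 80 * L * (4 * M) := by
      gcongr
    have hw2 : ‖w‖ ^ 2 ≤ Real.sqrt ε := by nlinarith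
    have hfin : ε ^ 2 * ‖w‖ * ‖A - K‖ ≤ 7 * Real.sqrt ε * (ε ^ 2 * (ε ^ 2 + k ^ 2) ^ 2) := by
      calc ε ^ 2 * ‖w‖ * ‖A - K‖ ≤ ε ^ 2 * ‖w‖ * (‖w‖ * (7 * (ε ^ 2 + k ^ 2) ^ 2)) := by gcongr
        _ = ‖w‖ ^ 2 * (7 * (ε ^ 2 * (ε ^ 2 + k ^ 2) ^ 2)) := by ring
        _ ≤ Real.sqrt ε * (7 * (ε ^ 2 * (ε ^ 2 + k ^ 2) ^ 2)) := by gcongr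
        _ = _ := by ring
    refine hfin.trans ?_
    have h9 : α ^ 2 * (ε ^ 2 * (ε ^ 2 + k ^ 2) ^ 2) ≤ 320 * (L * M) := by nlinarith
    have h10 : ε ^ 2 * (ε ^ 2 + k ^ 2) ^ 2 ≤ 320 / α ^ 2 * (L * M) := by
      rw [div_mul_eq_mul_div, le_div_iff₀ (by positivity)]
      linarith
    calc 7 * Real.sqrt ε * (ε ^ 2 * (ε ^ 2 + k ^ 2) ^ 2)
        ≤ 7 * Real.sqrt ε * (320 / α ^ 2 * (L * M)) := by gcongr
      _ = 2240 / α ^ 2 * Real.sqrt ε * (L * M) := by ring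
      _ ≤ _ := by gcongr; norm_num
  · have hek : ε ≤ |k| := by nlinarith
    have hw' : ‖w‖ ≤ 3 / 2 * |k| := by linarith
    have hk0 : 0 < |k| := by linarith
    have hsk : Real.sqrt ε * Real.sqrt ε ≤ Real.sqrt ε * |k| := by gcongr
    have hskk : ε * |k| ≤ Real.sqrt ε * k ^ 2 := by
      rw [← sq_abs k]
      nlinarith
    have hK1 : ε ^ 2 * ‖w‖ / M ≤ 6 / α * Real.sqrt ε := by
      rw [div_le_iff₀ hMp, div_mul_eq_mul_div, div_mul_eq_mul_div, le_div_iff₀ hα]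
      calc ε ^ 2 * ‖w‖ * α ≤ ε ^ 2 * (3 / 2 * |k|) * α := by gcongr
        _ = 3 / 2 * (α * ε) * (ε * |k|) := by ring
        _ ≤ 3 / 2 * (α * ε) * (Real.sqrt ε * k ^ 2) := by gcongr
        _ = 3 / 2 * Real.sqrt ε * (α * ε * k ^ 2) := by ring
        _ ≤ 3 / 2 * Real.sqrt ε * (4 * M) := mul_le_mul_of_nonneg_left
            (by linarith [mul_pos hαε (pow_pos hε 2)]) (by positivity)
        _ = _ := by ring
    have hA1 : ε ^ 2 * ‖w‖ / L ≤ 128000 / α * Real.sqrt ε := by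
      rw [div_le_iff₀ hLp, div_mul_eq_mul_div, div_mul_eq_mul_div, le_div_iff₀ hα]
      rcases le_total (1 / 2) |k| with hk' | hk'
      · obtain ⟨-, e2, -⟩ := hlarge hk'
        calc ε ^ 2 * ‖w‖ * α = ε * (α * (ε * ‖w‖)) := by ring
          _ ≤ Real.sqrt ε * (128000 * L) := mul_le_mul hes e2 (by positivity) hs0.le
          _ = _ := by ring
      · rw [min_eq_left (by nlinarith [sq_abs k])] at hL
        calc ε ^ 2 * ‖w‖ * α ≤ ε ^ 2 * (3 / 2 * |k|) * α := by gcongr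
          _ = 3 / 2 * (α * ε) * (ε * |k|) := by ring
          _ ≤ 3 / 2 * (α * ε) * (Real.sqrt ε * k ^ 2) := by gcongr
          _ = 3 / 2 * Real.sqrt ε * (α * ε * k ^ 2) := by ring
          _ ≤ 3 / 2 * Real.sqrt ε * (80 * L) := mul_le_mul_of_nonneg_left
              (by linarith [mul_pos hαε (pow_pos hε 2)]) (by positivity)
          _ ≤ _ := by linarith [mul_pos hs0 hLp]
    refine (norm_sub_le _ _).trans ?_
    rw [norm_div, norm_div, hnum, ← hLdef, ← hMdef]
    have h11 : 1 / α ≤ 1 / α ^ 2 := by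
      rw [div_le_div_iff₀ hα (by positivity)]
      nlinarith
    calc _ ≤ 128000 / α * Real.sqrt ε + 6 / α * Real.sqrt ε := add_le_add hA1 hK1
      _ = 128006 * (1 / α) * Real.sqrt ε := by ring
      _ ≤ 200000 * (1 / α ^ 2) * Real.sqrt ε := by
          gcongr
          norm_num
      _ = _ := by ring

/-- Bounds for the symbol of `(λ - ∂ + 𝒮)⁻¹`. -/
theorem bSym_bounds (h : SmallParam α ε) (hz1 : ‖(ε : ℂ) ^ 3 * z‖ ≤ 1)
    (hz : -(1 / 6) * α ≤ z.re) (k : ℝ) :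
    α * ε ≤ 2 * ‖(ε : ℂ) ^ 3 * z - (Complex.I * (k + (ε * α : ℝ) * Complex.I)
      - scSymbol (gam ε) (k + (ε * α : ℝ) * Complex.I))‖ ∧
    α * (ε * ‖(k + (ε * α : ℝ) * Complex.I : ℂ)‖)
      ≤ 3 * ‖(ε : ℂ) ^ 3 * z - (Complex.I * (k + (ε * α : ℝ) * Complex.I)
        - scSymbol (gam ε) (k + (ε * α : ℝ) * Complex.I))‖ := by
  have hε := h.ε_pos
  have hε1 := h.ε_le
  have hα := h.α_pos
  have hα1 := h.α_le
  have hS := re_scSymbol_nonneg (γ := gam ε) (k + (ε * α : ℝ) * Complex.I)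
  have hSr := scSymbol_eq (γ := gam ε) (strip_ne_zero h.a_pos (k := k))
  obtain ⟨p1, -, -⟩ := rSym_re_im (k := k) h.a_pos h.a_le h.gam_pos
  have e1 : ((ε : ℂ) ^ 3 * z).re = ε ^ 3 * z.re := by
    have : (ε : ℂ) ^ 3 = ((ε ^ 3 : ℝ) : ℂ) := by push_cast; rfl
    rw [this, Complex.re_ofReal_mul]
  have h1 : ε ^ 3 * (-(1 / 6) * α) ≤ ε ^ 3 * z.re := by gcongr
  have h2 := Complex.re_le_norm ((ε : ℂ) ^ 3 * z - (Complex.I * (k + (ε * α : ℝ) * Complex.I)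
      - scSymbol (gam ε) (k + (ε * α : ℝ) * Complex.I)))
  rw [Complex.sub_re, Complex.sub_re, e1] at h2
  -- In contrast to `𝒜₊`, here `-𝒮` also has nonpositive real part, so the full shift `εα` is
  -- available. It dominates `ε³ Re z` at once.
  have e2 : (Complex.I * (k + (ε * α : ℝ) * Complex.I)).re = -(ε * α) := by simp
  rw [e2] at h2
  have h3 : ε ^ 3 * α ≤ ε * α / 16 := by
    have : ε ^ 2 ≤ 1 / 16 := by nlinarith
    nlinarith [h.a_pos]
  have hB : α * ε ≤ 2 * ‖(ε : ℂ) ^ 3 * z - (Complex.I * (k + (ε * α : ℝ) * Complex.I)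
      - scSymbol (gam ε) (k + (ε * α : ℝ) * Complex.I))‖ := by nlinarith [h.a_pos]
  refine ⟨hB, ?_⟩
  set w : ℂ := k + (ε * α : ℝ) * Complex.I
  set B := Complex.I * w - scSymbol (gam ε) w with hBdef
  set L := ‖(ε : ℂ) ^ 3 * z - B‖ with hL
  have e3 : ‖w‖ ≤ ‖B‖ := by
    have : B = Complex.I * w * (1 + rSym (gam ε) w) := by
      rw [hBdef, hSr]
      ring
    rw [this, norm_mul, norm_mul, Complex.norm_I, one_mul]
    refine le_mul_of_one_le_right (norm_nonneg _) ?_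
    have := Complex.re_le_norm (1 + rSym (gam ε) w)
    rw [Complex.add_re, Complex.one_re] at this
    linarith
  have e4 : ‖B‖ ≤ L + 1 := by
    have : B = (ε : ℂ) ^ 3 * z - ((ε : ℂ) ^ 3 * z - B) := by ring
    calc ‖B‖ = ‖(ε : ℂ) ^ 3 * z - ((ε : ℂ) ^ 3 * z - B)‖ := by rw [← this]
      _ ≤ 1 + L := (norm_sub_le _ _).trans (by gcongr)
      _ = _ := by ring
  have hL0 : 0 ≤ L := norm_nonneg _
  have h8 : α * ε ≤ 1 / 8 := by nlinarith
  have h9 := mul_le_mul_of_nonneg_left (e3.trans e4) (mul_pos hα hε).le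
  nlinarith

end SmallParam

/-! ### Weighted Wiener algebras and their functional calculus. -/

/-- Tonelli for a series whose `L¹` norms are summable; it provides the density that represents a
power series of a Wiener function. -/
theorem integrable_tsum_of_summable {F : ℕ → ℝ → ℂ} (hF : ∀ n, Integrable (F n))
    (hs : Summable fun n => ∫ x, ‖F n x‖) :
    Integrable (fun x => ∑' n, F n x) ∧ (∀ᵐ x, Summable fun n => ‖F n x‖) ∧
      Integrable (fun x => ∑' n, ‖F n x‖) ∧ ∫ x, ∑' n, ‖F n x‖ = ∑' n, ∫ x, ‖F n x‖ := by
  have hlt : ∫⁻ x, ∑' n, ‖F n x‖ₑ ≠ ⊤ := by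
    rw [lintegral_tsum fun n => (hF n).1.enorm]
    have : ∀ n, ∫⁻ x, ‖F n x‖ₑ = ENNReal.ofReal (∫ x, ‖F n x‖) := fun n => by
      rw [ofReal_integral_norm_eq_lintegral_enorm (hF n)]
    simp_rw [this]
    rw [← ENNReal.ofReal_tsum_of_nonneg (fun n => integral_nonneg fun x => norm_nonneg _) hs]
    exact ENNReal.ofReal_ne_top
  have hae : ∀ᵐ x, Summable fun n => ‖F n x‖ := by
    filter_upwards [ae_lt_top' (AEMeasurable.tsum fun n => (hF n).1.enorm) hlt] with x hx
    have h1 : ∑' n, ((‖F n x‖₊ : NNReal) : ℝ≥0∞) ≠ ⊤ := hx.ne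
    have := ENNReal.tsum_coe_ne_top_iff_summable.1 h1
    exact NNReal.summable_coe.2 this
  have hm : AEStronglyMeasurable (fun x => ∑' n, F n x) := by
    refine aestronglyMeasurable_of_tendsto_ae Filter.atTop
      (f := fun N x => ∑ n ∈ Finset.range N, F n x) (fun N => ?_) ?_
    · exact Finset.aestronglyMeasurable_fun_sum _ fun n _ => (hF n).1
    · filter_upwards [hae] with x hx
      exact hx.of_norm.hasSum.tendsto_sum_nat
  have hm' : AEStronglyMeasurable (fun x => ∑' n, ‖F n x‖) := by
    refine aestronglyMeasurable_of_tendsto_ae Filter.atTop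
      (f := fun N x => ∑ n ∈ Finset.range N, ‖F n x‖) (fun N => ?_) ?_
    · exact Finset.aestronglyMeasurable_fun_sum _ fun n _ => (hF n).1.norm
    · filter_upwards [hae] with x hx
      exact hx.hasSum.tendsto_sum_nat
  refine ⟨⟨hm, lt_of_le_of_lt (lintegral_mono fun x => enorm_tsum_le_tsum_enorm) hlt.lt_top⟩, hae,
    ⟨hm', lt_of_le_of_lt (lintegral_mono fun x => ?_) hlt.lt_top⟩, ?_⟩
  · refine enorm_tsum_le_tsum_enorm.trans (le_of_eq ?_)
    simp
  · exact (integral_tsum_of_summable_integral_norm (fun n => (hF n).norm)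
      (by simpa using hs)).symm

/-- Even submultiplicative weights on the frequency line. -/
structure IsWeight (v : ℝ → ℝ) : Prop where
  measurable : Measurable v
  one_le : ∀ x, 1 ≤ v x
  neg : ∀ x, v (-x) = v x
  add_le : ∀ x y, v (x + y) ≤ v x * v y

/-- The real function `g` is an inverse Fourier transform `𝓕⁻ φ` with `∫ v |φ| ≤ C`. -/
def InWiener (v : ℝ → ℝ) (g : ℝ → ℝ) (C : ℝ) : Prop :=
  ∃ φ : ℝ → ℂ, Integrable φ ∧ Integrable (fun κ => v κ * ‖φ κ‖) ∧
    (∀ x, (g x : ℂ) = 𝓕⁻ φ x) ∧ ∫ κ, v κ * ‖φ κ‖ ≤ C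

theorem IsWeight.nonneg {v : ℝ → ℝ} (hv : IsWeight v) (x : ℝ) : 0 ≤ v x :=
  zero_le_one.trans (hv.one_le x)

/-- The frequency representation of a real part. -/
theorem fourierInv_symm {ψ : ℝ → ℂ} (hψ : Integrable ψ) (x : ℝ) :
    (((𝓕⁻ ψ x).re : ℝ) : ℂ)
      = 𝓕⁻ (fun κ => (ψ κ + (starRingEnd ℂ) (ψ (-κ))) / 2) x := by
  have hc : ∀ κ : ℝ, (starRingEnd ℂ) (Real.fourierChar (κ * x) : ℂ)
      = (Real.fourierChar (-κ * x) : ℂ) := fun κ => by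
    rw [neg_mul, AddChar.map_neg_eq_inv, Circle.coe_inv_eq_conj]
  have hi : Integrable fun κ => (Real.fourierChar (κ * x) : ℂ) * ψ κ :=
    hψ.bdd_mul (c := 1) (Continuous.aestronglyMeasurable (by fun_prop))
      (ae_of_all _ fun κ => (Circle.norm_coe _).le)
  have hi' : Integrable fun κ => (Real.fourierChar (κ * x) : ℂ) * (starRingEnd ℂ) (ψ (-κ)) := by
    refine (Integrable.bdd_mul (c := 1) ?_
      (Continuous.aestronglyMeasurable (by fun_prop))
      (ae_of_all _ fun κ => (Circle.norm_coe _).le))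
    exact (Complex.conjLIE.integrable_comp_iff (φ := fun κ => ψ (-κ))).2 hψ.comp_neg
  rw [fourierInv_real_eq, fourierInv_real_eq, Complex.re_eq_add_conj, ← integral_conj]
  rw [← integral_neg_eq_self fun κ => (starRingEnd ℂ) ((Real.fourierChar (κ * x) : ℂ) * ψ κ)]
  simp only [map_mul, hc, neg_neg]
  rw [← integral_add hi hi', ← integral_div]
  refine integral_congr_ae (ae_of_all _ fun κ => ?_)
  ring

namespace InWiener

variable {v v' g g₁ g₂ : ℝ → ℝ} {C C₁ C₂ C' : ℝ}

theorem mono (h : InWiener v g C) (hC : C ≤ C') : InWiener v g C' := by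
  obtain ⟨φ, h1, h2, h3, h4⟩ := h
  exact ⟨φ, h1, h2, h3, h4.trans hC⟩

theorem congr (h : InWiener v g₁ C) (hg : ∀ x, g₁ x = g₂ x) : InWiener v g₂ C := by
  rw [← funext hg]
  exact h

theorem nonneg (hv : IsWeight v) (h : InWiener v g C) : 0 ≤ C := by
  obtain ⟨φ, -, -, -, h4⟩ := h
  exact (integral_nonneg fun κ => mul_nonneg (hv.nonneg κ) (norm_nonneg _)).trans h4

theorem mono_weight (h : InWiener v' g C) (hv : Measurable v) (hv0 : ∀ x, 0 ≤ v x)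
    (hvv : ∀ x, v x ≤ v' x) : InWiener v g C := by
  obtain ⟨φ, h1, h2, h3, h4⟩ := h
  have hle : ∀ κ, v κ * ‖φ κ‖ ≤ v' κ * ‖φ κ‖ := fun κ =>
    mul_le_mul_of_nonneg_right (hvv κ) (norm_nonneg _)
  have hi : Integrable fun κ => v κ * ‖φ κ‖ := by
    refine h2.mono' (hv.aestronglyMeasurable.mul h1.1.norm) (ae_of_all _ fun κ => ?_)
    rw [Real.norm_of_nonneg (mul_nonneg (hv0 κ) (norm_nonneg _))]
    exact hle κ
  exact ⟨φ, h1, hi, h3, (integral_mono hi h2 hle).trans h4⟩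

theorem abs_le (hv : IsWeight v) (h : InWiener v g C) (x : ℝ) : |g x| ≤ C := by
  obtain ⟨φ, h1, h2, h3, h4⟩ := h
  rw [← Real.norm_eq_abs, ← Complex.norm_real, h3 x]
  refine (norm_fourierInv_le x).trans (le_trans ?_ h4)
  exact integral_mono h1.norm h2 fun κ => le_mul_of_one_le_left (norm_nonneg _) (hv.one_le κ)

theorem continuous (h : InWiener v g C) : Continuous g := by
  obtain ⟨φ, h1, -, h3, -⟩ := h
  have := continuous_fourierInv_of_integrable h1
  have h5 : g = fun x => (𝓕⁻ φ x).re := by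
    funext x
    rw [← h3 x, Complex.ofReal_re]
  rw [h5]
  fun_prop

theorem add (hv : IsWeight v) (ha : InWiener v g₁ C₁) (hb : InWiener v g₂ C₂) :
    InWiener v (fun x => g₁ x + g₂ x) (C₁ + C₂) := by
  obtain ⟨φ, h1, h2, h3, h4⟩ := ha
  obtain ⟨ψ, k1, k2, k3, k4⟩ := hb
  have hle : ∀ κ, v κ * ‖φ κ + ψ κ‖ ≤ v κ * ‖φ κ‖ + v κ * ‖ψ κ‖ := fun κ => by
    rw [← mul_add]
    exact mul_le_mul_of_nonneg_left (norm_add_le _ _) (hv.nonneg κ)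
  have hi : Integrable fun κ => v κ * ‖φ κ + ψ κ‖ := by
    refine (h2.add k2).mono' (hv.measurable.aestronglyMeasurable.mul (h1.add k1).1.norm)
      (ae_of_all _ fun κ => ?_)
    rw [Real.norm_of_nonneg (mul_nonneg (hv.nonneg κ) (norm_nonneg _))]
    exact hle κ
  refine ⟨fun κ => φ κ + ψ κ, h1.add k1, hi, fun x => ?_, ?_⟩
  · push_cast
    rw [h3, k3, fourierInv_real_eq, fourierInv_real_eq, fourierInv_real_eq, ← integral_add]
    · simp only [mul_add]
    · exact h1.bdd_mul (c := 1) (Continuous.aestronglyMeasurable (by fun_prop))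
        (ae_of_all _ fun κ => (Circle.norm_coe _).le)
    · exact k1.bdd_mul (c := 1) (Continuous.aestronglyMeasurable (by fun_prop))
        (ae_of_all _ fun κ => (Circle.norm_coe _).le)
  · refine (integral_mono hi (h2.add k2) hle).trans ?_
    rw [integral_add' h2 k2]
    exact add_le_add h4 k4

theorem const_mul (c : ℝ) (h : InWiener v g C) : InWiener v (fun x => c * g x) (|c| * C) := by
  obtain ⟨φ, h1, h2, h3, h4⟩ := h
  have he : ∀ κ, v κ * ‖(c : ℂ) * φ κ‖ = |c| * (v κ * ‖φ κ‖) := fun κ => by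
    rw [norm_mul, Complex.norm_real, Real.norm_eq_abs]
    ring
  refine ⟨fun κ => c * φ κ, h1.const_mul _, ?_, fun x => ?_, ?_⟩
  · simp only [he]
    exact h2.const_mul _
  · push_cast
    rw [h3, fourierInv_real_eq, fourierInv_real_eq, ← integral_const_mul]
    refine integral_congr_ae (ae_of_all _ fun κ => ?_)
    ring
  · simp only [he]
    rw [integral_const_mul]
    gcongr

theorem neg (h : InWiener v g C) : InWiener v (fun x => -g x) C := by
  have := h.const_mul (-1)
  rw [abs_neg, abs_one, one_mul] at this
  exact this.congr fun x => by ring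

theorem sub (hv : IsWeight v) (ha : InWiener v g₁ C₁) (hb : InWiener v g₂ C₂) :
    InWiener v (fun x => g₁ x - g₂ x) (C₁ + C₂) :=
  (ha.add hv hb.neg).congr fun x => by ring

/-- A product has the convolution as density, and `v(κ) ≤ v(t) v(κ - t)` distributes the weight over
the two factors. -/
theorem mul (hv : IsWeight v) (ha : InWiener v g₁ C₁) (hb : InWiener v g₂ C₂) :
    InWiener v (fun x => g₁ x * g₂ x) (C₁ * C₂) := by
  have hC₁ := ha.nonneg hv
  obtain ⟨φ, h1, h2, h3, h4⟩ := ha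
  obtain ⟨ψ, k1, k2, k3, k4⟩ := hb
  set L := ContinuousLinearMap.mul ℂ ℂ
  set M := ContinuousLinearMap.mul ℝ ℝ
  have hconv := h1.integrable_convolution L k1
  have hconv' := h2.integrable_convolution M k2
  have hle : ∀ᵐ κ, v κ * ‖(convolution φ ψ L volume) κ‖
      ≤ convolution (fun κ => v κ * ‖φ κ‖) (fun κ => v κ * ‖ψ κ‖) M volume κ := by
    filter_upwards [h2.ae_convolution_exists M k2, h1.ae_convolution_exists L k1] with κ hκ hκ'
    rw [convolution, convolution]
    calc v κ * ‖∫ t, L (φ t) (ψ (κ - t))‖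
        ≤ v κ * ∫ t, ‖L (φ t) (ψ (κ - t))‖ :=
          mul_le_mul_of_nonneg_left (norm_integral_le_integral_norm _) (hv.nonneg κ)
      _ = ∫ t, v κ * ‖L (φ t) (ψ (κ - t))‖ := (integral_const_mul _ _).symm
      _ ≤ _ := by
          refine integral_mono (hκ'.norm.const_mul _) hκ fun t => ?_
          have h5 := hv.add_le t (κ - t)
          rw [add_sub_cancel] at h5
          change v κ * ‖φ t * ψ (κ - t)‖ ≤ (v t * ‖φ t‖) * (v (κ - t) * ‖ψ (κ - t)‖)
          rw [norm_mul]
          calc v κ * (‖φ t‖ * ‖ψ (κ - t)‖) ≤ (v t * v (κ - t)) * (‖φ t‖ * ‖ψ (κ - t)‖) := by gcongr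
            _ = _ := by ring
  have hi : Integrable fun κ => v κ * ‖(convolution φ ψ L volume) κ‖ := by
    refine hconv'.mono' (hv.measurable.aestronglyMeasurable.mul hconv.1.norm) ?_
    filter_upwards [hle] with κ hκ
    rwa [Real.norm_of_nonneg (mul_nonneg (hv.nonneg κ) (norm_nonneg _))]
  refine ⟨convolution φ ψ L volume, hconv, hi, fun x => ?_, ?_⟩
  · have := Real.fourier_mul_convolution_eq h1 k1 (-x)
    push_cast
    rw [h3, k3, Real.fourierInv_eq_fourier_neg, Real.fourierInv_eq_fourier_neg,
      Real.fourierInv_eq_fourier_neg]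
    exact this.symm
  · refine (integral_mono_ae hi hconv' hle).trans ?_
    rw [integral_convolution M h2 k2]
    change (∫ κ, v κ * ‖φ κ‖) * (∫ κ, v κ * ‖ψ κ‖) ≤ _
    exact mul_le_mul h4 k4
      (integral_nonneg fun κ => mul_nonneg (hv.nonneg κ) (norm_nonneg _)) hC₁

theorem pow_succ (hv : IsWeight v) (h : InWiener v g C) (n : ℕ) :
    InWiener v (fun x => g x ^ (n + 1)) (C ^ (n + 1)) := by
  induction n with
  | zero => simpa using h
  | succ n ih =>
    rw [_root_.pow_succ]
    exact (ih.mul hv h).congr fun x => (_root_.pow_succ _ _).symm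

/-- Taking the real part replaces `ψ` by its Hermitian symmetrization, which does not increase the
norm because the weight is even. -/
theorem re_fourierInv (hv : IsWeight v) {ψ : ℝ → ℂ} (hψ : Integrable ψ)
    (hvψ : Integrable fun κ => v κ * ‖ψ κ‖) :
    InWiener v (fun x => (𝓕⁻ ψ x).re) (∫ κ, v κ * ‖ψ κ‖) := by
  have hneg : Integrable fun κ => v κ * ‖ψ (-κ)‖ :=
    hvψ.comp_neg.congr (ae_of_all _ fun κ => by simp only [hv.neg])
  have hneg' : ∫ κ, v κ * ‖ψ (-κ)‖ = ∫ κ, v κ * ‖ψ κ‖ := by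
    rw [← integral_neg_eq_self fun κ => v κ * ‖ψ κ‖]
    simp only [hv.neg]
  have hsum : Integrable fun κ => (v κ * ‖ψ κ‖ + v κ * ‖ψ (-κ)‖) / 2 := (hvψ.add hneg).div_const _
  have hle : ∀ κ, v κ * ‖(ψ κ + (starRingEnd ℂ) (ψ (-κ))) / 2‖
      ≤ (v κ * ‖ψ κ‖ + v κ * ‖ψ (-κ)‖) / 2 := fun κ => by
    have h1 := norm_add_le (ψ κ) ((starRingEnd ℂ) (ψ (-κ)))
    rw [Complex.norm_conj] at h1
    rw [norm_div, Complex.norm_ofNat, ← mul_add, mul_div_assoc]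
    have := hv.nonneg κ
    gcongr
  have hφ : Integrable fun κ => (ψ κ + (starRingEnd ℂ) (ψ (-κ))) / 2 :=
    (hψ.add ((Complex.conjLIE.integrable_comp_iff (φ := fun κ => ψ (-κ))).2 hψ.comp_neg)).div_const _
  have hi : Integrable fun κ => v κ * ‖(ψ κ + (starRingEnd ℂ) (ψ (-κ))) / 2‖ := by
    refine hsum.mono' (hv.measurable.aestronglyMeasurable.mul hφ.1.norm) (ae_of_all _ fun κ => ?_)
    rw [Real.norm_of_nonneg (mul_nonneg (hv.nonneg κ) (norm_nonneg _))]
    exact hle κ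
  refine ⟨_, hφ, hi, fun x => fourierInv_symm hψ x, (integral_mono hi hsum hle).trans ?_⟩
  rw [integral_div, integral_add hvψ hneg, hneg']
  linarith

/-- Integrability of `g` is needed to identify `𝓕 g`, on which the multiplier is defined, with the
density that represents `g`. -/
theorem realMul (hv : IsWeight v) (h : InWiener v g C)
    (hg : Integrable fun x => (g x : ℂ)) {P : ℝ → ℂ} (hP : Measurable P) {K : ℝ} (hK0 : 0 ≤ K)
    (hK : ∀ k, ‖P k‖ ≤ K) : InWiener v (realMul P g) (K * C) := by
  obtain ⟨φ, h1, h2, h3, h4⟩ := h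
  have h5 := fourier_ae_eq_of_eq_fourierInv hg h1 h3
  have hPm : Measurable fun ξ : ℝ => P (2 * Real.pi * ξ) := by fun_prop
  have hle : ∀ᵐ κ, v κ * ‖P (2 * Real.pi * κ) * 𝓕 (fun y => (g y : ℂ)) κ‖
      ≤ K * (v κ * ‖φ κ‖) := by
    filter_upwards [h5] with κ hκ
    rw [hκ, norm_mul]
    calc _ ≤ v κ * (K * ‖φ κ‖) :=
          mul_le_mul_of_nonneg_left (mul_le_mul_of_nonneg_right (hK _) (norm_nonneg _)) (hv.nonneg κ)
      _ = _ := by ring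
  have hψ : Integrable fun κ => P (2 * Real.pi * κ) * 𝓕 (fun y => (g y : ℂ)) κ := by
    refine (h1.congr h5.symm).bdd_mul (c := K) hPm.aestronglyMeasurable (ae_of_all _ fun κ => hK _)
  have hvψ : Integrable fun κ => v κ * ‖P (2 * Real.pi * κ) * 𝓕 (fun y => (g y : ℂ)) κ‖ := by
    refine (h2.const_mul K).mono' (hv.measurable.aestronglyMeasurable.mul hψ.1.norm) ?_
    filter_upwards [hle] with κ hκ
    rwa [Real.norm_of_nonneg (mul_nonneg (hv.nonneg κ) (norm_nonneg _))]
  refine (re_fourierInv hv hψ hvψ).mono ((integral_mono_ae hvψ (h2.const_mul K) hle).trans ?_)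
  rw [integral_const_mul]
  gcongr

/-- Composition with a power series with coefficients bounded by one. -/
theorem powerSeries (hv : IsWeight v) (h : InWiener v g C) (hC : C ≤ 1 / 2) {c : ℕ → ℝ}
    (hc : ∀ n, |c n| ≤ 1) {G : ℝ → ℝ} (hG : ∀ x, HasSum (fun n => c n * g x ^ (n + 1)) (G x)) :
    InWiener v G (2 * C) := by
  have hC0 := h.nonneg hv
  have hterm : ∀ n, InWiener v (fun x => c n * g x ^ (n + 1)) (C ^ (n + 1)) := fun n =>
    ((h.pow_succ hv n).const_mul (c n)).mono
      (mul_le_of_le_one_left (pow_nonneg hC0 _) (hc n))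
  choose φ h1 h2 h3 h4 using hterm
  -- The series starts with the first power, since nonzero constants do not belong to the algebra.
  -- For `C ≤ 1/2` the geometric sum is at most `2 C`.
  have hgeo : HasSum (fun n => C ^ (n + 1)) ((1 - C)⁻¹ * C) := by
    have := (hasSum_geometric_of_lt_one hC0 (by linarith)).mul_right C
    simpa only [_root_.pow_succ] using this
  have hgeo_le : (1 - C)⁻¹ * C ≤ 2 * C := by
    gcongr
    rw [inv_le_comm₀ (by linarith) (by norm_num)]
    linarith
  have hnn : ∀ n, ∫ κ, ‖φ n κ‖ ≤ C ^ (n + 1) := fun n => le_trans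
    (integral_mono (h1 n).norm (h2 n) fun κ =>
      le_mul_of_one_le_left (norm_nonneg _) (hv.one_le κ)) (h4 n)
  have hs1 : Summable fun n => ∫ κ, ‖φ n κ‖ :=
    hgeo.summable.of_nonneg_of_le (fun n => integral_nonneg fun _ => norm_nonneg _) hnn
  obtain ⟨i1, i2, -, -⟩ := integrable_tsum_of_summable h1 hs1
  have hvn : ∀ n κ, ‖((v κ : ℝ) : ℂ) * φ n κ‖ = v κ * ‖φ n κ‖ := fun n κ => by
    rw [norm_mul, Complex.norm_real, Real.norm_of_nonneg (hv.nonneg κ)]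
  have hs2 : Summable fun n => ∫ κ, ‖((v κ : ℝ) : ℂ) * φ n κ‖ := by
    simp only [hvn]
    exact hgeo.summable.of_nonneg_of_le
      (fun n => integral_nonneg fun κ => mul_nonneg (hv.nonneg κ) (norm_nonneg _)) h4
  have hvi : ∀ n, Integrable fun κ => ((v κ : ℝ) : ℂ) * φ n κ := fun n => by
    refine (h2 n).mono' ((Complex.measurable_ofReal.comp hv.measurable).aestronglyMeasurable.mul
      (h1 n).1) (ae_of_all _ fun κ => (hvn n κ).le)
  obtain ⟨-, j2, j3, j4⟩ := integrable_tsum_of_summable hvi hs2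
  simp only [hvn] at j2 j3 j4 hs2
  have hle : ∀ᵐ κ, v κ * ‖∑' n, φ n κ‖ ≤ ∑' n, v κ * ‖φ n κ‖ := by
    filter_upwards [i2] with κ hκ
    rw [tsum_mul_left]
    exact mul_le_mul_of_nonneg_left (norm_tsum_le_tsum_norm hκ) (hv.nonneg κ)
  have hi : Integrable fun κ => v κ * ‖∑' n, φ n κ‖ := by
    refine j3.mono' (hv.measurable.aestronglyMeasurable.mul i1.1.norm) ?_
    filter_upwards [hle] with κ hκ
    rwa [Real.norm_of_nonneg (mul_nonneg (hv.nonneg κ) (norm_nonneg _))]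
  refine ⟨fun κ => ∑' n, φ n κ, i1, hi, fun x => ?_, ?_⟩
  · have hF : ∀ n, Integrable fun κ => (Real.fourierChar (κ * x) : ℂ) * φ n κ := fun n =>
      (h1 n).bdd_mul (c := 1) (Continuous.aestronglyMeasurable (by fun_prop))
        (ae_of_all _ fun κ => (Circle.norm_coe _).le)
    have hsum := hasSum_integral_of_summable_integral_norm hF (by
      simpa [Circle.norm_coe] using hs1)
    simp only [tsum_mul_left] at hsum
    rw [fourierInv_real_eq]
    refine HasSum.unique ?_ hsum
    have := (Complex.hasSum_ofReal.2 (hG x))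
    refine this.congr_fun fun n => ?_
    rw [← fourierInv_real_eq, ← h3]
  · refine (integral_mono_ae hi j3 hle).trans ?_
    rw [j4]
    exact (hs2.tsum_le_tsum h4 hgeo.summable).trans (hgeo.tsum_eq.le.trans hgeo_le)

end InWiener

/-- Consecutive binomial coefficients have ratio `(a - n)/(n + 1)`, of absolute value at most one.
The range of `a` includes the inverse and the square root. -/
theorem abs_choose_le_one {a : ℝ} (h0 : -1 ≤ a) (h1 : a ≤ 1) (n : ℕ) : |Ring.choose a n| ≤ 1 := by
  induction n with
  | zero => simp
  | succ n ih =>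
    have h := Ring.choose_smul_choose a (Nat.le_succ n)
    rw [Nat.succ_eq_add_one, Nat.choose_succ_self_right, Nat.add_sub_cancel_left,
      Ring.choose_one_right, nsmul_eq_mul] at h
    have h2 : |((n + 1 : ℕ) : ℝ)| * |Ring.choose a (n + 1)| ≤ ((n + 1 : ℕ) : ℝ) * 1 := by
      rw [← abs_mul, h, abs_mul, mul_comm]
      refine mul_le_mul ?_ ih (abs_nonneg _) (by positivity)
      have : (0 : ℝ) ≤ n := n.cast_nonneg
      rw [abs_le]
      push_cast
      constructor <;> linarith
    rw [abs_of_nonneg (by positivity)] at h2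
    exact le_of_mul_le_mul_left h2 (by positivity)

theorem hasSum_one_add_rpow {a x : ℝ} (hx : |x| < 1) :
    HasSum (fun n => Ring.choose a (n + 1) * x ^ (n + 1)) ((1 + x) ^ a - 1) := by
  have h := (Real.one_add_rpow_hasFPowerSeriesOnBall_zero (a := a)).hasSum (y := x) (by
    simpa [Metric.mem_eball, edist_dist] using hx)
  simp only [binomialSeries_apply, zero_add] at h
  rw [hasSum_nat_add_iff (f := fun n => Ring.choose a n * x ^ n) 1]
  simpa using h

/-- Differentiation of an inverse Fourier transform. -/
theorem hasDerivAt_fourierInv {φ : ℝ → ℂ} (hφ : Integrable φ)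
    (hφ' : Integrable fun κ : ℝ => |κ| * ‖φ κ‖) (x : ℝ) :
    HasDerivAt (𝓕⁻ φ) (𝓕⁻ (fun κ : ℝ => 2 * Real.pi * Complex.I * κ * φ κ) x) x := by
  have hxi : Integrable fun κ : ℝ => κ • φ κ := by
    refine hφ'.mono' ((by fun_prop : Continuous fun κ : ℝ => κ).aestronglyMeasurable.smul hφ.1)
      (ae_of_all _ fun κ => ?_)
    rw [norm_smul, Real.norm_eq_abs]
  have hd := (Real.hasDerivAt_fourier hφ hxi (-x)).scomp x (hasDerivAt_neg x)
  have e1 : (𝓕 φ ∘ Neg.neg) = 𝓕⁻ φ := by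
    funext y
    rw [Real.fourierInv_eq_fourier_neg, Function.comp_apply]
  have e2 : -𝓕 (fun x : ℝ => (-2 * Real.pi * Complex.I * x) • φ x) (-x)
      = 𝓕⁻ (fun κ : ℝ => 2 * Real.pi * Complex.I * κ * φ κ) x := by
    rw [Real.fourierInv_eq_fourier_neg, Real.fourier_real_eq, Real.fourier_real_eq, ← integral_neg]
    refine integral_congr_ae (ae_of_all _ fun κ => ?_)
    simp only [Circle.smul_def, smul_eq_mul]
    ring
  rwa [neg_one_smul, e1, e2] at hd

/-- A real function whose complexification is differentiable. -/
theorem hasDerivAt_of_ofReal {g : ℝ → ℝ} {d : ℂ} {x : ℝ}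
    (h : HasDerivAt (fun y => (g y : ℂ)) d x) : HasDerivAt g d.re x ∧ (d.re : ℂ) = d := by
  have h1 : HasDerivAt g d.re x := by
    simpa [Function.comp_def] using Complex.reCLM.hasFDerivAt.comp_hasDerivAt x h
  exact ⟨h1, h1.ofReal_comp.unique h⟩

namespace InWiener

variable {v v' g : ℝ → ℝ} {C : ℝ}

theorem one_add_rpow (hv : IsWeight v) (h : InWiener v g C) (hC : C ≤ 1 / 2) {a : ℝ}
    (h0 : -1 ≤ a) (h1 : a ≤ 1) : InWiener v (fun x => (1 + g x) ^ a - 1) (2 * C) :=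
  h.powerSeries hv hC (fun n => abs_choose_le_one h0 h1 (n + 1)) fun x =>
    hasSum_one_add_rpow (((h.abs_le hv x).trans hC).trans_lt (by norm_num))

theorem inv_one_add (hv : IsWeight v) (h : InWiener v g C) (hC : C ≤ 1 / 2) :
    InWiener v (fun x => (1 + g x)⁻¹ - 1) (2 * C) :=
  (h.one_add_rpow hv hC (a := -1) le_rfl (by norm_num)).congr fun x => by rw [Real.rpow_neg_one]

theorem sqrt_one_add (hv : IsWeight v) (h : InWiener v g C) (hC : C ≤ 1 / 2) :
    InWiener v (fun x => Real.sqrt (1 + g x) - 1) (2 * C) :=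
  (h.one_add_rpow hv hC (a := 1 / 2) (by norm_num) (by norm_num)).congr fun x => by
    rw [Real.sqrt_eq_rpow]

/-- Differentiation costs one power of the frequency. -/
theorem deriv (hv : IsWeight v) (h : InWiener v' g C) {ε : ℝ} (hε : 0 ≤ ε)
    (hvv : ∀ κ, 2 * Real.pi * |κ| * v κ ≤ ε * v' κ) :
    (∀ x, DifferentiableAt ℝ g x) ∧ InWiener v (_root_.deriv g) (ε * C) := by
  obtain ⟨φ, h1, h2, h3, h4⟩ := h
  set ψ : ℝ → ℂ := fun κ => (2 * Real.pi * Complex.I * κ) * φ κ with hψ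
  have hn : ∀ κ, ‖ψ κ‖ = 2 * Real.pi * |κ| * ‖φ κ‖ := fun κ => by
    simp [hψ, abs_of_pos Real.pi_pos]
  have hψm : AEStronglyMeasurable ψ := by
    refine AEStronglyMeasurable.mul (Continuous.aestronglyMeasurable (by fun_prop)) h1.1
  have hle : ∀ κ, v κ * ‖ψ κ‖ ≤ ε * (v' κ * ‖φ κ‖) := fun κ => by
    rw [hn]
    have := mul_le_mul_of_nonneg_right (hvv κ) (norm_nonneg (φ κ))
    linarith
  have hvψ : Integrable fun κ => v κ * ‖ψ κ‖ := by
    refine (h2.const_mul ε).mono' (hv.measurable.aestronglyMeasurable.mul hψm.norm)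
      (ae_of_all _ fun κ => ?_)
    rw [Real.norm_of_nonneg (mul_nonneg (hv.nonneg κ) (norm_nonneg _))]
    exact hle κ
  have hψi : Integrable ψ := by
    refine hvψ.mono' hψm (ae_of_all _ fun κ => ?_)
    exact le_mul_of_one_le_left (norm_nonneg _) (hv.one_le κ)
  have hxi : Integrable fun κ : ℝ => |κ| * ‖φ κ‖ := by
    refine (hψi.norm.const_mul (2 * Real.pi)⁻¹).congr (ae_of_all _ fun κ => ?_)
    have : 2 * Real.pi ≠ 0 := Real.two_pi_pos.ne'
    simp only [hn]
    field_simp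
  have hder : ∀ x, HasDerivAt g (𝓕⁻ ψ x).re x := fun x => by
    refine (hasDerivAt_of_ofReal ?_).1
    rw [funext h3]
    exact hasDerivAt_fourierInv h1 hxi x
  refine ⟨fun x => (hder x).differentiableAt, ?_⟩
  have e : _root_.deriv g = fun x => (𝓕⁻ ψ x).re := funext fun x => (hder x).deriv
  rw [e]
  refine (re_fourierInv hv hψi hvψ).mono ((integral_mono hvψ (h2.const_mul ε) hle).trans ?_)
  rw [integral_const_mul]
  gcongr

end InWiener

theorem isWeight_one : IsWeight fun _ => 1 :=
  ⟨measurable_const, fun _ => le_rfl, fun _ => rfl, fun _ _ => by norm_num⟩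

/-! ### Hyperbolic secants -/

theorem one_add_sq_div_two_le_cosh (x : ℝ) : 1 + x ^ 2 / 2 ≤ Real.cosh x := by
  have h1 : Real.cosh x = 1 + 2 * Real.sinh (x / 2) ^ 2 := by
    have := Real.cosh_two_mul (x / 2)
    rw [mul_div_cancel₀ x two_ne_zero, Real.cosh_sq] at this
    linarith
  have h2 : (x / 2) ^ 2 ≤ Real.sinh (x / 2) ^ 2 := by
    rw [sq_le_sq, Real.abs_sinh]
    exact Real.self_le_sinh_iff.2 (abs_nonneg _)
  rw [h1]
  linarith

theorem integrable_sech {b : ℝ} (hb : b ≠ 0) : Integrable fun x => (Real.cosh (b * x))⁻¹ := by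
  have h := (integrable_inv_one_add_sq.comp_mul_left' (R := b / 2) (by positivity))
  refine (h.const_mul 1).mono' ?_ (ae_of_all _ fun x => ?_)
  · exact (Continuous.inv₀ (by fun_prop) fun x => (Real.cosh_pos _).ne').aestronglyMeasurable
  · rw [Real.norm_of_nonneg (inv_nonneg.2 (Real.cosh_pos _).le), one_mul]
    have := one_add_sq_div_two_le_cosh (b * x)
    refine inv_anti₀ (by positivity) (le_trans ?_ this)
    nlinarith [sq_nonneg (b * x)]

/-- A function with two integrable derivatives has an integrable Fourier transform. -/
theorem integrable_fourier_of_deriv {g g' g'' : ℝ → ℂ} (h0 : ∀ x, HasDerivAt g (g' x) x)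
    (h1 : ∀ x, HasDerivAt g' (g'' x) x) (hg : Integrable g) (hg' : Integrable g')
    (hg'' : Integrable g'') : Integrable (𝓕 g) := by
  have d0 : deriv g = g' := funext fun x => (h0 x).deriv
  have d1 : deriv g' = g'' := funext fun x => (h1 x).deriv
  have e0 := Real.fourier_deriv hg (fun x => (h0 x).differentiableAt) (by rwa [d0])
  have e1 := Real.fourier_deriv hg' (fun x => (h1 x).differentiableAt) (by rwa [d1])
  rw [d0] at e0
  rw [d1, e0] at e1
  refine (integrable_inv_one_add_sq.const_mul
    ((∫ x, ‖g x‖) + ∫ x, ‖g'' x‖)).mono' (continuous_fourier_of_integrable hg).aestronglyMeasurable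
    (ae_of_all _ fun ξ => ?_)
  have b0 := norm_fourier_le (φ := g) ξ
  have b1 := norm_fourier_le (φ := g'') ξ
  rw [e1] at b1
  simp only [norm_smul, norm_mul, Complex.norm_ofNat, Complex.norm_real, Complex.norm_I,
    mul_one, Real.norm_eq_abs, abs_of_pos Real.pi_pos] at b1
  rw [← div_eq_mul_inv, le_div_iff₀ (by positivity)]
  have hpi := Real.pi_gt_three
  have hξ : ξ ^ 2 ≤ 2 * Real.pi * |ξ| * (2 * Real.pi * |ξ|) := by
    rw [← sq_abs]
    have : (1 : ℝ) ≤ (2 * Real.pi) ^ 2 := by nlinarith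
    nlinarith [sq_nonneg |ξ|]
  have := mul_le_mul_of_nonneg_right hξ (norm_nonneg (𝓕 g ξ))
  nlinarith [norm_nonneg (𝓕 g ξ)]

/-- The weight `1 + |k|`. -/
def linWeight (κ : ℝ) : ℝ := 1 + 2 * Real.pi * |κ|

theorem isWeight_linWeight : IsWeight linWeight where
  measurable := by
    unfold linWeight
    fun_prop
  one_le κ := by
    have := mul_nonneg Real.two_pi_pos.le (abs_nonneg κ)
    rw [linWeight]
    linarith
  neg κ := by rw [linWeight, linWeight, abs_neg]
  add_le x y := by
    have h1 := mul_le_mul_of_nonneg_left (abs_add_le x y) Real.two_pi_pos.le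
    have hx := mul_nonneg Real.two_pi_pos.le (abs_nonneg x)
    have hy := mul_nonneg Real.two_pi_pos.le (abs_nonneg y)
    simp only [linWeight]
    nlinarith [mul_nonneg hx hy]

/-- The function `s = sech(bx)` satisfies `s'' = b² s - 2 b² s³`, so derivatives up to order three
are explicit and dominated by multiples of `s`. Applied to `s` and to `s'`, the criterion with two
integrable derivatives gives integrability of the transform and of its first moment. -/
theorem exists_inWiener_sech {b : ℝ} (hb : 0 < b) :
    ∃ C, InWiener linWeight (fun x => (Real.cosh (b * x))⁻¹) C := by
  have hc : ∀ x, Real.cosh (b * x) ≠ 0 := fun x => (Real.cosh_pos _).ne'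
  have hdc : ∀ x, HasDerivAt (fun x => Real.cosh (b * x)) (b * Real.sinh (b * x)) x := fun x => by
    have := (Real.hasDerivAt_cosh (b * x)).comp x ((hasDerivAt_id x).const_mul b)
    simpa [Function.comp_def, mul_comm] using this
  have hds : ∀ x, HasDerivAt (fun x => Real.sinh (b * x)) (b * Real.cosh (b * x)) x := fun x => by
    have := (Real.hasDerivAt_sinh (b * x)).comp x ((hasDerivAt_id x).const_mul b)
    simpa [Function.comp_def, mul_comm] using this
  set s : ℝ → ℝ := fun x => (Real.cosh (b * x))⁻¹ with hs
  set s' : ℝ → ℝ := fun x => -(b * Real.sinh (b * x)) / Real.cosh (b * x) ^ 2 with hs'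
  have h0 : ∀ x, HasDerivAt s (s' x) x := fun x => (hdc x).inv (hc x)
  have h1 : ∀ x, HasDerivAt s' (b ^ 2 * s x - 2 * b ^ 2 * s x ^ 3) x := fun x => by
    have := ((hds x).const_mul b).neg.div ((hdc x).pow 2) (pow_ne_zero 2 (hc x))
    refine this.congr_deriv ?_
    have hcx := hc x
    have hs2 := Real.cosh_sq (b * x)
    have hs3 : Real.sinh (b * x) ^ 2 = Real.cosh (b * x) ^ 2 - 1 := by linarith
    simp only [Pi.pow_apply, Pi.neg_apply, hs]
    field_simp
    ring_nf
    rw [hs3]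
    ring
  have h2 : ∀ x, HasDerivAt (fun x => b ^ 2 * s x - 2 * b ^ 2 * s x ^ 3)
      (b ^ 2 * s' x - 2 * b ^ 2 * (3 * (s x ^ 2 * s' x))) x := fun x => by
    refine (((h0 x).const_mul _).sub (((h0 x).pow 3).const_mul _)).congr_deriv ?_
    push_cast
    ring
  have hi : Integrable s := integrable_sech hb.ne'
  have hle1 : ∀ x, s x ≤ 1 := fun x => inv_le_one_of_one_le₀ (Real.one_le_cosh _)
  have hpos : ∀ x, 0 < s x := fun x => inv_pos.2 (Real.cosh_pos _)
  have hcont : Continuous s := continuous_iff_continuousAt.2 fun x => (h0 x).continuousAt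
  have hcont' : Continuous s' := continuous_iff_continuousAt.2 fun x => (h1 x).continuousAt
  have hi1 : Integrable s' := by
    refine (hi.const_mul b).mono' hcont'.aestronglyMeasurable (ae_of_all _ fun x => ?_)
    have hcp := Real.cosh_pos (b * x)
    simp only [hs, hs']
    rw [norm_div, norm_neg, norm_mul, Real.norm_of_nonneg hb.le,
      Real.norm_of_nonneg (pow_pos hcp 2).le, div_le_iff₀ (pow_pos hcp 2), mul_assoc, sq,
      inv_mul_cancel_left₀ hcp.ne']
    refine mul_le_mul_of_nonneg_left ?_ hb.le
    rw [Real.norm_eq_abs]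
    refine abs_le_of_sq_le_sq ?_ hcp.le
    rw [Real.cosh_sq]
    linarith
  have hi2 : Integrable fun x => b ^ 2 * s x - 2 * b ^ 2 * s x ^ 3 := by
    refine (hi.const_mul _).sub (Integrable.const_mul ?_ _)
    refine hi.mono' (hcont.pow 3).aestronglyMeasurable (ae_of_all _ fun x => ?_)
    rw [Real.norm_of_nonneg (pow_pos (hpos x) 3).le]
    exact pow_le_of_le_one (hpos x).le (hle1 x) (by norm_num)
  have hi3 : Integrable fun x => b ^ 2 * s' x - 2 * b ^ 2 * (3 * (s x ^ 2 * s' x)) := by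
    refine (hi1.const_mul _).sub ((Integrable.const_mul ?_ _).const_mul _)
    refine hi1.bdd_mul (c := 1) (hcont.pow 2).aestronglyMeasurable (ae_of_all _ fun x => ?_)
    rw [Real.norm_of_nonneg (pow_pos (hpos x) 2).le]
    exact pow_le_one₀ (hpos x).le (hle1 x)
  have hF := integrable_fourier_of_deriv (fun x => (h0 x).ofReal_comp) (fun x => (h1 x).ofReal_comp)
    hi.ofReal hi1.ofReal hi2.ofReal
  have hF' := integrable_fourier_of_deriv (fun x => (h1 x).ofReal_comp)
    (fun x => (h2 x).ofReal_comp) hi1.ofReal hi2.ofReal hi3.ofReal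
  have hd : deriv (fun x => (s x : ℂ)) = fun x => (s' x : ℂ) :=
    funext fun x => (h0 x).ofReal_comp.deriv
  have e0 := Real.fourier_deriv hi.ofReal (fun x => (h0 x).ofReal_comp.differentiableAt)
    (by rw [hd]; exact hi1.ofReal)
  rw [hd] at e0
  refine ⟨_, _, hF, ?_, fun x => ?_, le_rfl⟩
  · refine (hF.norm.add hF'.norm).congr (ae_of_all _ fun κ => ?_)
    have e1 := congrFun e0 κ
    change ‖𝓕 (fun x => (s x : ℂ)) κ‖ + ‖𝓕 (fun x => (s' x : ℂ)) κ‖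
      = (1 + 2 * Real.pi * |κ|) * ‖𝓕 (fun x => (s x : ℂ)) κ‖
    change 𝓕 (fun x => (s' x : ℂ)) κ = _ • 𝓕 (fun x => (s x : ℂ)) κ at e1
    rw [e1, norm_smul, norm_mul, norm_mul, norm_mul, Complex.norm_ofNat, Complex.norm_real,
      Complex.norm_real, Complex.norm_I, Real.norm_of_nonneg Real.pi_pos.le, Real.norm_eq_abs]
    ring
  · rw [Continuous.fourierInv_fourier_eq (by fun_prop) hi.ofReal hF]

theorem exists_inWiener_kdvProfile : ∃ C, InWiener linWeight kdvProfile C := by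
  obtain ⟨C, hC⟩ := exists_inWiener_sech (b := Real.sqrt 3 / 2) (by positivity)
  refine ⟨_, (hC.mul isWeight_linWeight hC).congr fun x => ?_⟩
  rw [kdvProfile, one_div, sq]
  ring_nf

theorem integrable_kdvProfile : Integrable kdvProfile := by
  have hi := integrable_sech (b := Real.sqrt 3 / 2) (by positivity)
  have hpos : ∀ x, 0 < (Real.cosh (Real.sqrt 3 / 2 * x))⁻¹ := fun x => inv_pos.2 (Real.cosh_pos _)
  have he : kdvProfile = fun x => (Real.cosh (Real.sqrt 3 / 2 * x))⁻¹ ^ 2 := by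
    funext x
    rw [kdvProfile, one_div]
    ring_nf
  rw [he]
  refine hi.mono' (hi.1.pow 2) (ae_of_all _ fun x => ?_)
  rw [Real.norm_of_nonneg (pow_pos (hpos x) 2).le]
  exact pow_le_of_le_one (hpos x).le (inv_le_one_of_one_le₀ (Real.one_le_cosh _)) (by norm_num)

theorem continuous_kdvProfile : Continuous kdvProfile := by
  obtain ⟨C, hC⟩ := exists_inWiener_kdvProfile
  exact hC.continuous

/-! ### The deviation from the KdV profile -/

/-- Cauchy–Schwarz against `(1 + k²)⁻¹`, whose integral over `ξ` is at most `π ≤ 4`; hence the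
constant `2`. -/
theorem integrable_of_weighted_sq {m : ℕ} (hm : 1 ≤ m) {E : ℝ} (hE : 0 ≤ E) {G : ℝ → ℂ}
    (hG : AEStronglyMeasurable G)
    (h : (∫⁻ ξ : ℝ, ENNReal.ofReal ((1 + (2 * Real.pi * ξ) ^ 2) ^ m) * ‖G ξ‖ₑ ^ 2) ^ (1 / 2 : ℝ)
      < ENNReal.ofReal E) :
    Integrable G ∧ ∫ ξ, ‖G ξ‖ ≤ 2 * E := by
  set K : ℝ → ℝ≥0∞ := fun ξ => ENNReal.ofReal ((1 + (2 * Real.pi * ξ) ^ 2)⁻¹) with hK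
  set u : ℝ → ℝ≥0∞ := fun ξ => ENNReal.ofReal (1 + (2 * Real.pi * ξ) ^ 2) * ‖G ξ‖ₑ with hu
  have hpos : ∀ ξ : ℝ, 0 < 1 + (2 * Real.pi * ξ) ^ 2 := fun ξ => by positivity
  have hKu : ∀ ξ, K ξ * u ξ = ‖G ξ‖ₑ := fun ξ => by
    rw [hK, hu]
    simp only
    rw [← mul_assoc, ← ENNReal.ofReal_mul (inv_nonneg.2 (hpos ξ).le),
      inv_mul_cancel₀ (hpos ξ).ne', ENNReal.ofReal_one, one_mul]
  have hKm : Measurable K := by fun_prop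
  have hum : AEMeasurable u := AEMeasurable.mul (by fun_prop) hG.enorm
  have hcs := sq_lintegral_mul_le hKm.aemeasurable hum
  have h1 : ∫⁻ ξ, K ξ ≤ ENNReal.ofReal Real.pi := by
    rw [← integral_univ_inv_one_add_sq, ofReal_integral_eq_lintegral_ofReal
      integrable_inv_one_add_sq (ae_of_all _ fun x => by positivity)]
    refine lintegral_mono fun ξ => ENNReal.ofReal_le_ofReal (inv_anti₀ (by positivity) ?_)
    have hpi := Real.pi_gt_three
    have : (1 : ℝ) ≤ (2 * Real.pi) ^ 2 := by nlinarith
    nlinarith [sq_nonneg ξ]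
  have h2 : ∫⁻ ξ, K ξ * u ξ ^ 2 ≤ ENNReal.ofReal (E ^ 2) := by
    have h3 : ∫⁻ ξ, K ξ * u ξ ^ 2
        ≤ ∫⁻ ξ : ℝ, ENNReal.ofReal ((1 + (2 * Real.pi * ξ) ^ 2) ^ m) * ‖G ξ‖ₑ ^ 2 := by
      refine lintegral_mono fun ξ => ?_
      rw [sq, ← mul_assoc, hKu, hu]
      simp only
      rw [mul_left_comm, ← sq]
      gcongr
      exact le_self_pow₀ (by nlinarith [sq_nonneg (2 * Real.pi * ξ)]) (by omega)
    refine h3.trans ?_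
    have h4 := ENNReal.rpow_le_rpow h.le (z := 2) (by norm_num)
    rw [← ENNReal.rpow_mul] at h4
    norm_num at h4
    rwa [ENNReal.ofReal_pow hE]
  simp only [hKu] at hcs
  have h5 : (∫⁻ ξ, ‖G ξ‖ₑ) ^ 2 ≤ ENNReal.ofReal ((2 * E) ^ 2) := by
    refine hcs.trans ((mul_le_mul' h1 h2).trans ?_)
    rw [← ENNReal.ofReal_mul Real.pi_pos.le]
    refine ENNReal.ofReal_le_ofReal ?_
    nlinarith [Real.pi_le_four, sq_nonneg E]
  have h6 : ∫⁻ ξ, ‖G ξ‖ₑ ≤ ENNReal.ofReal (2 * E) := by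
    rw [ENNReal.ofReal_pow (by positivity)] at h5
    exact (ENNReal.pow_le_pow_left_iff two_ne_zero).1 h5
  have hi : Integrable G := ⟨hG, h6.trans_lt ENNReal.ofReal_lt_top⟩
  refine ⟨hi, ?_⟩
  rw [← ofReal_integral_norm_eq_lintegral_enorm hi] at h6
  exact (ENNReal.ofReal_le_ofReal_iff (by positivity)).1 h6

theorem fourierInv_comp_neg (G : ℝ → ℂ) (x : ℝ) : 𝓕⁻ (fun κ => G (-κ)) x = 𝓕⁻ G (-x) := by
  rw [fourierInv_real_eq, fourierInv_real_eq,
    ← integral_neg_eq_self fun κ : ℝ => (Real.fourierChar (κ * -x) : ℂ) * G κ]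
  simp only [neg_mul_neg]

/-- An even function close to zero in `H^m_α` lies in the Wiener algebra after multiplication with
`cosh (αx)`. -/
theorem inWiener_cosh_mul {α E : ℝ} {m : ℕ} (hm : 1 ≤ m) (hE : 0 ≤ E) {f : ℝ → ℝ}
    (hf : Continuous f) (hev : ∀ x, f (-x) = f x)
    (h : weightedSobolevNorm m α (fun x => (f x : ℂ)) < ENNReal.ofReal E) :
    InWiener (fun _ => 1) (fun x => Real.cosh (α * x) * f x) (2 * E) := by
  classical
  rw [weightedSobolevNorm] at h
  split_ifs at h with hmem
  swap
  · exact absurd h (by simp)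
  set F := hmem.toLp (fun x => (f x : ℂ))
  set G : ℝ → ℂ := ⇑(spectralEquiv α F)
  obtain ⟨hG, hGE⟩ := integrable_of_weighted_sq hm hE
    (Lp.stronglyMeasurable (spectralEquiv α F)).aestronglyMeasurable h
  have h1 : weightEquiv α F =ᵐ[volume] 𝓕⁻ G := fourierInv_ae_eq_of_integrable hG
  have h2 : weightEquiv α F =ᵐ[volume] fun x => ((Real.exp (α * x) : ℝ) : ℂ) * f x := by
    refine (weightEquiv_ae_eq F).trans ?_
    filter_upwards [(volume_ac_weightMeasure α).ae_le hmem.coeFn_toLp] with x hx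
    rw [hx]
  have h3 : (fun x => ((Real.exp (α * x) : ℝ) : ℂ) * f x) = 𝓕⁻ G :=
    Continuous.ae_eq_iff_eq volume (by fun_prop) (continuous_fourierInv_of_integrable hG)
      |>.1 (h2.symm.trans h1)
  have h4 : ∀ x, ((Real.exp (α * x) : ℝ) : ℂ) * f x = 𝓕⁻ G x := fun x => congrFun h3 x
  have hneg : ∫ κ, ‖G (-κ)‖ = ∫ κ, ‖G κ‖ := integral_neg_eq_self (fun κ => ‖G κ‖) volume
  have w1 : InWiener (fun _ => 1) (fun x => Real.exp (α * x) * f x) (2 * E) := by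
    refine ⟨G, hG, by simpa using hG.norm, fun x => ?_, by simpa using hGE⟩
    rw [← h4]
    push_cast
    rfl
  -- Reflection of the density, together with evenness of `f`, gives the opposite exponential
  -- weight; the mean of the two is `cosh`.
  have w2 : InWiener (fun _ => 1) (fun x => Real.exp (α * -x) * f x) (2 * E) := by
    refine ⟨fun κ => G (-κ), hG.comp_neg, by simpa using hG.comp_neg.norm, fun x => ?_,
      by simpa [hneg] using hGE⟩
    rw [fourierInv_comp_neg, ← h4, hev]
    push_cast
    rfl
  have w3 := (w1.add isWeight_one w2).const_mul (1 / 2)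
  rw [abs_of_pos (by norm_num)] at w3
  refine (w3.mono (by linarith)).congr fun x => ?_
  rw [Real.cosh_eq, mul_neg]
  ring

/-- Dilation changes the density by an `L¹`-normalized scaling, so its total mass is the same. -/
theorem InWiener.comp_mul_left {g : ℝ → ℝ} {C ε : ℝ} (hε : 0 < ε)
    (h : InWiener (fun _ => 1) g C) : InWiener (fun _ => 1) (fun x => g (ε * x)) C := by
  obtain ⟨φ, h1, h2, h3, h4⟩ := h
  have hi : Integrable fun κ : ℝ => (ε : ℂ)⁻¹ * φ (κ / ε) :=
    (h1.comp_div hε.ne').const_mul _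
  have hn : ∀ κ, ‖(ε : ℂ)⁻¹ * φ (κ / ε)‖ = ε⁻¹ * ‖φ (κ / ε)‖ := fun κ => by
    rw [norm_mul, norm_inv, Complex.norm_real, Real.norm_of_nonneg hε.le]
  refine ⟨fun κ => (ε : ℂ)⁻¹ * φ (κ / ε), hi, by simpa using hi.norm, fun x => ?_, ?_⟩
  · rw [h3, fourierInv_real_eq, fourierInv_real_eq]
    have := Measure.integral_comp_div
      (fun κ : ℝ => (Real.fourierChar (κ * (ε * x)) : ℂ) * φ κ) ε
    rw [abs_of_pos hε] at this
    have h5 : ∀ κ : ℝ, κ / ε * (ε * x) = κ * x := fun κ => by field_simp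
    simp only [h5] at this
    have h6 : ∫ κ : ℝ, (Real.fourierChar (κ * x) : ℂ) * ((ε : ℂ)⁻¹ * φ (κ / ε))
        = (ε : ℂ)⁻¹ * ∫ κ : ℝ, (Real.fourierChar (κ * x) : ℂ) * φ (κ / ε) := by
      rw [← integral_const_mul]
      refine integral_congr_ae (ae_of_all _ fun κ => ?_)
      ring
    rw [h6, this, Complex.real_smul, inv_mul_cancel_left₀ (by exact_mod_cast hε.ne')]
  · simp only [hn, one_mul]
    rw [integral_const_mul, Measure.integral_comp_div (fun κ : ℝ => ‖φ κ‖) ε, abs_of_pos hε,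
      smul_eq_mul, inv_mul_cancel_left₀ hε.ne']
    simpa using h4

/-- Bounds for the scaled profile which depend only on `α`. -/
theorem exists_profile_bounds {α : ℝ} (hα : 0 < α) : ∃ C : ℝ, 1 ≤ C ∧
    ∀ (m : ℕ) (ν ε : ℝ) (θ : ℝ → ℝ), 2 ≤ m → 0 < ν → 0 < ε → ε ≤ 1 →
      IsSolitaryProfile α m ν ε θ → Integrable θ ∧ InWiener (fun _ => 1) θ C ∧
        ∀ x, |θ x - kdvProfile x| ≤ C * ε ^ ν := by
  obtain ⟨C₁, h₁⟩ := exists_inWiener_sech hα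
  obtain ⟨C₂, h₂⟩ := exists_inWiener_kdvProfile
  replace h₁ := h₁.mono_weight isWeight_one.measurable isWeight_one.nonneg isWeight_linWeight.one_le
  replace h₂ := h₂.mono_weight isWeight_one.measurable isWeight_one.nonneg isWeight_linWeight.one_le
  have hC₁ := h₁.nonneg isWeight_one
  have hC₂ := h₂.nonneg isWeight_one
  refine ⟨1 + 2 * C₁ + C₂, by linarith, fun m ν ε θ hm hν hε hε1 hθ => ?_⟩
  have hEν : 0 ≤ ε ^ ν := Real.rpow_nonneg hε.le _
  have hEν1 : ε ^ ν ≤ 1 := Real.rpow_le_one hε.le hε1 hν.le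
  set f : ℝ → ℝ := fun x => θ x - kdvProfile x with hf
  have hfc : Continuous f := hθ.continuous.sub continuous_kdvProfile
  have hfe : ∀ x, f (-x) = f x := fun x => by
    simp only [hf, hθ.even, kdvProfile, mul_neg, neg_div, Real.cosh_neg]
  have w := inWiener_cosh_mul (f := f) (by omega) hEν hfc hfe hθ.close
  -- The factorization `f = sech(αx) · (cosh(αx) f)` removes the weight here and also makes `f`
  -- integrable below.
  have wf : InWiener (fun _ => 1) f (C₁ * (2 * ε ^ ν)) :=
    (h₁.mul isWeight_one w).congr fun x => by
      rw [inv_mul_cancel_left₀ (Real.cosh_pos _).ne']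
  have hθf : ∀ x, f x + kdvProfile x = θ x := fun x => by simp [hf]
  have hfi : Integrable f := by
    refine ((integrable_sech hα.ne').const_mul 2).mono' hfc.aestronglyMeasurable
      (ae_of_all _ fun x => ?_)
    have hc := Real.cosh_pos (α * x)
    have := w.abs_le isWeight_one x
    rw [abs_mul, abs_of_pos hc] at this
    rw [Real.norm_eq_abs, ← div_eq_mul_inv, le_div_iff₀ hc]
    linarith
  refine ⟨?_, ?_, fun x => ?_⟩
  · exact (hfi.add integrable_kdvProfile).congr (ae_of_all _ fun x => hθf x)
  · refine ((wf.add isWeight_one h₂).congr hθf).mono ?_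
    nlinarith
  · refine (wf.abs_le isWeight_one x).trans ?_
    nlinarith

namespace InWiener

variable {v g : ℝ → ℝ} {C : ℝ}

theorem fourier (h : InWiener v g C) (hg : Integrable fun x => (g x : ℂ)) :
    Integrable (𝓕 fun x => (g x : ℂ)) ∧ Integrable (fun κ => v κ * ‖𝓕 (fun x => (g x : ℂ)) κ‖) ∧
      (∀ x, (g x : ℂ) = 𝓕⁻ (𝓕 fun x => (g x : ℂ)) x) ∧
      ∫ κ, v κ * ‖𝓕 (fun x => (g x : ℂ)) κ‖ ≤ C := by
  obtain ⟨φ, h1, h2, h3, h4⟩ := h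
  have h5 := fourier_ae_eq_of_eq_fourierInv hg h1 h3
  have h6 : (fun κ => v κ * ‖𝓕 (fun x => (g x : ℂ)) κ‖) =ᵐ[volume] fun κ => v κ * ‖φ κ‖ := by
    filter_upwards [h5] with κ hκ
    rw [hκ]
  refine ⟨h1.congr h5.symm, h2.congr h6.symm, fun x => ?_, ?_⟩
  · rw [h3, fourierInv_real_eq, fourierInv_real_eq]
    refine integral_congr_ae ?_
    filter_upwards [h5] with κ hκ
    rw [hκ]
  · rwa [integral_congr_ae h6]

end InWiener

/-! ### The steady equation -/

/-- The nonlinear term of the steady equation. -/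
def steadyRhs (γ : ℝ) (ω : ℝ → ℝ) (y : ℝ) : ℝ :=
  (3 / 2 * ω y ^ 2 + ω y ^ 3 - 1 / 2 * iTanhD ω y ^ 2 * (1 - 2 * γ * tanhDOverD ω y))
    / (1 + ω y) ^ 2

theorem measurable_tanh_real : Measurable Real.tanh := by
  simp only [funext Real.tanh_eq_sinh_div_cosh]
  exact Real.measurable_sinh.div Real.measurable_cosh

theorem tanh_div_le_one (k : ℝ) : Real.tanh k / k ≤ 1 := by
  have := tanh_div_le k
  have h0 : 0 ≤ min (k ^ 2) 1 := le_min (by positivity) zero_le_one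
  linarith

namespace InWiener

variable {v ω : ℝ → ℝ} {K γ : ℝ}

theorem iTanhD (hv : IsWeight v) (h : InWiener v ω K) (hi : Integrable fun x => (ω x : ℂ)) :
    InWiener v (iTanhD ω) K := by
  have := h.realMul hv hi (P := fun k => Complex.I * Real.tanh k) (K := 1) (by
    have := measurable_tanh_real
    fun_prop) zero_le_one (fun k => by
      rw [norm_mul, Complex.norm_I, one_mul, Complex.norm_real]
      exact (Real.abs_tanh_lt_one k).le)
  rwa [one_mul] at this

theorem tanhDOverD (hv : IsWeight v) (h : InWiener v ω K) (hi : Integrable fun x => (ω x : ℂ)) :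
    InWiener v (tanhDOverD ω) K := by
  have := h.realMul hv hi (P := fun k => ((Real.tanh k / k : ℝ) : ℂ)) (K := 1) (by
    have := measurable_tanh_real
    fun_prop) zero_le_one (fun k => by
      rw [Complex.norm_real, Real.norm_of_nonneg (tanh_div_nonneg k)]
      exact tanh_div_le_one k)
  rwa [one_mul] at this

/-- Every term of the numerator is at least quadratic, with total norm at most `3 K²`. Division by
`(1 + ω)²` is multiplication by `(1 + e)²` with `e` of norm at most `2 K ≤ 1`, which costs a factor
`1 + 2 + 1`. -/
theorem steadyRhs (hv : IsWeight v) (h : InWiener v ω K) (hi : Integrable fun x => (ω x : ℂ))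
    (hK : K ≤ 1 / 2) (hγ0 : 0 ≤ γ) (hγ1 : γ ≤ 1) : InWiener v (steadyRhs γ ω) (12 * K ^ 2) := by
  have hK0 := h.nonneg hv
  have hτ := h.iTanhD hv hi
  have hη := h.tanhDOverD hv hi
  have hτ2 := hτ.mul hv hτ
  have hω2 := h.mul hv h
  have hω3 := hω2.mul hv h
  have he := h.inv_one_add hv hK
  have b1 := ((hω2.const_mul (3 / 2)).add hv hω3).add hv
    ((hτ2.const_mul (-1 / 2)).add hv ((hτ2.mul hv hη).const_mul γ))
  have b2 : InWiener v (fun y => 3 / 2 * ω y ^ 2 + ω y ^ 3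
      - 1 / 2 * _root_.iTanhD ω y ^ 2 * (1 - 2 * γ * _root_.tanhDOverD ω y)) (3 * K ^ 2) := by
    refine (b1.mono ?_).congr fun x => by ring
    rw [abs_of_nonneg hγ0]
    norm_num
    have : K * K * K ≤ 1 / 2 * (K * K) := by nlinarith [mul_nonneg hK0 hK0]
    have h3 : 0 ≤ K * K * K := by positivity
    nlinarith
  have b3 := b2.mul hv he
  have b4 := b3.mul hv he
  have b5 := (b2.add hv (b3.const_mul 2)).add hv b4
  refine (b5.mono ?_).congr fun x => ?_
  · norm_num
    have h2 : (0 : ℝ) ≤ 3 * K ^ 2 := by positivity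
    have h3 : 3 * K ^ 2 * (2 * K) ≤ 3 * K ^ 2 * 1 := by gcongr; linarith
    have h4 : 3 * K ^ 2 * (2 * K) * (2 * K) ≤ 3 * K ^ 2 * 1 * 1 := by
      gcongr
      all_goals linarith
    linarith
  · have hx : 1 + ω x ≠ 0 := by
      have := _root_.abs_le.1 ((h.abs_le hv x).trans hK)
      intro h0
      linarith [this.1]
    rw [_root_.steadyRhs]
    field_simp
    ring

end InWiener

theorem realMul_eq_zero {P : ℝ → ℂ} {f : ℝ → ℝ} (h : ∀ ξ, 𝓕 (fun y => (f y : ℂ)) ξ = 0) (x : ℝ) :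
    realMul P f x = 0 := by
  rw [realMul]
  simp [h, fourierInv_real_eq]

/-- The integral of a nonintegrable function is zero by convention. If the nonlinear term were not
integrable, its transform would be zero, hence `ω = 0`, and the nonlinear term would vanish after
all. -/
theorem integrable_steadyRhs {γ : ℝ} {ω : ℝ → ℝ} (h : IsSteady γ ω) :
    Integrable fun y => (steadyRhs γ ω y : ℂ) := by
  by_contra hni
  have h0 : ∀ ξ, 𝓕 (fun y => (steadyRhs γ ω y : ℂ)) ξ = 0 := fun ξ => by
    rw [Real.fourier_eq]
    refine integral_undef fun hi => hni ?_
    exact (Real.fourierIntegral_convergent_iff ξ).1 hi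
  have hω : ∀ x, ω x = 0 := fun x => (h x).trans (realMul_eq_zero h0 x)
  have hF : ∀ ξ, 𝓕 (fun y => (ω y : ℂ)) ξ = 0 := fun ξ => by
    simp [hω, Real.fourier_eq]
  refine hni ?_
  have : (fun y => (steadyRhs γ ω y : ℂ)) = fun _ => 0 := by
    funext y
    simp [steadyRhs, hω, iTanhD, realMul_eq_zero hF]
  rw [this]
  exact integrable_zero _ _ _

theorem conj_fourier_neg (f : ℝ → ℝ) (ξ : ℝ) :
    (starRingEnd ℂ) (𝓕 (fun y => (f y : ℂ)) (-ξ)) = 𝓕 (fun y => (f y : ℂ)) ξ := by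
  rw [Real.fourier_real_eq, Real.fourier_real_eq, ← integral_conj]
  refine integral_congr_ae (ae_of_all _ fun x => ?_)
  simp only [Circle.smul_def, smul_eq_mul, map_mul, Complex.conj_ofReal]
  rw [← Circle.coe_inv_eq_conj, ← AddChar.map_neg_eq_inv, mul_neg, neg_neg]

/-- The symbol `(1 - γ tanh k / k)⁻¹`. -/
def dispInv (ε k : ℝ) : ℝ := (1 - gam ε * (Real.tanh k / k))⁻¹

section DispersionBounds

variable {ε k : ℝ}

theorem le_one_sub_gam_mul (hε1 : ε ≤ 1 / 4) (hε : 0 < ε) :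
    ε ^ 2 + min (k ^ 2) 1 / 18 ≤ 1 - gam ε * (Real.tanh k / k) := by
  have h1 := tanh_div_le k
  have h0 : 0 ≤ min (k ^ 2) 1 := le_min (by positivity) zero_le_one
  have h2 : 1 / 2 ≤ gam ε := by rw [gam]; nlinarith
  have h3 := mul_le_mul_of_nonneg_left h1 (by linarith : 0 ≤ gam ε)
  rw [gam] at *
  nlinarith

theorem dispInv_nonneg (hε1 : ε ≤ 1 / 4) (hε : 0 < ε) : 0 ≤ dispInv ε k := by
  have h0 : 0 ≤ min (k ^ 2) 1 := le_min (by positivity) zero_le_one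
  have := le_one_sub_gam_mul (k := k) hε1 hε
  exact inv_nonneg.2 (by nlinarith)

theorem sq_mul_dispInv_le_one (hε1 : ε ≤ 1 / 4) (hε : 0 < ε) : ε ^ 2 * dispInv ε k ≤ 1 := by
  have h0 : 0 ≤ min (k ^ 2) 1 := le_min (by positivity) zero_le_one
  have := le_one_sub_gam_mul (k := k) hε1 hε
  have hp : 0 < ε ^ 2 := by positivity
  rw [dispInv, ← div_eq_mul_inv, div_le_one (by linarith)]
  linarith

/-- The smoothing of the inverse operator at frequencies above `εS`: the factor `18/S²` is the
smallness that closes the moment estimate. -/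
theorem sq_mul_dispInv_le (hε1 : ε ≤ 1 / 4) (hε : 0 < ε) {S : ℝ} (hS : 0 < S) (hεS : ε * S ≤ 1)
    (hk : ε * S ≤ |k|) : ε ^ 2 * dispInv ε k ≤ 18 / S ^ 2 := by
  have h0 : (ε * S) ^ 2 ≤ min (k ^ 2) 1 := by
    refine le_min ?_ (by nlinarith [mul_pos hε hS])
    rw [← sq_abs k]
    exact pow_le_pow_left₀ (mul_pos hε hS).le hk 2
  have := le_one_sub_gam_mul (k := k) hε1 hε
  have hp : 0 < ε ^ 2 := by positivity
  have hq : 0 < (ε * S) ^ 2 := by positivity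
  rw [dispInv, ← div_eq_mul_inv, div_le_div_iff₀ (by linarith) (by positivity)]
  nlinarith

theorem dispInv_neg (k : ℝ) : dispInv ε (-k) = dispInv ε k := by
  rw [dispInv, dispInv, Real.tanh_neg, neg_div_neg_eq]

end DispersionBounds

/-- The real part in `realMul` has no effect: the symbol is real and even and the transform of a
real function is Hermitian, so symmetrization leaves the product unchanged. -/
theorem fourier_eq_of_isSteady {ε C : ℝ} {ω : ℝ → ℝ} (hε : 0 < ε) (hε1 : ε ≤ 1 / 4)
    (h : IsSteady (gam ε) ω) (hi : Integrable fun x => (ω x : ℂ))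
    (hN : InWiener (fun _ => 1) (steadyRhs (gam ε) ω) C) :
    𝓕 (fun x => (ω x : ℂ)) =ᵐ[volume]
      fun ξ => (dispInv ε (2 * Real.pi * ξ) : ℂ) * 𝓕 (fun y => (steadyRhs (gam ε) ω y : ℂ)) ξ := by
  have hNi := integrable_steadyRhs h
  obtain ⟨n1, -, -, -⟩ := hN.fourier hNi
  have hm : Measurable fun ξ : ℝ => (dispInv ε (2 * Real.pi * ξ) : ℂ) := by
    have := measurable_tanh_real
    unfold dispInv
    fun_prop
  have hψ : Integrable fun ξ : ℝ =>
      (dispInv ε (2 * Real.pi * ξ) : ℂ) * 𝓕 (fun y => (steadyRhs (gam ε) ω y : ℂ)) ξ := by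
    refine n1.bdd_mul (c := (ε ^ 2)⁻¹) hm.aestronglyMeasurable (ae_of_all _ fun ξ => ?_)
    rw [Complex.norm_real, Real.norm_of_nonneg (dispInv_nonneg hε1 hε),
      ← one_div, le_div_iff₀' (by positivity)]
    exact sq_mul_dispInv_le_one hε1 hε
  refine fourier_ae_eq_of_eq_fourierInv hi hψ fun x => ?_
  have h1 := h x
  rw [realMul] at h1
  have h2 : (fun ξ : ℝ => (((1 - gam ε * (Real.tanh (2 * Real.pi * ξ) / (2 * Real.pi * ξ)) : ℝ)
      : ℂ))⁻¹ * 𝓕 (fun y => (steadyRhs (gam ε) ω y : ℂ)) ξ) = fun ξ : ℝ =>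
      (dispInv ε (2 * Real.pi * ξ) : ℂ) * 𝓕 (fun y => (steadyRhs (gam ε) ω y : ℂ)) ξ := by
    funext ξ
    rw [dispInv]
    push_cast
    rfl
  have h3 : ω x = (𝓕⁻ (fun ξ : ℝ => (dispInv ε (2 * Real.pi * ξ) : ℂ)
      * 𝓕 (fun y => (steadyRhs (gam ε) ω y : ℂ)) ξ) x).re := by
    rw [← h2]
    exact h1
  rw [h3, fourierInv_symm hψ]
  refine congrArg (fun φ : ℝ → ℂ => 𝓕⁻ φ x) (funext fun ξ => ?_)
  rw [map_mul, Complex.conj_ofReal, conj_fourier_neg, mul_neg, dispInv_neg]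
  ring

/-! ### Moments of the transform of the strain -/

/-- The truncated cubic weight. -/
def cutWeight (ε R κ : ℝ) : ℝ := min (2 * Real.pi * |κ| / ε) R ^ 3

section CutWeight

variable {ε R : ℝ}

theorem freq_nonneg (hε : 0 < ε) (κ : ℝ) : 0 ≤ 2 * Real.pi * |κ| / ε :=
  div_nonneg (mul_nonneg Real.two_pi_pos.le (abs_nonneg _)) hε.le

theorem freq_add_le (hε : 0 < ε) (x y : ℝ) :
    2 * Real.pi * |x + y| / ε ≤ 2 * Real.pi * |x| / ε + 2 * Real.pi * |y| / ε := by
  have := Real.pi_pos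
  rw [← add_div, ← mul_add]
  gcongr
  exact abs_add_le x y

theorem cutWeight_nonneg (hε : 0 < ε) (hR : 0 ≤ R) (κ : ℝ) : 0 ≤ cutWeight ε R κ :=
  pow_nonneg (le_min (freq_nonneg hε κ) hR) 3

theorem cutWeight_le (hε : 0 < ε) (hR : 0 ≤ R) (κ : ℝ) : cutWeight ε R κ ≤ R ^ 3 :=
  pow_le_pow_left₀ (le_min (freq_nonneg hε κ) hR) (min_le_right _ _) 3

theorem measurable_cutWeight : Measurable (cutWeight ε R) := by
  unfold cutWeight
  fun_prop

theorem add_pow_three_le {a b : ℝ} (ha : 0 ≤ a) (hb : 0 ≤ b) :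
    (a + b) ^ 3 ≤ 4 * (a ^ 3 + b ^ 3) := by
  nlinarith [mul_nonneg (add_nonneg ha hb) (sq_nonneg (a - b))]

/-- Truncation preserves subadditivity of `|k|/ε`, and cubing costs a factor `4`, independent of
`R`. -/
theorem cutWeight_add_le (hε : 0 < ε) (hR : 0 ≤ R) (x y : ℝ) :
    cutWeight ε R (x + y) ≤ 4 * (cutWeight ε R x + cutWeight ε R y) := by
  have hx := freq_nonneg hε x
  have hy := freq_nonneg hε y
  have h1 : min (2 * Real.pi * |x + y| / ε) R
      ≤ min (2 * Real.pi * |x| / ε) R + min (2 * Real.pi * |y| / ε) R := by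
    refine (min_le_min_right R (freq_add_le hε x y)).trans ?_
    rcases le_total (2 * Real.pi * |x| / ε) R with h | h <;>
      rcases le_total (2 * Real.pi * |y| / ε) R with h' | h' <;>
      simp only [h, h', min_eq_left, min_eq_right] <;>
      first
        | exact min_le_left _ _
        | exact (min_le_right _ _).trans (by linarith)
  exact (pow_le_pow_left₀ (le_min (freq_nonneg hε _) hR) h1 3).trans
    (add_pow_three_le (le_min hx hR) (le_min hy hR))

/-- The prefactor `4` absorbs the constant of quasi-subadditivity, since `4 (1 + 4 (x + y)) ≤ 16 (1
+ x) (1 + y)` for `x, y ≥ 0`. Thus the algebra property holds for every `δ` and `R`. -/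
theorem isWeight_cutWeight (hε : 0 < ε) (hR : 0 ≤ R) {δ : ℝ} (hδ : 0 ≤ δ) :
    IsWeight fun κ => 4 * (1 + δ * cutWeight ε R κ) where
  measurable := ((measurable_cutWeight.const_mul δ).const_add 1).const_mul 4
  one_le κ := by linarith [mul_nonneg hδ (cutWeight_nonneg hε hR κ)]
  neg κ := by simp only [cutWeight, abs_neg]
  add_le x y := by
    have h1 := mul_le_mul_of_nonneg_left (cutWeight_add_le hε hR x y) hδ
    have h2 := mul_nonneg (mul_nonneg hδ (cutWeight_nonneg hε hR x))
      (mul_nonneg hδ (cutWeight_nonneg hε hR y))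
    nlinarith

theorem cutWeight_mul_dispInv_le (hε : 0 < ε) (hε1 : ε ≤ 1 / 4) (hR : 0 ≤ R) {S : ℝ} (hS : 0 < S)
    (hεS : ε * S ≤ 1) (κ : ℝ) :
    cutWeight ε R κ * (ε ^ 2 * dispInv ε (2 * Real.pi * κ))
      ≤ S ^ 3 + 18 / S ^ 2 * cutWeight ε R κ := by
  have hw := cutWeight_nonneg hε hR κ
  have habs : |2 * Real.pi * κ| = 2 * Real.pi * |κ| := by
    rw [abs_mul, abs_of_pos Real.two_pi_pos]
  rcases le_total (ε * S) (2 * Real.pi * |κ|) with h | h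
  · have := sq_mul_dispInv_le hε1 hε hS hεS (k := 2 * Real.pi * κ) (by rwa [habs])
    have h3 : 0 ≤ S ^ 3 := by positivity
    nlinarith
  · have h1 : cutWeight ε R κ ≤ S ^ 3 := by
      refine pow_le_pow_left₀ (le_min (freq_nonneg hε κ) hR) ((min_le_left _ _).trans ?_) 3
      rw [div_le_iff₀ hε]
      linarith
    have h2 := sq_mul_dispInv_le_one hε1 hε (k := 2 * Real.pi * κ)
    have h3 : 0 ≤ 18 / S ^ 2 * cutWeight ε R κ := by positivity
    have h4 := mul_le_of_le_one_right hw h2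
    linarith

end CutWeight

/-- The moment `I` is finite because of the truncation. It is bounded in terms of itself through the
steady equation: low frequencies contribute a constant, high frequencies at most half of `I`. The
bound does not depend on `R`. -/
theorem integral_cutWeight_le {ε A R : ℝ} {ω : ℝ → ℝ} (hε : 0 < ε) (hε1 : ε ≤ 1 / 4) (hA : 1 ≤ A)
    (hεA : ε * (42 * A) ≤ 1) (hR : 0 ≤ R) (h : IsSteady (gam ε) ω)
    (hi : Integrable fun x => (ω x : ℂ)) (hω : InWiener (fun _ => 1) ω ((A - 1) * ε ^ 2)) :
    ∫ κ, cutWeight ε R κ * ‖𝓕 (fun x => (ω x : ℂ)) κ‖ ≤ 96 * 42 ^ 3 * A ^ 5 * ε ^ 2 := by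
  set u := 𝓕 fun x => (ω x : ℂ) with hu
  obtain ⟨u1, u2, u3, u4⟩ := hω.fourier hi
  rw [← hu] at u1 u2 u3 u4
  have hci : ∀ {f : ℝ → ℂ}, Integrable f → Integrable fun κ => cutWeight ε R κ * ‖f κ‖ :=
    fun {f} hf => hf.norm.bdd_mul (c := R ^ 3) measurable_cutWeight.aestronglyMeasurable
      (ae_of_all _ fun κ => by
        rw [Real.norm_of_nonneg (cutWeight_nonneg hε hR κ)]
        exact cutWeight_le hε hR κ)
  have hεA' : ε * A ≤ 1 / 42 := by linarith
  have hK : 4 * A * ε ^ 2 ≤ 1 / 2 := by nlinarith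
  have hγ0 : 0 ≤ gam ε := by rw [gam]; nlinarith
  have hNi := integrable_steadyRhs h
  have h1K : (A - 1) * ε ^ 2 ≤ 1 / 2 := by nlinarith
  have hFeq := fourier_eq_of_isSteady hε hε1 h hi
    (hω.steadyRhs isWeight_one hi h1K hγ0 (gam_le_one ε))
  set n := 𝓕 fun y => (steadyRhs (gam ε) ω y : ℂ) with hn
  set I := ∫ κ, cutWeight ε R κ * ‖u κ‖ with hI
  have hI0 : 0 ≤ I := integral_nonneg fun κ => mul_nonneg (cutWeight_nonneg hε hR κ) (norm_nonneg _)
  rcases hI0.eq_or_lt with hI0 | hIp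
  · rw [← hI0]
    positivity
  -- This choice makes `δ I = ε²`, so `ω` has norm at most `4 A ε²` in the algebra with weight `4 (1
  -- + δ cutWeight)`, and the quadratic bound for the nonlinearity applies with a constant free of
  -- `I`.
  set δ := ε ^ 2 / I with hδ
  have hδp : 0 < δ := by positivity
  have hδI : δ * I = ε ^ 2 := div_mul_cancel₀ _ hIp.ne'
  have hv := isWeight_cutWeight hε hR hδp.le
  have hexp : ∀ f : ℝ → ℂ, (fun κ => 4 * (1 + δ * cutWeight ε R κ) * ‖f κ‖)
      = fun κ => 4 * ‖f κ‖ + 4 * δ * (cutWeight ε R κ * ‖f κ‖) := fun f => by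
    funext κ
    ring
  have hωv : InWiener (fun κ => 4 * (1 + δ * cutWeight ε R κ)) ω (4 * A * ε ^ 2) := by
    refine ⟨u, u1, ?_, u3, ?_⟩
    · rw [hexp]
      exact (u1.norm.const_mul 4).add ((hci u1).const_mul _)
    · rw [hexp, integral_add (u1.norm.const_mul 4) ((hci u1).const_mul _), integral_const_mul,
        integral_const_mul, ← hI]
      simp only [one_mul] at u4
      nlinarith
  obtain ⟨n1, -, -, n4⟩ := (hωv.steadyRhs hv hi hK hγ0 (gam_le_one ε)).fourier hNi
  rw [← hn] at n1 n4
  rw [hexp, integral_add (n1.norm.const_mul 4) ((hci n1).const_mul _), integral_const_mul,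
    integral_const_mul] at n4
  set a := ∫ κ, ‖n κ‖ with ha
  set b := ∫ κ, cutWeight ε R κ * ‖n κ‖ with hb
  have ha0 : 0 ≤ a := integral_nonneg fun κ => norm_nonneg _
  have hb0 : 0 ≤ b := integral_nonneg fun κ => mul_nonneg (cutWeight_nonneg hε hR κ) (norm_nonneg _)
  -- The constant is chosen so that `18 · 48 / 42² < 1/2`, which allows the high-frequency part to
  -- be absorbed.
  set S := 42 * A with hS
  have hSp : 0 < S := by positivity
  have hmain : ε ^ 2 * I ≤ S ^ 3 * a + 18 / S ^ 2 * b := by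
    rw [hI, ha, hb, ← integral_const_mul, ← integral_const_mul, ← integral_const_mul,
      ← integral_add (n1.norm.const_mul _) ((hci n1).const_mul _)]
    refine integral_mono_ae ((hci u1).const_mul _)
      ((n1.norm.const_mul _).add ((hci n1).const_mul _)) ?_
    filter_upwards [hFeq] with κ hκ
    change u κ = _ at hκ
    rw [hκ, norm_mul, Complex.norm_real, Real.norm_of_nonneg (dispInv_nonneg hε1 hε)]
    have := mul_le_mul_of_nonneg_right
      (cutWeight_mul_dispInv_le hε hε1 hR hSp hεA κ) (norm_nonneg (n κ))
    linarith
  have e1 : a ≤ 48 * A ^ 2 * ε ^ 4 := by nlinarith [mul_nonneg hδp.le hb0]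
  have e2 : δ * b ≤ 48 * A ^ 2 * ε ^ 4 := by nlinarith
  have e3 : ε ^ 2 * b ≤ 48 * A ^ 2 * ε ^ 4 * I := by
    rw [← hδI]
    nlinarith
  have e3' : b ≤ 48 * A ^ 2 * ε ^ 2 * I := by
    have : 0 < ε ^ 2 := by positivity
    refine le_of_mul_le_mul_left (e3.trans (le_of_eq ?_)) this
    ring
  have e4 : 18 / S ^ 2 * b ≤ 1 / 2 * (ε ^ 2 * I) := by
    rw [div_mul_eq_mul_div, div_le_iff₀ (by positivity), hS]
    have : 0 ≤ A ^ 2 * ε ^ 2 * I := by positivity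
    nlinarith
  have e5 : S ^ 3 * a ≤ S ^ 3 * (48 * A ^ 2 * ε ^ 4) := by gcongr
  have e6 : ε ^ 2 * I ≤ ε ^ 2 * (96 * 42 ^ 3 * A ^ 5 * ε ^ 2) := by
    have : S ^ 3 * (48 * A ^ 2 * ε ^ 4) = 48 * 42 ^ 3 * A ^ 5 * ε ^ 4 := by rw [hS]; ring
    nlinarith
  exact le_of_mul_le_mul_left e6 (by positivity)

/-- The polynomial weights `(1 + |k|/ε)ʲ`. -/
def polyWeight (ε : ℝ) (j : ℕ) (κ : ℝ) : ℝ := (1 + 2 * Real.pi * |κ| / ε) ^ j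

theorem isWeight_polyWeight {ε : ℝ} (hε : 0 < ε) (j : ℕ) : IsWeight (polyWeight ε j) where
  measurable := by
    unfold polyWeight
    fun_prop
  one_le κ := one_le_pow₀ (by linarith [freq_nonneg hε κ])
  neg κ := by simp only [polyWeight, abs_neg]
  add_le x y := by
    rw [polyWeight, polyWeight, polyWeight, ← mul_pow]
    have hx := freq_nonneg hε x
    have hy := freq_nonneg hε y
    refine pow_le_pow_left₀ (by linarith [freq_nonneg hε (x + y)]) ?_ j
    nlinarith [freq_add_le hε x y, mul_nonneg hx hy]

/-- The truncation is removed by monotone convergence along integer `R`. -/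
theorem inWiener_strain_of_isSteady {ε A : ℝ} {ω : ℝ → ℝ} (hε : 0 < ε) (hε1 : ε ≤ 1 / 4)
    (hA : 1 ≤ A) (hεA : ε * (42 * A) ≤ 1) (h : IsSteady (gam ε) ω)
    (hi : Integrable fun x => (ω x : ℂ)) (hω : InWiener (fun _ => 1) ω ((A - 1) * ε ^ 2)) :
    InWiener (polyWeight ε 3) ω (4 * (A + 96 * 42 ^ 3 * A ^ 5) * ε ^ 2) := by
  obtain ⟨u1, -, u3, u4⟩ := hω.fourier hi
  have hb : ∀ n : ℕ, _ := fun n => integral_cutWeight_le hε hε1 hA hεA (R := n) n.cast_nonneg h hi hω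
  set u := 𝓕 fun x => (ω x : ℂ) with hu
  have huc : Continuous u := continuous_fourier_of_integrable hi
  set s : ℝ → ℝ := fun κ => 2 * Real.pi * |κ| / ε with hs
  have hs0 : ∀ κ, 0 ≤ s κ := freq_nonneg hε
  have hsm : Measurable s := by fun_prop
  set B := 96 * 42 ^ 3 * A ^ 5 * ε ^ 2 with hB
  have hlim := lintegral_tendsto_of_tendsto_of_monotone (μ := volume)
    (f := fun (n : ℕ) κ => ENNReal.ofReal (cutWeight ε n κ * ‖u κ‖))
    (F := fun κ => ENNReal.ofReal (s κ ^ 3 * ‖u κ‖))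
    (fun n => by
      have := measurable_cutWeight (ε := ε) (R := n)
      have := huc.measurable
      fun_prop)
    (ae_of_all _ fun κ i j hij => by
      refine ENNReal.ofReal_le_ofReal (mul_le_mul_of_nonneg_right ?_ (norm_nonneg _))
      refine pow_le_pow_left₀ (le_min (hs0 κ) i.cast_nonneg) (min_le_min_left _ ?_) 3
      exact_mod_cast hij)
    (ae_of_all _ fun κ => by
      obtain ⟨N, hN⟩ := exists_nat_ge (s κ)
      refine tendsto_atTop_of_eventually_const (i₀ := N) fun n hn => ?_
      have : s κ ≤ n := hN.trans (by exact_mod_cast hn)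
      rw [cutWeight, min_eq_left this])
  have hle : ∫⁻ κ, ENNReal.ofReal (s κ ^ 3 * ‖u κ‖) ≤ ENNReal.ofReal B := by
    refine le_of_tendsto' hlim fun n => ?_
    have hci : Integrable fun κ => cutWeight ε n κ * ‖u κ‖ :=
      u1.norm.bdd_mul (c := (n : ℝ) ^ 3) measurable_cutWeight.aestronglyMeasurable
        (ae_of_all _ fun κ => by
          rw [Real.norm_of_nonneg (cutWeight_nonneg hε n.cast_nonneg κ)]
          exact cutWeight_le hε n.cast_nonneg κ)
    rw [← ofReal_integral_eq_lintegral_ofReal hci (ae_of_all _ fun κ =>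
      mul_nonneg (cutWeight_nonneg hε n.cast_nonneg κ) (norm_nonneg _))]
    exact ENNReal.ofReal_le_ofReal (hb n)
  have hsi : Integrable fun κ => s κ ^ 3 * ‖u κ‖ := by
    refine ⟨?_, ?_⟩
    · have := huc.measurable
      exact (by fun_prop : Measurable fun κ => s κ ^ 3 * ‖u κ‖).aestronglyMeasurable
    · rw [hasFiniteIntegral_iff_ofReal (ae_of_all _ fun κ =>
        mul_nonneg (pow_nonneg (hs0 κ) 3) (norm_nonneg _))]
      exact hle.trans_lt ENNReal.ofReal_lt_top
  have hB0 : 0 ≤ B := by positivity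
  have hint : ∫ κ, s κ ^ 3 * ‖u κ‖ ≤ B := by
    rw [← ofReal_integral_eq_lintegral_ofReal hsi (ae_of_all _ fun κ =>
      mul_nonneg (pow_nonneg (hs0 κ) 3) (norm_nonneg _))] at hle
    exact (ENNReal.ofReal_le_ofReal_iff hB0).1 hle
  have hsum : Integrable fun κ => 4 * (‖u κ‖ + s κ ^ 3 * ‖u κ‖) := (u1.norm.add hsi).const_mul 4
  have hple : ∀ κ, polyWeight ε 3 κ * ‖u κ‖ ≤ 4 * (‖u κ‖ + s κ ^ 3 * ‖u κ‖) := fun κ => by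
    have := mul_le_mul_of_nonneg_right (add_pow_three_le zero_le_one (hs0 κ)) (norm_nonneg (u κ))
    rw [polyWeight]
    change (1 + s κ) ^ 3 * ‖u κ‖ ≤ _
    linarith
  have hpi : Integrable fun κ => polyWeight ε 3 κ * ‖u κ‖ := by
    refine hsum.mono' ((isWeight_polyWeight hε 3).measurable.aestronglyMeasurable.mul u1.1.norm)
      (ae_of_all _ fun κ => ?_)
    rw [Real.norm_of_nonneg (mul_nonneg ((isWeight_polyWeight hε 3).nonneg κ) (norm_nonneg _))]
    exact hple κ
  refine ⟨u, u1, hpi, u3, (integral_mono hpi hsum hple).trans ?_⟩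
  rw [integral_const_mul, integral_add u1.norm hsi]
  simp only [one_mul] at u4
  have : 0 ≤ ε ^ 2 := by positivity
  nlinarith

theorem polyWeight_mono {ε : ℝ} (hε : 0 < ε) {i j : ℕ} (hij : i ≤ j) (κ : ℝ) :
    polyWeight ε i κ ≤ polyWeight ε j κ :=
  pow_le_pow_right₀ (by linarith [freq_nonneg hε κ]) hij

theorem freq_mul_polyWeight_le {ε : ℝ} (hε : 0 < ε) (j : ℕ) (κ : ℝ) :
    2 * Real.pi * |κ| * polyWeight ε j κ ≤ ε * polyWeight ε (j + 1) κ := by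
  have h0 := (isWeight_polyWeight hε j).nonneg κ
  have h1 : ε * (2 * Real.pi * |κ| / ε) = 2 * Real.pi * |κ| := mul_div_cancel₀ _ hε.ne'
  have h2 : polyWeight ε (j + 1) κ = polyWeight ε j κ * (1 + 2 * Real.pi * |κ| / ε) := by
    rw [polyWeight, pow_succ, polyWeight]
  rw [h2]
  nlinarith

theorem InWiener.poly_mono {ε C : ℝ} {g : ℝ → ℝ} (hε : 0 < ε) {i j : ℕ}
    (h : InWiener (polyWeight ε j) g C) (hij : i ≤ j) : InWiener (polyWeight ε i) g C :=
  h.mono_weight (isWeight_polyWeight hε i).measurable (isWeight_polyWeight hε i).nonneg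
    (polyWeight_mono hε hij)

/-! ### Expansion of the coefficients in powers of the strain. -/

/-- Smallness and regularity of the coefficients. -/
structure CoefBounds (ε C : ℝ) (ω : ℝ → ℝ) : Prop where
  p_wiener : InWiener (polyWeight ε 2) (fun x => pCoef ω x - 1) (C * ε ^ 2)
  q_wiener : InWiener (polyWeight ε 2) (fun x => qCoef (gam ε) ω x - 1) (C * ε ^ 2)
  sqrt_p_wiener : InWiener (polyWeight ε 2) (fun x => Real.sqrt (pCoef ω x) - 1) (C * ε ^ 2)
  rho_wiener : InWiener (polyWeight ε 2) (fun x => rhoCoef (gam ε) ω x - 1) (C * ε ^ 2)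
  rOne_continuous : Continuous fun x =>
    deriv (qCoef (gam ε) ω) x * pCoef ω x * (qCoef (gam ε) ω x)⁻¹
  rOne_le : ∀ x, |deriv (qCoef (gam ε) ω) x * pCoef ω x * (qCoef (gam ε) ω x)⁻¹| ≤ C * ε ^ 3
  rOne_sub_le : ∀ x, |deriv (qCoef (gam ε) ω) x * pCoef ω x * (qCoef (gam ε) ω x)⁻¹
    - deriv (qCoef (gam ε) ω) x| ≤ C * ε ^ 5
  main_le : ∀ x, |(pCoef ω x - 1) - (qCoef (gam ε) ω x - 1) + 3 / 2 * ω x| ≤ C * ε ^ 3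

section Coefficients

variable {ε κ : ℝ} {ω : ℝ → ℝ}

/-- As `1 - u₁ = (1 + ω)/((1 + ω)² + τ²)`, the factor `1 + ω` cancels. The form `(1 + d)⁻¹` suits
the functional calculus of the algebra. -/
theorem pCoef_eq (h1 : ∀ x, |ω x| ≤ 1 / 2) (x : ℝ) :
    pCoef ω x = (1 + (2 * ω x + ω x * ω x + iTanhD ω x * iTanhD ω x))⁻¹ := by
  have hx := abs_le.1 (h1 x)
  have h2 : 0 < 1 + ω x := by linarith
  have h3 : 0 < (1 + ω x) ^ 2 + iTanhD ω x ^ 2 := by positivity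
  have h4 : 1 + (2 * ω x + ω x * ω x + iTanhD ω x * iTanhD ω x)
      = (1 + ω x) ^ 2 + iTanhD ω x ^ 2 := by ring
  rw [pCoef, uOne, h4]
  field_simp
  ring

theorem vSurf_eq (h1 : ∀ x, |ω x| ≤ 1 / 2) (x : ℝ) :
    vSurf ω x = -(iTanhD ω x + iTanhD ω x * (pCoef ω x - 1)) := by
  rw [pCoef_eq h1, vSurf]
  have h4 : 1 + (2 * ω x + ω x * ω x + iTanhD ω x * iTanhD ω x)
      = (1 + ω x) ^ 2 + iTanhD ω x ^ 2 := by ring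
  rw [h4]
  ring

theorem vOne_eq (γ : ℝ) (h1 : ∀ x, |ω x| ≤ 1 / 2) (x : ℝ) :
    vOne γ ω x = γ⁻¹ * (deriv (vSurf ω) x + (pCoef ω x - 1) * deriv (vSurf ω) x) := by
  have hx := abs_le.1 (h1 x)
  have h2 : 1 + ω x ≠ 0 := by linarith
  rw [vOne, pCoef]
  field_simp
  ring

/-- The derivative in `v₁` uses up one of the three powers of the weight and contributes a factor
`ε`. Hence `v₁` is of higher order than the strain. -/
theorem coef_wiener (hε : 0 < ε) (hε1 : ε ≤ 1 / 4) (hκ : κ ≤ 1 / 100)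
    (hi : Integrable fun x => (ω x : ℂ)) (h : InWiener (polyWeight ε 3) ω κ) :
    InWiener (polyWeight ε 3) (fun x => pCoef ω x - 1) (6 * κ) ∧
    InWiener (polyWeight ε 2) (vOne (gam ε) ω) (6 * κ * ε) ∧
    InWiener (polyWeight ε 2) (fun x => (1 - vOne (gam ε) ω x) / (1 + ω x) - 1) (4 * κ) := by
  have v3 := isWeight_polyWeight hε 3
  have v2 := isWeight_polyWeight hε 2
  have hκ0 := h.nonneg v3
  have hω1 : ∀ x, |ω x| ≤ 1 / 2 := fun x => (h.abs_le v3 x).trans (by linarith)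
  have hτ := h.iTanhD v3 hi
  have hd := ((h.const_mul 2).add v3 (h.mul v3 h)).add v3 (hτ.mul v3 hτ)
  have hp : InWiener (polyWeight ε 3) (fun x => pCoef ω x - 1) (6 * κ) := by
    have hd' := hd.mono (C' := 3 * κ) (by
      rw [abs_of_pos two_pos]
      nlinarith)
    exact ((hd'.inv_one_add v3 (by linarith)).mono (by linarith)).congr fun x => by
      rw [pCoef_eq hω1]
  have hvs : InWiener (polyWeight ε 3) (vSurf ω) (2 * κ) :=
    ((hτ.add v3 (hτ.mul v3 hp)).neg.mono (by nlinarith)).congr fun x => (vSurf_eq hω1 x).symm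
  obtain ⟨-, hdv⟩ := hvs.deriv v2 hε.le (freq_mul_polyWeight_le hε 2)
  have hp2 := hp.poly_mono hε (i := 2) (by norm_num)
  have hγ : 1 / 2 ≤ gam ε := by rw [gam]; nlinarith
  have hγi : |(gam ε)⁻¹| ≤ 2 := by
    rw [abs_of_pos (inv_pos.2 (by linarith)), inv_le_comm₀ (by linarith) two_pos]
    linarith
  have hv1 : InWiener (polyWeight ε 2) (vOne (gam ε) ω) (6 * κ * ε) := by
    refine (((hdv.add v2 (hp2.mul v2 hdv)).const_mul (gam ε)⁻¹).mono ?_).congr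
      fun x => (vOne_eq _ hω1 x).symm
    have h0 : 0 ≤ ε * (2 * κ) + 6 * κ * (ε * (2 * κ)) := by positivity
    refine (mul_le_mul_of_nonneg_right hγi h0).trans ?_
    have : 0 ≤ κ * ε := by positivity
    nlinarith
  refine ⟨hp, hv1, ?_⟩
  have hf := (h.poly_mono hε (i := 2) (by norm_num)).inv_one_add v2 (by linarith)
  refine (((hf.sub v2 hv1).sub v2 (hv1.mul v2 hf)).mono ?_).congr fun x => ?_
  · have h0 : 0 ≤ κ * ε := by positivity
    have : κ * ε ≤ κ * (1 / 4) := by gcongr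
    nlinarith
  · have hx := abs_le.1 (hω1 x)
    have h2 : 1 + ω x ≠ 0 := by linarith
    field_simp
    ring

/-- From `p (1 + d) = 1` follows `p - 1 + 2 w = -w² - t² - d (p - 1)`, a sum of quadratic terms. -/
theorem p_taylor_le {w t d p k : ℝ} (hw : |w| ≤ k) (ht : |t| ≤ k) (hd : d = 2 * w + w * w + t * t)
    (hp : p * (1 + d) = 1) (hp1 : |p - 1| ≤ 6 * k) (hk : k ≤ 1 / 100) :
    |p - 1 + 2 * w| ≤ 20 * k ^ 2 := by
  have hk0 : 0 ≤ k := (abs_nonneg w).trans hw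
  have hw2 : |w * w| ≤ k * k := by rw [abs_mul]; gcongr
  have ht2 : |t * t| ≤ k * k := by rw [abs_mul]; gcongr
  have hdk : |d| ≤ 3 * k := by
    rw [hd]
    have h1 := abs_add_le (2 * w + w * w) (t * t)
    have h2 := abs_add_le (2 * w) (w * w)
    rw [abs_mul 2 w, abs_of_pos (two_pos (α := ℝ))] at h2
    nlinarith
  have e : p - 1 + 2 * w = -(w * w) - t * t - d * (p - 1) := by rw [hd] at hp ⊢; linarith
  have h3 : |d * (p - 1)| ≤ 3 * k * (6 * k) := by rw [abs_mul]; gcongr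
  rw [e]
  have h4 := abs_sub (-(w * w) - t * t) (d * (p - 1))
  have h5 := abs_sub (-(w * w)) (t * t)
  rw [abs_neg] at h5
  nlinarith

/-- Since `q² = 1 + g`, the error is `(g + w)/2 - (q - 1)²/2` with `g + w = (w² - v)/(1 + w)`. It is
quadratic except for the contribution of `v₁`. -/
theorem q_taylor_le {w v g q k e : ℝ} (hw : |w| ≤ k) (hv : |v| ≤ 6 * k * e)
    (hg : g = (1 - v) / (1 + w) - 1) (hq : q ^ 2 = 1 + g)
    (hq1 : |q - 1| ≤ 8 * k) (hk : k ≤ 1 / 100) (he : 0 ≤ e) :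
    |q - 1 + w / 2| ≤ 33 * k ^ 2 + 6 * k * e := by
  have hk0 : 0 ≤ k := (abs_nonneg w).trans hw
  have hw' := abs_le.1 hw
  have hq' := abs_le.1 hq1
  have h1w : 1 / 2 ≤ 1 + w := by linarith [hw'.1]
  have e1 : q - 1 + w / 2 = (g + w) / 2 - (q - 1) ^ 2 / 2 := by
    have : g = q ^ 2 - 1 := by linarith
    rw [this]
    ring
  have e2 : g + w = (w ^ 2 - v) / (1 + w) := by
    rw [hg]
    field_simp
    ring
  have e3 : |g + w| ≤ 2 * (k ^ 2 + 6 * k * e) := by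
    rw [e2, abs_div, abs_of_pos (by linarith : 0 < 1 + w), div_le_iff₀ (by linarith)]
    have h2 : |w ^ 2| ≤ k ^ 2 := by rw [abs_pow]; gcongr
    have h3 := abs_sub (w ^ 2) v
    have h4 : 0 ≤ k ^ 2 + 6 * k * e := by positivity
    nlinarith
  have e4 : |(q - 1) ^ 2| ≤ (8 * k) ^ 2 := by rw [abs_pow]; gcongr
  rw [e1]
  have h5 := abs_sub ((g + w) / 2) ((q - 1) ^ 2 / 2)
  rw [abs_div, abs_div, abs_of_pos (two_pos (α := ℝ))] at h5
  nlinarith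

theorem coefBounds {K : ℝ} (hε : 0 < ε) (hε1 : ε ≤ 1 / 4) (hK : 1 ≤ K) (hκ : K * ε ^ 2 ≤ 1 / 100)
    (hi : Integrable fun x => (ω x : ℂ)) (h : InWiener (polyWeight ε 3) ω (K * ε ^ 2)) :
    CoefBounds ε (400 * K ^ 2) ω := by
  obtain ⟨hp, hv, hg⟩ := coef_wiener hε hε1 hκ hi h
  have v3 := isWeight_polyWeight hε 3
  have v2 := isWeight_polyWeight hε 2
  have v1 := isWeight_polyWeight hε 1
  have hκ0 := h.nonneg v3
  set k := K * ε ^ 2 with hk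
  have hkC : 16 * k ≤ 400 * K ^ 2 * ε ^ 2 := by
    have : K * ε ^ 2 ≤ K ^ 2 * ε ^ 2 := by gcongr; nlinarith
    nlinarith [mul_nonneg (sq_nonneg K) (sq_nonneg ε)]
  have hk2 : k ^ 2 ≤ K ^ 2 * ε ^ 3 := by
    have : ε ^ 4 ≤ ε ^ 3 := pow_le_pow_of_le_one hε.le (by linarith) (by norm_num)
    calc k ^ 2 = K ^ 2 * ε ^ 4 := by rw [hk]; ring
      _ ≤ _ := by gcongr
  have hkε : k * ε ≤ K ^ 2 * ε ^ 3 := by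
    calc k * ε = K * ε ^ 3 := by rw [hk]; ring
      _ ≤ _ := by gcongr; nlinarith
  have hp2 := hp.poly_mono hε (i := 2) (by norm_num)
  have hq : InWiener (polyWeight ε 2) (fun x => qCoef (gam ε) ω x - 1) (8 * k) :=
    ((hg.sqrt_one_add v2 (by linarith)).mono (by linarith)).congr fun x => by
      rw [qCoef, add_sub_cancel]
  have hsp : InWiener (polyWeight ε 2) (fun x => Real.sqrt (pCoef ω x) - 1) (12 * k) :=
    ((hp2.sqrt_one_add v2 (by linarith)).mono (by linarith)).congr fun x => by
      rw [add_sub_cancel]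
  have hρ : InWiener (polyWeight ε 2) (fun x => rhoCoef (gam ε) ω x - 1) (16 * k) :=
    ((hq.sqrt_one_add v2 (by linarith)).mono (by linarith)).congr fun x => by
      rw [rhoCoef, add_sub_cancel]
  obtain ⟨hqd, hq'⟩ := hq.deriv v1 hε.le (freq_mul_polyWeight_le hε 1)
  have hder : deriv (fun x => qCoef (gam ε) ω x - 1) = deriv (qCoef (gam ε) ω) := by
    funext x
    exact deriv_sub_const _
  rw [hder] at hq'
  have bω := h.abs_le v3
  have bτ := (h.iTanhD v3 hi).abs_le v3
  have bp := hp.abs_le v3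
  have bq := hq.abs_le v2
  have bq' := hq'.abs_le v1
  have bv := hv.abs_le v2
  have bg := hg.abs_le v2
  have hω1 : ∀ x, |ω x| ≤ 1 / 2 := fun x => (bω x).trans (by linarith)
  have hqpos : ∀ x, 1 / 2 ≤ qCoef (gam ε) ω x := fun x => by
    have := (abs_le.1 (bq x)).1
    linarith
  have hqc : Continuous (qCoef (gam ε) ω) := by
    refine (hq.continuous.add (continuous_const (y := (1 : ℝ)))).congr fun x => ?_
    exact sub_add_cancel _ _
  have hpc : Continuous (pCoef ω) := by
    refine (hp.continuous.add (continuous_const (y := (1 : ℝ)))).congr fun x => ?_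
    exact sub_add_cancel _ _
  -- The difference `R₁ - q'` equals `q' (p - q)/q`, a factor of order `ε³` times one of order `ε²`.
  have hsub : ∀ x, |deriv (qCoef (gam ε) ω) x * pCoef ω x * (qCoef (gam ε) ω x)⁻¹
      - deriv (qCoef (gam ε) ω) x| ≤ 224 * k ^ 2 * ε := fun x => by
    have hqx := hqpos x
    have e : deriv (qCoef (gam ε) ω) x * pCoef ω x * (qCoef (gam ε) ω x)⁻¹
        - deriv (qCoef (gam ε) ω) x
        = deriv (qCoef (gam ε) ω) x * ((pCoef ω x - 1) - (qCoef (gam ε) ω x - 1))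
          / qCoef (gam ε) ω x := by
      field_simp
      ring
    have h1 := abs_sub (pCoef ω x - 1) (qCoef (gam ε) ω x - 1)
    have h2 : |(pCoef ω x - 1) - (qCoef (gam ε) ω x - 1)| ≤ 14 * k := by
      linarith [bp x, bq x]
    rw [e, abs_div, abs_mul, abs_of_pos (by linarith : 0 < qCoef (gam ε) ω x),
      div_le_iff₀ (by linarith)]
    have h3 : |deriv (qCoef (gam ε) ω) x| * |(pCoef ω x - 1) - (qCoef (gam ε) ω x - 1)|
        ≤ ε * (8 * k) * (14 * k) := mul_le_mul (bq' x) h2 (abs_nonneg _) (by positivity)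
    have h4 : 0 ≤ k ^ 2 * ε := by positivity
    nlinarith
  refine ⟨hp2.mono (by linarith), hq.mono (by linarith), hsp.mono (by linarith), hρ.mono hkC,
    ?_, fun x => ?_, fun x => ?_, fun x => ?_⟩
  · exact (hq'.continuous.mul hpc).mul (hqc.inv₀ fun x => by linarith [hqpos x])
  · have h1 := hsub x
    have h2 := bq' x
    have h3 := abs_add_le (deriv (qCoef (gam ε) ω) x * pCoef ω x * (qCoef (gam ε) ω x)⁻¹
      - deriv (qCoef (gam ε) ω) x) (deriv (qCoef (gam ε) ω) x)
    rw [sub_add_cancel] at h3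
    have h4 : k ^ 2 * ε ≤ 1 / 100 * (k * ε) := by
      have : 0 ≤ k * ε := by positivity
      nlinarith
    nlinarith
  · refine (hsub x).trans ?_
    have : k ^ 2 * ε = K ^ 2 * ε ^ 5 := by rw [hk]; ring
    have h0 : 0 ≤ K ^ 2 * ε ^ 5 := by positivity
    linarith
  · have hωx := abs_le.1 (hω1 x)
    have hD : 0 < 1 + (2 * ω x + ω x * ω x + iTanhD ω x * iTanhD ω x) := by
      nlinarith [mul_self_nonneg (iTanhD ω x)]
    have t1 := p_taylor_le (bω x) (bτ x) rfl (p := pCoef ω x)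
      (by rw [pCoef_eq hω1, inv_mul_cancel₀ hD.ne']) (bp x) hκ
    have hg0 : 0 ≤ (1 - vOne (gam ε) ω x) / (1 + ω x) := by
      have := (abs_le.1 (bg x)).1
      linarith
    have t2 := q_taylor_le (bω x) (bv x) rfl (q := qCoef (gam ε) ω x)
      (by rw [qCoef, Real.sq_sqrt hg0, add_sub_cancel]) (bq x) hκ hε.le
    -- The KdV coefficient arises as `-3/2 = -2 + 1/2` from `p ≈ 1 - 2 ω` and `q ≈ 1 - ω/2`.
    have e : (pCoef ω x - 1) - (qCoef (gam ε) ω x - 1) + 3 / 2 * ω x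
        = (pCoef ω x - 1 + 2 * ω x) - (qCoef (gam ε) ω x - 1 + ω x / 2) := by ring
    rw [e]
    have h1 := abs_sub (pCoef ω x - 1 + 2 * ω x) (qCoef (gam ε) ω x - 1 + ω x / 2)
    have h0 : 0 ≤ K ^ 2 * ε ^ 3 := by positivity
    nlinarith

/-- The coefficient bounds hold for small `ε`, with a constant which depends only on `α`. -/
theorem exists_coefBounds {α : ℝ} (hα : 0 < α) : ∃ C ε₀ : ℝ, 1 ≤ C ∧ 0 < ε₀ ∧
    ∀ (m : ℕ) (ν ε : ℝ) (θ : ℝ → ℝ), 2 ≤ m → 0 < ν → 0 < ε → ε < ε₀ →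
      IsSolitaryProfile α m ν ε θ → CoefBounds ε C (strain ε θ) ∧ Continuous θ ∧
        (∀ x, |θ x - kdvProfile x| ≤ C * ε ^ ν) ∧ ∀ x, |θ x| ≤ C := by
  obtain ⟨c, hc1, hc⟩ := exists_profile_bounds hα
  set A := c + 1 with hA
  set K := 4 * (A + 96 * 42 ^ 3 * A ^ 5) with hK
  have hA1 : 1 ≤ A := by linarith
  have hKA : 4 * A ≤ K := by
    have : 0 ≤ A ^ 5 := by positivity
    linarith
  refine ⟨400 * K ^ 2, min (1 / 4) (min (1 / (42 * A)) (1 / (100 * K))), by nlinarith,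
    lt_min (by norm_num) (lt_min (by positivity) (by positivity)),
    fun m ν ε θ hm hν hε hεlt hθ => ?_⟩
  have hε1 : ε ≤ 1 / 4 := hεlt.le.trans (min_le_left _ _)
  have hεA : ε * (42 * A) ≤ 1 := by
    rw [← le_div_iff₀ (by positivity)]
    exact hεlt.le.trans ((min_le_right _ _).trans (min_le_left _ _))
  have hεK : ε * (100 * K) ≤ 1 := by
    rw [← le_div_iff₀ (by positivity)]
    exact hεlt.le.trans ((min_le_right _ _).trans (min_le_right _ _))
  obtain ⟨hi, hw, hd⟩ := hc m ν ε θ hm hν hε (by linarith) hθ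
  have hsi : Integrable fun x => (strain ε θ x : ℂ) := by
    have := ((hi.comp_mul_left' hε.ne').const_mul (ε ^ 2)).ofReal (𝕜 := ℂ)
    exact this
  have hsw : InWiener (fun _ => 1) (strain ε θ) ((A - 1) * ε ^ 2) := by
    have := (hw.comp_mul_left hε).const_mul (ε ^ 2)
    rw [abs_of_pos (by positivity)] at this
    exact this.mono (by rw [hA]; linarith)
  have hω := inWiener_strain_of_isSteady hε hε1 hA1 hεA hθ.steady hsi hsw
  have hcK : c ≤ 400 * K ^ 2 := by nlinarith
  refine ⟨coefBounds hε hε1 (by linarith) ?_ hsi hω, hθ.continuous, fun x => (hd x).trans ?_,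
    fun x => (hw.abs_le isWeight_one x).trans hcK⟩
  · have : 0 < K := by linarith
    nlinarith [mul_pos this hε]
  · have := Real.rpow_nonneg hε.le ν
    gcongr

end Coefficients

/-! ### Fourier multipliers and their resolvents -/

section Multipliers

variable {a : ℝ} {P Q : ℂ → ℂ} {f g : L2w a}

theorem exists_maps_of_symbol_le (hP : Measurable P) {c : ℝ}
    (hPQ : ∀ ξ, ‖P (shiftedFreq a ξ)‖ ≤ c * (1 + ‖Q (shiftedFreq a ξ)‖))
    (h : Maps (fourierMul a Q) f g) : ∃ g', Maps (fourierMul a P) f g' := by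
  have hPm := hP.comp (measurable_shiftedFreq a)
  have hmem : MemLp (fun ξ => P (shiftedFreq a ξ) * spectralEquiv a f ξ) 2 volume := by
    refine (((memLp_spectral f).norm.add (memLp_spectral g).norm).const_mul c).mono'
      (hPm.aestronglyMeasurable.mul (measurable_spectral f).aestronglyMeasurable) ?_
    filter_upwards [maps_fourierMul_iff.1 h] with ξ hξ
    have h1 := mul_le_mul_of_nonneg_right (hPQ ξ) (norm_nonneg (spectralEquiv a f ξ))
    simp only [Pi.add_apply]
    rw [norm_mul, hξ, norm_mul]
    linarith
  refine ⟨(spectralEquiv a).symm (hmem.toLp _), maps_fourierMul_iff.2 ?_⟩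
  rw [LinearIsometryEquiv.apply_symm_apply]
  exact hmem.coeFn_toLp

theorem maps_fourierMul_comp {g' : L2w a} (h1 : Maps (fourierMul a P) f g)
    (h2 : Maps (fourierMul a Q) g g') : Maps (fourierMul a fun w => Q w * P w) f g' := by
  rw [maps_fourierMul_iff] at *
  filter_upwards [h1, h2] with ξ e1 e2
  rw [e2, e1, mul_assoc]

theorem maps_fourierMul_add {g' : L2w a} (h1 : Maps (fourierMul a P) f g)
    (h2 : Maps (fourierMul a Q) f g') : Maps (fourierMul a fun w => P w + Q w) f (g + g') := by
  rw [maps_fourierMul_iff] at *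
  filter_upwards [h1, h2, spectral_add g g'] with ξ e1 e2 e3
  rw [e3, e1, e2, add_mul]

theorem maps_fourierMul_sub {g' : L2w a} (h1 : Maps (fourierMul a P) f g)
    (h2 : Maps (fourierMul a Q) f g') : Maps (fourierMul a fun w => P w - Q w) f (g - g') := by
  rw [maps_fourierMul_iff] at *
  filter_upwards [h1, h2, spectral_sub g g'] with ξ e1 e2 e3
  rw [e3, e1, e2, sub_mul]

theorem maps_fourierMul_smul (c : ℂ) (h1 : Maps (fourierMul a P) f g) :
    Maps (fourierMul a fun w => c * P w) f (c • g) := by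
  rw [maps_fourierMul_iff] at *
  filter_upwards [h1, spectral_smul c g] with ξ e1 e3
  rw [e3, e1, mul_assoc]

theorem maps_fourierMul_congr (h : Maps (fourierMul a P) f g)
    (hPQ : ∀ ξ, P (shiftedFreq a ξ) = Q (shiftedFreq a ξ)) : Maps (fourierMul a Q) f g := by
  rw [maps_fourierMul_iff] at *
  filter_upwards [h] with ξ e1
  rw [e1, hPQ]

theorem isResolvent_fourierMul {z : ℂ} {R : L2w a →L[ℂ] L2w a}
    (hR : ∀ f, Maps (fourierMul a fun w => (z - P w)⁻¹) f (R f))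
    (h0 : ∀ ξ, z - P (shiftedFreq a ξ) ≠ 0) : IsResolvent (fourierMul a P) z R := by
  refine ⟨fun f => ?_, fun f g h => ?_⟩
  · rw [maps_fourierMul_iff]
    filter_upwards [maps_fourierMul_iff.1 (hR f), spectral_sub (z • R f) f,
      spectral_smul z (R f)] with ξ e1 e2 e3
    have := h0 ξ
    rw [e2, e3, e1]
    field_simp
    ring
  · apply eq_of_spectral_ae_eq
    filter_upwards [maps_fourierMul_iff.1 (hR (z • f - g)), spectral_sub (z • f) g,
      spectral_smul z f, maps_fourierMul_iff.1 h] with ξ e1 e2 e3 e4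
    have := h0 ξ
    rw [e1, e2, e3, e4]
    field_simp

theorem IsResolvent.congr {E : Type*} [NormedAddCommGroup E] [NormedSpace ℂ E] {A B : E →ₗ.[ℂ] E}
    {z : ℂ} {R : E →L[ℂ] E} (h : IsResolvent A z R) (hAB : ∀ f g, Maps B f g ↔ Maps A f g) :
    IsResolvent B z R :=
  ⟨fun f => (hAB _ _).2 (h.right f), fun f g hfg => h.left f g ((hAB _ _).1 hfg)⟩

/-- Relatively bounded perturbations. -/
theorem exists_isResolvent_of_perturbation {E : Type*} [NormedAddCommGroup E] [NormedSpace ℂ E]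
    [CompleteSpace E] {A B : E →ₗ.[ℂ] E} {z : ℂ} {R : E →L[ℂ] E} (hR : IsResolvent B z R)
    (hdom : ∀ f, f ∈ A.domain ↔ f ∈ B.domain)
    (hE : ∀ f a b, Maps A (R f) a → Maps B (R f) b → ‖a - b‖ ≤ 1 / 2 * ‖f‖) :
    ∃ R' : E →L[ℂ] E, IsResolvent A z R' ∧ ‖R'‖ ≤ 2 * ‖R‖ := by
  have hmem : ∀ f, R f ∈ (A - B).domain := fun f =>
    ⟨(hdom _).2 (hR.right f).mem, (hR.right f).mem⟩
  let G₀ : E →ₗ[ℂ] E := (A - B).toFun ∘ₗ (R : E →ₗ[ℂ] E).codRestrict (A - B).domain hmem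
  have hG₀ : ∀ f, Maps (A - B) (R f) (G₀ f) := fun f => ⟨hmem f, rfl⟩
  have hGb : ∀ f, ‖G₀ f‖ ≤ 1 / 2 * ‖f‖ := fun f => by
    obtain ⟨x, y, h1, h2, h3⟩ := maps_sub_iff.1 (hG₀ f)
    rw [← h3]
    exact hE f x y h1 h2
  let G : E →L[ℂ] E := G₀.mkContinuous (1 / 2) hGb
  have hGA : ∀ f, Maps A (R f) (z • R f - f + G f) := fun f => by
    obtain ⟨x, y, h1, h2, h3⟩ := maps_sub_iff.1 (hG₀ f)
    have h4 : G f = x - y := h3.symm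
    rw [h4, ← h2.unique (hR.right f), add_sub_cancel]
    exact h1
  have hG1 : ‖G‖ < 1 := lt_of_le_of_lt (G₀.mkContinuous_norm_le (by norm_num) hGb) (by norm_num)
  -- With `G = (A - B) R` one has `(z - A) R = 1 - G`. A Neumann series inverts the right side, and
  -- `R (1 - G)⁻¹` is the resolvent of `A`.
  let U := Units.oneSub G hG1
  have hU : (U : E →L[ℂ] E) = 1 - G := rfl
  have hU1 : ∀ f, (↑U⁻¹ : E →L[ℂ] E) f - G ((↑U⁻¹ : E →L[ℂ] E) f) = f := fun f => by
    have := congrArg (fun T : E →L[ℂ] E => T f) (Units.mul_inv U)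
    simpa [hU] using this
  have hU2 : ∀ f, (↑U⁻¹ : E →L[ℂ] E) (f - G f) = f := fun f => by
    have := congrArg (fun T : E →L[ℂ] E => T f) (Units.inv_mul U)
    simpa [hU] using this
  refine ⟨R ∘L (↑U⁻¹ : E →L[ℂ] E), ⟨fun f => ?_, fun f g h => ?_⟩, ?_⟩
  · have h1 := hGA ((↑U⁻¹ : E →L[ℂ] E) f)
    have h2 := hU1 f
    rw [sub_add, h2] at h1
    exact h1
  · obtain ⟨b, hb⟩ : ∃ b, Maps B f b := ⟨_, maps_of_mem ((hdom f).1 h.mem)⟩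
    have h1 : R (z • f - b) = f := hR.left f b hb
    have h2 := hGA (z • f - b)
    rw [h1] at h2
    have h3 := h.unique h2
    have h4 : z • f - g = (z • f - b) - G (z • f - b) := by
      rw [h3]
      abel
    rw [h4, ContinuousLinearMap.comp_apply, hU2, h1]
  · refine ContinuousLinearMap.opNorm_le_bound _ (by positivity) fun f => ?_
    set y := (↑U⁻¹ : E →L[ℂ] E) f with hy
    have h1 := hU1 f
    rw [← hy] at h1
    have h2 : ‖y‖ ≤ 2 * ‖f‖ := by
      have h3 : y = f + G y := by rw [← h1]; abel
      have h4 := norm_add_le f (G y)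
      rw [← h3] at h4
      have h5 : ‖G y‖ ≤ 1 / 2 * ‖y‖ := hGb y
      linarith
    rw [ContinuousLinearMap.comp_apply, ← hy]
    calc ‖R y‖ ≤ ‖R‖ * ‖y‖ := R.le_opNorm y
      _ ≤ ‖R‖ * (2 * ‖f‖) := by gcongr
      _ = _ := by ring

end Multipliers

/-! ### Multiplication operators with small smooth coefficients -/

/-- `g = 1 + 𝓕⁻ φ` with `∫ (1 + |k|/ε)² |φ| ≤ C ε²`. -/
structure NearOne (ε C : ℝ) (g : ℝ → ℝ) (φ : ℝ → ℂ) : Prop where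
  spectrum : HasSpectrum g 1 φ
  integrable_weight : Integrable fun κ => polyWeight ε 2 κ * ‖φ κ‖
  integral_le : ∫ κ, polyWeight ε 2 κ * ‖φ κ‖ ≤ C * ε ^ 2

theorem InWiener.exists_nearOne {ε C : ℝ} {g : ℝ → ℝ}
    (h : InWiener (polyWeight ε 2) (fun x => g x - 1) (C * ε ^ 2)) : ∃ φ, NearOne ε C g φ := by
  obtain ⟨φ, h1, h2, h3, h4⟩ := h
  refine ⟨φ, ⟨h1, fun x => ?_⟩, h2, h4⟩
  rw [← h3 x]
  push_cast
  ring

theorem norm_shiftedFreq_sub (a η κ : ℝ) :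
    ‖shiftedFreq a η - shiftedFreq a (η - κ)‖ = 2 * Real.pi * |κ| := by
  have : shiftedFreq a η - shiftedFreq a (η - κ) = ((2 * Real.pi * κ : ℝ) : ℂ) := by
    simp only [shiftedFreq]
    push_cast
    ring
  rw [this, Complex.norm_real, Real.norm_eq_abs, abs_mul, abs_of_pos Real.two_pi_pos]

namespace NearOne

variable {ε C : ℝ} {g : ℝ → ℝ} {φ : ℝ → ℂ} {a : ℝ}

theorem freq_le (hε : 0 < ε) (κ : ℝ) : 2 * Real.pi * |κ| ≤ ε * polyWeight ε 2 κ := by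
  have h1 := freq_mul_polyWeight_le hε 1 κ
  have h2 := mul_le_mul_of_nonneg_left ((isWeight_polyWeight hε 1).one_le κ)
    (mul_nonneg Real.two_pi_pos.le (abs_nonneg κ))
  rw [mul_one] at h2
  exact h2.trans h1

theorem integrable_abs (h : NearOne ε C g φ) (hε : 0 < ε) : Integrable fun κ => |κ| * ‖φ κ‖ := by
  refine (h.integrable_weight.const_mul (ε / (2 * Real.pi))).mono'
    (continuous_abs.aestronglyMeasurable.mul h.spectrum.integrable.1.norm) (ae_of_all _ fun κ => ?_)
  rw [Real.norm_of_nonneg (by positivity), ← mul_assoc]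
  gcongr
  rw [div_mul_eq_mul_div, le_div_iff₀ Real.two_pi_pos]
  linarith [freq_le hε κ]

theorem continuous (h : NearOne ε C g φ) : Continuous g := by
  have h1 := continuous_fourierInv_of_integrable h.spectrum.integrable
  have h2 : g = fun x => (((1 : ℝ) : ℂ) + 𝓕⁻ φ x).re := by
    funext x
    rw [← h.spectrum.eq x, Complex.ofReal_re]
  rw [h2]
  fun_prop

theorem abs_sub_one_le (h : NearOne ε C g φ) (hε : 0 < ε) (x : ℝ) : |g x - 1| ≤ C * ε ^ 2 := by
  have h1 : ((g x - 1 : ℝ) : ℂ) = 𝓕⁻ φ x := by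
    push_cast
    rw [h.spectrum.eq]
    push_cast
    ring
  rw [← Real.norm_eq_abs, ← Complex.norm_real, h1]
  refine (norm_fourierInv_le x).trans (le_trans ?_ h.integral_le)
  exact integral_mono h.spectrum.integrable.norm h.integrable_weight fun κ =>
    le_mul_of_one_le_left (norm_nonneg _) ((isWeight_polyWeight hε 2).one_le κ)

theorem abs_le_two (h : NearOne ε C g φ) (hε : 0 < ε) (hC : C * ε ^ 2 ≤ 1) (x : ℝ) :
    |g x| ≤ 2 := by
  have h1 := h.abs_sub_one_le hε x
  have h2 := abs_add_le (g x - 1) 1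
  rw [sub_add_cancel, abs_one] at h2
  linarith

theorem exists_maps (h : NearOne ε C g φ) (hε : 0 < ε) (hC : C * ε ^ 2 ≤ 1) (f : L2w a) :
    ∃ k, Maps (multOp a g) f k := by
  obtain ⟨B, -, hB⟩ := exists_multOp_clm a h.continuous.measurable zero_le_two
    (h.abs_le_two hε hC)
  exact ⟨B f, hB f⟩

theorem norm_le (h : NearOne ε C g φ) (hε : 0 < ε) (hC : C * ε ^ 2 ≤ 1) {f k : L2w a}
    (hm : Maps (multOp a g) f k) : ‖k‖ ≤ 2 * ‖f‖ :=
  norm_le_of_maps_multOp (h.abs_le_two hε hC) hm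

theorem norm_sub_le (h : NearOne ε C g φ) (hε : 0 < ε) {f k : L2w a}
    (hm : Maps (multOp a g) f k) : ‖k - f‖ ≤ C * ε ^ 2 * ‖f‖ := by
  refine norm_le_of_maps_multOp (g := fun x => g x - 1) (h.abs_sub_one_le hε) ?_
  rw [maps_multOp_iff] at *
  filter_upwards [hm, Lp.coeFn_sub k f] with x e1 e2
  rw [e2, Pi.sub_apply, e1]
  push_cast
  ring

/-- A kernel bound by a multiple of the weight. -/
theorem norm_le_of_kernel (h : NearOne ε C g φ) (hε : 0 < ε) {c : ℝ} (hc : 0 ≤ c) {b : ℝ → ℝ → ℂ}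
    (hb : ∀ η κ, ‖b η (η - κ)‖ ≤ c * polyWeight ε 2 κ) {f k : L2w a}
    (hh : ∀ᵐ η, spectralEquiv a k η
      = ∫ κ, φ κ * (b η (η - κ) * spectralEquiv a f (η - κ))) :
    ‖k‖ ≤ c * (C * ε ^ 2) * ‖f‖ := by
  have hi : Integrable fun κ => c * polyWeight ε 2 κ * ‖φ κ‖ := by
    simp only [mul_assoc]
    exact h.integrable_weight.const_mul c
  refine (_root_.norm_le_of_kernel (fun κ => mul_nonneg hc ((isWeight_polyWeight hε 2).nonneg κ))
    hi hb hh).trans ?_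
  gcongr
  simp only [mul_assoc]
  rw [integral_const_mul]
  exact mul_le_mul_of_nonneg_left h.integral_le hc

/-- The commutator with a Lipschitz multiplier. -/
theorem norm_commutator_le (h : NearOne ε C g φ) (hε : 0 < ε) {P : ℂ → ℂ} {c : ℝ} (hc : 0 ≤ c)
    (hP : ∀ η κ, ‖P (shiftedFreq a η) - P (shiftedFreq a (η - κ))‖ ≤ c * (2 * Real.pi * |κ|))
    {f f' k k' k'' : L2w a} (h1 : Maps (fourierMul a P) f f') (h2 : Maps (multOp a g) f k)
    (h3 : Maps (fourierMul a P) k k') (h4 : Maps (multOp a g) f' k'') :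
    ‖k' - k''‖ ≤ c * C * ε ^ 3 * ‖f‖ := by
  have := h.norm_le_of_kernel hε (mul_nonneg hc hε.le)
    (b := fun η ξ => P (shiftedFreq a η) - P (shiftedFreq a ξ)) (fun η κ => by
      refine (hP η κ).trans ?_
      rw [mul_assoc c ε]
      exact mul_le_mul_of_nonneg_left (freq_le hε κ) hc)
    (h.spectrum.spectral_commutator h1 h2 h3 h4)
  calc _ ≤ _ := this
    _ = _ := by ring

theorem exists_maps_fourierMul (h : NearOne ε C g φ) (hε : 0 < ε) {P : ℂ → ℂ} (hPm : Measurable P)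
    {c : ℝ} (hc : 0 ≤ c)
    (hP : ∀ η κ, ‖P (shiftedFreq a η) - P (shiftedFreq a (η - κ))‖ ≤ c * (2 * Real.pi * |κ|))
    {f f' k : L2w a} (h1 : Maps (fourierMul a P) f f') (h2 : Maps (multOp a g) f k) :
    ∃ k', Maps (fourierMul a P) k k' := by
  refine h.spectrum.exists_maps_fourierMul (h.integrable_abs hε) hPm (C := c * (2 * Real.pi))
    (mul_nonneg hc Real.two_pi_pos.le) (fun η ξ => ?_) h1 h2
  have h3 := hP η (η - ξ)
  rw [sub_sub_cancel] at h3
  have h4 := norm_le_norm_add_norm_sub' (P (shiftedFreq a η)) (P (shiftedFreq a ξ))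
  linarith

/-- `g P g - P` for a multiplier `P` of first order. -/
theorem norm_conj_sub_le (h : NearOne ε C g φ) (hε : 0 < ε) (hC : C * ε ^ 2 ≤ 1)
    (hC0 : 0 ≤ C) {P : ℂ → ℂ} {c : ℝ} (hc : 0 ≤ c)
    (hP : ∀ η κ, ‖P (shiftedFreq a η) - P (shiftedFreq a (η - κ))‖ ≤ c * (2 * Real.pi * |κ|))
    {f f' k k' k'' : L2w a} (h1 : Maps (fourierMul a P) f f') (h2 : Maps (multOp a g) f k)
    (h3 : Maps (fourierMul a P) k k') (h4 : Maps (multOp a g) k' k'') :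
    ‖k'' - f'‖ ≤ 3 * C * ε ^ 2 * ‖f'‖ + 2 * c * C * ε ^ 3 * ‖f‖ := by
  obtain ⟨y, hy⟩ := h.exists_maps hε hC f'
  have e1 := h.norm_commutator_le hε hc hP h1 h2 h3 hy
  have e2 := h.norm_sub_le hε h4
  have e3 := h.norm_sub_le hε hy
  have e4 := h.norm_le hε hC hy
  have e5 : ‖k'‖ ≤ c * C * ε ^ 3 * ‖f‖ + 2 * ‖f'‖ := by
    have := norm_add_le (k' - y) y
    rw [sub_add_cancel] at this
    linarith
  -- In operator form, `g P g - P = (g - 1) P g + [P, g] + (g - 1) P`.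
  have e6 : k'' - f' = (k'' - k') + ((k' - y) + (y - f')) := by abel
  have e7 : ‖k'' - f'‖ ≤ ‖k'' - k'‖ + (‖k' - y‖ + ‖y - f'‖) := by
    rw [e6]
    exact (norm_add_le _ _).trans (add_le_add_right (norm_add_le _ _) _)
  have e8 : C * ε ^ 2 * ‖k'‖ ≤ C * ε ^ 2 * (2 * ‖f'‖) + 1 * (c * C * ε ^ 3 * ‖f‖) := by
    have : 0 ≤ c * C * ε ^ 3 * ‖f‖ := by positivity
    have h0 : 0 ≤ C * ε ^ 2 := by positivity
    nlinarith
  nlinarith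

end NearOne

/-! ### Symbols on the line `k + ia` -/

namespace SmallParam

variable {α ε : ℝ} {z : ℂ}

theorem shiftedFreq_ne_zero (h : SmallParam α ε) (ξ : ℝ) : shiftedFreq (ε * α) ξ ≠ 0 :=
  strip_ne_zero h.a_pos

theorem rSym_shiftedFreq_ne_zero (h : SmallParam α ε) (ξ : ℝ) :
    rSym (gam ε) (shiftedFreq (ε * α) ξ) ≠ 0 :=
  rSym_ne_zero h.a_pos h.a_le h.gam_pos

theorem scSymbol_shiftedFreq_ne_zero (h : SmallParam α ε) (ξ : ℝ) :
    scSymbol (gam ε) (shiftedFreq (ε * α) ξ) ≠ 0 := by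
  rw [scSymbol_eq (h.shiftedFreq_ne_zero ξ)]
  exact neg_ne_zero.2 (mul_ne_zero (mul_ne_zero Complex.I_ne_zero (h.shiftedFreq_ne_zero ξ))
    (h.rSym_shiftedFreq_ne_zero ξ))

theorem norm_scSymbol_le (h : SmallParam α ε) (ξ : ℝ) :
    ‖scSymbol (gam ε) (shiftedFreq (ε * α) ξ)‖ ≤ ‖shiftedFreq (ε * α) ξ‖ := by
  rw [scSymbol_eq (h.shiftedFreq_ne_zero ξ), norm_neg, norm_mul, norm_mul, Complex.norm_I, one_mul]
  exact mul_le_of_le_one_right (norm_nonneg _) h.norm_rSym_le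

/-- The factor `1 + |w|` on the left and `|r|` on the right make both `[p, r] r⁻¹` and `∂ [p, r]
r⁻¹` bounded. -/
theorem rSym_lipschitz (h : SmallParam α ε) (η κ : ℝ) :
    (1 + ‖shiftedFreq (ε * α) η‖) * ‖rSym (gam ε) (shiftedFreq (ε * α) η)
      - rSym (gam ε) (shiftedFreq (ε * α) (η - κ))‖
      ≤ 168 * (2 * Real.pi * |κ|) * ‖rSym (gam ε) (shiftedFreq (ε * α) (η - κ))‖ := by
  have h1 := norm_rSym_sub_le (k := 2 * Real.pi * η) (l := 2 * Real.pi * (η - κ)) h.a_pos h.a_le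
    h.half_le_gam (gam_le_one ε)
  have h2 : |2 * Real.pi * η - 2 * Real.pi * (η - κ)| = 2 * Real.pi * |κ| := by
    rw [← mul_sub, sub_sub_cancel, abs_mul, abs_of_pos Real.two_pi_pos]
  rw [h2] at h1
  exact h1

theorem norm_rSym_sub_shiftedFreq_le (h : SmallParam α ε) (η κ : ℝ) :
    ‖rSym (gam ε) (shiftedFreq (ε * α) η) - rSym (gam ε) (shiftedFreq (ε * α) (η - κ))‖
      ≤ 168 * (2 * Real.pi * |κ|) := by
  have h1 := h.rSym_lipschitz η κ
  have h2 : ‖rSym (gam ε) (shiftedFreq (ε * α) (η - κ))‖ ≤ 1 := h.norm_rSym_le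
  have h3 := norm_nonneg (shiftedFreq (ε * α) η)
  have h4 := norm_nonneg (rSym (gam ε) (shiftedFreq (ε * α) η)
    - rSym (gam ε) (shiftedFreq (ε * α) (η - κ)))
  have h5 := mul_le_of_le_one_right
    (by positivity : 0 ≤ 168 * (2 * Real.pi * |κ|)) h2
  nlinarith

theorem dSym_lipschitz (a η κ : ℝ) :
    ‖Complex.I * shiftedFreq a η - Complex.I * shiftedFreq a (η - κ)‖
      ≤ 1 * (2 * Real.pi * |κ|) := by
  rw [← mul_sub, norm_mul, Complex.norm_I, norm_shiftedFreq_sub]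

theorem scSymbol_lipschitz (h : SmallParam α ε) (η κ : ℝ) :
    ‖scSymbol (gam ε) (shiftedFreq (ε * α) η) - scSymbol (gam ε) (shiftedFreq (ε * α) (η - κ))‖
      ≤ 169 * (2 * Real.pi * |κ|) := by
  rw [scSymbol_eq (h.shiftedFreq_ne_zero η), scSymbol_eq (h.shiftedFreq_ne_zero (η - κ))]
  have h1 := h.rSym_lipschitz η κ
  have h2 : ‖rSym (gam ε) (shiftedFreq (ε * α) (η - κ))‖ ≤ 1 := h.norm_rSym_le
  have h3 := norm_shiftedFreq_sub (ε * α) η κ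
  set w := shiftedFreq (ε * α) η
  set w' := shiftedFreq (ε * α) (η - κ)
  set r := rSym (gam ε) w
  set r' := rSym (gam ε) w'
  have e : -(Complex.I * w * r) - -(Complex.I * w' * r')
      = -(Complex.I * ((w - w') * r' + w * (r - r'))) := by ring
  rw [e, norm_neg, norm_mul, Complex.norm_I, one_mul]
  refine (norm_add_le _ _).trans ?_
  rw [norm_mul, norm_mul, h3]
  have hp : 0 ≤ 2 * Real.pi * |κ| := by positivity
  have h5 := mul_le_of_le_one_right hp h2
  have h6 := mul_le_of_le_one_right (by linarith : 0 ≤ 168 * (2 * Real.pi * |κ|)) h2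
  nlinarith [norm_nonneg (r - r')]

/-- The symbol of `𝒮⁻¹ ∂` is `-r⁻¹`. The relative Lipschitz bound, taken between `0` and `ξ`, shows
that it grows at most linearly. The constant serves only a question of domains, so its dependence on
`ε` is harmless. -/
theorem exists_scInv_symbol_le (h : SmallParam α ε) : ∃ c, ∀ ξ,
    ‖(scSymbol (gam ε) (shiftedFreq (ε * α) ξ))⁻¹ * (Complex.I * shiftedFreq (ε * α) ξ)‖
      ≤ c * (1 + ‖Complex.I * shiftedFreq (ε * α) ξ‖) := by
  have hr0 := norm_pos_iff.2 (h.rSym_shiftedFreq_ne_zero 0)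
  refine ⟨168 / ‖rSym (gam ε) (shiftedFreq (ε * α) 0)‖, fun ξ => ?_⟩
  have hw := h.shiftedFreq_ne_zero ξ
  have hr := norm_pos_iff.2 (h.rSym_shiftedFreq_ne_zero ξ)
  have e : (scSymbol (gam ε) (shiftedFreq (ε * α) ξ))⁻¹ * (Complex.I * shiftedFreq (ε * α) ξ)
      = -(rSym (gam ε) (shiftedFreq (ε * α) ξ))⁻¹ := by
    have := norm_pos_iff.1 hr
    rw [scSymbol_eq hw]
    field_simp
  have h1 := h.rSym_lipschitz 0 (-ξ)
  rw [sub_neg_eq_add, zero_add, abs_neg] at h1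
  have h2 : 2 * Real.pi * |ξ| ≤ ‖shiftedFreq (ε * α) ξ‖ := by
    have h3 := Complex.abs_re_le_norm (shiftedFreq (ε * α) ξ)
    have h4 : (shiftedFreq (ε * α) ξ).re = 2 * Real.pi * ξ := by simp [shiftedFreq]
    rwa [h4, abs_mul, abs_of_pos Real.two_pi_pos] at h3
  rw [e, norm_neg, norm_inv, norm_mul, Complex.norm_I, one_mul, div_mul_eq_mul_div,
    le_div_iff₀ hr0, ← div_eq_inv_mul, div_le_iff₀ hr]
  have h5 := norm_le_norm_add_norm_sub' (rSym (gam ε) (shiftedFreq (ε * α) 0))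
    (rSym (gam ε) (shiftedFreq (ε * α) ξ))
  have h6 := norm_nonneg (shiftedFreq (ε * α) 0)
  have h7 := norm_nonneg (rSym (gam ε) (shiftedFreq (ε * α) 0)
    - rSym (gam ε) (shiftedFreq (ε * α) ξ))
  have h8 := mul_le_mul_of_nonneg_right h2 hr.le
  nlinarith

end SmallParam

/-! ### Leibniz rule -/

theorem HasSpectrum.deriv {g : ℝ → ℝ} {c : ℝ} {φ : ℝ → ℂ} (h : HasSpectrum g c φ)
    (hφ : Integrable fun κ => |κ| * ‖φ κ‖) :
    HasSpectrum (_root_.deriv g) 0 fun κ : ℝ => 2 * Real.pi * Complex.I * κ * φ κ := by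
  refine ⟨?_, fun x => ?_⟩
  · refine (hφ.const_mul (2 * Real.pi)).mono'
      ((by fun_prop : Continuous fun κ : ℝ =>
        2 * Real.pi * Complex.I * (κ : ℂ)).aestronglyMeasurable.mul h.integrable.1)
      (ae_of_all _ fun κ => ?_)
    rw [norm_mul, norm_mul, norm_mul, norm_mul, Complex.norm_ofNat, Complex.norm_real,
      Complex.norm_real, Complex.norm_I, Real.norm_of_nonneg Real.pi_pos.le, Real.norm_eq_abs]
    linarith
  · have h1 := (hasDerivAt_fourierInv h.integrable hφ x).const_add (c : ℂ)
    have h2 : (fun y => (c : ℂ) + 𝓕⁻ φ y) = fun y => (g y : ℂ) := funext fun y => (h.eq y).symm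
    have h3 := hasDerivAt_of_ofReal (g := g) (by rw [← h2]; exact h1)
    rw [h3.1.deriv, h3.2]
    simp

theorem HasSpectrum.measurable {g : ℝ → ℝ} {c : ℝ} {φ : ℝ → ℂ} (h : HasSpectrum g c φ) :
    Measurable g := by
  have h1 := continuous_fourierInv_of_integrable h.integrable
  have h2 : g = fun x => ((c : ℂ) + 𝓕⁻ φ x).re := by
    funext x
    rw [← h.eq x, Complex.ofReal_re]
  rw [h2]
  fun_prop

theorem HasSpectrum.abs_le {g : ℝ → ℝ} {c : ℝ} {φ : ℝ → ℂ} (h : HasSpectrum g c φ) (x : ℝ) :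
    |g x| ≤ |c| + ∫ κ, ‖φ κ‖ := by
  rw [← Real.norm_eq_abs, ← Complex.norm_real, h.eq x]
  refine (norm_add_le _ _).trans ?_
  rw [Complex.norm_real, Real.norm_eq_abs]
  gcongr
  exact norm_fourierInv_le x

/-- `g' f = ∂(g f) - g ∂f`. -/
theorem HasSpectrum.maps_deriv {g : ℝ → ℝ} {c : ℝ} {φ : ℝ → ℂ} (h : HasSpectrum g c φ)
    (hφ : Integrable fun κ => |κ| * ‖φ κ‖) {a : ℝ} {f f' k k' k'' : L2w a}
    (h1 : Maps (dOp a) f f') (h2 : Maps (multOp a g) f k) (h3 : Maps (dOp a) k k')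
    (h4 : Maps (multOp a g) f' k'') : Maps (multOp a (_root_.deriv g)) f (k' - k'') := by
  have hd := h.deriv hφ
  obtain ⟨B, -, hB⟩ := exists_multOp_clm a hd.measurable
    (add_nonneg (abs_nonneg 0) (integral_nonneg fun κ => norm_nonneg _)) hd.abs_le
  have e : B f = k' - k'' := by
    apply eq_of_spectral_ae_eq
    filter_upwards [hd.spectral_ae_eq (hB f), h.spectral_commutator h1 h2 h3 h4] with η e1 e2
    rw [e1, e2, Complex.ofReal_zero, zero_mul, zero_add]
    refine integral_congr_ae (ae_of_all _ fun κ => ?_)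
    simp only [shiftedFreq]
    push_cast
    ring
  rw [← e]
  exact hB f

/-! ### The operators `R₁`, `R₂` and the commutators -/

section Bundle

variable {α ε C : ℝ} {ω : ℝ → ℝ}

theorem maps_scOp_of_maps_dOp (h : SmallParam α ε) {f f' : L2w (ε * α)}
    (hf : Maps (dOp (ε * α)) f f') :
    ∃ s, Maps (scOp (ε * α) (gam ε)) f s ∧ ‖s‖ ≤ ‖f'‖ := by
  obtain ⟨s, hs⟩ := exists_maps_of_symbol_le (P := scSymbol (gam ε)) (c := 1) measurable_scSymbol
    (fun ξ => by
      rw [norm_mul, Complex.norm_I, one_mul, one_mul]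
      linarith [h.norm_scSymbol_le ξ]) hf
  refine ⟨s, hs, ?_⟩
  rw [← norm_eq_norm_spectralEquiv s, ← norm_eq_norm_spectralEquiv f']
  refine Lp.norm_le_norm_of_ae_le ?_
  filter_upwards [maps_fourierMul_iff.1 hs, maps_dOp_iff.1 hf] with ξ e1 e2
  rw [e1, e2, norm_mul, norm_mul, norm_mul, Complex.norm_I, one_mul]
  exact mul_le_mul_of_nonneg_right (h.norm_scSymbol_le ξ) (norm_nonneg _)

theorem measurable_dSym : Measurable fun w : ℂ => Complex.I * w := by fun_prop

/-- The factor `∂` acts first in this composition. Therefore each operator containing it as a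
summand, in particular `𝒜₂₂` and the `J`, has its domain inside that of `∂`. -/
theorem exists_dOp_of_maps_pComm {a γ : ℝ} {f y : L2w a} (h : Maps (pComm a γ ω) f y) :
    ∃ f', Maps (dOp a) f f' := by
  obtain ⟨x, hx, -⟩ := maps_mul_iff.1 h
  obtain ⟨_, hderiv, -⟩ := maps_mul_iff.1 hx
  exact ⟨_, hderiv⟩

/-- `R₂ f = ∂ G` with `G` of the size of `[p, r] r⁻¹ f`. -/
theorem exists_maps_rTwo (h : SmallParam α ε) {φ : ℝ → ℂ} (hp : NearOne ε C (pCoef ω) φ)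
    (hC : C * ε ^ 2 ≤ 1) {f f' : L2w (ε * α)} (hf : Maps (dOp (ε * α)) f f') :
    ∃ y y' G, Maps (pComm (ε * α) (gam ε) ω) f y' ∧ Maps (rTwo (ε * α) (gam ε) ω) f y ∧
      Maps (dOp (ε * α)) G y ∧ ‖G‖ ≤ 168 * C * ε ^ 3 * ‖f‖ ∧ ‖y‖ ≤ 168 * C * ε ^ 3 * ‖f‖ ∧
      ‖y'‖ ≤ 169 * C * ε ^ 3 * ‖f‖ := by
  have hε := h.ε_pos
  set γ := gam ε with hγ
  set S := scSymbol γ with hS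
  set r := rSym γ with hr
  obtain ⟨c, hc⟩ := h.exists_scInv_symbol_le
  have hSm : Measurable S := measurable_scSymbol
  -- The element `f₂ = 𝒮⁻¹ ∂ f = -r⁻¹ f` exists because `f` lies in the domain of `∂`; `r⁻¹` itself
  -- is unbounded.
  obtain ⟨f₂, hf₂⟩ := exists_maps_of_symbol_le (P := fun w => (S w)⁻¹ * (Complex.I * w)) (c := c)
    (hSm.inv.mul measurable_dSym) hc hf
  have s0 : ∀ ξ, S (shiftedFreq (ε * α) ξ) ≠ 0 := h.scSymbol_shiftedFreq_ne_zero
  have w0 : ∀ ξ, shiftedFreq (ε * α) ξ ≠ 0 := h.shiftedFreq_ne_zero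
  have r0 : ∀ ξ, r (shiftedFreq (ε * α) ξ) ≠ 0 := h.rSym_shiftedFreq_ne_zero
  have hSr : ∀ ξ, S (shiftedFreq (ε * α) ξ) = -(Complex.I * shiftedFreq (ε * α) ξ * r (shiftedFreq (ε * α) ξ)) :=
    fun ξ => scSymbol_eq (w0 ξ)
  have m1 : Maps (scInvOp (ε * α) γ) f' f₂ := by
    refine maps_fourierMul_iff.2 ?_
    filter_upwards [maps_fourierMul_iff.1 hf₂, maps_dOp_iff.1 hf] with ξ e1 e2
    rw [e1, e2]
    ring
  have m2 : Maps (scOp (ε * α) γ) f₂ f' := by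
    refine maps_fourierMul_iff.2 ?_
    filter_upwards [maps_fourierMul_iff.1 hf₂, maps_dOp_iff.1 hf] with ξ e1 e2
    have := s0 ξ
    rw [e1, e2]
    change _ = S _ * _
    field_simp
  have hf₂' : ∀ᵐ ξ, spectralEquiv (ε * α) f₂ ξ = -(r (shiftedFreq (ε * α) ξ))⁻¹ * spectralEquiv (ε * α) f ξ := by
    filter_upwards [maps_fourierMul_iff.1 hf₂] with ξ e1
    have := w0 ξ
    have := r0 ξ
    rw [e1, hSr]
    field_simp
  have m3 : Maps (fourierMul (ε * α) r) f₂ (-f) := by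
    refine maps_fourierMul_iff.2 ?_
    have hneg : spectralEquiv (ε * α) (-f) =ᵐ[volume] fun ξ => -spectralEquiv (ε * α) f ξ := by
      rw [map_neg]
      exact Lp.coeFn_neg _
    filter_upwards [hf₂', hneg] with ξ e1 e2
    have := r0 ξ
    rw [e1, e2]
    field_simp
  obtain ⟨k, hk⟩ := hp.exists_maps hε hC f
  obtain ⟨k', hk'⟩ := hp.exists_maps_fourierMul hε measurable_dSym zero_le_one
    (SmallParam.dSym_lipschitz (ε * α)) hf hk
  obtain ⟨y₁, hy₁⟩ := hp.exists_maps hε hC f'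
  obtain ⟨k₂, hk₂⟩ := hp.exists_maps hε hC f₂
  obtain ⟨s₂, hs₂⟩ := hp.exists_maps_fourierMul hε hSm (by norm_num)
    h.scSymbol_lipschitz m2 hk₂
  have mp : Maps (pComm (ε * α) γ ω) f (y₁ - s₂) :=
    maps_mul_iff.2 ⟨f₂, maps_mul_iff.2 ⟨f', hf, m1⟩,
      maps_opComm_iff.2 ⟨f', y₁, k₂, s₂, m2, hy₁, hk₂, hs₂, rfl⟩⟩
  have mL : Maps (multOp (ε * α) (deriv (pCoef ω))) f (k' - y₁) :=
    hp.spectrum.maps_deriv (hp.integrable_abs hε) hf hk hk' hy₁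
  have mR : Maps (rTwo (ε * α) γ ω) f (k' - s₂) :=
    maps_add_iff.2 ⟨_, _, mL, mp, by abel⟩
  obtain ⟨B, -, hB⟩ := exists_fourierMul_clm (ε * α) (P := r) measurable_rSym zero_le_one
    fun ξ => h.norm_rSym_le
  have hmneg : Maps (multOp (ε * α) (pCoef ω)) (-f) (-k) := by
    rw [maps_multOp_iff] at *
    filter_upwards [hk, Lp.coeFn_neg f, Lp.coeFn_neg k] with x e1 e2 e3
    rw [e2, e3, Pi.neg_apply, Pi.neg_apply, e1]
    ring
  have hker : ∀ᵐ η, spectralEquiv (ε * α) (B k₂ - -k) η = ∫ κ, φ κ *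
      (((r (shiftedFreq (ε * α) η) - r (shiftedFreq (ε * α) (η - κ))) * -(r (shiftedFreq (ε * α) (η - κ)))⁻¹)
        * spectralEquiv (ε * α) f (η - κ)) := by
    filter_upwards [hp.spectrum.spectral_commutator m3 hk₂ (hB k₂) hmneg] with η e1
    rw [e1]
    refine integral_congr_ae ?_
    filter_upwards [ae_ae_sub hf₂' η] with κ e2
    rw [e2]
    ring
  -- By `𝒮 = -∂ r`, the element `R₂ f = ∂(p f) - 𝒮(p f₂)` equals `∂ (p f + r (p f₂))`, and as `r f₂
  -- = -f` the inner expression is `[r, p] f₂`.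
  have mG : Maps (dOp (ε * α)) (B k₂ - -k) (k' - s₂) := by
    refine maps_dOp_iff.2 ?_
    filter_upwards [spectral_sub k' s₂, spectral_sub (B k₂) (-k), maps_fourierMul_iff.1 (hB k₂),
      maps_dOp_iff.1 hk', maps_fourierMul_iff.1 hs₂, (by
        rw [map_neg]
        exact Lp.coeFn_neg _ : spectralEquiv (ε * α) (-k) =ᵐ[volume] -spectralEquiv (ε * α) k)]
      with ξ e1 e2 e3 e4 e5 e6
    rw [e1, e2, e3, e4, e5, e6, hSr, Pi.neg_apply]
    ring
  have hb : ∀ η κ, ‖(r (shiftedFreq (ε * α) η) - r (shiftedFreq (ε * α) (η - κ)))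
      * -(r (shiftedFreq (ε * α) (η - κ)))⁻¹‖ * (1 + ‖shiftedFreq (ε * α) η‖)
      ≤ 168 * ε * polyWeight ε 2 κ := fun η κ => by
    have h1 := h.rSym_lipschitz η κ
    have h2 := norm_pos_iff.2 (r0 (η - κ))
    rw [norm_mul, norm_neg, norm_inv, ← div_eq_mul_inv, div_mul_eq_mul_div, div_le_iff₀ h2]
    have h3 := mul_le_mul_of_nonneg_right (NearOne.freq_le hε κ) h2.le
    calc _ = (1 + ‖shiftedFreq (ε * α) η‖) * ‖r (shiftedFreq (ε * α) η) - r (shiftedFreq (ε * α) (η - κ))‖ := by ring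
      _ ≤ _ := h1
      _ ≤ _ := by linarith
  have bG : ‖B k₂ - -k‖ ≤ 168 * C * ε ^ 3 * ‖f‖ := by
    have := hp.norm_le_of_kernel hε (by positivity : 0 ≤ 168 * ε)
      (b := fun η ξ => (r (shiftedFreq (ε * α) η) - r (shiftedFreq (ε * α) ξ)) * -(r (shiftedFreq (ε * α) ξ))⁻¹)
      (fun η κ => le_trans (le_mul_of_one_le_right (norm_nonneg _)
        (by linarith [norm_nonneg (shiftedFreq (ε * α) η)])) (hb η κ)) hker
    calc _ ≤ _ := this
      _ = _ := by ring
  have by2 : ‖k' - s₂‖ ≤ 168 * C * ε ^ 3 * ‖f‖ := by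
    have hker2 : ∀ᵐ η, spectralEquiv (ε * α) (k' - s₂) η = ∫ κ, φ κ *
        (Complex.I * shiftedFreq (ε * α) η * ((r (shiftedFreq (ε * α) η) - r (shiftedFreq (ε * α) (η - κ)))
          * -(r (shiftedFreq (ε * α) (η - κ)))⁻¹) * spectralEquiv (ε * α) f (η - κ)) := by
      filter_upwards [hker, maps_dOp_iff.1 mG] with η e1 e2
      rw [e2, e1, ← integral_const_mul]
      refine integral_congr_ae (ae_of_all _ fun κ => ?_)
      ring
    have := hp.norm_le_of_kernel hε (by positivity : 0 ≤ 168 * ε)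
      (b := fun η ξ => Complex.I * shiftedFreq (ε * α) η
        * ((r (shiftedFreq (ε * α) η) - r (shiftedFreq (ε * α) ξ)) * -(r (shiftedFreq (ε * α) ξ))⁻¹))
      (fun η κ => by
        refine le_trans ?_ (hb η κ)
        rw [norm_mul, norm_mul, Complex.norm_I, one_mul, mul_comm]
        exact mul_le_mul_of_nonneg_left (by linarith) (norm_nonneg _)) hker2
    calc _ ≤ _ := this
      _ = _ := by ring
  have bL : ‖k' - y₁‖ ≤ 1 * C * ε ^ 3 * ‖f‖ :=
    hp.norm_commutator_le hε zero_le_one (SmallParam.dSym_lipschitz (ε * α)) hf hk hk' hy₁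
  refine ⟨_, _, _, mp, mR, mG, bG, by2, ?_⟩
  have e : y₁ - s₂ = (k' - s₂) - (k' - y₁) := by abel
  rw [e]
  refine (norm_sub_le _ _).trans ?_
  linarith

theorem exists_maps_scComm (h : SmallParam α ε) {g : ℝ → ℝ} {φ : ℝ → ℂ} (hg : NearOne ε C g φ)
    (hC : C * ε ^ 2 ≤ 1) {f s : L2w (ε * α)} (hs : Maps (scOp (ε * α) (gam ε)) f s) :
    ∃ y, Maps (opComm (scOp (ε * α) (gam ε)) (multOp (ε * α) g)) f y ∧
      ‖y‖ ≤ 169 * C * ε ^ 3 * ‖f‖ := by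
  have hε := h.ε_pos
  obtain ⟨k, hk⟩ := hg.exists_maps hε hC f
  obtain ⟨k', hk'⟩ := hg.exists_maps_fourierMul hε measurable_scSymbol (by norm_num)
    h.scSymbol_lipschitz hs hk
  obtain ⟨k'', hk''⟩ := hg.exists_maps hε hC s
  exact ⟨k' - k'', maps_opComm_iff.2 ⟨k, k', s, k'', hk, hk', hs, hk'', rfl⟩,
    hg.norm_commutator_le hε (by norm_num) h.scSymbol_lipschitz hs hk hk' hk''⟩

/-- The double commutator is treated as `[𝒮, ρ] ρ - ρ [𝒮, ρ]`; the further gain from the outer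
commutator is not needed. -/
theorem exists_maps_rhoComm (h : SmallParam α ε) {φ : ℝ → ℂ}
    (hρ : NearOne ε C (rhoCoef (gam ε) ω) φ) (hC0 : 0 ≤ C) (hC : C * ε ^ 2 ≤ 1)
    {f s : L2w (ε * α)} (hs : Maps (scOp (ε * α) (gam ε)) f s) :
    ∃ y, Maps (rhoComm (ε * α) (gam ε) ω) f y ∧ ‖y‖ ≤ 676 * C * ε ^ 3 * ‖f‖ := by
  have hε := h.ε_pos
  obtain ⟨k, hk⟩ := hρ.exists_maps hε hC f
  obtain ⟨k', hk'⟩ := hρ.exists_maps_fourierMul hε measurable_scSymbol (by norm_num)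
    h.scSymbol_lipschitz hs hk
  obtain ⟨y₁, hy₁, b1⟩ := exists_maps_scComm h hρ hC hk'
  obtain ⟨y₂, hy₂, b2⟩ := exists_maps_scComm h hρ hC hs
  obtain ⟨y₃, hy₃⟩ := hρ.exists_maps hε hC y₂
  refine ⟨y₁ - y₃, maps_opComm_iff.2 ⟨k, y₁, y₂, y₃, hk, hy₁, hy₂, hy₃, rfl⟩, ?_⟩
  have b3 := hρ.norm_le hε hC hk
  have b4 := hρ.norm_le hε hC hy₃
  have b5 : 169 * C * ε ^ 3 * ‖k‖ ≤ 169 * C * ε ^ 3 * (2 * ‖f‖) := by gcongr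
  refine (norm_sub_le _ _).trans ?_
  linarith

theorem exists_maps_rOne {a : ℝ} (hc : CoefBounds ε C ω) (hε : 0 < ε) (hC0 : 0 ≤ C) (f : L2w a) :
    ∃ y, Maps (rOne a (gam ε) ω) f y ∧ ‖y‖ ≤ C * ε ^ 3 * ‖f‖ := by
  obtain ⟨B, hB, hB'⟩ := exists_multOp_clm a hc.rOne_continuous.measurable
    (by positivity : 0 ≤ C * ε ^ 3) hc.rOne_le
  exact ⟨B f, hB' f, norm_le_of_maps_multOp hc.rOne_le (hB' f)⟩

/-- Bounds for the operators `J₁₂`, `J₂₁` and `J₂₂` on the domain of `∂`. -/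
theorem exists_maps_j (h : SmallParam α ε) (hc : CoefBounds ε C ω) (hC0 : 0 ≤ C)
    (hC : C * ε ^ 2 ≤ 1) {f f' : L2w (ε * α)} (hf : Maps (dOp (ε * α)) f f') :
    (∃ y, Maps (jOneTwo (ε * α) (gam ε) ω) f y ∧ ‖y‖ ≤ 169 * C * ε ^ 3 * ‖f‖) ∧
    (∃ y, Maps (jTwoOne (ε * α) (gam ε) ω) f y ∧ ‖y‖ ≤ 169 * C * ε ^ 3 * ‖f‖) ∧
    ∃ y, Maps (jTwoTwo (ε * α) (gam ε) ω) f y ∧ ‖y‖ ≤ 423 * C * ε ^ 3 * ‖f‖ := by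
  have hε := h.ε_pos
  obtain ⟨φp, hp⟩ := hc.p_wiener.exists_nearOne
  obtain ⟨φq, hq⟩ := hc.q_wiener.exists_nearOne
  obtain ⟨φρ, hρ⟩ := hc.rho_wiener.exists_nearOne
  obtain ⟨s, hs, -⟩ := maps_scOp_of_maps_dOp h hf
  obtain ⟨y₂, y₃, -, hy₃, hy₂, -, -, b2, b3⟩ := exists_maps_rTwo h hp hC hf
  obtain ⟨y₁, hy₁, b1⟩ := exists_maps_rOne hc hε hC0 f
  obtain ⟨y₄, hy₄, b4⟩ := exists_maps_scComm h hq hC hs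
  obtain ⟨y₅, hy₅, b5⟩ := exists_maps_rhoComm h hρ hC0 hC hs
  have hn : ∀ y : L2w (ε * α), ‖(-1 / 2 : ℂ) • y‖ = 1 / 2 * ‖y‖ := fun y => by
    rw [norm_smul]
    norm_num
  refine ⟨⟨_, maps_smul_iff.2 ⟨_, maps_sub_iff.2 ⟨_, y₄, maps_sub_iff.2 ⟨y₁, y₂, hy₁, hy₂, rfl⟩,
    hy₄, rfl⟩, rfl⟩, ?_⟩, ⟨_, maps_smul_iff.2 ⟨_, maps_add_iff.2 ⟨_, y₄, maps_sub_iff.2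
    ⟨y₁, y₂, hy₁, hy₂, rfl⟩, hy₄, rfl⟩, rfl⟩, ?_⟩, ⟨_, maps_smul_iff.2 ⟨_, maps_add_iff.2
    ⟨_, y₅, maps_add_iff.2 ⟨y₁, y₃, hy₁, hy₃, rfl⟩, hy₅, rfl⟩, rfl⟩, ?_⟩⟩
  · rw [hn]
    have := norm_sub_le (y₁ - y₂) y₄
    have := norm_sub_le y₁ y₂
    linarith
  · rw [hn]
    have := norm_add_le (y₁ - y₂) y₄
    have := norm_sub_le y₁ y₂
    linarith
  · rw [hn]
    have := norm_add_le (y₁ + y₃) y₅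
    have := norm_add_le y₁ y₃
    linarith

theorem exists_dOp_of_maps_aTwoTwo {a γ : ℝ} {f y : L2w a} (h : Maps (aTwoTwo a γ ω) f y) :
    ∃ f', Maps (dOp a) f f' := by
  obtain ⟨_, x, -, hx, -⟩ := maps_add_iff.1 h
  obtain ⟨x', hx', -⟩ := maps_smul_iff.1 hx
  obtain ⟨u, _, hu, -, -⟩ := maps_add_iff.1 hx'
  obtain ⟨_, v, -, hv, -⟩ := maps_add_iff.1 hu
  exact exists_dOp_of_maps_pComm hv

/-- `𝒜₂₂` is close to `∂ - 𝒮`. -/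
theorem exists_maps_aTwoTwo (h : SmallParam α ε) (hc : CoefBounds ε C ω) (hC0 : 0 ≤ C)
    (hC : C * ε ^ 2 ≤ 1) {f f' : L2w (ε * α)} (hf : Maps (dOp (ε * α)) f f') :
    ∃ y s, Maps (aTwoTwo (ε * α) (gam ε) ω) f y ∧ Maps (scOp (ε * α) (gam ε)) f s ∧
      ‖y - (f' - s)‖ ≤ 6 * C * ε ^ 2 * ‖f'‖ + 800 * C * ε ^ 3 * ‖f‖ := by
  have hε := h.ε_pos
  obtain ⟨φp, hp⟩ := hc.sqrt_p_wiener.exists_nearOne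
  obtain ⟨φρ, hρ⟩ := hc.rho_wiener.exists_nearOne
  obtain ⟨s, hs, bs⟩ := maps_scOp_of_maps_dOp h hf
  obtain ⟨k, hk⟩ := hp.exists_maps hε hC f
  obtain ⟨k', hk'⟩ := hp.exists_maps_fourierMul hε measurable_dSym zero_le_one
    (SmallParam.dSym_lipschitz _) hf hk
  obtain ⟨k'', hk''⟩ := hp.exists_maps hε hC k'
  obtain ⟨l, hl⟩ := hρ.exists_maps hε hC f
  obtain ⟨l', hl'⟩ := hρ.exists_maps_fourierMul hε measurable_scSymbol (by norm_num)
    h.scSymbol_lipschitz hs hl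
  obtain ⟨l'', hl''⟩ := hρ.exists_maps hε hC l'
  obtain ⟨-, -, j, hj, bj⟩ := exists_maps_j h hc hC0 hC hf
  have b1 := hp.norm_conj_sub_le hε hC hC0 zero_le_one (SmallParam.dSym_lipschitz _) hf hk hk' hk''
  have b2 := hρ.norm_conj_sub_le hε hC hC0 (by norm_num) h.scSymbol_lipschitz hs hl hl' hl''
  refine ⟨k'' - l'' + j, s, maps_add_iff.2 ⟨_, j, maps_sub_iff.2 ⟨k'', l'',
    maps_mul_iff.2 ⟨k', maps_mul_iff.2 ⟨k, hk, hk'⟩, hk''⟩,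
    maps_mul_iff.2 ⟨l', maps_mul_iff.2 ⟨l, hl, hl'⟩, hl''⟩, rfl⟩, hj, rfl⟩, hs, ?_⟩
  have e : k'' - l'' + j - (f' - s) = (k'' - f') - (l'' - s) + j := by abel
  have e2 : ‖(k'' - f') - (l'' - s) + j‖ ≤ ‖k'' - f'‖ + ‖l'' - s‖ + ‖j‖ :=
    (norm_add_le _ _).trans (add_le_add_left (norm_sub_le _ _) _)
  have e3 : 3 * C * ε ^ 2 * ‖s‖ ≤ 3 * C * ε ^ 2 * ‖f'‖ := by gcongr
  have e4 : 0 ≤ C * ε ^ 3 * ‖f‖ := by positivity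
  rw [e]
  linarith

end Bundle

/-! ### Resolvents -/

section Resolvents

variable {α ε C : ℝ} {ω : ℝ → ℝ} {z : ℂ}

/-- The parameters are small and `z` lies in the region `|ε³ z| ≤ 1`, `Re z ≥ -α/6`. -/
structure SpectralPoint (α ε : ℝ) (z : ℂ) : Prop extends SmallParam α ε where
  norm_le : ‖(ε : ℂ) ^ 3 * z‖ ≤ 1
  le_re : -(1 / 6) * α ≤ z.re

/-- At `z = 0` the resolvent bounds become lower bounds for the symbols themselves, from which the
domains of `𝒜₊` and `∂ - 𝒮` are read off. -/
theorem SmallParam.spectralPoint_zero (h : SmallParam α ε) : SpectralPoint α ε 0 :=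
  ⟨h, by simp, by simpa using h.α_pos.le⟩

namespace SpectralPoint

theorem aPlus_lower (h : SpectralPoint α ε z) (ξ : ℝ) :
    α * ε ^ 3 ≤ 80 * ‖(ε : ℂ) ^ 3 * z - aSym (gam ε) (shiftedFreq (ε * α) ξ)‖ :=
  h.pow_le_norm_sub_aSym h.le_re

theorem aPlus_bounds (h : SpectralPoint α ε z) (ξ : ℝ) :
    α * (ε * ‖aSym (gam ε) (shiftedFreq (ε * α) ξ)‖)
      ≤ 128000 * ‖(ε : ℂ) ^ 3 * z - aSym (gam ε) (shiftedFreq (ε * α) ξ)‖ ∧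
    α * (ε ^ 2 * ‖shiftedFreq (ε * α) ξ‖)
      ≤ 128000 * ‖(ε : ℂ) ^ 3 * z - aSym (gam ε) (shiftedFreq (ε * α) ξ)‖ ∧
    α * (ε * ‖1 - rSym (gam ε) (shiftedFreq (ε * α) ξ)‖)
      ≤ 128000 * ‖(ε : ℂ) ^ 3 * z - aSym (gam ε) (shiftedFreq (ε * α) ξ)‖ :=
  h.aSym_bounds h.norm_le h.le_re _

theorem aPlus_pos (h : SpectralPoint α ε z) (ξ : ℝ) :
    0 < ‖(ε : ℂ) ^ 3 * z - aSym (gam ε) (shiftedFreq (ε * α) ξ)‖ := by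
  have h1 := h.aPlus_lower ξ
  have h2 : 0 < α * ε ^ 3 := mul_pos h.α_pos (pow_pos h.ε_pos 3)
  linarith

theorem aMinus_bounds (h : SpectralPoint α ε z) (ξ : ℝ) :
    α * ε ≤ 2 * ‖(ε : ℂ) ^ 3 * z - (Complex.I * shiftedFreq (ε * α) ξ
      - scSymbol (gam ε) (shiftedFreq (ε * α) ξ))‖ ∧
    α * (ε * ‖shiftedFreq (ε * α) ξ‖)
      ≤ 3 * ‖(ε : ℂ) ^ 3 * z - (Complex.I * shiftedFreq (ε * α) ξ
        - scSymbol (gam ε) (shiftedFreq (ε * α) ξ))‖ :=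
  h.bSym_bounds h.norm_le h.le_re _

theorem aMinus_pos (h : SpectralPoint α ε z) (ξ : ℝ) :
    0 < ‖(ε : ℂ) ^ 3 * z - (Complex.I * shiftedFreq (ε * α) ξ
      - scSymbol (gam ε) (shiftedFreq (ε * α) ξ))‖ := by
  have h1 := (h.aMinus_bounds ξ).1
  have h2 := mul_pos h.α_pos h.ε_pos
  linarith

theorem kdv_lower (h : SpectralPoint α ε z) (ξ : ℝ) :
    α * (ε ^ 2 * ‖shiftedFreq (ε * α) ξ‖)
      ≤ 4 * ‖(ε : ℂ) ^ 3 * z - kdvSym ε (shiftedFreq (ε * α) ξ)‖ :=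
  h.kdvSym_bound h.le_re _

end SpectralPoint

theorem norm_div_le_of_mul_le {P Q : ℂ} {c d : ℝ} (hc : 0 < c) (hQ : 0 < ‖Q‖)
    (h : c * ‖P‖ ≤ d * ‖Q‖) : ‖P / Q‖ ≤ d / c := by
  rw [norm_div, div_le_div_iff₀ hQ hc]
  linarith

/-- The sum lives on the intersection of the domains, while the multiplier might have a larger one
because of cancellation in `∂ + 𝒮`. The bound of `|w|` by the symbol excludes this. -/
theorem maps_aPlus_iff (h : SmallParam α ε) {f g : L2w (ε * α)} :
    Maps (aPlus (ε * α) (gam ε)) f g ↔ Maps (fourierMul (ε * α) (aSym (gam ε))) f g := by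
  constructor
  · intro hm
    obtain ⟨g₁, g₂, h1, h2, rfl⟩ := maps_add_iff.1 hm
    exact maps_fourierMul_add h1 h2
  · intro hm
    have hε := h.ε_pos
    have hα := h.α_pos
    obtain ⟨g₁, h1⟩ := exists_maps_of_symbol_le (P := fun w => Complex.I * w)
      (c := 128000 / (α * ε ^ 2)) measurable_dSym (fun ξ => by
        have h1 := (h.spectralPoint_zero.aPlus_bounds ξ).2.1
        rw [mul_zero, zero_sub, norm_neg] at h1
        rw [norm_mul, Complex.norm_I, one_mul, div_mul_eq_mul_div, le_div_iff₀ (by positivity)]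
        linarith) hm
    obtain ⟨g₂, h2, -⟩ := maps_scOp_of_maps_dOp h h1
    have h3 : Maps (fourierMul (ε * α) (aSym (gam ε))) f (g₁ + g₂) := maps_fourierMul_add h1 h2
    exact maps_add_iff.2 ⟨g₁, g₂, h1, h2, h3.unique hm⟩

theorem exists_isResolvent_aPlus (h : SpectralPoint α ε z) :
    ∃ R : L2w (ε * α) →L[ℂ] L2w (ε * α),
      IsResolvent (aPlus (ε * α) (gam ε)) ((ε : ℂ) ^ 3 * z) R ∧
      (∀ f, Maps (fourierMul (ε * α) fun w => ((ε : ℂ) ^ 3 * z - aSym (gam ε) w)⁻¹) f (R f)) ∧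
      ‖R‖ ≤ 80 / (α * ε ^ 3) := by
  have hpos : 0 < α * ε ^ 3 := mul_pos h.α_pos (pow_pos h.ε_pos 3)
  obtain ⟨R, hR, hR'⟩ := exists_fourierMul_clm (ε * α)
    (P := fun w => ((ε : ℂ) ^ 3 * z - aSym (gam ε) w)⁻¹)
    (measurable_const.sub measurable_aSym).inv (by positivity : 0 ≤ 80 / (α * ε ^ 3)) (fun ξ => by
      rw [inv_eq_one_div]
      refine norm_div_le_of_mul_le hpos (h.aPlus_pos ξ) ?_
      rw [norm_one, mul_one]
      exact h.aPlus_lower ξ)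
  exact ⟨R, (isResolvent_fourierMul hR' fun ξ => norm_pos_iff.1 (h.aPlus_pos ξ)).congr
    fun f g => maps_aPlus_iff h.toSmallParam, hR', hR⟩

theorem maps_aMinus_iff (h : SpectralPoint α ε z) {f g : L2w (ε * α)} :
    Maps (dOp (ε * α) - scOp (ε * α) (gam ε)) f g ↔
      Maps (fourierMul (ε * α) fun w => Complex.I * w - scSymbol (gam ε) w) f g := by
  constructor
  · intro hm
    obtain ⟨g₁, g₂, h1, h2, rfl⟩ := maps_sub_iff.1 hm
    exact maps_fourierMul_sub h1 h2
  · intro hm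
    have hε := h.ε_pos
    have hα := h.α_pos
    obtain ⟨g₁, h1⟩ := exists_maps_of_symbol_le (P := fun w => Complex.I * w)
      (c := 3 / (α * ε)) measurable_dSym (fun ξ => by
        have h1 := (h.spectralPoint_zero.aMinus_bounds ξ).2
        rw [mul_zero, zero_sub, norm_neg] at h1
        rw [norm_mul, Complex.norm_I, one_mul, div_mul_eq_mul_div, le_div_iff₀ (by positivity)]
        linarith) hm
    obtain ⟨g₂, h2, -⟩ := maps_scOp_of_maps_dOp h.toSmallParam h1
    have h3 : Maps (fourierMul (ε * α) fun w => Complex.I * w - scSymbol (gam ε) w) f (g₁ - g₂) :=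
      maps_fourierMul_sub h1 h2
    exact maps_sub_iff.2 ⟨g₁, g₂, h1, h2, h3.unique hm⟩

/-- The bound on `∂ R` is kept because the perturbation leading to `𝒜₂₂` is of first order. -/
theorem exists_isResolvent_aMinus (h : SpectralPoint α ε z) :
    ∃ R : L2w (ε * α) →L[ℂ] L2w (ε * α),
      IsResolvent (dOp (ε * α) - scOp (ε * α) (gam ε)) ((ε : ℂ) ^ 3 * z) R ∧
      ‖R‖ ≤ 2 / (α * ε) ∧
      ∀ f f', Maps (dOp (ε * α)) (R f) f' → ‖f'‖ ≤ 3 / (α * ε) * ‖f‖ := by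
  have hpos : 0 < α * ε := mul_pos h.α_pos h.ε_pos
  obtain ⟨R, hR, hR'⟩ := exists_fourierMul_clm (ε * α)
    (P := fun w => ((ε : ℂ) ^ 3 * z - (Complex.I * w - scSymbol (gam ε) w))⁻¹)
    (measurable_const.sub (measurable_dSym.sub measurable_scSymbol)).inv
    (by positivity : 0 ≤ 2 / (α * ε)) (fun ξ => by
      rw [inv_eq_one_div]
      refine norm_div_le_of_mul_le hpos (h.aMinus_pos ξ) ?_
      rw [norm_one, mul_one]
      exact (h.aMinus_bounds ξ).1)
  refine ⟨R, (isResolvent_fourierMul hR' fun ξ => norm_pos_iff.1 (h.aMinus_pos ξ)).congr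
    fun f g => maps_aMinus_iff h, hR, fun f f' hf => ?_⟩
  refine norm_le_of_maps_fourierMul (fun ξ => ?_) (maps_fourierMul_comp (hR' f) hf)
  rw [← div_eq_mul_inv]
  refine norm_div_le_of_mul_le hpos (h.aMinus_pos ξ) ?_
  rw [norm_mul, Complex.norm_I, one_mul, mul_assoc]
  exact (h.aMinus_bounds ξ).2

/-- The perturbation of `∂ - 𝒮`, composed with its resolvent, has norm at most `6 C ε² · 3/(αε) +
800 C ε³ · 2/(αε)`, and `4000 C ε ≤ α` makes this less than `1/2`. -/
theorem exists_isResolvent_aTwoTwo (h : SpectralPoint α ε z) (hc : CoefBounds ε C ω) (hC1 : 1 ≤ C)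
    (hC : 4000 * C * ε ≤ α) :
    ∃ R : L2w (ε * α) →L[ℂ] L2w (ε * α),
      IsResolvent (aTwoTwo (ε * α) (gam ε) ω) ((ε : ℂ) ^ 3 * z) R ∧ ‖R‖ ≤ 4 / (α * ε) := by
  have hε := h.ε_pos
  have hα := h.α_pos
  have hα1 := h.α_le
  have hε1 := h.ε_le
  have hpos : 0 < α * ε := mul_pos hα hε
  have hC2 : C * ε ^ 2 ≤ 1 := by nlinarith [mul_pos (by linarith : 0 < C) hε]
  have hC0 : 0 ≤ C := by linarith
  obtain ⟨R, hR, hRb, hRd⟩ := exists_isResolvent_aMinus h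
  have hdom : ∀ f, f ∈ (aTwoTwo (ε * α) (gam ε) ω).domain ↔
      f ∈ (dOp (ε * α) - scOp (ε * α) (gam ε)).domain := fun f => by
    constructor
    · intro hf
      obtain ⟨f', hf'⟩ := exists_dOp_of_maps_aTwoTwo (maps_of_mem hf)
      obtain ⟨s, hs, -⟩ := maps_scOp_of_maps_dOp h.toSmallParam hf'
      exact (maps_sub_iff.2 ⟨f', s, hf', hs, rfl⟩).mem
    · intro hf
      obtain ⟨y, s, hy, -⟩ := exists_maps_aTwoTwo h.toSmallParam hc hC0 hC2 (maps_of_mem hf.1)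
      exact hy.mem
  have hE : ∀ f y b, Maps (aTwoTwo (ε * α) (gam ε) ω) (R f) y →
      Maps (dOp (ε * α) - scOp (ε * α) (gam ε)) (R f) b → ‖y - b‖ ≤ 1 / 2 * ‖f‖ := by
    intro f y b hy hb
    obtain ⟨f', s, hf', hs, rfl⟩ := maps_sub_iff.1 hb
    obtain ⟨y', s', hy', hs', e⟩ := exists_maps_aTwoTwo h.toSmallParam hc hC0 hC2 hf'
    rw [hy.unique hy', hs.unique hs']
    refine e.trans ?_
    have e1 := hRd f f' hf'
    have e2 : ‖R f‖ ≤ 2 / (α * ε) * ‖f‖ := (R.le_opNorm f).trans (by gcongr)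
    have e3 : 6 * C * ε ^ 2 * ‖f'‖ ≤ 6 * C * ε ^ 2 * (3 / (α * ε) * ‖f‖) := by gcongr
    have e4 : 800 * C * ε ^ 3 * ‖R f‖ ≤ 800 * C * ε ^ 3 * (2 / (α * ε) * ‖f‖) := by gcongr
    have e5 : 6 * C * ε ^ 2 * (3 / (α * ε) * ‖f‖) + 800 * C * ε ^ 3 * (2 / (α * ε) * ‖f‖)
        = ((18 * C * ε + 1600 * C * ε * ε) / α) * ‖f‖ := by
      field_simp
      ring
    have e6 : (18 * C * ε + 1600 * C * ε * ε) / α ≤ 1 / 2 := by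
      rw [div_le_iff₀ hα]
      have : 0 ≤ C * ε := by positivity
      nlinarith
    have e7 := mul_le_mul_of_nonneg_right e6 (norm_nonneg f)
    linarith
  obtain ⟨R', hR', hb⟩ := exists_isResolvent_of_perturbation hR hdom hE
  refine ⟨R', hR', hb.trans ?_⟩
  calc 2 * ‖R‖ ≤ 2 * (2 / (α * ε)) := by gcongr
    _ = _ := by ring

end Resolvents

/-! ### The linearized KdV operator -/

section Kdv

variable {α : ℝ} {z : ℂ}

theorem measurable_kdvSym {ε : ℝ} : Measurable (kdvSym ε) := by
  unfold kdvSym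
  fun_prop

theorem kdvSym_mul (ε : ℝ) (w : ℂ) : kdvSym ε (ε * w) = ε ^ 3 * kdvSym 1 w := by
  simp only [kdvSym]
  push_cast
  ring

/-- The unscaled bound follows by homogeneity from the scaled one; `ε = 1/4` is merely an admissible
value. -/
theorem le_norm_sub_kdvSym_one (hα0 : 0 < α) (hα : α ≤ 1 / 2) (hz : -(1 / 6) * α ≤ z.re) (ξ : ℝ) :
    α * (1 + (2 * Real.pi * ξ) ^ 2) ≤ 4 * ‖z - kdvSym 1 (shiftedFreq α ξ)‖ := by
  have h : SmallParam α (1 / 4) := ⟨hα0, hα, by norm_num, le_rfl⟩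
  have h1 := h.le_norm_sub_kdvSym (k := 1 / 4 * (2 * Real.pi * ξ)) hz
  have e : (((1 / 4 * (2 * Real.pi * ξ) : ℝ) : ℂ) + ((1 / 4 * α : ℝ) : ℂ) * Complex.I)
      = ((1 / 4 : ℝ) : ℂ) * shiftedFreq α ξ := by
    simp only [shiftedFreq]
    push_cast
    ring
  rw [e, kdvSym_mul, ← mul_sub, norm_mul, norm_pow, Complex.norm_real,
    Real.norm_of_nonneg (by norm_num)] at h1
  nlinarith

theorem norm_sub_kdvSym_one_pos (hα0 : 0 < α) (hα : α ≤ 1 / 2) (hz : -(1 / 6) * α ≤ z.re)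
    (ξ : ℝ) : 0 < ‖z - kdvSym 1 (shiftedFreq α ξ)‖ := by
  have h1 := le_norm_sub_kdvSym_one hα0 hα hz ξ
  have h2 : 0 < α * (1 + (2 * Real.pi * ξ) ^ 2) := by positivity
  linarith

/-- The cubic term dominates the linear one. Hence the domain of the multiplier is that of `∂³`, as
needed for iterated composition. -/
theorem norm_pow_three_le_kdvSym (w : ℂ) : ‖w‖ ^ 3 ≤ 12 * ‖kdvSym 1 w‖ + 6 := by
  have e : Complex.I * w ^ 3 = 6 * kdvSym 1 w - 3 * (Complex.I * w) := by
    simp only [kdvSym]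
    push_cast
    ring
  have h1 := congrArg norm e
  rw [norm_mul, Complex.norm_I, one_mul, norm_pow] at h1
  have h2 := norm_sub_le (6 * kdvSym 1 w) (3 * (Complex.I * w))
  rw [← h1, norm_mul, norm_mul, norm_mul, Complex.norm_I, one_mul, Complex.norm_ofNat,
    Complex.norm_ofNat] at h2
  have h0 := norm_nonneg w
  have h3 : 3 * ‖w‖ ≤ ‖w‖ ^ 3 / 2 + 3 := by
    nlinarith [mul_nonneg h0 (sq_nonneg (‖w‖ - 7 / 5)), sq_nonneg (‖w‖ - 7 / 5)]
  linarith

theorem maps_kdvOp_iff {f g : L2w α} :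
    Maps (kdvOp α) f g ↔ Maps (fourierMul α (kdvSym 1)) f g := by
  have key : ∀ {g₁ g₂ g₃ : L2w α}, Maps (dOp α) f g₁ → Maps (dOp α) g₁ g₂ → Maps (dOp α) g₂ g₃ →
      Maps (fourierMul α (kdvSym 1)) f ((1 / 2 : ℂ) • g₁ - (1 / 6 : ℂ) • g₃) := by
    intro g₁ g₂ g₃ h1 h2 h3
    refine maps_fourierMul_congr (maps_fourierMul_sub (maps_fourierMul_smul (1 / 2) h1)
      (maps_fourierMul_smul (1 / 6) (maps_fourierMul_comp (maps_fourierMul_comp h1 h2) h3)))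
      fun ξ => ?_
    simp only [kdvSym]
    have := Complex.I_sq
    push_cast
    linear_combination (-(1 / 6) * Complex.I * shiftedFreq α ξ ^ 3) * this
  have hpow : ∀ w : ℂ, ‖w‖ ≤ 1 + ‖w‖ ^ 3 ∧ ‖w‖ ^ 2 ≤ 1 + ‖w‖ ^ 3 := fun w => by
    have h0 := norm_nonneg w
    constructor <;> nlinarith [mul_nonneg h0 (sq_nonneg (‖w‖ - 1)), sq_nonneg (‖w‖ - 1),
      mul_nonneg h0 h0]
  constructor
  · intro hm
    obtain ⟨_, _, h1, h2, rfl⟩ := maps_sub_iff.1 hm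
    obtain ⟨g₁, h3, rfl⟩ := maps_smul_iff.1 h1
    obtain ⟨g₃, h4, rfl⟩ := maps_smul_iff.1 h2
    obtain ⟨g₂, h5, h6⟩ := maps_mul_iff.1 h4
    obtain ⟨g₁', h7, h8⟩ := maps_mul_iff.1 h5
    rw [h7.unique h3] at h8
    exact key h3 h8 h6
  · intro hm
    obtain ⟨g₁, h1⟩ := exists_maps_of_symbol_le (P := fun w => Complex.I * w) (c := 12)
      measurable_dSym (fun ξ => by
        have h2 := norm_pow_three_le_kdvSym (shiftedFreq α ξ)
        have h3 := (hpow (shiftedFreq α ξ)).1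
        rw [norm_mul, Complex.norm_I, one_mul]
        linarith) hm
    obtain ⟨g₂, h2⟩ := exists_maps_of_symbol_le (P := fun w => Complex.I * w * (Complex.I * w))
      (c := 12) (measurable_dSym.mul measurable_dSym) (fun ξ => by
        have h2 := norm_pow_three_le_kdvSym (shiftedFreq α ξ)
        have h3 := (hpow (shiftedFreq α ξ)).2
        rw [norm_mul, norm_mul, Complex.norm_I, one_mul]
        linarith) hm
    obtain ⟨g₃, h3⟩ := exists_maps_of_symbol_le
      (P := fun w => Complex.I * w * (Complex.I * w * (Complex.I * w)))
      (c := 12) (measurable_dSym.mul (measurable_dSym.mul measurable_dSym)) (fun ξ => by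
        have h2 := norm_pow_three_le_kdvSym (shiftedFreq α ξ)
        simp only [norm_mul, Complex.norm_I, one_mul]
        linarith) hm
    have h12 : Maps (dOp α) g₁ g₂ := by
      refine maps_dOp_iff.2 ?_
      filter_upwards [maps_dOp_iff.1 h1, maps_fourierMul_iff.1 h2] with ξ e1 e2
      rw [e1, e2]
      ring
    have h23 : Maps (dOp α) g₂ g₃ := by
      refine maps_dOp_iff.2 ?_
      filter_upwards [maps_fourierMul_iff.1 h2, maps_fourierMul_iff.1 h3] with ξ e1 e2
      rw [e1, e2]
      ring
    refine maps_sub_iff.2 ⟨_, _, maps_smul_iff.2 ⟨g₁, h1, rfl⟩, maps_smul_iff.2 ⟨g₃,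
      maps_mul_iff.2 ⟨g₂, maps_mul_iff.2 ⟨g₁, h1, h12⟩, h23⟩, rfl⟩, (key h1 h12 h23).unique hm⟩

theorem exists_isResolvent_kdvOp (hα0 : 0 < α) (hα : α ≤ 1 / 2) (hz : -(1 / 6) * α ≤ z.re) :
    ∃ R : L2w α →L[ℂ] L2w α, IsResolvent (kdvOp α) z R ∧
      ∀ f, Maps (fourierMul α fun w => (z - kdvSym 1 w)⁻¹) f (R f) := by
  obtain ⟨R, -, hR'⟩ := exists_fourierMul_clm α (P := fun w => (z - kdvSym 1 w)⁻¹)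
    (measurable_const.sub measurable_kdvSym).inv (by positivity : 0 ≤ 4 / α) (fun ξ => by
      rw [inv_eq_one_div]
      refine norm_div_le_of_mul_le hα0 (norm_sub_kdvSym_one_pos hα0 hα hz ξ) ?_
      have := le_norm_sub_kdvSym_one hα0 hα hz ξ
      rw [norm_one]
      nlinarith [mul_nonneg hα0.le (sq_nonneg (2 * Real.pi * ξ))])
  exact ⟨R, (isResolvent_fourierMul hR' fun ξ =>
    norm_pos_iff.1 (norm_sub_kdvSym_one_pos hα0 hα hz ξ)).congr fun f g => maps_kdvOp_iff, hR'⟩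

/-- The operator `W₀(z)` is `I + M (3/2 Θ)`, with `M` the bounded multiplier
`(z - ½ ∂ + ⅙ ∂³)⁻¹ ∂`. -/
theorem exists_isBoundedExtension_wZero (hα0 : 0 < α) (hα : α ≤ 1 / 2)
    (hz : -(1 / 6) * α ≤ z.re) :
    ∃ W₀ : L2w α →L[ℂ] L2w α, IsBoundedExtension W₀ (wZero α z) ∧
      ∀ f k g, Maps (multOp α fun x => 3 / 2 * kdvProfile x) f k →
        Maps (fourierMul α fun w => Complex.I * w / (z - kdvSym 1 w)) k g → W₀ f = f + g := by
  obtain ⟨R, hR, hR'⟩ := exists_isResolvent_kdvOp hα0 hα hz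
  obtain ⟨M, -, hM⟩ := exists_fourierMul_clm α (P := fun w => Complex.I * w / (z - kdvSym 1 w))
    (measurable_dSym.div (measurable_const.sub measurable_kdvSym))
    (by positivity : 0 ≤ 4 / α) (fun ξ => by
      refine norm_div_le_of_mul_le hα0 (norm_sub_kdvSym_one_pos hα0 hα hz ξ) ?_
      refine le_trans ?_ (le_norm_sub_kdvSym_one hα0 hα hz ξ)
      rw [norm_mul, Complex.norm_I, one_mul]
      refine mul_le_mul_of_nonneg_left ?_ hα0.le
      have h1 : ‖shiftedFreq α ξ‖ ≤ |2 * Real.pi * ξ| + α := by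
        refine (norm_add_le _ _).trans ?_
        rw [norm_mul, Complex.norm_I, mul_one, Complex.norm_real, Complex.norm_real,
          Real.norm_eq_abs, Real.norm_of_nonneg hα0.le]
      nlinarith [sq_abs (2 * Real.pi * ξ), sq_nonneg (|2 * Real.pi * ξ| - 1 / 2)])
  obtain ⟨C, hC⟩ := exists_inWiener_kdvProfile
  obtain ⟨φ, h1, h2, h3, -⟩ := hC.const_mul (3 / 2)
  have hs : HasSpectrum (fun x => 3 / 2 * kdvProfile x) 0 φ := ⟨h1, fun x => by
    rw [← h3 x]
    simp⟩
  have hφ : Integrable fun κ => |κ| * ‖φ κ‖ := by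
    refine h2.mono' (continuous_abs.aestronglyMeasurable.mul h1.1.norm) (ae_of_all _ fun κ => ?_)
    rw [Real.norm_of_nonneg (by positivity)]
    refine mul_le_mul_of_nonneg_right ?_ (norm_nonneg _)
    simp only [linWeight]
    nlinarith [abs_nonneg κ, Real.pi_gt_three]
  obtain ⟨Q, -, hQ⟩ := exists_multOp_clm α hs.measurable
    (add_nonneg (abs_nonneg 0) (integral_nonneg fun κ => norm_nonneg _)) hs.abs_le
  have hRM : ∀ {k k'}, Maps (dOp α) k k' → R k' = M k := fun {k k'} hk =>
    (maps_fourierMul_congr (Q := fun w => Complex.I * w / (z - kdvSym 1 w))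
      (maps_fourierMul_comp hk (hR' k')) fun ξ => by rw [div_eq_mul_inv, mul_comm]).unique (hM k)
  refine ⟨1 + M ∘L Q, ⟨?_, fun f => ?_⟩, fun f k g hk hg => ?_⟩
  · refine (dense_fourierMul_domain α measurable_dSym).mono fun f hf => ?_
    obtain ⟨k', hk'⟩ := hs.exists_maps_fourierMul hφ measurable_dSym (C := 2 * Real.pi)
      Real.two_pi_pos.le (fun η ξ => by
        have h3 := SmallParam.dSym_lipschitz α η (η - ξ)
        rw [sub_sub_cancel] at h3
        have h4 := norm_le_norm_add_norm_sub' (Complex.I * shiftedFreq α η)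
          (Complex.I * shiftedFreq α ξ)
        linarith) (maps_of_mem hf) (hQ f)
    exact (maps_add_iff.2 ⟨_, _, maps_scalarOp_iff.2 rfl,
      maps_mul_iff.2 ⟨_, maps_mul_iff.2 ⟨_, hQ f, hk'⟩, hR.maps_resolventOp _⟩, rfl⟩).mem
  · obtain ⟨_, g, e1, e2, e3⟩ := maps_add_iff.1 (maps_of_mem f.2)
    rw [maps_scalarOp_iff, one_smul] at e1
    obtain ⟨k', e4, e5⟩ := maps_mul_iff.1 e2
    obtain ⟨k, e6, e7⟩ := maps_mul_iff.1 e4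
    rw [hR.maps_resolventOp_iff] at e5
    change (f : L2w α) + M (Q f) = _
    rw [← e3, ← e1, e5, hRM e7, e6.unique (hQ f)]
  · change f + M (Q f) = _
    rw [hg.unique (hM k), hk.unique (hQ f)]

end Kdv

/-! ### Comparison of `W` with `W₀` -/

theorem Maps.add {E : Type*} [AddCommGroup E] [Module ℂ E] {T : E →ₗ.[ℂ] E} {f f' g g' : E}
    (h : Maps T f g) (h' : Maps T f' g') : Maps T (f + f') (g + g') := by
  obtain ⟨h1, rfl⟩ := h
  obtain ⟨h2, rfl⟩ := h'
  exact ⟨T.domain.add_mem h1 h2, T.map_add ⟨f, h1⟩ ⟨f', h2⟩⟩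

theorem Maps.sub {E : Type*} [AddCommGroup E] [Module ℂ E] {T : E →ₗ.[ℂ] E} {f f' g g' : E}
    (h : Maps T f g) (h' : Maps T f' g') : Maps T (f - f') (g - g') := by
  obtain ⟨h1, rfl⟩ := h
  obtain ⟨h2, rfl⟩ := h'
  exact ⟨T.domain.sub_mem h1 h2, T.map_sub ⟨f, h1⟩ ⟨f', h2⟩⟩

theorem maps_multOp_sub {a : ℝ} {g₁ g₂ : ℝ → ℝ} {f k₁ k₂ : L2w a} (h1 : Maps (multOp a g₁) f k₁)
    (h2 : Maps (multOp a g₂) f k₂) : Maps (multOp a fun x => g₁ x - g₂ x) f (k₁ - k₂) := by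
  rw [maps_multOp_iff] at *
  filter_upwards [h1, h2, Lp.coeFn_sub k₁ k₂] with x e1 e2 e3
  rw [e3, Pi.sub_apply, e1, e2]
  push_cast
  ring

theorem maps_multOp_sub_one {a : ℝ} {g : ℝ → ℝ} {f k : L2w a} (h : Maps (multOp a g) f k) :
    Maps (multOp a fun x => g x - 1) f (k - f) :=
  maps_multOp_sub h (maps_multOp_iff.2 (ae_of_all _ fun x => by simp))

section Comparison

variable {α ε C : ℝ} {ω θ : ℝ → ℝ} {z : ℂ}

theorem sq_freq_le (hε : 0 < ε) (κ : ℝ) :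
    (2 * Real.pi * |κ|) ^ 2 ≤ ε ^ 2 * polyWeight ε 2 κ := by
  rw [polyWeight, ← mul_pow, mul_add, mul_one, mul_div_cancel₀ _ hε.ne']
  have : 0 ≤ 2 * Real.pi * |κ| := by positivity
  exact pow_le_pow_left₀ this (by linarith) 2

/-- The kernel of `(ε³ z - 𝒜₊)⁻¹ [𝒜₊, q]`. -/
theorem SpectralPoint.norm_commutator_kernel_le (h : SpectralPoint α ε z) (η κ : ℝ) :
    ‖((ε : ℂ) ^ 3 * z - aSym (gam ε) (shiftedFreq (ε * α) η))⁻¹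
      * (aSym (gam ε) (shiftedFreq (ε * α) η) - aSym (gam ε) (shiftedFreq (ε * α) (η - κ)))‖
      ≤ 22000000 / (α * ε) * polyWeight ε 2 κ := by
  have hε := h.ε_pos
  have hα := h.α_pos
  have hε1 := h.ε_le
  have hL := h.aPlus_pos η
  have b0 := h.aPlus_lower η
  obtain ⟨-, b1, b2⟩ := h.aPlus_bounds η
  have b3 := norm_shiftedFreq_sub (ε * α) η κ
  have b4 := h.norm_rSym_sub_shiftedFreq_le η κ
  have f1 := NearOne.freq_le hε κ
  have f2 := sq_freq_le hε κ
  rw [norm_mul, norm_inv, ← div_eq_inv_mul, div_le_iff₀ hL, div_mul_eq_mul_div, div_mul_eq_mul_div,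
    le_div_iff₀ (by positivity), aSym_eq (h.shiftedFreq_ne_zero (η - κ))]
  nth_rewrite 1 [aSym_eq (h.shiftedFreq_ne_zero η)]
  set L := ‖(ε : ℂ) ^ 3 * z - aSym (gam ε) (shiftedFreq (ε * α) η)‖
  set w := shiftedFreq (ε * α) η
  set w' := shiftedFreq (ε * α) (η - κ)
  set r := rSym (gam ε) w
  set r' := rSym (gam ε) w'
  set F := 2 * Real.pi * |κ|
  set V := polyWeight ε 2 κ
  have hF : 0 ≤ F := by positivity
  have hV : 0 ≤ V := (isWeight_polyWeight hε 2).nonneg κ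
  -- Each of the three terms is matched with one resolvent bound: `1 - r` with that for `(1 - r) R`,
  -- the term quadratic in `κ` with that for `R`, and `w (r - r')` with that for `∂ R`.
  have e : Complex.I * w * (1 - r) - Complex.I * w' * (1 - r')
      = Complex.I * ((w - w') * (1 - r) + (w - w') * (r - r') - w * (r - r')) := by ring
  have n1 : ‖Complex.I * w * (1 - r) - Complex.I * w' * (1 - r')‖
      ≤ F * ‖1 - r‖ + F * (168 * F) + ‖w‖ * (168 * F) := by
    rw [e, norm_mul, Complex.norm_I, one_mul]
    refine (norm_sub_le _ _).trans (add_le_add ((norm_add_le _ _).trans (add_le_add ?_ ?_)) ?_)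
    · rw [norm_mul, b3]
    · rw [norm_mul, b3]
      gcongr
    · rw [norm_mul]
      gcongr
  have n2 : F * ‖1 - r‖ * (α * ε) ≤ 128000 * (V * L) := by
    calc F * ‖1 - r‖ * (α * ε) = F * (α * (ε * ‖1 - r‖)) := by ring
      _ ≤ (ε * V) * (128000 * L) := by gcongr
      _ ≤ (1 * V) * (128000 * L) := by gcongr; linarith
      _ = _ := by ring
  have n3 : F * (168 * F) * (α * ε) ≤ 13440 * (V * L) := by
    calc F * (168 * F) * (α * ε) = 168 * (α * ε) * F ^ 2 := by ring
      _ ≤ 168 * (α * ε) * (ε ^ 2 * V) := by gcongr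
      _ = 168 * V * (α * ε ^ 3) := by ring
      _ ≤ 168 * V * (80 * L) := by gcongr
      _ = _ := by ring
  have n4 : ‖w‖ * (168 * F) * (α * ε) ≤ 168 * 128000 * (V * L) := by
    calc ‖w‖ * (168 * F) * (α * ε) ≤ ‖w‖ * (168 * (ε * V)) * (α * ε) := by gcongr
      _ = 168 * V * (α * (ε ^ 2 * ‖w‖)) := by ring
      _ ≤ 168 * V * (128000 * L) := by gcongr
      _ = _ := by ring
  have n5 := mul_le_mul_of_nonneg_right n1 (by positivity : 0 ≤ α * ε)
  have n6 : 0 ≤ V * L := mul_nonneg hV hL.le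
  nlinarith

/-- On derivatives the resolvent loses only `ε⁻²` instead of `ε⁻³`; this is the use of writing `R₂`
as a derivative. -/
theorem SpectralPoint.norm_le_of_maps_dOp (h : SpectralPoint α ε z) {x y g : L2w (ε * α)}
    (hx : Maps (dOp (ε * α)) x y)
    (hy : Maps (fourierMul (ε * α) fun w => ((ε : ℂ) ^ 3 * z - aSym (gam ε) w)⁻¹) y g) :
    ‖g‖ ≤ 128000 / (α * ε ^ 2) * ‖x‖ := by
  have hpos : 0 < α * ε ^ 2 := mul_pos h.α_pos (pow_pos h.ε_pos 2)
  refine norm_le_of_maps_fourierMul (fun ξ => ?_) (maps_fourierMul_comp hx hy)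
  rw [mul_comm, ← div_eq_mul_inv]
  refine norm_div_le_of_mul_le hpos (h.aPlus_pos ξ) ?_
  rw [norm_mul, Complex.norm_I, one_mul, mul_assoc]
  exact (h.aPlus_bounds ξ).2.1

/-- Bounding `J₁₁` by `ε³` and the resolvent by `ε⁻³` would only give `O(1)`. Since `q' = [∂, q]`,
one has `R₂ + R₁ + [𝒮, q] = ∂ G + (R₁ - q') + [𝒜₊, q]`, and each term gains at least one power of
`ε`. -/
theorem exists_maps_jOneOne (h : SpectralPoint α ε z) (hc : CoefBounds ε C ω) (hC0 : 0 ≤ C)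
    (hC : C * ε ^ 2 ≤ 1) {f f' : L2w (ε * α)} (hf : Maps (dOp (ε * α)) f f')
    {R : L2w (ε * α) →L[ℂ] L2w (ε * α)} (hRb : ‖R‖ ≤ 80 / (α * ε ^ 3))
    (hR : ∀ f, Maps (fourierMul (ε * α) fun w => ((ε : ℂ) ^ 3 * z - aSym (gam ε) w)⁻¹) f (R f)) :
    ∃ y, Maps (jOneOne (ε * α) (gam ε) ω) f y ∧ ‖R y‖ ≤ 22000000 * (C * ε / α) * ‖f‖ := by
  have hε := h.ε_pos
  have hα := h.α_pos
  have hε1 := h.ε_le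
  have h0 := h.toSmallParam
  obtain ⟨φp, hp⟩ := hc.p_wiener.exists_nearOne
  obtain ⟨φq, hq⟩ := hc.q_wiener.exists_nearOne
  obtain ⟨s, hs, -⟩ := maps_scOp_of_maps_dOp h0 hf
  obtain ⟨y₂, -, G, -, hy₂, hG, bG, -, -⟩ := exists_maps_rTwo h0 hp hC hf
  obtain ⟨y₁, hy₁, -⟩ := exists_maps_rOne hc hε hC0 f
  obtain ⟨k, hk⟩ := hq.exists_maps hε hC f
  obtain ⟨k', hk'⟩ := hq.exists_maps_fourierMul hε measurable_dSym zero_le_one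
    (SmallParam.dSym_lipschitz _) hf hk
  obtain ⟨k'', hk''⟩ := hq.exists_maps hε hC f'
  obtain ⟨l', hl'⟩ := hq.exists_maps_fourierMul hε measurable_scSymbol (by norm_num)
    h0.scSymbol_lipschitz hs hk
  obtain ⟨l'', hl''⟩ := hq.exists_maps hε hC s
  have hcomm : Maps (qComm (ε * α) (gam ε) ω) f (l' - l'') :=
    maps_opComm_iff.2 ⟨k, l', s, l'', hk, hl', hs, hl'', rfl⟩
  have hd := hq.spectrum.maps_deriv (hq.integrable_abs hε) hf hk hk' hk''
  have b1 : ‖y₁ - (k' - k'')‖ ≤ C * ε ^ 5 * ‖f‖ :=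
    norm_le_of_maps_multOp hc.rOne_sub_le (maps_multOp_sub hy₁ hd)
  have hA : Maps (fourierMul (ε * α) (aSym (gam ε))) f (f' + s) := maps_fourierMul_add hf hs
  have hAk : Maps (fourierMul (ε * α) (aSym (gam ε))) k (k' + l') := maps_fourierMul_add hk' hl'
  have hker := hq.spectrum.spectral_commutator hA hk hAk (hk''.add hl'')
  have b2 : ‖R (k' + l' - (k'' + l''))‖ ≤ 22000000 / (α * ε) * (C * ε ^ 2) * ‖f‖ := by
    refine hq.norm_le_of_kernel hε (by positivity)
      (b := fun η ξ => ((ε : ℂ) ^ 3 * z - aSym (gam ε) (shiftedFreq (ε * α) η))⁻¹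
        * (aSym (gam ε) (shiftedFreq (ε * α) η) - aSym (gam ε) (shiftedFreq (ε * α) ξ)))
      h.norm_commutator_kernel_le ?_
    filter_upwards [hker, maps_fourierMul_iff.1 (hR (k' + l' - (k'' + l'')))] with η e1 e2
    rw [e2, e1, ← integral_const_mul]
    refine integral_congr_ae (ae_of_all _ fun κ => ?_)
    ring
  have b3 := h.norm_le_of_maps_dOp hG (hR y₂)
  have b4 : 128000 / (α * ε ^ 2) * ‖G‖ ≤ 128000 / (α * ε ^ 2) * (168 * C * ε ^ 3 * ‖f‖) := by
    gcongr
  have b5 : ‖R (y₁ - (k' - k''))‖ ≤ 80 / (α * ε ^ 3) * (C * ε ^ 5 * ‖f‖) :=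
    (R.le_opNorm _).trans (mul_le_mul hRb b1 (norm_nonneg _) (by positivity))
  refine ⟨_, maps_smul_iff.2 ⟨_, maps_add_iff.2 ⟨_, _, maps_add_iff.2 ⟨y₂, y₁, hy₂, hy₁, rfl⟩,
    hcomm, rfl⟩, rfl⟩, ?_⟩
  have e : y₂ + y₁ + (l' - l'') = y₂ + (y₁ - (k' - k'')) + (k' + l' - (k'' + l'')) := by abel
  rw [e, map_smul, map_add, map_add, norm_smul]
  have e1 : ‖(-1 / 2 : ℂ)‖ = 1 / 2 := by norm_num
  rw [e1]
  have e2 := norm_add_le (R y₂ + R (y₁ - (k' - k''))) (R (k' + l' - (k'' + l'')))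
  have e3 := norm_add_le (R y₂) (R (y₁ - (k' - k'')))
  have c1 : 128000 / (α * ε ^ 2) * (168 * C * ε ^ 3 * ‖f‖)
      = 21504000 * (C * ε / α) * ‖f‖ := by
    field_simp
    ring
  have c2 : 80 / (α * ε ^ 3) * (C * ε ^ 5 * ‖f‖) ≤ 80 * (C * ε / α) * ‖f‖ := by
    have : 80 / (α * ε ^ 3) * (C * ε ^ 5 * ‖f‖) = 80 * (C * ε / α) * ‖f‖ * ε := by field_simp
    rw [this]
    exact mul_le_of_le_one_right (by positivity) (by linarith)
  have c3 : 22000000 / (α * ε) * (C * ε ^ 2) * ‖f‖ = 22000000 * (C * ε / α) * ‖f‖ := by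
    field_simp
  have c4 : 0 ≤ C * ε / α * ‖f‖ := by positivity
  linarith

/-- Substituting `𝒮 = 𝒜₊ - ∂` gives `𝒰 = ∂ ((p - 1) - (q - 1)) + 𝒜₊ (q - 1)`. In the first term the
leading part `-(3/2) ω` is split off, and the second is small because `𝒜₊` times its resolvent is
only of size `ε⁻¹`. -/
theorem exists_maps_uuOp (h : SpectralPoint α ε z) (hc : CoefBounds ε C (strain ε θ))
    (hC : C * ε ^ 2 ≤ 1) {f f' k y : L2w (ε * α)} (hf : Maps (dOp (ε * α)) f f')
    {R : L2w (ε * α) →L[ℂ] L2w (ε * α)}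
    (hR : ∀ f, Maps (fourierMul (ε * α) fun w => ((ε : ℂ) ^ 3 * z - aSym (gam ε) w)⁻¹) f (R f))
    (hk : Maps (multOp (ε * α) fun x => 3 / 2 * θ (ε * x)) f k)
    (hy : Maps (fourierMul (ε * α) fun w => (ε : ℂ) ^ 2 * (Complex.I * w)
      / ((ε : ℂ) ^ 3 * z - aSym (gam ε) w)) k y) :
    ∃ u, Maps (uuOp (ε * α) (gam ε) (strain ε θ)) f u ∧
      ‖R u + y‖ ≤ 256000 * (C * ε / α) * ‖f‖ := by
  have hε := h.ε_pos
  have hα := h.α_pos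
  have h0 := h.toSmallParam
  obtain ⟨φp, hp⟩ := hc.p_wiener.exists_nearOne
  obtain ⟨φq, hq⟩ := hc.q_wiener.exists_nearOne
  obtain ⟨s, hs, -⟩ := maps_scOp_of_maps_dOp h0 hf
  obtain ⟨kp, hkp⟩ := hp.exists_maps hε hC f
  obtain ⟨kp', hkp'⟩ := hp.exists_maps_fourierMul hε measurable_dSym zero_le_one
    (SmallParam.dSym_lipschitz _) hf hkp
  obtain ⟨kq, hkq⟩ := hq.exists_maps hε hC f
  obtain ⟨kq', hkq'⟩ := hq.exists_maps_fourierMul hε measurable_scSymbol (by norm_num)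
    h0.scSymbol_lipschitz hs hkq
  have hxp := maps_multOp_sub_one hkp
  have hxq := maps_multOp_sub_one hkq
  have hup : Maps (dOp (ε * α)) (kp - f) (kp' - f') := Maps.sub hkp' hf
  have huq : Maps (scOp (ε * α) (gam ε)) (kq - f) (kq' - s) := Maps.sub hkq' hs
  refine ⟨_, maps_add_iff.2 ⟨_, _, maps_mul_iff.2 ⟨_, hxp, hup⟩,
    maps_mul_iff.2 ⟨_, hxq, huq⟩, rfl⟩, ?_⟩
  obtain ⟨T, hT, hT'⟩ := exists_fourierMul_clm (ε * α)
    (P := fun w => Complex.I * w / ((ε : ℂ) ^ 3 * z - aSym (gam ε) w))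
    (measurable_dSym.div (measurable_const.sub measurable_aSym))
    (by positivity : 0 ≤ 128000 / (α * ε ^ 2)) (fun ξ => by
      refine norm_div_le_of_mul_le (by positivity) (h.aPlus_pos ξ) ?_
      rw [norm_mul, Complex.norm_I, one_mul, mul_assoc]
      exact (h.aPlus_bounds ξ).2.1)
  obtain ⟨A, hA, hA'⟩ := exists_fourierMul_clm (ε * α)
    (P := fun w => aSym (gam ε) w / ((ε : ℂ) ^ 3 * z - aSym (gam ε) w))
    (measurable_aSym.div (measurable_const.sub measurable_aSym))
    (by positivity : 0 ≤ 128000 / (α * ε)) (fun ξ => by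
      refine norm_div_le_of_mul_le (by positivity) (h.aPlus_pos ξ) ?_
      rw [mul_assoc]
      exact (h.aPlus_bounds ξ).1)
  set X : L2w (ε * α) := (kp - f) - (kq - f) + (ε : ℂ) ^ 2 • k with hX
  have bX : ‖X‖ ≤ C * ε ^ 3 * ‖f‖ := by
    refine norm_le_of_maps_multOp hc.main_le ?_
    rw [maps_multOp_iff] at *
    filter_upwards [hxp, hxq, hk, Lp.coeFn_add ((kp - f) - (kq - f)) ((ε : ℂ) ^ 2 • k),
      Lp.coeFn_sub (kp - f) (kq - f), Lp.coeFn_smul ((ε : ℂ) ^ 2) k] with x e1 e2 e3 e4 e5 e6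
    rw [hX, e4, Pi.add_apply, e5, Pi.sub_apply, e6, Pi.smul_apply, e1, e2, e3, strain, smul_eq_mul]
    push_cast
    ring
  have key : R (kp' - f' + (kq' - s)) + y = T X + A (kq - f) := by
    apply eq_of_spectral_ae_eq
    filter_upwards [spectral_add (R (kp' - f' + (kq' - s))) y, spectral_add (T X) (A (kq - f)),
      maps_fourierMul_iff.1 (hR (kp' - f' + (kq' - s))), maps_fourierMul_iff.1 hy,
      maps_fourierMul_iff.1 (hT' X), maps_fourierMul_iff.1 (hA' (kq - f)),
      spectral_add (kp' - f') (kq' - s), maps_dOp_iff.1 hup, maps_fourierMul_iff.1 huq,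
      spectral_add ((kp - f) - (kq - f)) ((ε : ℂ) ^ 2 • k), spectral_sub (kp - f) (kq - f),
      spectral_smul ((ε : ℂ) ^ 2) k] with ξ e1 e2 e3 e4 e5 e6 e7 e8 e9 e10 e11 e12
    have := norm_pos_iff.1 (h.aPlus_pos ξ)
    rw [e1, e2, e3, e4, e5, e6, e7, e8, e9, hX, e10, e11, e12]
    field_simp
    rw [aSym]
    ring
  rw [key]
  have c1 : ‖T X‖ ≤ 128000 / (α * ε ^ 2) * (C * ε ^ 3 * ‖f‖) :=
    (T.le_opNorm _).trans (mul_le_mul hT bX (norm_nonneg _) (by positivity))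
  have c2 : ‖A (kq - f)‖ ≤ 128000 / (α * ε) * (C * ε ^ 2 * ‖f‖) :=
    (A.le_opNorm _).trans (mul_le_mul hA (hq.norm_sub_le hε hkq) (norm_nonneg _) (by positivity))
  have c3 : 128000 / (α * ε ^ 2) * (C * ε ^ 3 * ‖f‖) = 128000 * (C * ε / α) * ‖f‖ := by
    field_simp
  have c4 : 128000 / (α * ε) * (C * ε ^ 2 * ‖f‖) = 128000 * (C * ε / α) * ‖f‖ := by
    field_simp
  have c5 := norm_add_le (T X) (A (kq - f))
  linarith

theorem SpectralPoint.norm_kdv_symbol_le (h : SpectralPoint α ε z) (ξ : ℝ) :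
    ‖(ε : ℂ) ^ 2 * (Complex.I * shiftedFreq (ε * α) ξ)
      / ((ε : ℂ) ^ 3 * z - kdvSym ε (shiftedFreq (ε * α) ξ))‖ ≤ 4 / α := by
  have hε := h.ε_pos
  have hα := h.α_pos
  have h1 : 0 < ‖(ε : ℂ) ^ 3 * z - kdvSym ε (shiftedFreq (ε * α) ξ)‖ := by
    have h2 := h.kdv_lower ξ
    have h3 := norm_pos_iff.2 (h.shiftedFreq_ne_zero ξ)
    have h4 : 0 < α * (ε ^ 2 * ‖shiftedFreq (ε * α) ξ‖) := by positivity
    linarith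
  refine norm_div_le_of_mul_le hα h1 ?_
  rw [norm_mul, norm_mul, Complex.norm_I, one_mul, norm_pow, Complex.norm_real,
    Real.norm_of_nonneg hε.le]
  exact h.kdv_lower ξ

/-- The difference of the two main terms. -/
theorem norm_main_sub_le (h : SpectralPoint α ε z) {d : ℝ} (hθC : ∀ x, |θ x| ≤ C)
    (hd : ∀ x, |θ x - kdvProfile x| ≤ d) {f k k₀ y y₀ : L2w (ε * α)}
    (hk : Maps (multOp (ε * α) fun x => 3 / 2 * θ (ε * x)) f k)
    (hk₀ : Maps (multOp (ε * α) fun x => 3 / 2 * kdvProfile (ε * x)) f k₀)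
    (hy : Maps (fourierMul (ε * α) fun w => (ε : ℂ) ^ 2 * (Complex.I * w)
      / ((ε : ℂ) ^ 3 * z - aSym (gam ε) w)) k y)
    (hy₀ : Maps (fourierMul (ε * α) fun w => (ε : ℂ) ^ 2 * (Complex.I * w)
      / ((ε : ℂ) ^ 3 * z - kdvSym ε w)) k₀ y₀) :
    ‖y - y₀‖ ≤ (300000 / α ^ 2 * C * Real.sqrt ε + 6 / α * d) * ‖f‖ := by
  have hε := h.ε_pos
  have hα := h.α_pos
  obtain ⟨M, -, hM'⟩ := exists_fourierMul_clm (ε * α)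
    (P := fun w => (ε : ℂ) ^ 2 * (Complex.I * w) / ((ε : ℂ) ^ 3 * z - kdvSym ε w))
    ((measurable_const.mul measurable_dSym).div (measurable_const.sub measurable_kdvSym))
    (by positivity : 0 ≤ 4 / α) h.norm_kdv_symbol_le
  -- The intermediate term `M k` separates the two limits: here the symbol changes with the profile
  -- kept, in the next bound the profile with the KdV symbol kept.
  have e1 : ‖y - M k‖ ≤ 200000 / α ^ 2 * Real.sqrt ε * ‖k‖ :=
    norm_le_of_maps_fourierMul (fun ξ => h.norm_symbol_sub_le h.norm_le h.le_re _)
      (maps_fourierMul_sub hy (hM' k))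
  have e2 : ‖M k - y₀‖ ≤ 4 / α * ‖k - k₀‖ :=
    norm_le_of_maps_fourierMul h.norm_kdv_symbol_le ((hM' k).sub hy₀)
  have e3 : ‖k‖ ≤ 3 / 2 * C * ‖f‖ := norm_le_of_maps_multOp (fun x => by
    rw [abs_mul, abs_of_pos (by norm_num : (0 : ℝ) < 3 / 2)]
    exact mul_le_mul_of_nonneg_left (hθC _) (by norm_num)) hk
  have e4 : ‖k - k₀‖ ≤ 3 / 2 * d * ‖f‖ := norm_le_of_maps_multOp (fun x => by
    rw [← mul_sub, abs_mul, abs_of_pos (by norm_num : (0 : ℝ) < 3 / 2)]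
    exact mul_le_mul_of_nonneg_left (hd _) (by norm_num)) (maps_multOp_sub hk hk₀)
  have e5 : 200000 / α ^ 2 * Real.sqrt ε * ‖k‖
      ≤ 200000 / α ^ 2 * Real.sqrt ε * (3 / 2 * C * ‖f‖) := by gcongr
  have e6 : 4 / α * ‖k - k₀‖ ≤ 4 / α * (3 / 2 * d * ‖f‖) := by gcongr
  have e7 : y - y₀ = (y - M k) + (M k - y₀) := by abel
  rw [e7]
  calc ‖(y - M k) + (M k - y₀)‖ ≤ ‖y - M k‖ + ‖M k - y₀‖ := norm_add_le _ _
    _ ≤ 200000 / α ^ 2 * Real.sqrt ε * (3 / 2 * C * ‖f‖) + 4 / α * (3 / 2 * d * ‖f‖) := by linarith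
    _ = _ := by ring

end Comparison

/-! ### Assembly of the operator estimate. -/

section MainEstimate

variable {α ε C : ℝ} {ω θ : ℝ → ℝ} {z : ℂ}

/-- The term `[p, 𝒮] 𝒮⁻¹ ∂` inside `J₁₁` confines the domain of `W` to that of `∂`, so the estimate
on the latter covers all of it. -/
theorem exists_dOp_of_maps_wBundle {a γ : ℝ} {f g : L2w a} (h : Maps (wBundle a γ ω z) f g) :
    ∃ f', Maps (dOp a) f f' := by
  obtain ⟨_, x, -, hx, -⟩ := maps_sub_iff.1 h
  obtain ⟨y, hy, -⟩ := maps_mul_iff.1 hx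
  obtain ⟨y₁, _, hy₁, -, -⟩ := maps_add_iff.1 hy
  obtain ⟨_, h1, -⟩ := maps_smul_iff.1 hy₁
  obtain ⟨_, _, h2, -, -⟩ := maps_add_iff.1 h1
  obtain ⟨_, _, h3, -, -⟩ := maps_add_iff.1 h2
  obtain ⟨_, _, -, h4, -⟩ := maps_add_iff.1 h3
  exact exists_dOp_of_maps_pComm h4

/-- The operator `I + (ε³ z - ε² ½ ∂ + ⅙ ∂³)⁻¹ ε² ∂ (3/2 Θ(ε ·))`, which the dilation conjugates
to `W₀(z)`, applied to `f`. -/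
theorem dilation_symm_wZero (hε : 0 < ε) {W₀ : L2w α →L[ℂ] L2w α}
    (hW₀ : ∀ f k g, Maps (multOp α fun x => 3 / 2 * kdvProfile x) f k →
      Maps (fourierMul α fun w => Complex.I * w / (z - kdvSym 1 w)) k g → W₀ f = f + g)
    {f k y : L2w (ε * α)} (hk : Maps (multOp (ε * α) fun x => 3 / 2 * kdvProfile (ε * x)) f k)
    (hy : Maps (fourierMul (ε * α) fun w => (ε : ℂ) ^ 2 * (Complex.I * w)
      / ((ε : ℂ) ^ 3 * z - kdvSym ε w)) k y) :
    (dilation α hε).symm (W₀ (dilation α hε f)) = f + y := by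
  have h1 := maps_multOp_dilation (g := fun x => 3 / 2 * kdvProfile x) hε hk
  have h2 := maps_fourierMul_dilation hε (P := fun w => Complex.I * w / (z - kdvSym 1 w))
    (fun w => by
      have : (ε : ℂ) ≠ 0 := Complex.ofReal_ne_zero.2 hε.ne'
      rw [kdvSym_mul, ← mul_sub, ← mul_div_mul_left (Complex.I * w) _ (pow_ne_zero 3 this)]
      congr 1
      ring) hy
  rw [hW₀ _ _ _ h1 h2, ← map_add, LinearIsometryEquiv.symm_apply_apply]

/-- Four errors add up: the change of the main term, the remainder of `𝒰`, the `J₁₁` term, and the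
term through `𝒜₂₂`. The last is of size `ε⁻³ ε³ ε⁻¹ ε³ = ε²`, and the others vanish with `ε` and
`d`. -/
theorem exists_maps_wBundle (h : SpectralPoint α ε z) (hc : CoefBounds ε C (strain ε θ))
    (hC1 : 1 ≤ C) (hC : 4000 * C * ε ≤ α) {d : ℝ} (hθ : Continuous θ)
    (hθC : ∀ x, |θ x| ≤ C) (hd : ∀ x, |θ x - kdvProfile x| ≤ d) {f f' k₀ y₀ : L2w (ε * α)}
    (hf : Maps (dOp (ε * α)) f f')
    (hk₀ : Maps (multOp (ε * α) fun x => 3 / 2 * kdvProfile (ε * x)) f k₀)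
    (hy₀ : Maps (fourierMul (ε * α) fun w => (ε : ℂ) ^ 2 * (Complex.I * w)
      / ((ε : ℂ) ^ 3 * z - kdvSym ε w)) k₀ y₀) :
    ∃ g, Maps (wBundle (ε * α) (gam ε) (strain ε θ) ((ε : ℂ) ^ 3 * z)) f g ∧
      ‖g - (f + y₀)‖ ≤ (40000000 * (C * ε / α) + 300000 / α ^ 2 * C * Real.sqrt ε
        + 6 / α * d) * ‖f‖ := by
  have hε := h.ε_pos
  have hα := h.α_pos
  have hα1 := h.α_le
  have hε1 := h.ε_le
  have hC0 : 0 < C := by linarith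
  have hC2 : C * ε ^ 2 ≤ 1 := by nlinarith [mul_pos hC0 hε]
  have h0 := h.toSmallParam
  obtain ⟨R, hR, hR', hRb⟩ := exists_isResolvent_aPlus h
  obtain ⟨S, hS, hSb⟩ := exists_isResolvent_aTwoTwo h hc hC1 hC
  obtain ⟨Q, -, hQ⟩ := exists_multOp_clm (ε * α) (g := fun x => 3 / 2 * θ (ε * x))
    (by fun_prop) (by positivity : 0 ≤ 3 / 2 * C) (fun x => by
      rw [abs_mul, abs_of_pos (by norm_num : (0 : ℝ) < 3 / 2)]
      exact mul_le_mul_of_nonneg_left (hθC _) (by norm_num))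
  obtain ⟨T, -, hT⟩ := exists_fourierMul_clm (ε * α)
    (P := fun w => (ε : ℂ) ^ 2 * (Complex.I * w) / ((ε : ℂ) ^ 3 * z - aSym (gam ε) w))
    ((measurable_const.mul measurable_dSym).div (measurable_const.sub measurable_aSym))
    (by positivity : 0 ≤ 128000 / α) (fun ξ => by
      refine norm_div_le_of_mul_le hα (h.aPlus_pos ξ) ?_
      rw [norm_mul, norm_mul, Complex.norm_I, one_mul, norm_pow, Complex.norm_real,
        Real.norm_of_nonneg hε.le]
      exact (h.aPlus_bounds ξ).2.1)
  obtain ⟨u, hu, bu⟩ := exists_maps_uuOp h hc hC2 hf hR' (hQ f) (hT (Q f))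
  obtain ⟨j, hj, bj⟩ := exists_maps_jOneOne h hc hC0.le hC2 hf hRb hR'
  obtain ⟨-, ⟨l, hl, bl⟩, -⟩ := exists_maps_j h0 hc hC0.le hC2 hf
  -- The resolvent maps into the domain of `𝒜₂₂`, hence into that of `∂`, on which `J₁₂` is defined.
  obtain ⟨e', he'⟩ := exists_dOp_of_maps_aTwoTwo (hS.right l)
  obtain ⟨⟨n, hn, bn⟩, -, -⟩ := exists_maps_j h0 hc hC0.le hC2 he'
  have bm := norm_main_sub_le h hθC hd (hQ f) hk₀ (hT (Q f)) hy₀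
  refine ⟨_, maps_sub_iff.2 ⟨_, _, maps_sub_iff.2 ⟨_, _, maps_scalarOp_iff.2 rfl,
    maps_mul_iff.2 ⟨u, hu, hR.maps_resolventOp u⟩, rfl⟩, maps_mul_iff.2 ⟨_, maps_add_iff.2
    ⟨j, n, hj, maps_mul_iff.2 ⟨S l, maps_mul_iff.2 ⟨l, hl, hS.maps_resolventOp l⟩, hn⟩, rfl⟩,
    hR.maps_resolventOp _⟩, rfl⟩, ?_⟩
  have bS : ‖S l‖ ≤ 4 / (α * ε) * (169 * C * ε ^ 3 * ‖f‖) :=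
    (S.le_opNorm _).trans (mul_le_mul hSb bl (norm_nonneg _) (by positivity))
  have bn' : ‖n‖ ≤ 169 * C * ε ^ 3 * (4 / (α * ε) * (169 * C * ε ^ 3 * ‖f‖)) :=
    bn.trans (by gcongr)
  have bR : ‖R n‖ ≤ 80 / (α * ε ^ 3)
      * (169 * C * ε ^ 3 * (4 / (α * ε) * (169 * C * ε ^ 3 * ‖f‖))) :=
    (R.le_opNorm _).trans (mul_le_mul hRb bn' (norm_nonneg _) (by positivity))
  have e1 : 80 / (α * ε ^ 3) * (169 * C * ε ^ 3 * (4 / (α * ε) * (169 * C * ε ^ 3 * ‖f‖)))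
      = 9139520 * (C * ε / α) * ‖f‖ * (C * ε / α) := by
    field_simp
    ring
  have e2 : C * ε / α ≤ 1 := by
    rw [div_le_one hα]
    nlinarith [mul_pos hC0 hε]
  have e3 : 9139520 * (C * ε / α) * ‖f‖ * (C * ε / α) ≤ 9139520 * (C * ε / α) * ‖f‖ :=
    mul_le_of_le_one_right (by positivity) e2
  have e4 : (1 : ℂ) • f - R u - R (j + n) - (f + y₀)
      = (T (Q f) - y₀) - (R u + T (Q f)) - R j - R n := by
    rw [one_smul, map_add]
    abel
  rw [e4]
  have t1 := norm_sub_le ((T (Q f) - y₀) - (R u + T (Q f)) - R j) (R n)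
  have t2 := norm_sub_le ((T (Q f) - y₀) - (R u + T (Q f))) (R j)
  have t3 := norm_sub_le (T (Q f) - y₀) (R u + T (Q f))
  have t4 : 0 ≤ C * ε / α * ‖f‖ := by positivity
  linarith

theorem norm_dilConj_sub_le (hε : 0 < ε) {W : L2w (ε * α) →L[ℂ] L2w (ε * α)}
    {W₀ : L2w α →L[ℂ] L2w α} {c : ℝ} (hc : 0 ≤ c)
    (h : ∀ f, ‖W f - (dilation α hε).symm (W₀ (dilation α hε f))‖ ≤ c * ‖f‖) :
    ‖dilConj α hε W - W₀‖ ≤ c := by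
  refine ContinuousLinearMap.opNorm_le_bound _ hc fun g => ?_
  have h1 := h ((dilation α hε).symm g)
  rw [LinearIsometryEquiv.apply_symm_apply, LinearIsometryEquiv.norm_map] at h1
  rw [← LinearIsometryEquiv.norm_map (dilation α hε), map_sub,
    LinearIsometryEquiv.apply_symm_apply] at h1
  exact h1

/-- The comparison operator `B` is the dilation conjugate of `W₀`. Closeness of `W` to it on a dense
domain yields the bounded extension and the norm estimate at the same time. -/
theorem exists_wBundle_near_wZero (h : SpectralPoint α ε z) (hε : 0 < ε)
    (hc : CoefBounds ε C (strain ε θ)) (hC1 : 1 ≤ C) (hC : 4000 * C * ε ≤ α) {d : ℝ}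
    (hd0 : 0 ≤ d) (hθ : Continuous θ) (hθC : ∀ x, |θ x| ≤ C)
    (hd : ∀ x, |θ x - kdvProfile x| ≤ d) :
    ∃ (W : L2w (ε * α) →L[ℂ] L2w (ε * α)) (W₀ : L2w α →L[ℂ] L2w α),
      IsBoundedExtension W (wBundle (ε * α) (gam ε) (strain ε θ) ((ε : ℂ) ^ 3 * z)) ∧
      IsBoundedExtension W₀ (wZero α z) ∧
      ‖dilConj α hε W - W₀‖ ≤ 40000000 * (C * ε / α) + 300000 / α ^ 2 * C * Real.sqrt ε
        + 6 / α * d := by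
  have hα := h.α_pos
  have hC0 : 0 < C := by linarith
  obtain ⟨W₀, hW₀, hW₀'⟩ := exists_isBoundedExtension_wZero h.α_pos h.α_le h.le_re
  obtain ⟨Q, -, hQ⟩ := exists_multOp_clm (ε * α) (g := fun x => 3 / 2 * kdvProfile (ε * x))
    ((continuous_kdvProfile.comp (continuous_const_mul ε)).const_mul _).measurable
    (by positivity : 0 ≤ 3 / 2 * (C + d)) (fun x => by
      rw [abs_mul, abs_of_pos (by norm_num : (0 : ℝ) < 3 / 2)]
      refine mul_le_mul_of_nonneg_left ?_ (by norm_num)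
      have h1 := norm_le_norm_add_norm_sub (θ (ε * x)) (kdvProfile (ε * x))
      simp only [Real.norm_eq_abs] at h1
      linarith [hθC (ε * x), hd (ε * x)])
  obtain ⟨M, -, hM⟩ := exists_fourierMul_clm (ε * α)
    (P := fun w => (ε : ℂ) ^ 2 * (Complex.I * w) / ((ε : ℂ) ^ 3 * z - kdvSym ε w))
    ((measurable_const.mul measurable_dSym).div (measurable_const.sub measurable_kdvSym))
    (by positivity : 0 ≤ 4 / α) h.norm_kdv_symbol_le
  set B : L2w (ε * α) →L[ℂ] L2w (ε * α) := 1 + M ∘L Q with hB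
  have hBf : ∀ f, B f = f + M (Q f) := fun f => rfl
  obtain ⟨W, hW, hWb⟩ := exists_isBoundedExtension
    (T := wBundle (ε * α) (gam ε) (strain ε θ) ((ε : ℂ) ^ 3 * z))
    ((dense_fourierMul_domain (ε * α) measurable_dSym).mono fun f hf => by
      obtain ⟨g, hg, -⟩ := exists_maps_wBundle h hc hC1 hC hθ hθC hd (maps_of_mem hf) (hQ f)
        (hM (Q f))
      exact hg.mem) B
    (C := 40000000 * (C * ε / α) + 300000 / α ^ 2 * C * Real.sqrt ε + 6 / α * d)
    (fun f g hg => by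
      obtain ⟨f', hf⟩ := exists_dOp_of_maps_wBundle hg
      obtain ⟨g', hg', b⟩ := exists_maps_wBundle h hc hC1 hC hθ hθC hd hf (hQ f) (hM (Q f))
      rw [hg.unique hg', hBf]
      exact b) (by positivity)
  refine ⟨W, W₀, hW, hW₀, norm_dilConj_sub_le hε (by positivity) fun f => ?_⟩
  rw [dilation_symm_wZero hε hW₀' (hQ f) (hM (Q f)), ← hBf, ← sub_apply]
  exact (ContinuousLinearMap.le_opNorm _ _).trans (by gcongr)

end MainEstimate

end

theorem proposition10p1 (α : ℝ) (hα0 : 0 < α) (hα : α ≤ 1 / 2) (m : ℕ) (hm : 2 ≤ m)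
    (ν : ℝ) (hν0 : 0 < ν) (hν1 : ν < 1) :
    ∀ δ : ℝ, 0 < δ → ∃ ε₀ : ℝ, 0 < ε₀ ∧ ∀ (ε : ℝ) (hε : 0 < ε), ε < ε₀ →
      ∀ θ : ℝ → ℝ, IsSolitaryProfile α m ν ε θ →
        ∀ z : ℂ, ‖(ε : ℂ) ^ 3 * z‖ ≤ 1 → -(1 / 6) * α ≤ z.re →
          InResolventSet (aPlus (ε * α) (gam ε)) ((ε : ℂ) ^ 3 * z) ∧
          InResolventSet (aTwoTwo (ε * α) (gam ε) (strain ε θ)) ((ε : ℂ) ^ 3 * z) ∧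
          InResolventSet (kdvOp α) z ∧
          ∃ (W : L2w (ε * α) →L[ℂ] L2w (ε * α)) (W₀ : L2w α →L[ℂ] L2w α),
            IsBoundedExtension W
              (wBundle (ε * α) (gam ε) (strain ε θ) ((ε : ℂ) ^ 3 * z)) ∧
            IsBoundedExtension W₀ (wZero α z) ∧
            ‖dilConj α hε W - W₀‖ ≤ δ := by
  intro δ hδ
  obtain ⟨C, ε₁, hC1, hε₁, hmain⟩ := exists_coefBounds hα0
  have hC0 : 0 < C := by linarith
  -- The constant `C` depends only on `α`, so the resulting threshold is uniform in `θ` and `z`.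
  -- Positivity of `ν` is what makes the last term vanish at zero.
  have hlim : Filter.Tendsto (fun ε : ℝ => 40000000 * (C * ε / α)
      + 300000 / α ^ 2 * C * Real.sqrt ε + 6 / α * (C * ε ^ ν)) (nhds 0) (nhds 0) := by
    have h1 : ContinuousAt (fun ε : ℝ => 40000000 * (C * ε / α)
      + 300000 / α ^ 2 * C * Real.sqrt ε + 6 / α * (C * ε ^ ν)) 0 := by
      have := Real.continuousAt_rpow_const 0 ν (Or.inr hν0.le)
      fun_prop
    have h2 := h1.tendsto
    rw [Real.zero_rpow hν0.ne'] at h2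
    simpa using h2
  obtain ⟨ε₂, hε₂, hsmall⟩ := Metric.eventually_nhds_iff.1 (hlim.eventually_le_const hδ)
  refine ⟨min (min ε₁ ε₂) (min (1 / 4) (α / (4000 * C))),
    lt_min (lt_min hε₁ hε₂) (lt_min (by norm_num) (by positivity)),
    fun ε hε hlt θ hθ z hz1 hz => ?_⟩
  obtain ⟨h12, h34⟩ := lt_min_iff.1 hlt
  obtain ⟨h1, h2⟩ := lt_min_iff.1 h12
  obtain ⟨h3, h4⟩ := lt_min_iff.1 h34
  have hp : SpectralPoint α ε z := ⟨⟨hα0, hα, hε, h3.le⟩, hz1, hz⟩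
  obtain ⟨hc, hcont, hd, hθC⟩ := hmain m ν ε θ hm hν0 hε h1 hθ
  have hCε : 4000 * C * ε ≤ α := by
    rw [lt_div_iff₀ (by positivity)] at h4
    linarith
  obtain ⟨R, hR, -, -⟩ := exists_isResolvent_aPlus hp
  obtain ⟨S, hS, -⟩ := exists_isResolvent_aTwoTwo hp hc hC1 hCε
  obtain ⟨K, hK, -⟩ := exists_isResolvent_kdvOp hα0 hα hz
  obtain ⟨W, W₀, hW, hW₀, hb⟩ := exists_wBundle_near_wZero hp hε hc hC1 hCε
    (by positivity : 0 ≤ C * ε ^ ν) hcont hθC hd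
  refine ⟨hR.inResolventSet, hS.inResolventSet, hK.inResolventSet, W, W₀, hW, hW₀, hb.trans ?_⟩
  refine hsmall ?_
  rwa [dist_zero_right, Real.norm_of_nonneg hε.le]
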